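/- **Conventions.** The base theory is primitive recursive set theory with infinity. The *primitive recursive set functions* are generated from projections, the constants $\emptyset$ and $\omega$, $(x,y)\mapsto x\cup\{y\}$ and the case distinction $(x,y,a,b)\mapsto(x$ if $a\in b$, else $y)$ by composition and the recursion $F(z,\vec x)=H(\bigcup\{F(y,\vec x)\mid y\in z\},z,\vec x)$. Let $W$ be a *transitive model* of the base theory, i.e. a transitive class of sets closed under all primitive recursive set functions ($W$ may be the class of all sets). "In $W$" means that quantifiers over ordinals, over admissible sets and over subsets (in the definition of a well-ordering) range over elements of $W$. An *admissible set* is a transitive set $\mathbb A$ such that $(\mathbb A,\in)$ satisfies Kripke-Platek set theory with infinity (equality, extensionality, pairing, union, infinity, $\Delta_0$-separation, $\Delta_0$-collection, foundation). Formulas are in negation normal form over $\in,=$; the negation $\neg\varphi$ is pushed down to prime formulas; $\Delta_0$-formulas have only quantifiers of the form $\forall x(x\in y\to\cdots)$, $\exists x(x\in y\land\cdots)$ with $y\neq x$. *Axioms.* Fix $K\ge1$ and a primitive recursive enumeration $\langle\theta_k\rangle_{k\in\omega}$ of the following axioms: equality, extensionality, pairing, union, infinity, the instances of $\Delta_0$-separation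 with at most $K$ parameters, and the instances of $\Delta_0$-collection with at most $K$ parameters for $\Delta_0$-formulas that are disjunctions. *Hierarchy.* Let $u=\{u_i\mid i\in\omega\}$ be a countable transitive set, with a fixed enumeration, with $0,1\in u$. Put $\mathbb L_0^u=u$, let $\mathbb L_{\alpha+1}^u$ be the set of subsets of $\mathbb L^u_\alpha$ definable over $(\mathbb L_\alpha^u,\in)$ with parameters, and $\mathbb L^u_\lambda=\bigcup_{\alpha<\lambda}\mathbb L_\alpha^u$ for limits $\lambda$. Let $\mathbf L_0^u=\{\langle0,a\rangle\mid a\in u\}$ and, for $\alpha>0$, $\mathbf L_\alpha^u=\{\langle\beta,a\rangle\mid\beta<\alpha$ minimal with $a\in\mathbb L_{\beta+1}^u\}$. In formulas a parameter $\langle\beta,a\rangle$ is interpreted as $a$; elements $a\in u$ are identified with $\langle0,a\rangle$. The set $\mathbf L_\alpha^u$ is well-ordered via the projection $\langle\beta,a\rangle\mapsto a$ and the following ordering of $\mathbb L_\alpha^u$: elements of $u$ are ordered by least index, $\mathbb L_{\beta+1}^u$ is an end-extension of $\mathbb L_\beta^u$, and new elements of $\mathbb L_{\beta+1}^u$ are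 ordered by their least definition over $\mathbb L_\beta^u$, where definitions are compared by the number of parameters, then by the Gödel number of the formula, then lexicographically by the parameters. *Search tree.* The tree $S_\alpha^u\subseteq(\mathbf L_\alpha^u)^{<\omega}$ and its labels $l(\sigma)$ (finite sequences of closed formulas with parameters in $\mathbf L_\alpha^u$) are defined recursively. Put $\langle\rangle\in S_\alpha^u$, $l(\langle\rangle)=\langle\rangle$. If $\sigma\in S^u_\alpha$ has length $2k$, its only child is $\sigma^\frown0$, with label $l(\sigma),\neg\theta_k$. If $\sigma\in S^u_\alpha$ has odd length: $\sigma$ is a leaf if $l(\sigma)$ contains a true $\Delta_0$-formula; otherwise, if $l(\sigma)$ consists of (negated) prime formulas, its only child is $\sigma^\frown0$ with label $l(\sigma)$; otherwise write $l(\sigma)=\Gamma,\varphi,\Gamma'$, where $\varphi$ is the first formula that is not a (negated) prime formula. The children are then: - $\varphi=\psi_0\land\psi_1$: $\sigma^\frown i$ with label $\Gamma,\Gamma',\varphi,\psi_i$, for $i=0,1$; - $\varphi=\psi_0\lor\psi_1$: $\sigma^\frown0$ with label $\Gamma,\Gamma',\varphi,\psi_i$, where $i=0$ if $\psi_0$ does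 not occur in $l(\sigma)$ and $i=1$ otherwise; - $\varphi=\forall x\,\psi$: $\sigma^\frown a$ with label $\Gamma,\Gamma',\varphi,\psi(a)$, for all $a\in\mathbf L_\alpha^u$; - $\varphi=\exists x\,\psi$: $\sigma^\frown0$ with label $\Gamma,\Gamma',\varphi,\psi(b)$, where $b$ is the first entry of $u_0,\sigma_0,\dots,u_{n-1},\sigma_{n-1},u_n,u_{n+1},\dots$ ($n$ the length of $\sigma$) such that $\psi(b)$ does not occur in $l(\sigma)$; if there is no such $b$, the label is $\Gamma,\Gamma',\varphi$. The Kleene-Brouwer ordering on $S_\alpha^u$ is: $\sigma<\tau$ iff $\sigma$ properly extends $\tau$, or $\sigma=\sigma_0{}^\frown a^\frown\sigma'$ and $\tau=\sigma_0{}^\frown b^\frown\tau'$ with $a<_{\mathbf L_\alpha^u}b$. *Term system.* $\varepsilon(S_{\omega^\alpha}^u)$ consists of the terms $0$; $\varepsilon_\sigma$ for $\sigma\in S_{\omega^\alpha}^u$; and $\Omega^{s_0}\cdot\beta_0+\dots+\Omega^{s_n}\cdot\beta_n$ for terms $s_n<\dots<s_0$ and ordinals $0<\beta_i<\omega^\alpha$,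 except $\Omega^{\varepsilon_\sigma}\cdot1$. Its order is given by: $0<t$ for $t\ne0$; $\varepsilon_\sigma<\varepsilon_\tau$ iff $\sigma<\tau$ in $S^u_{\omega^\alpha}$; $\varepsilon_\sigma<\Omega^{t_0}\cdot\gamma_0+\cdots$ iff $\varepsilon_\sigma\le t_0$; $\Omega^{s_0}\cdot\beta_0+\cdots<\varepsilon_\tau$ iff $s_0<\varepsilon_\tau$; and two sums are compared lexicographically as sequences of pairs $\langle s_i,\beta_i\rangle$ (pairs being compared first by the exponent $s_i$, then by $\beta_i$; a proper initial segment is smaller). *Well-ordering principles.* For primitive recursive set functions $(u,\alpha)\mapsto T(u,\alpha)=\langle T_\alpha^u,<_{T_\alpha^u}\rangle$ and $(u,s)\mapsto|s|_T^u$ we say that $T^u$ is a (ranked compatible) *well-ordering principle* if (i) each $<_{T_\alpha^u}$ is a linear order of $T_\alpha^u$, and every nonempty subset of $T_\alpha^u$ has a minimal element; (ii) for $\alpha<\beta$ we have $T_\alpha^u\subseteq T_\beta^u$ and ${<_{T_\alpha^u}}={<_{T_\beta^u}}\cap(T_\alpha^u\times T_\alpha^u)$, and $T_\lambda^u=\bigcup_{\alpha<\lambda}T_\alpha^u$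 for limits $\lambda$; (iii) $|s|_T^u=\min\{\alpha\mid s\in T_{\alpha+1}^u\}$ if such an $\alpha$ exists, and $|s|_T^u=\{1\}$ (not an ordinal) otherwise. **Proposition.** The set $\varepsilon(S_{\omega^\alpha}^u)$ (terms being represented by sets in a standard way) and its order are given by a primitive recursive set function of $\alpha$ and of the enumeration $i\mapsto u_i$, and there is a primitive recursive function $|\cdot|$ of the enumeration and of $s$ (both functions independent of $u$ and of $W$) such that the following holds for each countable transitive set $u=\{u_i\mid i\in\omega\}\supseteq\{0,1\}$ and each transitive model $W$ that contains the enumeration $i\mapsto u_i$: If in $W$ there is no admissible set $\mathbb A$ with $u\subseteq\mathbb A$, then in $W$ the family $\alpha\mapsto\varepsilon(S_{\omega^\alpha}^u)$ with the rank function $|\cdot|$ is a ranked compatible well-ordering principle. In particular (the case where $W$ is the class of all sets): if no admissible set contains $u$ as a subset, then $\alpha\mapsto\varepsilon(S_{\omega^\alpha}^u)$ is a ranked compatible well-ordering principle. -/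

import Mathlib

universe v w

noncomputable section

namespace KPTree

/-! ### First-order formulas of set theory in negation normal form -/

/-- Terms with at most the variables `0, …, n-1` free: variables and parameters from `P`. -/
inductive Tm (P : Type w) (n : ℕ) : Type w
  | var (i : Fin n) : Tm P n
  | par (p : P) : Tm P n

/-- Formulas in negation normal form over `∈` and `=` whose free variables are among `0, …, n-1`;
a quantifier in front of a formula with `n + 1` variables binds the last variable `n`. So
`Fml P 0` is the type of closed formulas with parameters from `P`, and formulas that differ
in the names of bound variables only are identified. -/
inductive Fml (P : Type w) : ℕ → Type w
  | mem {n : ℕ} (s t : Tm P n) : Fml P n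
  | nmem {n : ℕ} (s t : Tm P n) : Fml P n
  | eq {n : ℕ} (s t : Tm P n) : Fml P n
  | ne {n : ℕ} (s t : Tm P n) : Fml P n
  | and {n : ℕ} (φ ψ : Fml P n) : Fml P n
  | or {n : ℕ} (φ ψ : Fml P n) : Fml P n
  | all {n : ℕ} (φ : Fml P (n + 1)) : Fml P n
  | ex {n : ℕ} (φ : Fml P (n + 1)) : Fml P n

namespace Tm

variable {P : Type w} {Q : Type w}

def rename {n m : ℕ} (f : Fin n → Fin m) : Tm P n → Tm P m
  | var i => var (f i)
  | par p => par p

/-- The same term, seen as a term with one more variable available. -/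
def lift {n : ℕ} : Tm P n → Tm P (n + 1) := rename Fin.castSucc

/-- Substitute the parameter `a` for the variable `0`; the other variables move down by one. -/
def inst (a : P) {n : ℕ} : Tm P (n + 1) → Tm P n
  | var i => Fin.cases (par a) var i
  | par p => par p

/-- A parameter-free term seen as a term over any set of parameters. -/
def ofPure {n : ℕ} : Tm Empty n → Tm P n
  | var i => var i
  | par p => p.elim

def eval (val : P → ZFSet.{v}) {n : ℕ} (x : Fin n → ZFSet.{v}) : Tm P n → ZFSet.{v}
  | var i => x i
  | par p => val p

def index {n : ℕ} : Tm Empty n → ℕ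
  | var i => i
  | par p => p.elim

end Tm

namespace Fml

variable {P : Type w}

/-- Negation: pushed down to prime formulas. -/
def neg {n : ℕ} : Fml P n → Fml P n
  | mem s t => nmem s t
  | nmem s t => mem s t
  | eq s t => ne s t
  | ne s t => eq s t
  | and φ ψ => or φ.neg ψ.neg
  | or φ ψ => and φ.neg ψ.neg
  | all φ => ex φ.neg
  | ex φ => all φ.neg

def imp {n : ℕ} (φ ψ : Fml P n) : Fml P n := or φ.neg ψ

/-- Bounded quantification `∀ x ∈ y, ψ`, that is `∀ x (x ∈ y → ψ)`; here `x` is the variable `n`,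
and `y` is a parameter or a variable different from `x`. -/
def ball {n : ℕ} (y : Tm P n) (ψ : Fml P (n + 1)) : Fml P n :=
  all (imp (mem (Tm.var (Fin.last n)) y.lift) ψ)

/-- Bounded quantification `∃ x ∈ y, ψ`, that is `∃ x (x ∈ y ∧ ψ)`. -/
def bex {n : ℕ} (y : Tm P n) (ψ : Fml P (n + 1)) : Fml P n :=
  ex (and (mem (Tm.var (Fin.last n)) y.lift) ψ)

/-- Prime formulas and negated prime formulas. -/
inductive IsLiteral : ∀ {n : ℕ}, Fml P n → Prop
  | mem {n : ℕ} (s t : Tm P n) : IsLiteral (mem s t)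
  | nmem {n : ℕ} (s t : Tm P n) : IsLiteral (nmem s t)
  | eq {n : ℕ} (s t : Tm P n) : IsLiteral (eq s t)
  | ne {n : ℕ} (s t : Tm P n) : IsLiteral (ne s t)

/-- `Δ₀`-formulas: all quantifiers are bounded. -/
inductive IsDelta0 : ∀ {n : ℕ}, Fml P n → Prop
  | lit {n : ℕ} {φ : Fml P n} : IsLiteral φ → IsDelta0 φ
  | and {n : ℕ} {φ ψ : Fml P n} : IsDelta0 φ → IsDelta0 ψ → IsDelta0 (and φ ψ)
  | or {n : ℕ} {φ ψ : Fml P n} : IsDelta0 φ → IsDelta0 ψ → IsDelta0 (or φ ψ)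
  | ball {n : ℕ} (y : Tm P n) {ψ : Fml P (n + 1)} : IsDelta0 ψ → IsDelta0 (ball y ψ)
  | bex {n : ℕ} (y : Tm P n) {ψ : Fml P (n + 1)} : IsDelta0 ψ → IsDelta0 (bex y ψ)

/-- Renaming of free variables. -/
def rename {n m : ℕ} (f : Fin n → Fin m) : Fml P n → Fml P m
  | mem s t => mem (s.rename f) (t.rename f)
  | nmem s t => nmem (s.rename f) (t.rename f)
  | eq s t => eq (s.rename f) (t.rename f)
  | ne s t => ne (s.rename f) (t.rename f)
  | and φ ψ => and (φ.rename f) (ψ.rename f)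
  | or φ ψ => or (φ.rename f) (ψ.rename f)
  | all φ => all (φ.rename (Fin.snoc (α := fun _ => Fin (m + 1)) (fun i => (f i).castSucc)
      (Fin.last m)))
  | ex φ => ex (φ.rename (Fin.snoc (α := fun _ => Fin (m + 1)) (fun i => (f i).castSucc)
      (Fin.last m)))

/-- Substitute the parameter `a` for the variable `0`, the outermost one. For `ψ : Fml P 1` and a
closed formula `all ψ` or `ex ψ`, `ψ.inst a` is the instance `ψ(a)`. -/
def inst (a : P) : {n : ℕ} → Fml P (n + 1) → Fml P n
  | _, mem s t => mem (s.inst a) (t.inst a)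
  | _, nmem s t => nmem (s.inst a) (t.inst a)
  | _, eq s t => eq (s.inst a) (t.inst a)
  | _, ne s t => ne (s.inst a) (t.inst a)
  | _, and φ ψ => and (inst a φ) (inst a ψ)
  | _, or φ ψ => or (inst a φ) (inst a ψ)
  | _, all φ => all (inst a φ)
  | _, ex φ => ex (inst a φ)

/-- A parameter-free formula seen as a formula over any set of parameters. -/
def ofPure {n : ℕ} : Fml Empty n → Fml P n
  | mem s t => mem s.ofPure t.ofPure
  | nmem s t => nmem s.ofPure t.ofPure
  | eq s t => eq s.ofPure t.ofPure
  | ne s t => ne s.ofPure t.ofPure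
  | and φ ψ => and φ.ofPure ψ.ofPure
  | or φ ψ => or φ.ofPure ψ.ofPure
  | all φ => all φ.ofPure
  | ex φ => ex φ.ofPure

/-- Satisfaction in the structure `(M, ∈)`, where parameters are interpreted by `val` and
variables by `x`. -/
def Sat (val : P → ZFSet.{v}) (M : Set ZFSet.{v}) {n : ℕ} (x : Fin n → ZFSet.{v}) :
    Fml P n → Prop
  | mem s t => s.eval val x ∈ t.eval val x
  | nmem s t => s.eval val x ∉ t.eval val x
  | eq s t => s.eval val x = t.eval val x
  | ne s t => s.eval val x ≠ t.eval val x
  | and φ ψ => φ.Sat val M x ∧ ψ.Sat val M x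
  | or φ ψ => φ.Sat val M x ∨ ψ.Sat val M x
  | all φ => ∀ a ∈ M, φ.Sat val M (Fin.snoc (α := fun _ => ZFSet.{v}) x a)
  | ex φ => ∃ a ∈ M, φ.Sat val M (Fin.snoc (α := fun _ => ZFSet.{v}) x a)

/-- Gödel numbers of parameter-free formulas. -/
def godel {n : ℕ} : Fml Empty n → ℕ
  | mem s t => 8 * Nat.pair s.index t.index
  | nmem s t => 8 * Nat.pair s.index t.index + 1
  | eq s t => 8 * Nat.pair s.index t.index + 2
  | ne s t => 8 * Nat.pair s.index t.index + 3
  | and φ ψ => 8 * Nat.pair φ.godel ψ.godel + 4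
  | or φ ψ => 8 * Nat.pair φ.godel ψ.godel + 5
  | all φ => 8 * φ.godel + 6
  | ex φ => 8 * φ.godel + 7

/-- `∀ v₁ ⋯ ∀ vₖ φ`, where `φ` has the free variables `0, …, k-1`. -/
def allN : (k : ℕ) → Fml P k → Fml P 0
  | 0, φ => φ
  | k + 1, φ => allN k (all φ)

end Fml

/-! ### The axioms of Kripke-Platek set theory with infinity -/

section Axioms

open Fml

/-- The variable `i`, in a context of `n` variables. -/
def x_ {n : ℕ} (i : ℕ) (h : i < n := by omega) : Tm Empty n := Tm.var ⟨i, h⟩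

def axEquality : Fml Empty 0 :=
  all (all (all (all
    (imp (and (and (eq (x_ 0) (x_ 1)) (eq (x_ 2) (x_ 3))) (mem (x_ 0) (x_ 2)))
      (mem (x_ 1) (x_ 3))))))

def axExtensionality : Fml Empty 0 :=
  all (all (imp (and (ball (x_ 0) (mem (x_ 2) (x_ 1))) (ball (x_ 1) (mem (x_ 2) (x_ 0))))
    (eq (x_ 0) (x_ 1))))

def axPairing : Fml Empty 0 :=
  all (all (ex (and (mem (x_ 0) (x_ 2)) (mem (x_ 1) (x_ 2)))))

def axUnion : Fml Empty 0 :=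
  all (ex (ball (x_ 0) (ball (x_ 2) (mem (x_ 3) (x_ 1)))))

/-- `∃ x`, `x` is a limit ordinal: `x` and all its elements are transitive, `x` is not empty,
and every element of `x` is an element of an element of `x`. -/
def axInfinity : Fml Empty 0 :=
  ex (and (and (ball (x_ 0) (ball (x_ 1) (mem (x_ 2) (x_ 0))))
      (ball (x_ 0) (ball (x_ 1) (ball (x_ 2) (mem (x_ 3) (x_ 1))))))
    (and (bex (x_ 0) (eq (x_ 1) (x_ 1)))
      (ball (x_ 0) (bex (x_ 0) (mem (x_ 1) (x_ 2))))))

/-- Rename the variables `0, …, n-1` so that all those from `j` on move up by one. -/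
def skip {n : ℕ} (j : ℕ) (φ : Fml Empty n) : Fml Empty (n + 1) :=
  φ.rename fun i => if (i : ℕ) < j then i.castSucc else i.succ

/-- Separation for `θ(v₁, …, vₖ, x, z)`, where `vᵢ` is the variable `i-1`:
`∀ v⃗ ∀ x ∃ y (∀ z ∈ x (θ → z ∈ y) ∧ ∀ z ∈ y (z ∈ x ∧ θ))`. -/
def axSeparation (k : ℕ) (θ : Fml Empty (k + 2)) : Fml Empty 0 :=
  allN k (all (ex (and
    (ball (x_ k) (imp (skip (k + 1) θ) (mem (x_ (k + 2)) (x_ (k + 1)))))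
    (ball (x_ (k + 1)) (and (mem (x_ (k + 2)) (x_ k)) (skip (k + 1) θ))))))

/-- Collection for `θ(v₁, …, vₖ, x, y, z)`:
`∀ v⃗ ∀ x (∀ y ∈ x ∃ z θ → ∃ w ∀ y ∈ x ∃ z ∈ w θ)`. -/
def axCollection (k : ℕ) (θ : Fml Empty (k + 3)) : Fml Empty 0 :=
  allN k (all (imp (ball (x_ k) (ex θ))
    (ex (ball (x_ k) (bex (x_ (k + 1)) (skip (k + 1) θ))))))

/-- Foundation for `θ(v₁, …, vₖ, x)`: `∀ v⃗ (∀ x (∀ y ∈ x θ(y) → θ(x)) → ∀ x θ(x))`. -/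
def axFoundation (k : ℕ) (θ : Fml Empty (k + 1)) : Fml Empty 0 :=
  allN k (imp (all (imp (ball (x_ k) (skip k θ)) θ)) (all θ))

/-- The axioms of Kripke-Platek set theory with infinity. -/
inductive IsKPAxiom : Fml Empty 0 → Prop
  | equality : IsKPAxiom axEquality
  | extensionality : IsKPAxiom axExtensionality
  | pairing : IsKPAxiom axPairing
  | union : IsKPAxiom axUnion
  | infinity : IsKPAxiom axInfinity
  | separation (k : ℕ) (θ : Fml Empty (k + 2)) : IsDelta0 θ → IsKPAxiom (axSeparation k θ)
  | collection (k : ℕ) (θ : Fml Empty (k + 3)) : IsDelta0 θ → IsKPAxiom (axCollection k θ)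
  | foundation (k : ℕ) (θ : Fml Empty (k + 1)) : IsKPAxiom (axFoundation k θ)

/-- The axioms that are used to build the search trees: foundation is left out, the instances of
separation and collection have at most `K` parameters, and collection is restricted to
disjunctions. -/
inductive IsTreeAxiom (K : ℕ) : Fml Empty 0 → Prop
  | equality : IsTreeAxiom K axEquality
  | extensionality : IsTreeAxiom K axExtensionality
  | pairing : IsTreeAxiom K axPairing
  | union : IsTreeAxiom K axUnion
  | infinity : IsTreeAxiom K axInfinity
  | separation (k : ℕ) (θ : Fml Empty (k + 2)) : k ≤ K → IsDelta0 θ →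
      IsTreeAxiom K (axSeparation k θ)
  | collection (k : ℕ) (θ₀ θ₁ : Fml Empty (k + 3)) : k ≤ K → IsDelta0 (or θ₀ θ₁) →
      IsTreeAxiom K (axCollection k (or θ₀ θ₁))

end Axioms

/-- Admissible sets: transitive models of Kripke-Platek set theory with infinity. -/
def Admissible (A : ZFSet.{v}) : Prop :=
  A.IsTransitive ∧ ∀ φ, IsKPAxiom φ → φ.Sat Empty.elim {x | x ∈ A} Fin.elim0

/-! ### The constructible hierarchy over a set, and its ranked version -/

/-- The formula `φ` with parameters `p` from `M` defines `b` as a subset of `M`. -/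
def Defines (M : Set ZFSet.{v}) {n : ℕ} (φ : Fml Empty (n + 1)) (p : Fin n → ZFSet.{v})
    (b : ZFSet.{v}) : Prop :=
  (∀ i, p i ∈ M) ∧
    ∀ x, x ∈ b ↔ x ∈ M ∧ φ.Sat Empty.elim M (Fin.snoc (α := fun _ => ZFSet.{v}) p x)

/-- The sets that are definable over `(M, ∈)` with parameters. -/
def definablePowerset (M : Set ZFSet.{v}) : Set ZFSet.{v} :=
  {b | ∃ (n : ℕ) (φ : Fml Empty (n + 1)) (p : Fin n → ZFSet.{v}), Defines M φ p b}

/-- The stage `𝕃_α^u` of the constructible hierarchy, with `𝕃_0^u = u`. -/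
def LStage (u : Set ZFSet.{v}) (α : Ordinal.{v}) : Set ZFSet.{v} :=
  Ordinal.limitRecOn (motive := fun _ => Set ZFSet.{v}) α u
    (fun _ M => definablePowerset M) (fun _ _ M => {a | ∃ β h, a ∈ M β h})

/-- Pairs `⟨β, a⟩` of an ordinal and a set. -/
abbrev Ranked : Type (v + 1) := Ordinal.{v} × ZFSet.{v}

/-- The ranked stage `𝐋_α^u`: pairs `⟨β, a⟩` where `β < α` is minimal with `a ∈ 𝕃_{β+1}^u`
(and `⟨0, a⟩` with `a ∈ u` if `α = 0`). -/
def RStage (u : Set ZFSet.{v}) (α : Ordinal.{v}) : Set Ranked.{v} :=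
  {c | (α = 0 ∧ c.1 = 0 ∧ c.2 ∈ u) ∨
    (c.1 < α ∧ c.2 ∈ LStage u (c.1 + 1) ∧ ∀ γ < c.1, c.2 ∉ LStage u (γ + 1))}

/-- Comparison of definitions: first by the number of parameters, then by the Gödel number of the
formula, then lexicographically by the parameters. -/
inductive DefnLt (lt : ZFSet.{v} → ZFSet.{v} → Prop) :
    ∀ {n m : ℕ}, Fml Empty (n + 1) → (Fin n → ZFSet.{v}) →
      Fml Empty (m + 1) → (Fin m → ZFSet.{v}) → Prop
  | arity {n m : ℕ} (φ : Fml Empty (n + 1)) (p : Fin n → ZFSet.{v})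
      (ψ : Fml Empty (m + 1)) (q : Fin m → ZFSet.{v}) : n < m → DefnLt lt φ p ψ q
  | formula {n : ℕ} (φ ψ : Fml Empty (n + 1)) (p q : Fin n → ZFSet.{v}) :
      φ.godel < ψ.godel → DefnLt lt φ p ψ q
  | params {n : ℕ} (φ : Fml Empty (n + 1)) (p q : Fin n → ZFSet.{v}) (i : Fin n) :
      (∀ j < i, p j = q j) → lt (p i) (q i) → DefnLt lt φ p φ q

/-- The well-ordering of `𝕃_α^u` for `u = {e 0, e 1, …}`. Elements of `u` are ordered by their
least index, `𝕃_{β+1}^u` is an end-extension of `𝕃_β^u`, and the new elements of `𝕃_{β+1}^u` are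
ordered by their least definition over `𝕃_β^u`. -/
def LLt (e : ℕ → ZFSet.{v}) (α : Ordinal.{v}) : ZFSet.{v} → ZFSet.{v} → Prop :=
  Ordinal.limitRecOn (motive := fun _ => ZFSet.{v} → ZFSet.{v} → Prop) α
    (fun a b => b ∈ Set.range e ∧ ∃ i, e i = a ∧ ∀ j, e j = b → i < j)
    (fun β lt a b =>
      let L := LStage (Set.range e) β
      let L' := LStage (Set.range e) (β + 1)
      (a ∈ L ∧ b ∈ L ∧ lt a b) ∨ (a ∈ L ∧ b ∈ L' \ L) ∨
        (a ∈ L' \ L ∧ b ∈ L' \ L ∧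
          ∃ (n : ℕ) (φ : Fml Empty (n + 1)) (p : Fin n → ZFSet.{v}), Defines L φ p a ∧
            ∀ (m : ℕ) (ψ : Fml Empty (m + 1)) (q : Fin m → ZFSet.{v}), Defines L ψ q b →
              DefnLt lt φ p ψ q))
    (fun _ _ lt a b => ∃ β h, lt β h a b)

/-- The induced well-ordering of the ranked stage `𝐋_α^u`. -/
def RLt (e : ℕ → ZFSet.{v}) (α : Ordinal.{v}) (c d : Ranked.{v}) : Prop :=
  c ∈ RStage (Set.range e) α ∧ d ∈ RStage (Set.range e) α ∧ LLt e α c.2 d.2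

/-! ### Search trees -/

/-- A sequent is a finite sequence of closed formulas. -/
abbrev Sequent : Type (v + 1) := List (Fml Ranked.{v} 0)

/-- The sequent contains a true `Δ₀`-formula; parameters `⟨β, a⟩` stand for `a`. -/
def HasTrueDelta0 (Γ : Sequent.{v}) : Prop :=
  ∃ φ ∈ Γ, φ.IsDelta0 ∧ φ.Sat Prod.snd Set.univ Fin.elim0

/-- The list `u₀, σ₀, …, u_{n-1}, σ_{n-1}, u_n, u_{n+1}, …`, where `n` is the length of `σ`. -/
def candidate (e : ℕ → ZFSet.{v}) (σ : List Ranked.{v}) (i : ℕ) : Ranked.{v} :=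
  if h : i < 2 * σ.length then
    if i % 2 = 0 then (0, e (i / 2)) else σ[i / 2]'(by omega)
  else (0, e (i - σ.length))

def mark0 : Ranked.{v} := (0, ∅)

def mark1 : Ranked.{v} := (0, {∅})

/-- `SearchTree e θ α σ Γ` says that `σ` is a node of the search tree `S_α^u` for
`u = {e 0, e 1, …}`, and that its label is the sequent `Γ`. -/
inductive SearchTree (e : ℕ → ZFSet.{v}) (θ : ℕ → Fml Empty 0) (α : Ordinal.{v}) :
    List Ranked.{v} → Sequent.{v} → Prop
  | root : SearchTree e θ α [] []
  | axm {σ : List Ranked.{v}} {Γ : Sequent.{v}} (k : ℕ) :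
      SearchTree e θ α σ Γ → σ.length = 2 * k →
      SearchTree e θ α (σ ++ [mark0]) (Γ ++ [(θ k).neg.ofPure])
  | stall {σ : List Ranked.{v}} {Γ : Sequent.{v}} :
      SearchTree e θ α σ Γ → Odd σ.length → ¬ HasTrueDelta0 Γ → (∀ χ ∈ Γ, χ.IsLiteral) →
      SearchTree e θ α (σ ++ [mark0]) Γ
  | conjLeft {σ : List Ranked.{v}} {Γ Γ' : Sequent.{v}} {ψ₀ ψ₁ : Fml Ranked.{v} 0} :
      SearchTree e θ α σ (Γ ++ .and ψ₀ ψ₁ :: Γ') → Odd σ.length →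
      ¬ HasTrueDelta0 (Γ ++ .and ψ₀ ψ₁ :: Γ') → (∀ χ ∈ Γ, χ.IsLiteral) →
      SearchTree e θ α (σ ++ [mark0]) (Γ ++ Γ' ++ [.and ψ₀ ψ₁, ψ₀])
  | conjRight {σ : List Ranked.{v}} {Γ Γ' : Sequent.{v}} {ψ₀ ψ₁ : Fml Ranked.{v} 0} :
      SearchTree e θ α σ (Γ ++ .and ψ₀ ψ₁ :: Γ') → Odd σ.length →
      ¬ HasTrueDelta0 (Γ ++ .and ψ₀ ψ₁ :: Γ') → (∀ χ ∈ Γ, χ.IsLiteral) →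
      SearchTree e θ α (σ ++ [mark1]) (Γ ++ Γ' ++ [.and ψ₀ ψ₁, ψ₁])
  | disjLeft {σ : List Ranked.{v}} {Γ Γ' : Sequent.{v}} {ψ₀ ψ₁ : Fml Ranked.{v} 0} :
      SearchTree e θ α σ (Γ ++ .or ψ₀ ψ₁ :: Γ') → Odd σ.length →
      ¬ HasTrueDelta0 (Γ ++ .or ψ₀ ψ₁ :: Γ') → (∀ χ ∈ Γ, χ.IsLiteral) →
      ψ₀ ∉ Γ ++ .or ψ₀ ψ₁ :: Γ' →
      SearchTree e θ α (σ ++ [mark0]) (Γ ++ Γ' ++ [.or ψ₀ ψ₁, ψ₀])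
  | disjRight {σ : List Ranked.{v}} {Γ Γ' : Sequent.{v}} {ψ₀ ψ₁ : Fml Ranked.{v} 0} :
      SearchTree e θ α σ (Γ ++ .or ψ₀ ψ₁ :: Γ') → Odd σ.length →
      ¬ HasTrueDelta0 (Γ ++ .or ψ₀ ψ₁ :: Γ') → (∀ χ ∈ Γ, χ.IsLiteral) →
      ψ₀ ∈ Γ ++ .or ψ₀ ψ₁ :: Γ' →
      SearchTree e θ α (σ ++ [mark0]) (Γ ++ Γ' ++ [.or ψ₀ ψ₁, ψ₁])
  | all {σ : List Ranked.{v}} {Γ Γ' : Sequent.{v}} {ψ : Fml Ranked.{v} 1} (a : Ranked.{v}) :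
      SearchTree e θ α σ (Γ ++ .all ψ :: Γ') → Odd σ.length →
      ¬ HasTrueDelta0 (Γ ++ .all ψ :: Γ') → (∀ χ ∈ Γ, χ.IsLiteral) →
      a ∈ RStage (Set.range e) α →
      SearchTree e θ α (σ ++ [a]) (Γ ++ Γ' ++ [.all ψ, ψ.inst a])
  | ex {σ : List Ranked.{v}} {Γ Γ' : Sequent.{v}} {ψ : Fml Ranked.{v} 1} (i : ℕ) :
      SearchTree e θ α σ (Γ ++ .ex ψ :: Γ') → Odd σ.length →
      ¬ HasTrueDelta0 (Γ ++ .ex ψ :: Γ') → (∀ χ ∈ Γ, χ.IsLiteral) →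
      ψ.inst (candidate e σ i) ∉ Γ ++ .ex ψ :: Γ' →
      (∀ j < i, ψ.inst (candidate e σ j) ∈ Γ ++ .ex ψ :: Γ') →
      SearchTree e θ α (σ ++ [mark0]) (Γ ++ Γ' ++ [.ex ψ, ψ.inst (candidate e σ i)])
  /-- If all instances from the list occur already (possible only if `u` is finite), then no new
  formula is added. -/
  | exDone {σ : List Ranked.{v}} {Γ Γ' : Sequent.{v}} {ψ : Fml Ranked.{v} 1} :
      SearchTree e θ α σ (Γ ++ .ex ψ :: Γ') → Odd σ.length →
      ¬ HasTrueDelta0 (Γ ++ .ex ψ :: Γ') → (∀ χ ∈ Γ, χ.IsLiteral) →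
      (∀ j, ψ.inst (candidate e σ j) ∈ Γ ++ .ex ψ :: Γ') →
      SearchTree e θ α (σ ++ [mark0]) (Γ ++ Γ' ++ [.ex ψ])

/-- The set of nodes of the search tree `S_α^u`. -/
def nodes (e : ℕ → ZFSet.{v}) (θ : ℕ → Fml Empty 0) (α : Ordinal.{v}) :
    Set (List Ranked.{v}) :=
  {σ | ∃ Γ, SearchTree e θ α σ Γ}

/-- The Kleene-Brouwer ordering on `S_α^u`. -/
def KBLt (e : ℕ → ZFSet.{v}) (θ : ℕ → Fml Empty 0) (α : Ordinal.{v})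
    (σ τ : List Ranked.{v}) : Prop :=
  σ ∈ nodes e θ α ∧ τ ∈ nodes e θ α ∧
    ((∃ a ρ, σ = τ ++ a :: ρ) ∨
      ∃ σ₀ a b σ' τ', σ = σ₀ ++ a :: σ' ∧ τ = σ₀ ++ b :: τ' ∧ RLt e α a b)

/-! ### The term systems `ε(S)` -/

/-- Preliminary terms: `0`, `ε_σ` and `Ω^{s₀}·β₀ + ⋯ + Ω^{sₙ}·βₙ`. -/
inductive Term : Type (v + 1)
  | zero : Term
  | eps (σ : List Ranked.{v}) : Term
  | sum (l : List (Term × Ordinal.{v})) : Term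

/-- The order relation on terms, for an order relation `lt` on the indices `σ` of `ε_σ`. -/
inductive TermLt (lt : List Ranked.{v} → List Ranked.{v} → Prop) : Term.{v} → Term.{v} → Prop
  | zero {t : Term.{v}} : t ≠ .zero → TermLt lt .zero t
  | eps_eps {σ τ : List Ranked.{v}} : lt σ τ → TermLt lt (.eps σ) (.eps τ)
  | eps_sum_lt {σ : List Ranked.{v}} {t₀ : Term.{v}} {γ₀ : Ordinal.{v}}
      {l : List (Term.{v} × Ordinal.{v})} :
      TermLt lt (.eps σ) t₀ → TermLt lt (.eps σ) (.sum ((t₀, γ₀) :: l))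
  | eps_sum_eq {σ : List Ranked.{v}} {γ₀ : Ordinal.{v}}
      {l : List (Term.{v} × Ordinal.{v})} :
      TermLt lt (.eps σ) (.sum ((.eps σ, γ₀) :: l))
  | sum_eps {s₀ : Term.{v}} {β₀ : Ordinal.{v}} {l : List (Term.{v} × Ordinal.{v})}
      {τ : List Ranked.{v}} :
      TermLt lt s₀ (.eps τ) → TermLt lt (.sum ((s₀, β₀) :: l)) (.eps τ)
  | sum_prefix {l l' : List (Term.{v} × Ordinal.{v})} :
      l' ≠ [] → TermLt lt (.sum l) (.sum (l ++ l'))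
  | sum_exponent {l l₁ l₂ : List (Term.{v} × Ordinal.{v})} {s t : Term.{v}}
      {β γ : Ordinal.{v}} :
      TermLt lt s t → TermLt lt (.sum (l ++ (s, β) :: l₁)) (.sum (l ++ (t, γ) :: l₂))
  | sum_coefficient {l l₁ l₂ : List (Term.{v} × Ordinal.{v})} {s : Term.{v}}
      {β γ : Ordinal.{v}} :
      β < γ → TermLt lt (.sum (l ++ (s, β) :: l₁)) (.sum (l ++ (s, γ) :: l₂))

/-- The terms of `ε(S)`, for a set `S` of indices with order relation `lt`, and with coefficients
below `δ`. -/
inductive IsTerm (S : Set (List Ranked.{v})) (lt : List Ranked.{v} → List Ranked.{v} → Prop)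
    (δ : Ordinal.{v}) : Term.{v} → Prop
  | zero : IsTerm S lt δ .zero
  | eps {σ : List Ranked.{v}} : σ ∈ S → IsTerm S lt δ (.eps σ)
  | sum {l : List (Term.{v} × Ordinal.{v})} : l ≠ [] →
      (∀ s β, (s, β) ∈ l → IsTerm S lt δ s) → (∀ s β, (s, β) ∈ l → 0 < β ∧ β < δ) →
      (∀ σ, l ≠ [(.eps σ, 1)]) →
      l.IsChain (fun x y => TermLt lt y.1 x.1) → IsTerm S lt δ (.sum l)

/-- The set of terms `ε(S_{ω^α}^u)`. -/
def epsTerms (e : ℕ → ZFSet.{v}) (θ : ℕ → Fml Empty 0) (α : Ordinal.{v}) : Set Term.{v} :=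
  {t | IsTerm (nodes e θ (Ordinal.omega0 ^ α)) (KBLt e θ (Ordinal.omega0 ^ α))
    (Ordinal.omega0 ^ α) t}

/-- The order relation of `ε(S_{ω^α}^u)`. -/
def EpsLt (e : ℕ → ZFSet.{v}) (θ : ℕ → Fml Empty 0) (α : Ordinal.{v}) (s t : Term.{v}) : Prop :=
  s ∈ epsTerms e θ α ∧ t ∈ epsTerms e θ α ∧ TermLt (KBLt e θ (Ordinal.omega0 ^ α)) s t

/-! ### Terms as sets -/

def listCode : List ZFSet.{v} → ZFSet.{v}
  | [] => ∅
  | a :: l => ZFSet.pair a (listCode l)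

def rankedCode (c : Ranked.{v}) : ZFSet.{v} := ZFSet.pair c.1.toZFSet c.2

mutual

/-- The set that represents a term; distinct terms are represented by distinct sets. -/
def Term.code : Term.{v} → ZFSet.{v}
  | .zero => ZFSet.pair (Ordinal.toZFSet 0) ∅
  | .eps σ => ZFSet.pair (Ordinal.toZFSet 1) (listCode (σ.map rankedCode))
  | .sum l => ZFSet.pair (Ordinal.toZFSet 2) (Term.codes l)

def Term.codes : List (Term.{v} × Ordinal.{v}) → ZFSet.{v}
  | [] => ∅
  | (s, β) :: l => ZFSet.pair (ZFSet.pair s.code β.toZFSet) (Term.codes l)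

end

/-- The function with domain `ω` that maps `n` to `e n`, as a set of pairs. -/
def enumCode (e : ℕ → ZFSet.{v}) : ZFSet.{v} :=
  ZFSet.range fun n : ℕ => ZFSet.pair (Ordinal.toZFSet n) (e n)

/-- The set `x` is the pair of the set `ε(S_{ω^α}^u)` and its order relation. -/
def IsEpsSystem (e : ℕ → ZFSet.{v}) (θ : ℕ → Fml Empty 0) (α : Ordinal.{v}) (x : ZFSet.{v}) :
    Prop :=
  ∃ X R : ZFSet.{v}, x = ZFSet.pair X R ∧
    (∀ z, z ∈ X ↔ ∃ s ∈ epsTerms e θ α, z = s.code) ∧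
    (∀ z, z ∈ R ↔ ∃ s t, EpsLt e θ α s t ∧ z = ZFSet.pair s.code t.code)

/-! ### Primitive recursive set functions -/

/-- The primitive recursive set functions (relative to `ω`). -/
inductive SetPrimrec : ∀ {n : ℕ}, ((Fin n → ZFSet.{v}) → ZFSet.{v}) → Prop
  | proj {n : ℕ} (i : Fin n) : SetPrimrec fun x => x i
  | empty {n : ℕ} : SetPrimrec fun _ : Fin n → ZFSet.{v} => ∅
  | omega {n : ℕ} : SetPrimrec fun _ : Fin n → ZFSet.{v} => ZFSet.omega
  /-- `x ∪ {y}` -/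
  | adjoin : SetPrimrec fun x : Fin 2 → ZFSet.{v} => insert (x 1) (x 0)
  | cond : SetPrimrec fun x : Fin 4 → ZFSet.{v} => open Classical in if x 2 ∈ x 3 then x 0 else x 1
  | comp {n m : ℕ} {F : (Fin m → ZFSet.{v}) → ZFSet.{v}}
      {G : Fin m → (Fin n → ZFSet.{v}) → ZFSet.{v}} :
      SetPrimrec F → (∀ i, SetPrimrec (G i)) → SetPrimrec fun x => F fun i => G i x
  /-- `F(z, x) = H(⋃ {F(y, x) | y ∈ z}, z, x)` -/
  | recursion {n : ℕ} {H : (Fin (n + 2) → ZFSet.{v}) → ZFSet.{v}}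
      {F : (Fin (n + 1) → ZFSet.{v}) → ZFSet.{v}} :
      SetPrimrec H →
      (∀ (z : ZFSet.{v}) (x : Fin n → ZFSet.{v}), ∃ U : ZFSet.{v},
        (∀ a, a ∈ U ↔ ∃ y ∈ z, a ∈ F (Matrix.vecCons y x)) ∧
        F (Matrix.vecCons z x) = H (Matrix.vecCons U (Matrix.vecCons z x))) →
      SetPrimrec F

/-- Transitive models of primitive recursive set theory with infinity: transitive classes of sets
that are closed under all primitive recursive set functions. The class of all sets is one. -/
structure IsTransitiveModel (W : Set ZFSet.{v}) : Prop where
  trans : ∀ x ∈ W, ∀ y ∈ x, y ∈ W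
  closed : ∀ (n : ℕ) (F : (Fin n → ZFSet.{v}) → ZFSet.{v}), SetPrimrec F →
    ∀ x : Fin n → ZFSet.{v}, (∀ i, x i ∈ W) → F x ∈ W

/-! ### Well-ordering principles -/

/-- The set `T_α^u`, where `T(u, α) = ⟨T_α^u, <⟩`. -/
def carrier (T : (Fin 2 → ZFSet.{v}) → ZFSet.{v}) (u : ZFSet.{v}) (α : Ordinal.{v}) :
    Set ZFSet.{v} :=
  {s | ∃ X R, T ![u, α.toZFSet] = ZFSet.pair X R ∧ s ∈ X}

/-- The relation `<` on `T_α^u`, where `T(u, α) = ⟨T_α^u, <⟩`. -/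
def CarrierLt (T : (Fin 2 → ZFSet.{v}) → ZFSet.{v}) (u : ZFSet.{v}) (α : Ordinal.{v})
    (s t : ZFSet.{v}) : Prop :=
  ∃ X R, T ![u, α.toZFSet] = ZFSet.pair X R ∧ ZFSet.pair s t ∈ R

/-- In the sense of `W`, the linear order `lt` well-orders `X`: every nonempty subset of `X` has a
minimal element. -/
structure WellOrders (W : Set ZFSet.{v}) (lt : ZFSet.{v} → ZFSet.{v} → Prop)
    (X : Set ZFSet.{v}) : Prop where
  irrefl : ∀ s ∈ X, ¬ lt s s
  trans : ∀ r ∈ X, ∀ s ∈ X, ∀ t ∈ X, lt r s → lt s t → lt r t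
  total : ∀ s ∈ X, ∀ t ∈ X, lt s t ∨ s = t ∨ lt t s
  minimal : ∀ a ∈ W, (∀ s ∈ a, s ∈ X) → a ≠ ∅ → ∃ m ∈ a, ∀ s ∈ a, ¬ lt s m

/-- In the sense of `W`, the primitive recursive family `α ↦ T(u, α) = ⟨T_α^u, <⟩` with the
rank function `s ↦ rk(u, s)` is a ranked compatible well-ordering principle. -/
structure IsWOP (W : Set ZFSet.{v}) (T rk : (Fin 2 → ZFSet.{v}) → ZFSet.{v}) (u : ZFSet.{v}) :
    Prop where
  primrec : SetPrimrec T
  primrec_rank : SetPrimrec rk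
  isPair : ∀ α : Ordinal.{v}, α.toZFSet ∈ W →
    ∃ X R, T ![u, α.toZFSet] = ZFSet.pair X R ∧ R ⊆ X.prod X
  wellOrders : ∀ α : Ordinal.{v}, α.toZFSet ∈ W →
    WellOrders W (CarrierLt T u α) (carrier T u α)
  subset : ∀ α β : Ordinal.{v}, β.toZFSet ∈ W → α < β → carrier T u α ⊆ carrier T u β
  restrict : ∀ α β : Ordinal.{v}, β.toZFSet ∈ W → α < β → ∀ s t,
    CarrierLt T u α s t ↔ CarrierLt T u β s t ∧ s ∈ carrier T u α ∧ t ∈ carrier T u α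
  limit : ∀ γ : Ordinal.{v}, γ.toZFSet ∈ W → Order.IsSuccLimit γ →
    ∀ s, s ∈ carrier T u γ ↔ ∃ α < γ, s ∈ carrier T u α
  rank_eq : ∀ s ∈ W, ∀ α : Ordinal.{v}, α.toZFSet ∈ W →
    IsLeast {β : Ordinal.{v} | β.toZFSet ∈ W ∧ s ∈ carrier T u (β + 1)} α →
    rk ![u, s] = α.toZFSet
  rank_default : ∀ s ∈ W,
    (¬ ∃ β : Ordinal.{v}, β.toZFSet ∈ W ∧ s ∈ carrier T u (β + 1)) →
    rk ![u, s] = {{∅}}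

end KPTree

end

open KPTree

/-!
The proof has a computational and a combinatorial half.

*Primitive recursion.* The set functions `T` and `rk` have to be exhibited as primitive recursive,
and the minimal elements demanded by `IsWOP` have to be found with sets that belong to the
transitive model `W`. Both tasks are reduced to one calculus. Types such as `Ordinal`, `List α`,
`Fml Ranked n`, `Term` carry an injection `code` into sets (`SetCode`); `PR f` says that a function
between such types is induced by a primitive recursive set function, and `PRS s` that a family of
subsets is. Closure under recursion on ordinals, lists, natural numbers and codes of formulas comes
from course-of-values recursion along `∈` (`SetPrimrec.covValue`). Satisfaction, the hierarchy
`LStage` and its ordering, the search trees and the term systems are then treated by their recursive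
definitions; `fun_prop` handles the compositions. By `IsTransitiveModel.exists_cset` the values of
`PRS` families at arguments in `W` belong to `W`. The rank function is a search below the
set-theoretic rank of the code of a term, which bounds all ordinals in the term
(`mem_epsTerms_rank`).

*Order.* The order of `ε(S)` is the lexicographic order of sums, where `ε_σ` counts as `Ω^{ε_σ}·1`
(`termLt_iff_lex`). So it is linear if `S` is, and passage to a later stage does not change it.

*Well-foundedness.* Let `U ∈ W` be a nonempty set of terms without minimal element. It is turned
into an admissible set in `W` that includes `u`, in three steps. They replace choices of descending
sequences, which might lead out of `W`, by canonical definitions.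

* A list of summands *recurs* in `U` if arbitrarily small elements of `U` begin with it. The
  exponents that follow recurring lists again form a nonempty set without minimal element
  (`Descending.exponents`), because the coefficients are well-ordered. Iteration reaches smaller
  and smaller subterms, so that the nodes `σ` with `ε_σ` in some iterate form a nonempty set `B ∈ W`
  without minimal element in the Kleene-Brouwer ordering (`exists_descending_nodes`).
* The nodes that are extended by arbitrarily small elements of `B` form an infinite branch of the
  search tree (`exists_branch`), because the stages of the constructible hierarchy over `u` are
  well-ordered. All formulas on the branch are false in the structure `m` that consists of `u` and
  the entries of the branch (`IsBranch.not_sat`): no true `Δ₀`-formula occurs on the branch, each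
  other formula is expanded, and all elements of `m` appear among the candidates for witnesses. As
  all negated axioms occur, `m` satisfies the axioms.
* The Mostowski collapse `A` of `m` satisfies the axioms and includes `u`, since `u` is transitive.
  Pairing and separation allow to contract finitely many parameters into one, and `φ` is equivalent
  to the disjunction `φ ∨ φ`. So `A` satisfies full `Δ₀`-separation and `Δ₀`-collection, and
  foundation holds because `∈` is well-founded (`admissible_of_sat`).
-/

set_option autoImplicit false

noncomputable section

namespace KPTree

section

/-! ### Closure properties of primitive recursive set functions -/

namespace SetPrimrec

variable {n : ℕ}

theorem comp₁ {f : ZFSet.{v} → ZFSet.{v}} {G : (Fin n → ZFSet.{v}) → ZFSet.{v}}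
    (hf : SetPrimrec fun x : Fin 1 → ZFSet.{v} => f (x 0)) (hG : SetPrimrec G) :
    SetPrimrec fun x => f (G x) :=
  comp (G := fun _ => G) hf fun _ => hG

theorem comp₂ {f : ZFSet.{v} → ZFSet.{v} → ZFSet.{v}} {G H : (Fin n → ZFSet.{v}) → ZFSet.{v}}
    (hf : SetPrimrec fun x : Fin 2 → ZFSet.{v} => f (x 0) (x 1)) (hG : SetPrimrec G)
    (hH : SetPrimrec H) : SetPrimrec fun x => f (G x) (H x) :=
  comp (G := ![G, H]) hf (by simp [Fin.forall_fin_two, hG, hH])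

theorem insert' {G H : (Fin n → ZFSet.{v}) → ZFSet.{v}} (hG : SetPrimrec G)
    (hH : SetPrimrec H) : SetPrimrec fun x => insert (G x) (H x) :=
  comp₂ (f := fun a b => insert b a) adjoin hH hG

theorem singleton {G : (Fin n → ZFSet.{v}) → ZFSet.{v}} (hG : SetPrimrec G) :
    SetPrimrec fun x => ({G x} : ZFSet.{v}) := by
  simpa using insert' hG empty

open Classical in
theorem ite_mem {A B C D : (Fin n → ZFSet.{v}) → ZFSet.{v}} (hA : SetPrimrec A)
    (hB : SetPrimrec B) (hC : SetPrimrec C) (hD : SetPrimrec D) :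
    SetPrimrec fun x => if C x ∈ D x then A x else B x :=
  comp (G := ![A, B, C, D]) cond (by simp [Fin.forall_fin_succ, hA, hB, hC, hD])

end SetPrimrec

/-- The union of the sets `G y` for `y ∈ z`. -/
def bigUnion (z : ZFSet.{v}) (G : ZFSet.{v} → ZFSet.{v}) : ZFSet.{v} :=
  ZFSet.iUnion fun y : z => G y

@[simp]
theorem mem_bigUnion {z : ZFSet.{v}} {G : ZFSet.{v} → ZFSet.{v}} {a : ZFSet.{v}} :
    a ∈ bigUnion z G ↔ ∃ y ∈ z, a ∈ G y := by
  simp [bigUnion]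

/-- The characteristic value of a proposition: `1` if it is true, and `0` otherwise. -/
def truth (p : Prop) : ZFSet.{v} := open Classical in if p then {∅} else ∅

@[simp]
theorem empty_mem_truth {p : Prop} : (∅ : ZFSet.{v}) ∈ truth p ↔ p := by
  by_cases h : p <;> simp [truth, h]

namespace SetPrimrec

variable {n : ℕ}

open Classical in
/-- Bounded unions come from the recursion scheme: recurse on `y` with `z` as a parameter, and
pass to the union of the previous values only when `y = z` is reached. -/
theorem bigUnion {Z : (Fin n → ZFSet.{v}) → ZFSet.{v}}
    {G : ZFSet.{v} → (Fin n → ZFSet.{v}) → ZFSet.{v}} (hZ : SetPrimrec Z)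
    (hG : SetPrimrec fun x : Fin (n + 1) → ZFSet.{v} => G (x 0) fun i => x i.succ) :
    SetPrimrec fun x => KPTree.bigUnion (Z x) fun y => G y x := by
  let F : (Fin (n + 1 + 1) → ZFSet.{v}) → ZFSet.{v} := fun w =>
    if w 0 ∈ w 1 then G (w 0) (fun i => w i.succ.succ)
    else if w 0 = w 1 then KPTree.bigUnion (w 1) (fun y => G y fun i => w i.succ.succ) else ∅
  have hF : SetPrimrec F := by
    let H : (Fin (n + 1 + 2) → ZFSet.{v}) → ZFSet.{v} := fun w =>
      if w 1 ∈ w 2 then G (w 1) (fun i => w i.succ.succ.succ)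
      else if w 1 ∈ ({w 2} : ZFSet.{v}) then w 0 else ∅
    refine recursion (H := H) ?_ ?_
    · refine ite_mem ?_ (ite_mem (proj 0) empty (proj 1) (singleton (proj 2))) (proj 1) (proj 2)
      exact comp (G := Fin.cons (fun w => w 1) fun i w => w i.succ.succ.succ) hG
        (Fin.cases (proj 1) fun i => proj i.succ.succ.succ)
    · intro z x
      refine ⟨KPTree.bigUnion z fun y => F (Matrix.vecCons y x), fun a => by simp, ?_⟩
      have hFe : ∀ y, F (Matrix.vecCons y x) = if y ∈ x 0 then G y (fun i => x i.succ)
          else if y = x 0 then KPTree.bigUnion (x 0) (fun y => G y fun i => x i.succ) else ∅ :=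
        fun _ => rfl
      have hHe : ∀ U, H (Matrix.vecCons U (Matrix.vecCons z x)) =
          if z ∈ x 0 then G z (fun i => x i.succ) else if z ∈ ({x 0} : ZFSet.{v}) then U else ∅ :=
        fun _ => rfl
      rw [hHe, hFe]
      by_cases h : z ∈ x 0
      · simp [h]
      · by_cases h' : z = x 0
        · subst h'
          simp only [h, if_false, if_true, ZFSet.mem_singleton]
          ext a
          simp only [mem_bigUnion]
          refine exists_congr fun y => and_congr_right fun hy => ?_
          simp [hFe, hy]
        · simp [h, h']
  have := comp (G := Fin.cons Z (Fin.cons Z fun i x => x i)) hF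
    (Fin.cases hZ (Fin.cases hZ fun i => proj i))
  convert this using 2 with x
  simp [F, ZFSet.mem_irrefl]

/-- The predicate `P` has a primitive recursive characteristic function. -/
def Rel (P : (Fin n → ZFSet.{v}) → Prop) : Prop := SetPrimrec fun x => truth (P x)

open Classical in
theorem ite {P : (Fin n → ZFSet.{v}) → Prop} {A B : (Fin n → ZFSet.{v}) → ZFSet.{v}}
    (hP : Rel P) (hA : SetPrimrec A) (hB : SetPrimrec B) :
    SetPrimrec fun x => if P x then A x else B x := by
  simpa using ite_mem hA hB (empty (n := n)) hP

theorem Rel.mem {A B : (Fin n → ZFSet.{v}) → ZFSet.{v}} (hA : SetPrimrec A) (hB : SetPrimrec B) :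
    Rel fun x => A x ∈ B x :=
  ite_mem (singleton empty) empty hA hB

theorem Rel.eq {A B : (Fin n → ZFSet.{v}) → ZFSet.{v}} (hA : SetPrimrec A) (hB : SetPrimrec B) :
    Rel fun x => A x = B x := by
  simpa using Rel.mem hA (singleton hB)

theorem Rel.exists_mem {Z : (Fin n → ZFSet.{v}) → ZFSet.{v}}
    {P : ZFSet.{v} → (Fin n → ZFSet.{v}) → Prop} (hZ : SetPrimrec Z)
    (hP : Rel fun x : Fin (n + 1) → ZFSet.{v} => P (x 0) fun i => x i.succ) :
    Rel fun x => ∃ y ∈ Z x, P y x := by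
  simpa using Rel.mem empty (bigUnion (G := fun y x => truth (P y x)) hZ hP)

open Classical in
theorem sep {Z : (Fin n → ZFSet.{v}) → ZFSet.{v}}
    {P : ZFSet.{v} → (Fin n → ZFSet.{v}) → Prop} (hZ : SetPrimrec Z)
    (hP : Rel fun x : Fin (n + 1) → ZFSet.{v} => P (x 0) fun i => x i.succ) :
    SetPrimrec fun x => (Z x).sep fun y => P y x := by
  convert bigUnion (G := fun y x => if P y x then {y} else ∅) hZ
    (ite hP (singleton (proj 0)) empty) using 2 with x
  ext a
  simp only [ZFSet.mem_sep, mem_bigUnion]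
  constructor
  · rintro ⟨h, h'⟩
    exact ⟨a, h, by simp [h']⟩
  · rintro ⟨y, h, h'⟩
    by_cases hy : P y x <;> simp_all

theorem sUnion {Z : (Fin n → ZFSet.{v}) → ZFSet.{v}} (hZ : SetPrimrec Z) :
    SetPrimrec fun x => (Z x).sUnion := by
  convert bigUnion (G := fun y _ => y) hZ (proj 0) using 2 with x
  ext a
  simp

theorem pair {A B : (Fin n → ZFSet.{v}) → ZFSet.{v}} (hA : SetPrimrec A) (hB : SetPrimrec B) :
    SetPrimrec fun x => ZFSet.pair (A x) (B x) :=
  insert' (singleton hA) (singleton (insert' hA (singleton hB)))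

end SetPrimrec

/-- The first component of an ordered pair. -/
def zfst (p : ZFSet.{v}) : ZFSet.{v} :=
  (p.sUnion.sep fun a => ∃ b ∈ p.sUnion, p = ZFSet.pair a b).sUnion

/-- The second component of an ordered pair. -/
def zsnd (p : ZFSet.{v}) : ZFSet.{v} :=
  (p.sUnion.sep fun b => ∃ a ∈ p.sUnion, p = ZFSet.pair a b).sUnion

theorem mem_sUnion_pair {a b c : ZFSet.{v}} :
    c ∈ (ZFSet.pair a b).sUnion ↔ c = a ∨ c = b := by
  simp [ZFSet.pair]

@[simp]
theorem zfst_pair (a b : ZFSet.{v}) : zfst (ZFSet.pair a b) = a := by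
  have : ((ZFSet.pair a b).sUnion.sep fun a' => ∃ b' ∈ (ZFSet.pair a b).sUnion,
      ZFSet.pair a b = ZFSet.pair a' b') = {a} := by
    ext c
    simp only [ZFSet.mem_sep, mem_sUnion_pair, ZFSet.pair_inj, ZFSet.mem_singleton]
    exact ⟨fun h => h.2.choose_spec.2.1.symm, fun h => ⟨.inl h, b, .inr rfl, h.symm, rfl⟩⟩
  simp only [zfst, this, ZFSet.sUnion_singleton]

@[simp]
theorem zsnd_pair (a b : ZFSet.{v}) : zsnd (ZFSet.pair a b) = b := by
  have : ((ZFSet.pair a b).sUnion.sep fun b' => ∃ a' ∈ (ZFSet.pair a b).sUnion,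
      ZFSet.pair a b = ZFSet.pair a' b') = {b} := by
    ext c
    simp only [ZFSet.mem_sep, mem_sUnion_pair, ZFSet.pair_inj, ZFSet.mem_singleton]
    exact ⟨fun h => h.2.choose_spec.2.2.symm, fun h => ⟨.inr h, a, .inl rfl, rfl, h.symm⟩⟩
  simp only [zsnd, this, ZFSet.sUnion_singleton]

/-- The value at `y` of a function that is given as a set of pairs. -/
def app (g y : ZFSet.{v}) : ZFSet.{v} :=
  bigUnion g fun p => open Classical in if zfst p = y then zsnd p else ∅

namespace SetPrimrec

variable {n : ℕ}

theorem zfst {A : (Fin n → ZFSet.{v}) → ZFSet.{v}} (hA : SetPrimrec A) :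
    SetPrimrec fun x => zfst (A x) := by
  refine comp₁ (f := KPTree.zfst) (sUnion (sep (sUnion (proj 0)) ?_)) hA
  exact Rel.exists_mem (P := fun b x => x 1 = ZFSet.pair (x 0) b) (sUnion (proj 1))
    (Rel.eq (proj 2) (pair (proj 1) (proj 0)))

theorem zsnd {A : (Fin n → ZFSet.{v}) → ZFSet.{v}} (hA : SetPrimrec A) :
    SetPrimrec fun x => zsnd (A x) := by
  refine comp₁ (f := KPTree.zsnd) (sUnion (sep (sUnion (proj 0)) ?_)) hA
  exact Rel.exists_mem (P := fun b x => x 1 = ZFSet.pair b (x 0)) (sUnion (proj 1))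
    (Rel.eq (proj 2) (pair (proj 0) (proj 1)))

theorem app {A B : (Fin n → ZFSet.{v}) → ZFSet.{v}} (hA : SetPrimrec A) (hB : SetPrimrec B) :
    SetPrimrec fun x => app (A x) (B x) :=
  comp₂ (f := KPTree.app) (bigUnion (proj 0)
    (ite (Rel.eq (zfst (proj 0)) (proj 2)) (zsnd (proj 0)) empty)) hA hB

end SetPrimrec

theorem app_eq {g y w : ZFSet.{v}} (h : ZFSet.pair y w ∈ g)
    (h' : ∀ p ∈ g, zfst p = y → zsnd p = w) : app g y = w := by
  ext a
  simp only [app, mem_bigUnion]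
  constructor
  · rintro ⟨p, hp, ha⟩
    split_ifs at ha with hy
    · rwa [h' p hp hy] at ha
    · simp at ha
  · intro ha
    exact ⟨_, h, by simpa using ha⟩

/-- Course-of-values recursion: the graph, on the transitive closure of `{z}`, of the function `f`
with `f z = H z (f ↾ z)`, where `f ↾ z` is the graph on the transitive closure of `z`. -/
def courseOfValues (H : ZFSet.{v} → ZFSet.{v} → ZFSet.{v}) (z : ZFSet.{v}) : ZFSet.{v} :=
  insert (ZFSet.pair z (H z (ZFSet.iUnion fun y : z => courseOfValues H y.1)))
    (ZFSet.iUnion fun y : z => courseOfValues H y.1)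
termination_by z
decreasing_by all_goals exact y.2

/-- The function defined by course-of-values recursion from `H`. -/
def covValue (H : ZFSet.{v} → ZFSet.{v} → ZFSet.{v}) (z : ZFSet.{v}) : ZFSet.{v} :=
  H z (bigUnion z (courseOfValues H))

theorem courseOfValues_eq (H : ZFSet.{v} → ZFSet.{v} → ZFSet.{v}) (z : ZFSet.{v}) :
    courseOfValues H z =
      insert (ZFSet.pair z (covValue H z)) (bigUnion z (courseOfValues H)) := by
  rw [courseOfValues]; rfl

/-- `TC y z`: the set `y` is an element of the transitive closure of `z`. -/
abbrev TC : ZFSet.{v} → ZFSet.{v} → Prop := Relation.TransGen (· ∈ ·)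

theorem mem_courseOfValues {H : ZFSet.{v} → ZFSet.{v} → ZFSet.{v}} {z a : ZFSet.{v}} :
    a ∈ courseOfValues H z ↔
      ∃ y, Relation.ReflTransGen (· ∈ ·) y z ∧ a = ZFSet.pair y (covValue H y) := by
  induction z using ZFSet.inductionOn with
  | _ z ih =>
    rw [courseOfValues_eq]
    simp only [ZFSet.mem_insert_iff, mem_bigUnion]
    constructor
    · rintro (rfl | ⟨y, hy, ha⟩)
      · exact ⟨z, .refl, rfl⟩
      · obtain ⟨x, hx, rfl⟩ := (ih y hy).1 ha
        exact ⟨x, hx.tail hy, rfl⟩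
    · rintro ⟨y, hy, rfl⟩
      rcases Relation.ReflTransGen.cases_tail hy with rfl | ⟨c, hc, hcz⟩
      · exact .inl rfl
      · exact .inr ⟨c, hcz, (ih c hcz).2 ⟨y, hc, rfl⟩⟩

theorem app_bigUnion_courseOfValues {H : ZFSet.{v} → ZFSet.{v} → ZFSet.{v}} {z y : ZFSet.{v}}
    (h : TC y z) : app (bigUnion z (courseOfValues H)) y = covValue H y := by
  refine app_eq ?_ ?_
  · obtain ⟨c, hc, hcz⟩ := Relation.TransGen.tail'_iff.1 h
    exact mem_bigUnion.2 ⟨c, hcz, mem_courseOfValues.2 ⟨y, hc, rfl⟩⟩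
  · intro p hp hy
    obtain ⟨c, hc, hp⟩ := mem_bigUnion.1 hp
    obtain ⟨x, hx, rfl⟩ := mem_courseOfValues.1 hp
    simp only [zfst_pair] at hy
    simp [hy]

/-- Course-of-values recursion is primitive recursive: the recursion scheme yields the graphs, from
which previous values can be read off. -/
theorem SetPrimrec.covValue {H : ZFSet.{v} → ZFSet.{v} → ZFSet.{v} → ZFSet.{v}}
    (hH : SetPrimrec fun x : Fin 3 → ZFSet.{v} => H (x 0) (x 1) (x 2)) :
    SetPrimrec fun x : Fin 2 → ZFSet.{v} => covValue (H (x 1)) (x 0) := by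
  have hF : SetPrimrec fun x : Fin 2 → ZFSet.{v} => courseOfValues (H (x 1)) (x 0) := by
    refine recursion
      (H := fun w => insert (ZFSet.pair (w 1) (H (w 2) (w 1) (w 0))) (w 0)) ?_ ?_
    · exact insert' (pair (proj 1) (comp (G := ![fun w => w 2, fun w => w 1, fun w => w 0]) hH
        (by simp [Fin.forall_fin_succ, proj]))) (proj 0)
    · intro z x
      exact ⟨KPTree.bigUnion z (courseOfValues (H (x 0))), fun a => by simp,
        courseOfValues_eq _ _⟩
  refine comp (G := ![fun w => w 1, fun w => w 0,
    fun w => KPTree.bigUnion (w 0) (courseOfValues (H (w 1)))]) hH ?_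
  have h₂ : SetPrimrec fun w : Fin 2 → ZFSet.{v} =>
      KPTree.bigUnion (w 0) (courseOfValues (H (w 1))) :=
    bigUnion (proj 0) (comp (G := ![fun w => w 0, fun w => w 2]) hF
      (Fin.forall_fin_two.2 ⟨proj 0, proj 2⟩))
  exact Fin.cases (proj 1) (Fin.cases (proj 0) (Fin.cases h₂ fun i => i.elim0))

end

section

/-! ### Primitive recursion on types whose elements are coded by sets -/

/-- Types whose elements are represented by sets, distinct elements by distinct sets. -/
class SetCode.{a, b} (α : Type b) where
  enc : α → ZFSet.{a}
  injective : Function.Injective enc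

/-- The set that represents `a`. -/
def code.{a, b} {α : Type b} [SetCode.{a} α] (a : α) : ZFSet.{a} := SetCode.enc a

theorem code_injective {α : Type*} [SetCode.{v} α] : Function.Injective (code.{v} (α := α)) :=
  SetCode.injective

instance : SetCode.{v} ZFSet.{v} := ⟨id, fun _ _ h => h⟩

instance : SetCode.{v} Ordinal.{v} := ⟨Ordinal.toZFSet, Ordinal.toZFSet_injective⟩

instance : SetCode.{v} ℕ :=
  ⟨fun n => Ordinal.toZFSet n, fun m n h => by simpa using Ordinal.toZFSet_injective h⟩

instance : SetCode.{v} Prop :=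
  ⟨truth, fun p q h => by rw [← empty_mem_truth.{v} (p := p), h, empty_mem_truth]⟩

instance {α β : Type*} [SetCode.{v} α] [SetCode.{v} β] : SetCode.{v} (α × β) :=
  ⟨fun x => ZFSet.pair (code x.1) (code x.2), fun x y h => by
    have := ZFSet.pair_inj.1 h
    exact Prod.ext (code_injective this.1) (code_injective this.2)⟩

theorem pair_ne_empty (a b : ZFSet.{v}) : ZFSet.pair a b ≠ ∅ := by
  intro h
  have : ({a} : ZFSet.{v}) ∈ ZFSet.pair a b := by simp [ZFSet.pair]
  rw [h] at this
  simp at this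

theorem listCode_injective : Function.Injective listCode.{v}
  | [], [], _ => rfl
  | [], _ :: _, h => (pair_ne_empty _ _ h.symm).elim
  | _ :: _, [], h => (pair_ne_empty _ _ h).elim
  | a :: l, b :: l', h => by
    obtain ⟨h₁, h₂⟩ := ZFSet.pair_inj.1 h
    rw [h₁, listCode_injective h₂]

instance {α : Type*} [SetCode.{v} α] : SetCode.{v} (List α) :=
  ⟨fun l => listCode (l.map code),
    listCode_injective.comp (List.map_injective_iff.2 code_injective)⟩

@[simp] theorem code_zfset (x : ZFSet.{v}) : code.{v} x = x := rfl
theorem code_nat (n : ℕ) : code.{v} n = Ordinal.toZFSet n := rfl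
theorem code_ordinal (o : Ordinal.{v}) : code.{v} o = o.toZFSet := rfl
@[simp] theorem code_prop (p : Prop) : code.{v} p = truth p := rfl
@[simp] theorem code_prod {α β : Type*} [SetCode.{v} α] [SetCode.{v} β] (x : α × β) :
    code.{v} x = ZFSet.pair (code x.1) (code x.2) := rfl
@[simp] theorem code_nil {α : Type*} [SetCode.{v} α] : code.{v} ([] : List α) = ∅ := rfl
@[simp] theorem code_cons {α : Type*} [SetCode.{v} α] (a : α) (l : List α) :
    code.{v} (a :: l) = ZFSet.pair (code a) (code l) := rfl
@[simp] theorem code_inj {α : Type*} [SetCode.{v} α] {a b : α} :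
    code.{v} a = code.{v} b ↔ a = b := code_injective.eq_iff

/-- The function `f` between coded types is primitive recursive: it is induced by a primitive
recursive set function on the codes. -/
@[fun_prop]
def PR {α β : Type*} [SetCode.{v} α] [SetCode.{v} β] (f : α → β) : Prop :=
  ∃ F : ZFSet.{v} → ZFSet.{v}, (SetPrimrec fun x : Fin 1 → ZFSet.{v} => F (x 0)) ∧
    ∀ a, F (code a) = code (f a)

/-- The family `a ↦ s a` of sets is primitive recursive: a primitive recursive set function maps
the code of `a` to the set of the codes of elements of `s a`. -/
@[fun_prop]
def PRS {α β : Type*} [SetCode.{v} α] [SetCode.{v} β] (s : α → Set β) : Prop :=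
  ∃ F : ZFSet.{v} → ZFSet.{v}, (SetPrimrec fun x : Fin 1 → ZFSet.{v} => F (x 0)) ∧
    ∀ a z, z ∈ F (code a) ↔ ∃ b ∈ s a, code b = z

variable {α β γ δ : Type*} [SetCode.{v} α] [SetCode.{v} β] [SetCode.{v} γ] [SetCode.{v} δ]

namespace PR

@[fun_prop]
theorem id : PR.{v} fun a : α => a := ⟨fun x => x, .proj 0, fun _ => rfl⟩

@[fun_prop]
theorem comp {g : β → γ} {f : α → β} (hg : PR.{v} g) (hf : PR.{v} f) :
    PR.{v} fun a => g (f a) := by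
  obtain ⟨G, hG, hG'⟩ := hg
  obtain ⟨F, hF, hF'⟩ := hf
  exact ⟨fun x => G (F x), hG.comp₁ hF, fun a => by beta_reduce; rw [hF', hG']⟩

@[fun_prop]
theorem prodMk {f : α → β} {g : α → γ} (hf : PR.{v} f) (hg : PR.{v} g) :
    PR.{v} fun a => (f a, g a) := by
  obtain ⟨G, hG, hG'⟩ := hg
  obtain ⟨F, hF, hF'⟩ := hf
  exact ⟨fun x => ZFSet.pair (F x) (G x), hF.pair hG, fun a => by simp [hF', hG']⟩

@[fun_prop]
theorem fst {f : α → β × γ} (hf : PR.{v} f) : PR.{v} fun a => (f a).1 := by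
  obtain ⟨F, hF, hF'⟩ := hf
  exact ⟨fun x => zfst (F x), hF.zfst, fun a => by simp [hF']⟩

@[fun_prop]
theorem snd {f : α → β × γ} (hf : PR.{v} f) : PR.{v} fun a => (f a).2 := by
  obtain ⟨F, hF, hF'⟩ := hf
  exact ⟨fun x => zsnd (F x), hF.zsnd, fun a => by simp [hF']⟩

theorem empty : PR.{v} fun _ : α => (∅ : ZFSet.{v}) := ⟨fun _ => ∅, .empty, fun _ => rfl⟩

theorem omega : PR.{v} fun _ : α => ZFSet.omega.{v} := ⟨fun _ => ZFSet.omega, .omega, fun _ => rfl⟩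

/-- The code of the value, as a set, is primitive recursive. -/
@[fun_prop]
theorem code_comp {f : α → β} (hf : PR.{v} f) : PR.{v} fun a => code.{v} (f a) := hf

theorem of_code {f : α → β} (hf : PR.{v} fun a => code.{v} (f a)) : PR.{v} f := hf

/-- A unary primitive recursive set function, applied to sets. -/
theorem of_setPrimrec {F : ZFSet.{v} → ZFSet.{v}}
    (h : SetPrimrec fun x : Fin 1 → ZFSet.{v} => F (x 0)) {f : α → ZFSet.{v}}
    (hf : PR.{v} f) : PR.{v} fun a => F (f a) := by
  obtain ⟨G, hG, hG'⟩ := hf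
  exact ⟨fun x => F (G x), h.comp₁ hG, fun a => by simp [hG']⟩

theorem of_setPrimrec₂ {F : ZFSet.{v} → ZFSet.{v} → ZFSet.{v}}
    (h : SetPrimrec fun x : Fin 2 → ZFSet.{v} => F (x 0) (x 1)) {f g : α → ZFSet.{v}}
    (hf : PR.{v} f) (hg : PR.{v} g) : PR.{v} fun a => F (f a) (g a) := by
  obtain ⟨G, hG, hG'⟩ := hf
  obtain ⟨K, hK, hK'⟩ := hg
  exact ⟨fun x => F (G x) (K x), h.comp₂ hG hK, fun a => by simp [hG', hK']⟩

@[fun_prop]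
theorem zfst_comp {f : α → ZFSet.{v}} (hf : PR.{v} f) : PR.{v} fun a => zfst (f a) :=
  of_setPrimrec (SetPrimrec.zfst (.proj 0)) hf

@[fun_prop]
theorem zsnd_comp {f : α → ZFSet.{v}} (hf : PR.{v} f) : PR.{v} fun a => zsnd (f a) :=
  of_setPrimrec (SetPrimrec.zsnd (.proj 0)) hf

@[fun_prop]
theorem sUnion {f : α → ZFSet.{v}} (hf : PR.{v} f) : PR.{v} fun a => (f a).sUnion :=
  of_setPrimrec (SetPrimrec.sUnion (.proj 0)) hf

@[fun_prop]
theorem app_comp {f g : α → ZFSet.{v}} (hf : PR.{v} f) (hg : PR.{v} g) :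
    PR.{v} fun a => app (f a) (g a) :=
  of_setPrimrec₂ (SetPrimrec.app (.proj 0) (.proj 1)) hf hg

@[fun_prop]
theorem zpair {f g : α → ZFSet.{v}} (hf : PR.{v} f) (hg : PR.{v} g) :
    PR.{v} fun a => ZFSet.pair (f a) (g a) :=
  of_setPrimrec₂ (SetPrimrec.pair (.proj 0) (.proj 1)) hf hg

@[fun_prop]
theorem zinsert {f g : α → ZFSet.{v}} (hf : PR.{v} f) (hg : PR.{v} g) :
    PR.{v} fun a => insert (f a) (g a) :=
  of_setPrimrec₂ (SetPrimrec.insert' (.proj 0) (.proj 1)) hf hg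

@[fun_prop]
theorem zsingleton {f : α → ZFSet.{v}} (hf : PR.{v} f) :
    PR.{v} fun a => ({f a} : ZFSet.{v}) :=
  of_setPrimrec (F := fun x => {x}) (SetPrimrec.singleton (.proj 0)) hf

/-- Natural numbers are hereditarily finite, so that constants are primitive recursive. -/
theorem const_nat (n : ℕ) : PR.{v} fun _ : α => n := by
  induction n with
  | zero => exact ⟨fun _ => ∅, .empty, fun a => by simp [code_nat]⟩
  | succ n ih =>
    obtain ⟨F, hF, hF'⟩ := ih
    refine ⟨fun x => Insert.insert (F x) (F x), hF.insert' hF, fun a => ?_⟩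
    beta_reduce; rw [hF', code_nat, code_nat, Nat.cast_succ, Ordinal.toZFSet_add_one]

@[fun_prop]
theorem succ {f : α → ℕ} (hf : PR.{v} f) : PR.{v} fun a => f a + 1 := by
  obtain ⟨F, hF, hF'⟩ := hf
  refine ⟨fun x => Insert.insert (F x) (F x), hF.insert' hF, fun a => ?_⟩
  beta_reduce; rw [hF', code_nat, code_nat, Nat.cast_succ, Ordinal.toZFSet_add_one]

@[fun_prop]
theorem ordinal_succ {f : α → Ordinal.{v}} (hf : PR.{v} f) : PR.{v} fun a => f a + 1 := by
  obtain ⟨F, hF, hF'⟩ := hf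
  refine ⟨fun x => Insert.insert (F x) (F x), hF.insert' hF, fun a => ?_⟩
  beta_reduce; rw [hF', code_ordinal, code_ordinal, Ordinal.toZFSet_add_one]

@[fun_prop]
theorem natCast {f : α → ℕ} (hf : PR.{v} f) : PR.{v} fun a => (f a : Ordinal.{v}) := hf

theorem const_zero : PR.{v} fun _ : α => (0 : Ordinal.{v}) := by
  simpa using natCast (const_nat 0)

/-! ### Primitive recursive predicates -/

theorem rel_iff {p : α → Prop} : PR.{v} p ↔
    ∃ P : ZFSet.{v} → Prop, (SetPrimrec.Rel fun x : Fin 1 → ZFSet.{v} => P (x 0)) ∧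
      ∀ a, P (code a) ↔ p a := by
  constructor
  · rintro ⟨F, hF, hF'⟩
    exact ⟨fun x => ∅ ∈ F x, .mem .empty hF, fun a => by simp [hF']⟩
  · rintro ⟨P, hP, hP'⟩
    exact ⟨fun x => truth (P x), hP, fun a => by simp [hP']⟩

@[fun_prop]
theorem ite {p : α → Prop} [∀ a, Decidable (p a)] {f g : α → β} (hp : PR.{v} p) (hf : PR.{v} f)
    (hg : PR.{v} g) :
    PR.{v} fun a => if p a then f a else g a := by
  obtain ⟨P, hP, hP'⟩ := rel_iff.1 hp
  obtain ⟨F, hF, hF'⟩ := hf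
  obtain ⟨G, hG, hG'⟩ := hg
  refine ⟨fun x => open Classical in if P x then F x else G x, .ite hP hF hG, fun a => ?_⟩
  by_cases h : p a <;> simp [hP', h, hF', hG']

theorem const_true : PR.{v} fun _ : α => True :=
  ⟨fun _ => {∅}, SetPrimrec.singleton .empty, fun _ => by simp [truth]⟩

theorem const_false : PR.{v} fun _ : α => False :=
  ⟨fun _ => ∅, .empty, fun _ => by simp [truth]⟩

@[fun_prop]
theorem not {p : α → Prop} (hp : PR.{v} p) : PR.{v} fun a => ¬ p a := by
  classical convert ite hp const_false const_true using 2 with a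
  by_cases h : p a <;> simp [h]

@[fun_prop]
theorem and {p q : α → Prop} (hp : PR.{v} p) (hq : PR.{v} q) : PR.{v} fun a => p a ∧ q a := by
  classical convert ite hp hq const_false using 2 with a
  by_cases h : p a <;> simp [h]

@[fun_prop]
theorem or {p q : α → Prop} (hp : PR.{v} p) (hq : PR.{v} q) : PR.{v} fun a => p a ∨ q a := by
  classical convert ite hp const_true hq using 2 with a
  by_cases h : p a <;> simp [h]

theorem imp {p q : α → Prop} (hp : PR.{v} p) (hq : PR.{v} q) : PR.{v} fun a => p a → q a := by
  classical convert ite hp hq const_true using 2 with a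
  by_cases h : p a <;> simp [h]

@[fun_prop]
theorem eq {f g : α → β} (hf : PR.{v} f) (hg : PR.{v} g) : PR.{v} fun a => f a = g a := by
  obtain ⟨F, hF, hF'⟩ := hf
  obtain ⟨G, hG, hG'⟩ := hg
  exact rel_iff.2 ⟨fun x => F x = G x, .eq hF hG, fun a => by simp [hF', hG']⟩

@[fun_prop]
theorem zmem {f g : α → ZFSet.{v}} (hf : PR.{v} f) (hg : PR.{v} g) :
    PR.{v} fun a => f a ∈ g a := by
  obtain ⟨F, hF, hF'⟩ := hf
  obtain ⟨G, hG, hG'⟩ := hg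
  exact rel_iff.2 ⟨fun x => F x ∈ G x, .mem hF hG, fun a => by simp [hF', hG']⟩

@[fun_prop]
theorem mem {f : α → β} {s : α → Set β} (hf : PR.{v} f) (hs : PRS.{v} s) :
    PR.{v} fun a => f a ∈ s a := by
  obtain ⟨F, hF, hF'⟩ := hf
  obtain ⟨S, hS, hS'⟩ := hs
  exact rel_iff.2 ⟨fun x => F x ∈ S x, .mem hF hS, fun a => by simp [hF', hS']⟩

@[fun_prop]
theorem ordinal_lt {f g : α → Ordinal.{v}} (hf : PR.{v} f) (hg : PR.{v} g) :
    PR.{v} fun a => f a < g a := by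
  simpa [code_ordinal] using zmem (code_comp hf) (code_comp hg)

@[fun_prop]
theorem nat_lt {f g : α → ℕ} (hf : PR.{v} f) (hg : PR.{v} g) : PR.{v} fun a => f a < g a := by
  simpa using ordinal_lt (natCast hf) (natCast hg)

theorem bex {s : α → Set β} {p : α → β → Prop} (hs : PRS.{v} s)
    (hp : PR.{v} fun x : α × β => p x.1 x.2) : PR.{v} fun a => ∃ b ∈ s a, p a b := by
  obtain ⟨S, hS, hS'⟩ := hs
  obtain ⟨P, hP, hP'⟩ := rel_iff.1 hp
  refine rel_iff.2 ⟨fun x => ∃ y ∈ S x, P (ZFSet.pair x y), .exists_mem hS ?_, fun a => ?_⟩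
  · exact SetPrimrec.comp₁ (f := fun x => truth (P x)) hP (.pair (.proj 1) (.proj 0))
  · constructor
    · rintro ⟨y, hy, h⟩
      obtain ⟨b, hb, rfl⟩ := (hS' a y).1 hy
      exact ⟨b, hb, (hP' (a, b)).1 h⟩
    · rintro ⟨b, hb, h⟩
      exact ⟨_, (hS' _ _).2 ⟨b, hb, rfl⟩, (hP' (a, b)).2 h⟩

theorem ball {s : α → Set β} {p : α → β → Prop} (hs : PRS.{v} s)
    (hp : PR.{v} fun x : α × β => p x.1 x.2) : PR.{v} fun a => ∀ b ∈ s a, p a b := by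
  simpa using not (bex (p := fun a b => ¬ p a b) hs (not hp))

attribute [fun_prop] bex ball imp empty omega const_nat const_zero const_true const_false

end PR

namespace PRS

theorem of_PR {s : α → Set β} {S : α → ZFSet.{v}} (hS : PR.{v} S)
    (h : ∀ a z, z ∈ S a ↔ ∃ b ∈ s a, code b = z) : PRS.{v} s := by
  obtain ⟨F, hF, hF'⟩ := hS
  exact ⟨F, hF, fun a z => by rw [hF', code_zfset, h]⟩

theorem exists_PR {s : α → Set β} (hs : PRS.{v} s) :
    ∃ S : α → ZFSet.{v}, PR.{v} S ∧ ∀ a z, z ∈ S a ↔ ∃ b ∈ s a, code b = z := by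
  obtain ⟨F, hF, hF'⟩ := hs
  exact ⟨fun a => F (code a), ⟨F, hF, fun _ => rfl⟩, hF'⟩

theorem comp {s : β → Set γ} {f : α → β} (hs : PRS.{v} s) (hf : PR.{v} f) :
    PRS.{v} fun a => s (f a) := by
  obtain ⟨S, hS, hS'⟩ := exists_PR hs
  exact of_PR (hS.comp hf) fun a z => hS' _ _

/-- The elements of a set, as a family of sets. -/
@[fun_prop]
theorem coe {f : α → ZFSet.{v}} (hf : PR.{v} f) : PRS.{v} fun a => {x | x ∈ f a} :=
  of_PR hf fun a z => by simp

@[fun_prop]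
theorem empty : PRS.{v} fun _ : α => (∅ : Set β) := of_PR PR.empty fun a z => by simp

@[fun_prop]
theorem singleton {f : α → β} (hf : PR.{v} f) : PRS.{v} fun a => ({f a} : Set β) :=
  of_PR hf.code_comp.zsingleton fun a z => by simp [eq_comm]

@[fun_prop]
theorem ite {p : α → Prop} [∀ a, Decidable (p a)] {s t : α → Set β} (hp : PR.{v} p) (hs : PRS.{v} s)
    (ht : PRS.{v} t) :
    PRS.{v} fun a => if p a then s a else t a := by
  obtain ⟨S, hS, hS'⟩ := exists_PR hs
  obtain ⟨T, hT, hT'⟩ := exists_PR ht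
  refine of_PR (hp.ite hS hT) fun a z => ?_
  by_cases h : p a <;> simp [h, hS', hT']

/-- A family of unions `⋃ {t a b | b ∈ s a}`. -/
@[fun_prop]
theorem bind {s : α → Set β} {t : α → β → Set γ} (hs : PRS.{v} s)
    (ht : PRS.{v} fun x : α × β => t x.1 x.2) :
    PRS.{v} fun a => {c | ∃ b ∈ s a, c ∈ t a b} := by
  obtain ⟨S, hS, hS'⟩ := hs
  obtain ⟨T, hT, hT'⟩ := ht
  refine ⟨fun x => bigUnion (S x) fun y => T (ZFSet.pair x y), .bigUnion hS ?_, fun a z => ?_⟩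
  · exact hT.comp₁ (.pair (.proj 1) (.proj 0))
  · simp only [mem_bigUnion, hS', Set.mem_ofPred_eq]
    constructor
    · rintro ⟨_, ⟨b, hb, rfl⟩, h⟩
      obtain ⟨c, hc, rfl⟩ := (hT' (a, b) z).1 h
      exact ⟨c, ⟨b, hb, hc⟩, rfl⟩
    · rintro ⟨c, ⟨b, hb, hc⟩, rfl⟩
      exact ⟨_, ⟨b, hb, rfl⟩, (hT' (a, b) _).2 ⟨c, hc, rfl⟩⟩

@[fun_prop]
theorem image {s : α → Set β} {f : α → β → γ} (hs : PRS.{v} s)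
    (hf : PR.{v} fun x : α × β => f x.1 x.2) : PRS.{v} fun a => {c | ∃ b ∈ s a, c = f a b} :=
  bind hs (singleton hf)

@[fun_prop]
theorem sep {s : α → Set β} {p : α → β → Prop} (hs : PRS.{v} s)
    (hp : PR.{v} fun x : α × β => p x.1 x.2) : PRS.{v} fun a => {b | b ∈ s a ∧ p a b} := by
  classical
  have := bind (t := fun a b => if p a b then {b} else ∅) hs
    (ite hp (singleton (PR.snd PR.id)) empty)
  convert this using 2 with a
  ext b
  constructor
  · rintro ⟨h, h'⟩
    exact ⟨b, h, by simp [h']⟩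
  · rintro ⟨c, h, h'⟩
    by_cases hc : p a c <;> simp_all

@[fun_prop]
theorem union {s t : α → Set β} (hs : PRS.{v} s) (ht : PRS.{v} t) :
    PRS.{v} fun a => s a ∪ t a := by
  obtain ⟨S, hS, hS'⟩ := exists_PR hs
  obtain ⟨T, hT, hT'⟩ := exists_PR ht
  refine of_PR ((hS.zinsert hT.zsingleton).sUnion) fun a z => ?_
  simp [hS', hT', or_and_right, exists_or]

@[fun_prop]
theorem prod {s : α → Set β} {t : α → Set γ} (hs : PRS.{v} s) (ht : PRS.{v} t) :
    PRS.{v} fun a => s a ×ˢ t a := by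
  have := bind (t := fun a b => {c : β × γ | ∃ d ∈ t a, c = (b, d)}) hs
    (image (ht.comp (PR.fst PR.id)) (by fun_prop))
  convert this using 2 with a
  ext ⟨b, c⟩
  simp

@[fun_prop]
theorem Iio {f : α → Ordinal.{v}} (hf : PR.{v} f) : PRS.{v} fun a => Set.Iio (f a) :=
  of_PR hf.code_comp fun a z => by simp [code_ordinal, Ordinal.mem_toZFSet_iff]

theorem mem_omega {z : ZFSet.{v}} : z ∈ ZFSet.omega ↔ ∃ n : ℕ, code n = z := by
  have key : ∀ n : ℕ, code.{v} n = ZFSet.mk (PSet.ofNat n) := by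
    intro n
    induction n with
    | zero => simp [code_nat]; rfl
    | succ n ih => rw [code_nat, Nat.cast_succ, Ordinal.toZFSet_add_one, ← code_nat, ih]; rfl
  simp only [key]
  constructor
  · refine Quotient.inductionOn z fun z h => ?_
    obtain ⟨⟨n⟩, hn⟩ := h
    exact ⟨n, (ZFSet.sound hn).symm⟩
  · rintro ⟨n, rfl⟩
    exact ⟨⟨n⟩, PSet.Equiv.refl _⟩

@[fun_prop]
theorem univ_nat : PRS.{v} fun _ : α => (Set.univ : Set ℕ) :=
  of_PR PR.omega fun a z => by simp [mem_omega]

@[fun_prop]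
theorem Iio_nat {f : α → ℕ} (hf : PR.{v} f) : PRS.{v} fun a => Set.Iio (f a) := by
  have := sep (p := fun a n => n < f a) univ_nat ((PR.snd PR.id).nat_lt (hf.comp (PR.fst PR.id)))
  convert this using 2 with a
  ext n
  simp

theorem iUnion_nat {s : ℕ → α → Set β} (hs : PRS.{v} fun x : ℕ × α => s x.1 x.2) :
    PRS.{v} fun a => {b | ∃ n, b ∈ s n a} := by
  have := bind (t := fun a n => s n a) univ_nat
    (hs.comp ((PR.snd PR.id).prodMk (PR.fst PR.id)) : PRS.{v} fun x : α × ℕ => s x.2 x.1)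
  simpa using this

end PRS

/-- A function is primitive recursive if its graph is so and its values can be bounded. -/
theorem PR.of_graph {f : α → β} {s : α → Set β} (hs : PRS.{v} s) (hf : ∀ a, f a ∈ s a)
    (h : PR.{v} fun x : α × β => x.2 = f x.1) : PR.{v} f := by
  obtain ⟨S, hS, hS'⟩ := PRS.exists_PR (PRS.sep (p := fun a b => b = f a) hs h)
  refine of_code ?_
  convert hS.sUnion using 2 with a
  have : S a = {code (f a)} := by
    ext z
    rw [hS', ZFSet.mem_singleton]
    constructor
    · rintro ⟨b, ⟨-, rfl⟩, rfl⟩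
      rfl
    · rintro rfl
      exact ⟨_, ⟨hf a, rfl⟩, rfl⟩
  rw [this, ZFSet.sUnion_singleton]

end

section

variable {α β γ δ : Type*} [SetCode.{v} α] [SetCode.{v} β] [SetCode.{v} γ] [SetCode.{v} δ]

/-! ### Recursion principles -/

/-- A primitive recursive function between coded types is induced by one on the universe of sets. -/
theorem PR.exists_raw {f : α → β} (hf : PR.{v} f) :
    ∃ F : ZFSet.{v} → ZFSet.{v}, PR.{v} F ∧ ∀ a, F (code a) = code (f a) := by
  obtain ⟨F, hF, hF'⟩ := hf
  exact ⟨F, ⟨F, hF, fun _ => rfl⟩, hF'⟩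

theorem TC.pair_left (a b : ZFSet.{v}) : TC a (ZFSet.pair a b) :=
  .tail (.single (by simp : a ∈ ({a, b} : ZFSet.{v}))) (by simp [ZFSet.pair])

theorem TC.pair_right (a b : ZFSet.{v}) : TC b (ZFSet.pair a b) :=
  .tail (.single (by simp : b ∈ ({a, b} : ZFSet.{v}))) (by simp [ZFSet.pair])

/-- Course-of-values recursion on the codes: the value of `f c` at `d` may be computed from a set
`G` that contains the values of `f c` at all arguments with codes in the transitive closure of the
code of `d`. -/
theorem PR.covRec {f : γ → δ → β} {H : γ × δ × ZFSet.{v} → ZFSet.{v}} (hH : PR.{v} H)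
    (h : ∀ c d G, (∀ d', TC (code.{v} d') (code d) → app G (code d') = code (f c d')) →
      H (c, d, G) = code (f c d)) : PR.{v} fun x : γ × δ => f x.1 x.2 := by
  obtain ⟨F, hF, hF'⟩ := hH
  have hK : SetPrimrec fun x : Fin 2 → ZFSet.{v} =>
      covValue (fun z U => F (ZFSet.pair (x 1) (ZFSet.pair z U))) (x 0) :=
    SetPrimrec.covValue (H := fun x z U => F (ZFSet.pair x (ZFSet.pair z U)))
      (hF.comp₁ (.pair (.proj 0) (.pair (.proj 1) (.proj 2))))
  refine ⟨fun x => covValue (fun z U => F (ZFSet.pair (zfst x) (ZFSet.pair z U))) (zsnd x),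
    hK.comp₂ (f := fun a b => covValue (fun z U => F (ZFSet.pair b (ZFSet.pair z U))) a)
      (SetPrimrec.zsnd (.proj 0)) (SetPrimrec.zfst (.proj 0)), ?_⟩
  rintro ⟨c, d⟩
  simp only [code_prod, zfst_pair, zsnd_pair]
  obtain ⟨z, hz⟩ : ∃ z, z = code.{v} d := ⟨_, rfl⟩
  induction z using ZFSet.mem_wf.transGen.induction generalizing d with
  | _ z ih =>
    subst hz
    rw [covValue]
    have := hF' (c, d, bigUnion (code d)
      (courseOfValues fun z U => F (ZFSet.pair (code c) (ZFSet.pair z U))))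
    simp only [code_prod, code_zfset] at this
    rw [this]
    refine h _ _ _ fun d' hd' => ?_
    rw [app_bigUnion_courseOfValues hd', ih _ hd' _ rfl]

theorem sUnion_insert_self {x : ZFSet.{v}} (hx : x.IsTransitive) : (insert x x).sUnion = x := by
  ext z
  simp only [ZFSet.mem_sUnion, ZFSet.mem_insert_iff]
  constructor
  · rintro ⟨y, rfl | hy, hz⟩
    · exact hz
    · exact hx y hy hz
  · exact fun h => ⟨x, .inl rfl, h⟩

theorem sUnion_toZFSet_succ (o : Ordinal.{v}) : (o + 1).toZFSet.sUnion = o.toZFSet := by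
  rw [Ordinal.toZFSet_add_one, sUnion_insert_self (ZFSet.isOrdinal_toZFSet o).isTransitive]

theorem PR.nat_rec {f : γ → ℕ → β} {g : γ → β} {h : γ × ℕ × β → β} (hg : PR.{v} g)
    (hh : PR.{v} h) (h0 : ∀ c, f c 0 = g c) (hs : ∀ c n, f c (n + 1) = h (c, n, f c n)) :
    PR.{v} fun x : γ × ℕ => f x.1 x.2 := by
  obtain ⟨K, hK, hK'⟩ := hh.exists_raw
  refine covRec (H := fun x => open Classical in if x.2.1 = 0 then code (g x.1) else
    K (ZFSet.pair (code x.1) (ZFSet.pair (code x.2.1).sUnion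
      (app x.2.2 (code x.2.1).sUnion)))) (by fun_prop) ?_
  rintro c (_ | n) G ih
  · simp [h0]
  · have e : (code.{v} (n + 1)).sUnion = code.{v} n := by
      rw [code_nat, code_nat, Nat.cast_succ, sUnion_toZFSet_succ]
    have ht : TC (code.{v} n) (code.{v} (n + 1)) := .single (by simp [code_nat])
    simp only [e, ih n ht, Nat.succ_ne_zero, if_false]
    rw [hs, ← hK']
    rfl

theorem PR.nil : PR.{v} fun _ : α => ([] : List β) := ⟨fun _ => ∅, .empty, fun _ => rfl⟩

attribute [fun_prop] PR.nil

@[fun_prop]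
theorem PR.cons {f : α → β} {g : α → List β} (hf : PR.{v} f) (hg : PR.{v} g) :
    PR.{v} fun a => f a :: g a :=
  of_code (by simpa using hf.code_comp.zpair hg.code_comp)

theorem PR.list_rec {f : γ → List δ → β} {g : γ → β} {h : γ × δ × List δ × β → β}
    (hg : PR.{v} g) (hh : PR.{v} h) (h0 : ∀ c, f c [] = g c)
    (hs : ∀ c d l, f c (d :: l) = h (c, d, l, f c l)) :
    PR.{v} fun x : γ × List δ => f x.1 x.2 := by
  obtain ⟨K, hK, hK'⟩ := hh.exists_raw
  refine covRec (H := fun x => open Classical in if x.2.1 = [] then code (g x.1) else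
    K (ZFSet.pair (code x.1) (ZFSet.pair (zfst (code x.2.1)) (ZFSet.pair (zsnd (code x.2.1))
      (app x.2.2 (zsnd (code x.2.1))))))) (by fun_prop) ?_
  rintro c (_ | ⟨d, l⟩) G ih
  · simp [h0]
  · have ht : TC (code.{v} l) (code.{v} (d :: l)) := by
      rw [code_cons]; exact TC.pair_right _ _
    simp only [code_cons, zfst_pair, zsnd_pair, ih l ht, reduceCtorEq, if_false]
    rw [hs, ← hK']
    rfl

/-- Sets of elements of a coded type, represented by the set of the codes. -/
structure CSet.{a, b} (β : Type b) [SetCode.{a} β] : Type (max (a + 1) b) where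
  val : ZFSet.{a}
  exists_code : ∀ z ∈ val, ∃ b : β, code.{a} b = z

/-- The underlying set of elements. -/
def CSet.toSet (A : CSet.{v} β) : Set β := {b | code.{v} b ∈ A.val}

instance : SetCode.{v} (CSet.{v} β) := ⟨CSet.val, fun x y h => by cases x; cases y; simp_all⟩

theorem CSet.mem_val {A : CSet.{v} β} {z : ZFSet.{v}} :
    z ∈ A.val ↔ ∃ b ∈ A.toSet, code.{v} b = z := by
  constructor
  · intro h
    obtain ⟨b, rfl⟩ := A.exists_code z h
    exact ⟨b, h, rfl⟩
  · rintro ⟨b, hb, rfl⟩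
    exact hb

theorem CSet.code_eq (A : CSet.{v} β) : code.{v} A = A.val := rfl

@[fun_prop]
theorem PRS.toSet {f : α → CSet.{v} β} (hf : PR.{v} f) : PRS.{v} fun a => (f a).toSet :=
  of_PR hf.code_comp fun _ _ => CSet.mem_val

/-- A primitive recursive family of sets, as a primitive recursive function whose values are coded
sets. -/
theorem PRS.exists_cset {s : α → Set β} (hs : PRS.{v} s) :
    ∃ S : α → CSet.{v} β, PR.{v} S ∧ ∀ a, (S a).toSet = s a := by
  obtain ⟨S, hS, hS'⟩ := hs.exists_PR
  refine ⟨fun a => ⟨S a, fun z hz => ?_⟩, PR.of_code hS, fun a => ?_⟩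
  · obtain ⟨b, -, h⟩ := (hS' a z).1 hz
    exact ⟨b, h⟩
  · ext b
    simp [CSet.toSet, hS']

/-- Recursion on natural numbers for families of sets: the previous value enters the step as a coded
set. -/
theorem PRS.nat_rec {s : γ → ℕ → Set β} {step : γ → ℕ → Set β → Set β}
    (h0 : PRS.{v} fun c => s c 0)
    (hs : PRS.{v} fun x : γ × ℕ × CSet.{v} β => step x.1 x.2.1 x.2.2.toSet)
    (h : ∀ c n, s c (n + 1) = step c n (s c n)) : PRS.{v} fun x : γ × ℕ => s x.1 x.2 := by
  obtain ⟨S, hS, hS'⟩ := h0.exists_cset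
  obtain ⟨K, hK, hK'⟩ := hs.exists_cset
  let f : γ → ℕ → CSet.{v} β := fun c n => Nat.rec (S c) (fun n X => K (c, n, X)) n
  have hf : PR.{v} fun x : γ × ℕ => f x.1 x.2 :=
    PR.nat_rec hS hK (fun _ => rfl) (fun _ _ => rfl)
  convert PRS.toSet hf using 2 with x
  obtain ⟨c, n⟩ := x
  simp only
  induction n with
  | zero => exact (hS' c).symm
  | succ n ih => rw [h, ih, ← hK' (c, n, f c n)]

theorem PRS.list_rec {s : γ → List δ → Set β} {step : γ → δ → List δ → Set β → Set β}
    (h0 : PRS.{v} fun c => s c [])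
    (hs : PRS.{v} fun x : γ × δ × List δ × CSet.{v} β => step x.1 x.2.1 x.2.2.1 x.2.2.2.toSet)
    (h : ∀ c d l, s c (d :: l) = step c d l (s c l)) :
    PRS.{v} fun x : γ × List δ => s x.1 x.2 := by
  obtain ⟨S, hS, hS'⟩ := h0.exists_cset
  obtain ⟨K, hK, hK'⟩ := hs.exists_cset
  let f : γ → List δ → CSet.{v} β := fun c l => List.rec (S c) (fun d l X => K (c, d, l, X)) l
  have hf : PR.{v} fun x : γ × List δ => f x.1 x.2 :=
    PR.list_rec hS hK (fun _ => rfl) (fun _ _ _ => rfl)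
  convert PRS.toSet hf using 2 with x
  obtain ⟨c, l⟩ := x
  simp only
  induction l with
  | nil => exact (hS' c).symm
  | cons d l ih => rw [h, ih, ← hK' (c, d, l, f c l)]

open Classical in
/-- Recursion on ordinals for families of sets, with unions at limits. -/
theorem PRS.ordinal_rec {s : γ → Ordinal.{v} → Set β}
    {step : γ → Ordinal.{v} → Set β → Set β} (h0 : PRS.{v} fun c => s c 0)
    (hs : PRS.{v} fun x : γ × Ordinal.{v} × CSet.{v} β => step x.1 x.2.1 x.2.2.toSet)
    (h : ∀ c o, s c (o + 1) = step c o (s c o))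
    (hl : ∀ c o, Order.IsSuccLimit o → s c o = {b | ∃ o' < o, b ∈ s c o'}) :
    PRS.{v} fun x : γ × Ordinal.{v} => s x.1 x.2 := by
  obtain ⟨S, hS, hS'⟩ := h0.exists_cset
  obtain ⟨K, hK, hK'⟩ := hs.exists_cset
  have hex : ∀ c o, ∃ A : CSet.{v} β, A.toSet = s c o := by
    intro c o
    induction o using Ordinal.limitRecOn with
    | zero => exact ⟨_, hS' c⟩
    | add_one o ih =>
      obtain ⟨A, hA⟩ := ih
      exact ⟨K (c, o, A), by rw [hK', h, ← hA]⟩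
    | limit o ho ih =>
      choose A hA using ih
      refine ⟨⟨ZFSet.iUnion fun i : Set.Iio o => (A i.1 i.2).val, fun z hz => ?_⟩, ?_⟩
      · obtain ⟨i, hi⟩ := ZFSet.mem_iUnion.1 hz
        exact (A i.1 i.2).exists_code z hi
      · rw [hl c o ho]
        ext b
        simp only [CSet.toSet, ZFSet.mem_iUnion, Subtype.exists, Set.mem_ofPred_eq]
        refine exists_congr fun i => ?_
        constructor
        · rintro ⟨hi, hb⟩
          exact ⟨hi, hA i hi ▸ hb⟩
        · rintro ⟨hi, hb⟩
          exact ⟨hi, by rw [← hA i hi] at hb; exact hb⟩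
  choose f hf using hex
  obtain ⟨KK, hKK, hKK'⟩ := hK.exists_raw
  have key : PR.{v} fun x : γ × Ordinal.{v} => f x.1 x.2 := by
    refine PR.covRec (H := fun x =>
      if x.2.1 = 0 then code (S x.1) else
      if ∃ o ∈ Set.Iio x.2.1, x.2.1 = o + 1 then
        KK (ZFSet.pair (code x.1) (ZFSet.pair (code x.2.1).sUnion
          (app x.2.2 (code x.2.1).sUnion)))
      else bigUnion (code x.2.1) (app x.2.2)) ?_ ?_
    · have : PR.{v} fun x : γ × Ordinal.{v} × ZFSet.{v} =>
          bigUnion (code x.2.1) (app x.2.2) :=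
        PR.of_setPrimrec₂ (F := fun y z => bigUnion y (app z))
          (SetPrimrec.bigUnion (.proj 0) (SetPrimrec.app (.proj 2) (.proj 0)))
          (by fun_prop) (by fun_prop)
      fun_prop
    · intro c o G ih
      have ih' : ∀ o' < o, app G o'.toZFSet = (f c o').val := fun o' ho' =>
        ih o' (.single (by simpa [code_ordinal] using ho'))
      ext z
      refine Iff.trans ?_ (b := ∃ b ∈ s c o, code.{v} b = z)
        (by rw [CSet.code_eq, CSet.mem_val, hf])
      induction o using Ordinal.limitRecOn with
      | zero => simp [CSet.code_eq, CSet.mem_val, hS']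
      | add_one o _ =>
        have : ∃ o' ∈ Set.Iio (o + 1), o + 1 = o' + 1 := ⟨o, by simp, rfl⟩
        have h0 : o + 1 ≠ 0 := by simp
        simp only [h0, if_false, this, if_true]
        rw [code_ordinal, sUnion_toZFSet_succ, ih' o (by simp)]
        have := hKK' (c, o, f c o)
        simp only [code_prod] at this
        erw [this]
        rw [CSet.code_eq, CSet.mem_val, hK', hf, h]
      | limit o ho _ =>
        have h1 : o ≠ 0 := ho.ne_bot
        have h2 : ¬ ∃ o' ∈ Set.Iio o, o = o' + 1 := by
          rintro ⟨o', -, rfl⟩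
          exact Order.not_isSuccLimit_succ o' (by simp at ho)
        simp only [h1, h2, if_false, mem_bigUnion, code_ordinal, Ordinal.mem_toZFSet_iff]
        rw [hl c o ho]
        constructor
        · rintro ⟨_, ⟨o', ho', rfl⟩, hz⟩
          rw [ih' o' ho', CSet.mem_val, hf] at hz
          obtain ⟨b, hb, rfl⟩ := hz
          exact ⟨b, ⟨o', ho', hb⟩, rfl⟩
        · rintro ⟨b, ⟨o', ho', hb⟩, rfl⟩
          refine ⟨_, ⟨o', ho', rfl⟩, ?_⟩
          rw [ih' o' ho', CSet.mem_val, hf]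
          exact ⟨b, hb, rfl⟩
  convert PRS.toSet key using 2 with x
  exact (hf x.1 x.2).symm

/-! ### Lists, ordinals and natural numbers -/

@[fun_prop]
theorem PR.append {f g : α → List β} (hf : PR.{v} f) (hg : PR.{v} g) :
    PR.{v} fun a => f a ++ g a :=
  comp (g := fun x : List β × List β => x.2 ++ x.1)
    (list_rec (f := fun c l => l ++ c) (h := fun x => x.2.1 :: x.2.2.2) PR.id (by fun_prop)
      (fun _ => rfl) (fun _ _ _ => rfl)) (hg.prodMk hf)

@[fun_prop]
theorem PR.length {f : α → List β} (hf : PR.{v} f) : PR.{v} fun a => (f a).length :=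
  comp (g := fun x : ℕ × List β => x.2.length)
    (list_rec (f := fun _ l => l.length) (g := fun _ => 0) (h := fun x => x.2.2.2 + 1)
      (by fun_prop) (by fun_prop) (fun _ => rfl) (fun _ _ _ => rfl))
    ((PR.const_nat 0).prodMk hf)

@[fun_prop]
theorem PRS.list {f : α → List β} (hf : PR.{v} f) : PRS.{v} fun a => {b | b ∈ f a} :=
  comp (s := fun x : ℕ × List β => {b | b ∈ x.2})
    (list_rec (s := fun _ l => {b | b ∈ l}) (step := fun _ d _ X => {d} ∪ X)
      (by simpa using PRS.empty) (by fun_prop) (fun _ d l => by ext; simp))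
    ((PR.const_nat 0).prodMk hf)

@[fun_prop]
theorem PR.mem_list {f : α → β} {g : α → List β} (hf : PR.{v} f) (hg : PR.{v} g) :
    PR.{v} fun a => f a ∈ g a := hf.mem (PRS.list hg)

@[fun_prop]
theorem PR.tail {f : α → List β} (hf : PR.{v} f) : PR.{v} fun a => (f a).tail :=
  comp (g := fun x : ℕ × List β => x.2.tail)
    (list_rec (f := fun _ l => l.tail) (g := fun _ => []) (h := fun x => x.2.2.1)
      (by fun_prop) (by fun_prop) (fun _ => rfl) (fun _ _ _ => rfl))
    ((PR.const_nat 0).prodMk hf)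

@[fun_prop]
theorem PR.drop {f : α → ℕ} {g : α → List β} (hf : PR.{v} f) (hg : PR.{v} g) :
    PR.{v} fun a => (g a).drop (f a) :=
  comp (g := fun x : List β × ℕ => x.1.drop x.2)
    (nat_rec (f := fun (l : List β) n => l.drop n) (g := fun l => l)
      (h := fun x : List β × ℕ × List β => x.2.2.tail)
      (by fun_prop) (by fun_prop) (fun _ => rfl) (fun l n => by simp))
    (hg.prodMk hf)

@[fun_prop]
theorem PR.headD {f : α → List β} {d : α → β} (hf : PR.{v} f) (hd : PR.{v} d) :
    PR.{v} fun a => (f a).headD (d a) :=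
  comp (g := fun x : β × List β => x.2.headD x.1)
    (list_rec (f := fun d l => l.headD d) (g := fun d => d) (h := fun x => x.2.1)
      (by fun_prop) (by fun_prop) (fun _ => rfl) (fun _ _ _ => rfl)) (hd.prodMk hf)

@[fun_prop]
theorem PR.getD {f : α → List β} {i : α → ℕ} {d : α → β} (hf : PR.{v} f) (hi : PR.{v} i)
    (hd : PR.{v} d) : PR.{v} fun a => (f a).getD (i a) (d a) := by
  convert (PR.drop hi hf).headD hd using 2 with a
  simp [List.getD_eq_getElem?_getD]

/-- The decompositions `l = l₁ ++ b :: l₂`. -/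
def splits {β : Type*} (l : List β) : Set (List β × β × List β) := {x | l = x.1 ++ x.2.1 :: x.2.2}

@[fun_prop]
theorem PRS.splits {f : α → List β} (hf : PR.{v} f) : PRS.{v} fun a => splits (f a) := by
  refine comp (s := fun x : ℕ × List β => KPTree.splits x.2)
    (list_rec (s := fun _ l => KPTree.splits l)
      (step := fun _ d l X => {([], d, l)} ∪ {y | ∃ x ∈ X, y = (d :: x.1, x.2.1, x.2.2)})
      ?_ (by fun_prop) ?_) ((PR.const_nat 0).prodMk hf)
  · convert PRS.empty with a
    ext x
    simp [KPTree.splits]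
  · intro _ d l
    ext ⟨l₁, b, l₂⟩
    cases l₁ <;> simp [KPTree.splits]
    · tauto
    · rw [and_comm, eq_comm (a := d)]

@[fun_prop]
theorem PRS.prefixes {f : α → List β} (hf : PR.{v} f) : PRS.{v} fun a => {p | p <+: f a} := by
  refine comp (s := fun x : ℕ × List β => {p | p <+: x.2})
    (list_rec (s := fun _ l => {p | p <+: l})
      (step := fun _ d l X => {[]} ∪ {y | ∃ x ∈ X, y = d :: x})
      ?_ (by fun_prop) ?_) ((PR.const_nat 0).prodMk hf)
  · convert PRS.singleton (PR.nil) using 2 with a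
    ext x
    simp
  · intro _ d l
    ext p
    cases p <;> simp [List.cons_prefix_cons]
    grind

@[fun_prop]
theorem PR.isPrefix {f g : α → List β} (hf : PR.{v} f) (hg : PR.{v} g) :
    PR.{v} fun a => f a <+: g a := hf.mem (PRS.prefixes hg)

/-- All finite sequences of elements of `s`. -/
def listsOver {β : Type*} (s : Set β) : Set (List β) := {l | ∀ b ∈ l, b ∈ s}

@[fun_prop]
theorem PRS.listsOver {s : α → Set β} (hs : PRS.{v} s) : PRS.{v} fun a => listsOver (s a) := by
  have h : PRS.{v} fun x : α × ℕ => {l : List β | l.length ≤ x.2 ∧ ∀ b ∈ l, b ∈ s x.1} := by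
    refine nat_rec (s := fun a n => {l : List β | l.length ≤ n ∧ ∀ b ∈ l, b ∈ s a})
      (step := fun a _ X => {[]} ∪ {y | ∃ b ∈ s a, y ∈ {y | ∃ x ∈ X, y = b :: x}}) ?_ ?_ ?_
    · convert PRS.singleton (PR.nil) using 2 with a
      ext x
      simp +contextual
    · have := hs.comp (PR.fst (PR.id (α := α × ℕ × CSet.{v} (List β))))
      have h₂ := PRS.image (f := fun (x : (α × ℕ × CSet.{v} (List β)) × β) y => x.2 :: y)
        (PRS.toSet (PR.snd (PR.snd (PR.fst PR.id)))) (by fun_prop)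
      exact PRS.union (by fun_prop) (PRS.bind this h₂)
    · intro a n
      ext l
      cases l <;> simp
      grind
  have := PRS.iUnion_nat (s := fun n a => {l : List β | l.length ≤ n ∧ ∀ b ∈ l, b ∈ s a})
    (h.comp (by fun_prop : PR.{v} fun x : ℕ × α => (x.2, x.1)))
  convert this using 2 with a
  ext l
  simp only [KPTree.listsOver, Set.mem_ofPred_eq]
  exact ⟨fun h => ⟨_, le_rfl, h⟩, fun ⟨_, _, h⟩ => h⟩

theorem PR.isChain {l : α → List β} {r : α → β → β → Prop} (hl : PR.{v} l)
    (hr : PR.{v} fun x : (α × β) × β => r x.1.1 x.1.2 x.2) :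
    PR.{v} fun a => (l a).IsChain (r a) := by
  have h1 : PRS.{v} fun x : α × List β × β × List β => splits x.2.2.2 := by fun_prop
  have : PR.{v} fun a => ∀ x ∈ splits (l a), ∀ y ∈ splits x.2.2, y.1 = [] → r a x.2.1 y.2.1 := by
    refine PR.ball (PRS.splits hl) (PR.ball h1 (PR.imp (by fun_prop) ?_))
    exact hr.comp (by fun_prop : PR.{v} fun x : (α × List β × β × List β) × List β × β × List β =>
      ((x.1.1, x.1.2.2.1), x.2.2.1))
  convert this using 2 with a
  rw [List.isChain_iff_forall_rel_of_append_cons_cons]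
  simp only [splits, Set.mem_ofPred_eq, Prod.forall]
  constructor
  · rintro h l₁ x l₂ e l₃ y l₄ rfl rfl
    exact h e
  · intro h x y l₁ l₂ e
    exact h l₁ x _ e [] y l₂ rfl rfl

@[fun_prop]
theorem PR.nat_add {f g : α → ℕ} (hf : PR.{v} f) (hg : PR.{v} g) : PR.{v} fun a => f a + g a :=
  comp (g := fun x : ℕ × ℕ => x.1 + x.2)
    (nat_rec (f := fun m n => m + n) (g := fun m => m) (h := fun x => x.2.2 + 1)
      (by fun_prop) (by fun_prop) (fun _ => rfl) (fun _ _ => rfl)) (hf.prodMk hg)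

@[fun_prop]
theorem PR.nat_mul {f g : α → ℕ} (hf : PR.{v} f) (hg : PR.{v} g) : PR.{v} fun a => f a * g a :=
  comp (g := fun x : ℕ × ℕ => x.1 * x.2)
    (nat_rec (f := fun m n => m * n) (g := fun _ => 0) (h := fun x => x.2.2 + x.1)
      (by fun_prop) (by fun_prop) (fun _ => rfl) (fun _ _ => rfl)) (hf.prodMk hg)

@[fun_prop]
theorem PR.nat_pair {f g : α → ℕ} (hf : PR.{v} f) (hg : PR.{v} g) :
    PR.{v} fun a => Nat.pair (f a) (g a) := by
  have : PR.{v} fun a => open Classical in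
      if f a < g a then g a * g a + f a else f a * f a + f a + g a := by fun_prop
  convert this using 2 with a
  rw [Nat.pair]

theorem PR.nat_unpair : PR.{v} fun n : ℕ => n.unpair := by
  have h : PRS.{v} fun n : ℕ => Set.Iio (n + 1) ×ˢ Set.Iio (n + 1) := by fun_prop
  refine of_graph h (fun n => ?_) ?_
  · simp [Nat.unpair_left_le, Nat.unpair_right_le]
  · have : PR.{v} fun x : ℕ × ℕ × ℕ => Nat.pair x.2.1 x.2.2 = x.1 := by fun_prop
    convert this using 2 with x
    refine ⟨fun h => ?_, fun h => ?_⟩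
    · rw [h, Nat.pair_unpair]
    · rw [← h, Nat.unpair_pair]

/-- The usual primitive recursive functions on natural numbers are primitive recursive set
functions on `ω`. -/
theorem PR.of_nat_primrec {f : ℕ → ℕ} (hf : Nat.Primrec f) : PR.{v} f := by
  induction hf with
  | zero => exact const_nat 0
  | succ => exact succ PR.id
  | left => exact fst nat_unpair
  | right => exact snd nat_unpair
  | pair _ _ hf hg => exact nat_pair hf hg
  | comp _ _ hf hg => exact comp hf hg
  | @prec f g _ _ hf hg =>
    have hg' : PR.{v} fun x : ℕ × ℕ × ℕ => g (Nat.pair x.1 (Nat.pair x.2.1 x.2.2)) :=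
      comp hg (by fun_prop)
    have := comp (nat_rec (f := fun a n => Nat.rec (f a)
      (fun y IH => g (Nat.pair a (Nat.pair y IH))) n) hf hg' (fun _ => rfl) (fun _ _ => rfl))
      nat_unpair
    exact this

theorem TC_iff {y z : ZFSet.{v}} :
    TC y z ↔ ∃ c ∈ z, Relation.ReflTransGen (· ∈ ·) y c :=
  Relation.TransGen.tail'_iff.trans (by simp only [and_comm])

theorem PRS.tc : PRS.{v} fun x : ZFSet.{v} => {y | TC y x} := by
  have hex : ∀ x : ZFSet.{v}, ∃ T : ZFSet.{v}, ∀ z, z ∈ T ↔ TC z x := by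
    intro x
    induction x using ZFSet.inductionOn with
    | _ x ih =>
      choose! f hf using ih
      refine ⟨bigUnion x fun y => insert y (f y), fun z => ?_⟩
      rw [TC_iff]
      simp only [mem_bigUnion, ZFSet.mem_insert_iff]
      refine exists_congr fun y => and_congr_right fun hy => ?_
      rw [hf y hy, Relation.reflTransGen_iff_eq_or_transGen, eq_comm]
  choose f hf using hex
  refine of_PR (S := f) ?_ fun x z => by simp [hf]
  have := PR.covRec (γ := ℕ) (f := fun _ x => f x) (H := fun x =>
    bigUnion x.2.1 fun y => insert y (app x.2.2 y)) ?_ ?_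
  · exact this.comp (by fun_prop : PR.{v} fun x : ZFSet.{v} => (0, x))
  · exact PR.of_setPrimrec₂ (F := fun y z => bigUnion y fun y => insert y (app z y))
      (SetPrimrec.bigUnion (.proj 0) (.insert' (.proj 0) (SetPrimrec.app (.proj 2) (.proj 0))))
      (by fun_prop) (by fun_prop)
  · intro _ x G ih
    ext z
    rw [code_zfset, hf, TC_iff]
    simp only [mem_bigUnion, ZFSet.mem_insert_iff]
    refine exists_congr fun y => and_congr_right fun hy => ?_
    have : app G y = f y := ih y (.single hy)
    rw [this, hf y, Relation.reflTransGen_iff_eq_or_transGen, eq_comm]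

@[fun_prop]
theorem PR.rank {f : α → ZFSet.{v}} (hf : PR.{v} f) : PR.{v} fun a => (f a).rank := by
  have := PR.covRec (γ := ℕ) (f := fun _ (x : ZFSet.{v}) => x.rank) (H := fun x =>
    bigUnion x.2.1 fun y => insert (app x.2.2 y) (app x.2.2 y)) ?_ ?_
  · exact this.comp (by fun_prop : PR.{v} fun x : α => (0, f x))
  · exact PR.of_setPrimrec₂ (F := fun y z => bigUnion y fun y => insert (app z y) (app z y))
      (SetPrimrec.bigUnion (.proj 0) (.insert' (SetPrimrec.app (.proj 2) (.proj 0))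
        (SetPrimrec.app (.proj 2) (.proj 0)))) (by fun_prop) (by fun_prop)
  · intro _ x G ih
    ext z
    simp only [mem_bigUnion, code_ordinal, Ordinal.mem_toZFSet_iff]
    have ih' : ∀ y ∈ x, app G y = y.rank.toZFSet := fun y hy => ih y (.single hy)
    constructor
    · rintro ⟨y, hy, hz⟩
      rw [ih' y hy, ← Ordinal.toZFSet_add_one, Ordinal.mem_toZFSet_iff] at hz
      obtain ⟨o, ho, rfl⟩ := hz
      exact ⟨o, (Order.lt_succ_iff.1 (by simpa using ho)).trans_lt (ZFSet.rank_lt_of_mem hy), rfl⟩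
    · rintro ⟨o, ho, rfl⟩
      obtain ⟨y, hy, hoy⟩ := ZFSet.lt_rank_iff.1 ho
      refine ⟨y, hy, ?_⟩
      rw [ih' y hy, ← Ordinal.toZFSet_add_one, Ordinal.toZFSet_mem_toZFSet_iff]
      simpa using Order.lt_succ_iff.2 hoy

theorem lt_add_iff_exists {a b c : Ordinal.{v}} : c < a + b ↔ c < a ∨ ∃ d < b, c ≤ a + d := by
  constructor
  · intro h
    rcases lt_or_ge c a with hc | hc
    · exact .inl hc
    · exact .inr ⟨c - a, Ordinal.sub_lt_of_lt_add h (by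
        rcases eq_or_ne b 0 with rfl | hb
        · simp at h; exact (h.not_ge hc).elim
        · exact pos_iff_ne_zero.2 hb), by rw [Ordinal.add_sub_cancel_of_le hc]⟩
  · rintro (h | ⟨d, hd, h⟩)
    · exact h.trans_le le_self_add
    · exact h.trans_lt (by simpa using hd)

@[fun_prop]
theorem PR.ordinal_add {f g : α → Ordinal.{v}} (hf : PR.{v} f) (hg : PR.{v} g) :
    PR.{v} fun a => f a + g a := by
  refine comp (g := fun x : Ordinal.{v} × Ordinal.{v} => x.1 + x.2) ?_ (hf.prodMk hg)
  refine PR.covRec (f := fun a b => a + b) (H := fun x : Ordinal.{v} × Ordinal.{v} × ZFSet.{v} =>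
    ({code x.1, bigUnion (code x.2.1) fun y => insert (app x.2.2 y) (app x.2.2 y)} :
      ZFSet.{v}).sUnion) ?_ ?_
  · have := PR.of_setPrimrec₂ (F := fun y z => bigUnion y fun y => insert (app z y) (app z y))
      (SetPrimrec.bigUnion (.proj 0) (.insert' (SetPrimrec.app (.proj 2) (.proj 0))
        (SetPrimrec.app (.proj 2) (.proj 0))))
      (by fun_prop : PR.{v} fun x : Ordinal.{v} × Ordinal.{v} × ZFSet.{v} => code.{v} x.2.1)
      (by fun_prop : PR.{v} fun x : Ordinal.{v} × Ordinal.{v} × ZFSet.{v} => x.2.2)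
    fun_prop
  · intro a b G ih
    have ih' : ∀ d < b, app G d.toZFSet = (a + d).toZFSet := fun d hd =>
      ih d (.single (by simpa [code_ordinal] using hd))
    ext z
    simp only [ZFSet.sUnion_pair, ZFSet.mem_union, mem_bigUnion, code_ordinal,
      Ordinal.mem_toZFSet_iff, lt_add_iff_exists, or_and_right, exists_or]
    refine or_congr Iff.rfl ?_
    constructor
    · rintro ⟨_, ⟨d, hd, rfl⟩, hz⟩
      rw [ih' d hd, ← Ordinal.toZFSet_add_one, Ordinal.mem_toZFSet_iff] at hz
      obtain ⟨o, ho, rfl⟩ := hz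
      exact ⟨o, ⟨d, hd, Order.lt_succ_iff.1 (by simpa using ho)⟩, rfl⟩
    · rintro ⟨o, ⟨d, hd, ho⟩, rfl⟩
      refine ⟨_, ⟨d, hd, rfl⟩, ?_⟩
      rw [ih' d hd, ← Ordinal.toZFSet_add_one, Ordinal.toZFSet_mem_toZFSet_iff]
      simpa using Order.lt_succ_iff.2 ho

@[fun_prop]
theorem PR.omega_opow {f : α → Ordinal.{v}} (hf : PR.{v} f) :
    PR.{v} fun a => Ordinal.omega0.{v} ^ f a := by
  have hm : PR.{v} fun x : Ordinal.{v} × ℕ => x.1 * (x.2 : Ordinal.{v}) :=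
    nat_rec (f := fun (o : Ordinal.{v}) (n : ℕ) => o * (n : Ordinal.{v})) (g := fun _ => 0)
      (h := fun x => x.2.2 + x.1) (by fun_prop) (by fun_prop) (by simp)
      (fun o n => by simp [mul_add])
  obtain ⟨K, hK, hK'⟩ := hm
  simp only [Prod.forall, code_prod] at hK'
  have := PR.covRec (γ := ℕ) (f := fun _ (o : Ordinal.{v}) => Ordinal.omega0.{v} ^ o) (H := fun x =>
    ({{∅}, bigUnion (code x.2.1) fun y => bigUnion ZFSet.omega fun n =>
      K (ZFSet.pair (app x.2.2 y) n)} : ZFSet.{v}).sUnion) ?_ ?_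
  · exact this.comp (by fun_prop : PR.{v} fun x : α => (0, f x))
  · have := PR.of_setPrimrec₂ (F := fun y z => bigUnion y fun y => bigUnion ZFSet.omega fun n =>
        K (ZFSet.pair (app z y) n))
      (SetPrimrec.bigUnion (.proj 0) (.bigUnion .omega
        (hK.comp₁ (.pair (SetPrimrec.app (.proj 3) (.proj 1)) (.proj 0)))))
      (by fun_prop : PR.{v} fun x : ℕ × Ordinal.{v} × ZFSet.{v} => code.{v} x.2.1)
      (by fun_prop : PR.{v} fun x : ℕ × Ordinal.{v} × ZFSet.{v} => x.2.2)
    fun_prop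
  · intro _ b G ih
    have ih' : ∀ d < b, app G d.toZFSet = (Ordinal.omega0 ^ d).toZFSet := fun d hd =>
      ih d (.single (by simpa [code_ordinal] using hd))
    have key : ∀ c : Ordinal.{v}, c < Ordinal.omega0 ^ b ↔
        c = 0 ∨ ∃ d < b, ∃ n : ℕ, c < Ordinal.omega0 ^ d * n := by
      intro c
      constructor
      · intro h
        rcases eq_or_ne c 0 with hc | hc
        · exact .inl hc
        · refine .inr ⟨Ordinal.log Ordinal.omega0 c, (Ordinal.lt_opow_iff_log_lt
            Ordinal.one_lt_omega0 hc).1 h, ?_⟩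
          have h1 := Ordinal.lt_opow_succ_log_self Ordinal.one_lt_omega0 c
          rw [Ordinal.opow_succ, Ordinal.lt_mul_iff_of_isSuccLimit
            Ordinal.isSuccLimit_omega0] at h1
          obtain ⟨m, hm, h1⟩ := h1
          obtain ⟨n, rfl⟩ := Ordinal.lt_omega0.1 hm
          exact ⟨n, h1⟩
      · rintro (rfl | ⟨d, hd, n, h⟩)
        · exact Ordinal.opow_pos _ Ordinal.omega0_pos
        · refine h.trans_le ((mul_le_mul_right (Ordinal.natCast_lt_omega0 n).le _).trans ?_)
          rw [← Ordinal.opow_succ]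
          exact Ordinal.opow_le_opow_right Ordinal.omega0_pos (Order.succ_le_of_lt hd)
    ext z
    simp only [ZFSet.sUnion_pair, ZFSet.mem_union, mem_bigUnion, code_ordinal,
      Ordinal.mem_toZFSet_iff, key, or_and_right, exists_or, exists_eq_left,
      Ordinal.toZFSet_zero, ZFSet.mem_singleton]
    refine or_congr eq_comm ?_
    constructor
    · rintro ⟨_, ⟨d, hd, rfl⟩, y, hy, hz⟩
      obtain ⟨n, rfl⟩ := PRS.mem_omega.1 hy
      rw [ih' d hd, ← code_ordinal, hK', code_ordinal, Ordinal.mem_toZFSet_iff] at hz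
      obtain ⟨o, ho, rfl⟩ := hz
      exact ⟨o, ⟨d, hd, n, ho⟩, rfl⟩
    · rintro ⟨o, ⟨d, hd, n, ho⟩, rfl⟩
      refine ⟨_, ⟨d, hd, rfl⟩, _, PRS.mem_omega.2 ⟨n, rfl⟩, ?_⟩
      rw [ih' d hd, ← code_ordinal, hK', code_ordinal, Ordinal.toZFSet_mem_toZFSet_iff]
      exact ho

end

section

variable {α β γ δ : Type*} [SetCode.{v} α] [SetCode.{v} β] [SetCode.{v} γ] [SetCode.{v} δ]

/-! ### Formulas as sets -/

theorem PR.zsep {f : α → ZFSet.{v}} {p : α → ZFSet.{v} → Prop} (hf : PR.{v} f)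
    (hp : PR.{v} fun x : α × ZFSet.{v} => p x.1 x.2) : PR.{v} fun a => (f a).sep (p a) := by
  obtain ⟨S, hS, hS'⟩ := (PRS.sep (PRS.coe hf) hp).exists_PR
  convert hS using 2 with a
  ext z
  simp [hS']

attribute [fun_prop] PR.zsep

/-- The set that represents a term: a tag, and the index of the variable or the code of the
parameter. -/
def tmCode {n : ℕ} : Tm Ranked.{v} n → ZFSet.{v}
  | .var i => ZFSet.pair (code 0) (code (i : ℕ))
  | .par p => ZFSet.pair (code 1) (code p)

theorem tmCode_injective {n : ℕ} : Function.Injective (tmCode.{v} (n := n)) := by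
  rintro (i | p) (j | q) h <;> simp only [tmCode, ZFSet.pair_inj, code_inj] at h
  · rw [Fin.ext h.2]
  · simp at h
  · simp at h
  · rw [h.2]

/-- The set that represents a formula: a node consists of a tag and two components. Nodes for
quantifiers record the number of free variables, which is the index of the bound variable. -/
def fmlCode : {n : ℕ} → Fml Ranked.{v} n → ZFSet.{v}
  | _, .mem s t => ZFSet.pair (code 0) (ZFSet.pair (tmCode s) (tmCode t))
  | _, .nmem s t => ZFSet.pair (code 1) (ZFSet.pair (tmCode s) (tmCode t))
  | _, .eq s t => ZFSet.pair (code 2) (ZFSet.pair (tmCode s) (tmCode t))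
  | _, .ne s t => ZFSet.pair (code 3) (ZFSet.pair (tmCode s) (tmCode t))
  | _, .and φ ψ => ZFSet.pair (code 4) (ZFSet.pair (fmlCode φ) (fmlCode ψ))
  | _, .or φ ψ => ZFSet.pair (code 5) (ZFSet.pair (fmlCode φ) (fmlCode ψ))
  | n, .all φ => ZFSet.pair (code 6) (ZFSet.pair (code n) (fmlCode φ))
  | n, .ex φ => ZFSet.pair (code 7) (ZFSet.pair (code n) (fmlCode φ))

theorem fmlCode_injective {n : ℕ} : Function.Injective (fmlCode.{v} (n := n)) := by
  intro φ
  induction φ with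
  | mem s t | nmem s t | eq s t | ne s t =>
    intro ψ h
    cases ψ <;> simp [fmlCode, ZFSet.pair_inj, tmCode_injective.eq_iff] at h ⊢
    exact h
  | and φ₁ φ₂ ih₁ ih₂ | or φ₁ φ₂ ih₁ ih₂ =>
    intro ψ h
    cases ψ <;> simp [fmlCode, ZFSet.pair_inj] at h ⊢
    exact ⟨ih₁ h.1, ih₂ h.2⟩
  | all φ ih | ex φ ih =>
    intro ψ h
    cases ψ <;> simp [fmlCode, ZFSet.pair_inj] at h ⊢
    exact ih h

instance (n : ℕ) : SetCode.{v} (Fml Ranked.{v} n) := ⟨fmlCode, fmlCode_injective⟩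

theorem code_fml {n : ℕ} (φ : Fml Ranked.{v} n) : code.{v} φ = fmlCode φ := rfl

theorem PR.covValue {H : γ → ZFSet.{v} → ZFSet.{v} → ZFSet.{v}}
    (hH : PR.{v} fun x : γ × ZFSet.{v} × ZFSet.{v} => H x.1 x.2.1 x.2.2) :
    PR.{v} fun x : γ × ZFSet.{v} => covValue (H x.1) x.2 := by
  obtain ⟨F, hF, hF'⟩ := hH
  have hK : SetPrimrec fun x : Fin 2 → ZFSet.{v} =>
      KPTree.covValue (fun z U => F (ZFSet.pair (x 1) (ZFSet.pair z U))) (x 0) :=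
    SetPrimrec.covValue (H := fun x z U => F (ZFSet.pair x (ZFSet.pair z U)))
      (hF.comp₁ (.pair (.proj 0) (.pair (.proj 1) (.proj 2))))
  refine ⟨fun x => KPTree.covValue (fun z U => F (ZFSet.pair (zfst x) (ZFSet.pair z U))) (zsnd x),
    hK.comp₂ (f := fun a b => KPTree.covValue
      (fun z U => F (ZFSet.pair b (ZFSet.pair z U))) a)
    (SetPrimrec.zsnd (.proj 0)) (SetPrimrec.zfst (.proj 0)), ?_⟩
  rintro ⟨c, z⟩
  have : (fun z U => F (ZFSet.pair (code c) (ZFSet.pair z U))) = H c := by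
    ext1 z
    ext1 U
    exact hF' (c, z, U)
  simp only [code_prod, code_zfset, zfst_pair, zsnd_pair, this]

/-- Recursion on formula codes. -/
theorem exists_node_rec {h : γ × ZFSet.{v} × ZFSet.{v} × ZFSet.{v} × ZFSet.{v} × ZFSet.{v} →
    ZFSet.{v}} (hh : PR.{v} h) :
    ∃ F : γ → ZFSet.{v} → ZFSet.{v}, PR.{v} (fun x : γ × ZFSet.{v} => F x.1 x.2) ∧
      ∀ c k x y, F c (ZFSet.pair k (ZFSet.pair x y)) = h (c, k, x, y, F c x, F c y) := by
  let H : γ → ZFSet.{v} → ZFSet.{v} → ZFSet.{v} := fun c z G =>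
    h (c, zfst z, zfst (zsnd z), zsnd (zsnd z), app G (zfst (zsnd z)), app G (zsnd (zsnd z)))
  have hH : PR.{v} fun x : γ × ZFSet.{v} × ZFSet.{v} => H x.1 x.2.1 x.2.2 := by fun_prop
  refine ⟨fun c => covValue (H c), PR.covValue hH, fun c k x y => ?_⟩
  have hx : TC x (ZFSet.pair k (ZFSet.pair x y)) := (TC.pair_left x y).trans (TC.pair_right _ _)
  have hy : TC y (ZFSet.pair k (ZFSet.pair x y)) := (TC.pair_right x y).trans (TC.pair_right _ _)
  beta_reduce
  rw [covValue]
  simp only [H, zfst_pair, zsnd_pair, app_bigUnion_courseOfValues hx,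
    app_bigUnion_courseOfValues hy]

/-- The set `z` is the number `k`, used as a tag. -/
def HasTag (z : ZFSet.{v}) (k : ℕ) : Prop := z = code.{v} k

@[fun_prop]
theorem PR.hasTag {f : α → ZFSet.{v}} (hf : PR.{v} f) (k : ℕ) : PR.{v} fun a => HasTag (f a) k :=
  PR.eq hf (PR.code_comp (PR.const_nat k))

@[simp]
theorem hasTag_code {j k : ℕ} : HasTag.{v} (code j) k ↔ j = k := by simp [HasTag]

@[simp]
theorem code_mem_code {j k : ℕ} : code.{v} j ∈ code.{v} k ↔ j < k := by simp [code_nat]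

theorem neg_ofPure {P : Type*} {n : ℕ} (φ : Fml Empty n) :
    (φ.neg.ofPure : Fml P n) = φ.ofPure.neg := by
  induction φ <;> simp_all [Fml.neg, Fml.ofPure]

@[fun_prop]
theorem PR.neg {n : ℕ} {f : α → Fml Ranked.{v} n} (hf : PR.{v} f) : PR.{v} fun a => (f a).neg := by
  have hN : PR.{v} fun k : ℕ => if k = 0 then 1 else if k = 1 then 0 else if k = 2 then 3 else
    if k = 3 then 2 else if k = 4 then 5 else if k = 5 then 4 else if k = 6 then 7 else 6 := by
    fun_prop
  obtain ⟨N, hN, hN'⟩ := hN.exists_raw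
  have hh : PR.{v} fun x : ℕ × ZFSet.{v} × ZFSet.{v} × ZFSet.{v} × ZFSet.{v} × ZFSet.{v} =>
      open Classical in ZFSet.pair (N x.2.1) (ZFSet.pair
        (if HasTag x.2.1 4 ∨ HasTag x.2.1 5 then x.2.2.2.2.1 else x.2.2.1)
        (if x.2.1 ∈ code.{v} 4 then x.2.2.2.1 else x.2.2.2.2.2)) := by fun_prop
  obtain ⟨F, hF, hF'⟩ := exists_node_rec hh
  have key : ∀ {n : ℕ} (φ : Fml Ranked.{v} n), F 0 (fmlCode φ) = fmlCode φ.neg := by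
    intro n φ
    induction φ <;> simp only [fmlCode, hF', Fml.neg, hN', hasTag_code, code_mem_code] <;>
      simp [*]
  have : PR.{v} fun a => F 0 (code (f a)) :=
    hF.comp (by fun_prop : PR.{v} fun a => ((0 : ℕ), code (f a)))
  refine of_code ?_
  simpa only [code_fml, key] using this

theorem PR.sUnion_nat_succ (n : ℕ) : (code.{v} (n + 1)).sUnion = code.{v} n := by
  rw [code_nat, code_nat, Nat.cast_succ, sUnion_toZFSet_succ]

@[fun_prop]
theorem PR.inst {n : ℕ} {f : α → Fml Ranked.{v} (n + 1)} {g : α → Ranked.{v}} (hf : PR.{v} f)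
    (hg : PR.{v} g) : PR.{v} fun a => (f a).inst (g a) := by
  let ti : ZFSet.{v} → ZFSet.{v} → ZFSet.{v} := fun a t => open Classical in
    if HasTag (zfst t) 0 then
      if HasTag (zsnd t) 0 then ZFSet.pair (code 1) a else ZFSet.pair (code 0) (zsnd t).sUnion
    else t
  have hti : PR.{v} fun x : ZFSet.{v} × ZFSet.{v} => ti x.1 x.2 := by fun_prop
  have hti' : ∀ {n : ℕ} (a : Ranked.{v}) (t : Tm Ranked.{v} (n + 1)),
      ti (code a) (tmCode t) = tmCode (t.inst a) := by
    rintro n a (i | p)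
    · refine Fin.cases ?_ (fun i => ?_) i
      · simp [ti, tmCode, Tm.inst]
      · simp [ti, tmCode, Tm.inst, sUnion_nat_succ]
    · simp [ti, tmCode, Tm.inst]
  have hh : PR.{v} fun x : Ranked.{v} × ZFSet.{v} × ZFSet.{v} × ZFSet.{v} × ZFSet.{v} ×
      ZFSet.{v} => open Classical in
      if HasTag x.2.1 0 ∨ HasTag x.2.1 1 ∨ HasTag x.2.1 2 ∨ HasTag x.2.1 3 then
        ZFSet.pair x.2.1 (ZFSet.pair (ti (code x.1) x.2.2.1) (ti (code x.1) x.2.2.2.1)) else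
      if HasTag x.2.1 4 ∨ HasTag x.2.1 5 then
        ZFSet.pair x.2.1 (ZFSet.pair x.2.2.2.2.1 x.2.2.2.2.2) else
      ZFSet.pair x.2.1 (ZFSet.pair x.2.2.1.sUnion x.2.2.2.2.2) := by fun_prop
  obtain ⟨F, hF, hF'⟩ := exists_node_rec hh
  have key : ∀ (a : Ranked.{v}) {m : ℕ} (φ : Fml Ranked.{v} m) {n : ℕ} (e : m = n + 1),
      F a (fmlCode φ) = fmlCode ((e ▸ φ).inst a) := by
    intro a m φ
    induction φ with
    | mem | nmem | eq | ne | and | or =>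
      rintro n rfl
      simp only [fmlCode, hF', Fml.inst, hasTag_code, hti']
      simp [*]
    | all φ ih | ex φ ih =>
      rintro n rfl
      have := ih (n := n + 1) rfl
      simp only [fmlCode, hF', Fml.inst, hasTag_code, sUnion_nat_succ]
      simp [this]
  have : PR.{v} fun a => F (g a) (code (f a)) :=
    hF.comp (by fun_prop : PR.{v} fun a => (g a, code (f a)))
  refine of_code ?_
  simpa only [code_fml, fun a => key (g a) (f a) rfl] using this

/-- A primitive recursive function that computes Gödel numbers of parameter-free formulas. -/
theorem exists_godel : ∃ F : ZFSet.{v} → ZFSet.{v}, PR.{v} F ∧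
    ∀ {n : ℕ} (φ : Fml Empty n), F (fmlCode φ.ofPure) = code φ.godel := by
  have hK : PR.{v} fun x : ℕ × ℕ × ℕ => open Classical in
    if x.1 < 6 then 8 * Nat.pair x.2.1 x.2.2 + x.1 else 8 * x.2.2 + x.1 := by fun_prop
  obtain ⟨K, hK, hK'⟩ := hK.exists_raw
  simp only [code_prod, Prod.forall] at hK'
  have hh : PR.{v} fun x : ℕ × ZFSet.{v} × ZFSet.{v} × ZFSet.{v} × ZFSet.{v} × ZFSet.{v} =>
      open Classical in
      if HasTag x.2.1 0 ∨ HasTag x.2.1 1 ∨ HasTag x.2.1 2 ∨ HasTag x.2.1 3 then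
        K (ZFSet.pair x.2.1 (ZFSet.pair (zsnd x.2.2.1) (zsnd x.2.2.2.1))) else
      if HasTag x.2.1 4 ∨ HasTag x.2.1 5 then
        K (ZFSet.pair x.2.1 (ZFSet.pair x.2.2.2.2.1 x.2.2.2.2.2)) else
      K (ZFSet.pair x.2.1 (ZFSet.pair x.2.2.1 x.2.2.2.2.2)) := by fun_prop
  obtain ⟨F, hF, hF'⟩ := exists_node_rec hh
  refine ⟨F 0, hF.comp (by fun_prop : PR.{v} fun z : ZFSet.{v} => ((0 : ℕ), z)), ?_⟩
  have ht : ∀ {n : ℕ} (t : Tm Empty n), zsnd (tmCode.{v} t.ofPure) = code t.index := by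
    rintro n (i | p)
    · simp [Tm.ofPure, tmCode, Tm.index]
    · exact p.elim
  intro n φ
  induction φ <;> simp only [fmlCode, hF', Fml.ofPure, Fml.godel, hasTag_code, hK', ht] <;>
    simp [*]

theorem index_injective {n : ℕ} : Function.Injective (Tm.index (n := n)) := by
  rintro (i | p) (j | q) h
  · simp only [Tm.index] at h
    rw [Fin.ext h]
  all_goals contradiction

theorem godel_injective {n : ℕ} : Function.Injective (Fml.godel (n := n)) := by
  intro φ
  induction φ with
  | mem s t | nmem s t | eq s t | ne s t =>
    intro ψ h
    cases ψ <;> simp only [Fml.godel] at h <;> first | omega | skip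
    simp only [Nat.add_right_cancel_iff, Nat.mul_right_inj (by simp : 8 ≠ 0)] at h
    have := Nat.pair_eq_pair.1 h
    rw [index_injective this.1, index_injective this.2]
  | and φ₁ φ₂ ih₁ ih₂ | or φ₁ φ₂ ih₁ ih₂ =>
    intro ψ h
    cases ψ <;> simp only [Fml.godel] at h <;> first | omega | skip
    simp only [Nat.add_right_cancel_iff, Nat.mul_right_inj (by simp : 8 ≠ 0)] at h
    have := Nat.pair_eq_pair.1 h
    rw [ih₁ this.1, ih₂ this.2]
  | all φ ih | ex φ ih =>
    intro ψ h
    cases ψ <;> simp only [Fml.godel] at h <;> first | omega | skip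
    simp only [Nat.add_right_cancel_iff, Nat.mul_right_inj (by simp : 8 ≠ 0)] at h
    rw [ih h]

end

section

variable {α β γ δ : Type*} [SetCode.{v} α] [SetCode.{v} β] [SetCode.{v} γ] [SetCode.{v} δ]

/-! ### Satisfaction and definability -/

theorem PRS.exists_code_mem {s : α → Set β} (hs : PRS.{v} s) :
    ∃ S : α → ZFSet.{v}, PR.{v} S ∧ ∀ a b, code b ∈ S a ↔ b ∈ s a := by
  obtain ⟨S, hS, hS'⟩ := hs.exists_PR
  exact ⟨S, hS, fun a b => by simp only [hS', code_inj, exists_eq_right]⟩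

theorem snoc_getD {n : ℕ} {l : List ZFSet.{v}} (hl : l.length = n) (a : ZFSet.{v}) :
    Fin.snoc (α := fun _ => ZFSet.{v}) (fun i : Fin n => l.getD i ∅) a =
      fun i : Fin (n + 1) => (l ++ [a]).getD i ∅ := by
  ext1 i
  refine Fin.lastCases ?_ (fun j => ?_) i
  · simp [← hl]
  · have : (j : ℕ) < l.length := hl ▸ j.2
    simp [List.getElem?_append_left this]

/-- The set `F M z` consists of the assignments in `M`, as lists, that satisfy the formula with
code `z` in `(M, ∈)`. -/
theorem exists_sat : ∃ F : ZFSet.{v} → ZFSet.{v} → ZFSet.{v},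
    PR.{v} (fun x : ZFSet.{v} × ZFSet.{v} => F x.1 x.2) ∧
      ∀ (M : ZFSet.{v}) {n : ℕ} (φ : Fml Ranked.{v} n) (l : List ZFSet.{v}), (∀ a ∈ l, a ∈ M) →
        l.length = n → (code l ∈ F M (fmlCode φ) ↔
          φ.Sat Prod.snd {y | y ∈ M} fun i : Fin n => l.getD i ∅) := by
  have hK : PR.{v} fun x : List ZFSet.{v} × ℕ => x.1.getD x.2 ∅ := by fun_prop
  obtain ⟨K, hK, hK'⟩ := hK.exists_raw
  simp only [code_prod, Prod.forall, code_zfset] at hK'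
  let ev : ZFSet.{v} → List ZFSet.{v} → ZFSet.{v} := fun t l => open Classical in
    if HasTag (zfst t) 0 then K (ZFSet.pair (code l) (zsnd t)) else zsnd (zsnd t)
  have hev : PR.{v} fun x : ZFSet.{v} × List ZFSet.{v} => ev x.1 x.2 := by fun_prop
  have hev' : ∀ {n : ℕ} (t : Tm Ranked.{v} n) (l : List ZFSet.{v}),
      ev (tmCode t) l = t.eval Prod.snd fun i : Fin n => l.getD i ∅ := by
    rintro n (i | p) l
    · simp [ev, tmCode, Tm.eval, hK']
    · simp [ev, tmCode, Tm.eval]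
  have hh : PRS.{v} fun x : ZFSet.{v} × ZFSet.{v} × ZFSet.{v} × ZFSet.{v} × ZFSet.{v} ×
      ZFSet.{v} => {l : List ZFSet.{v} | l ∈ listsOver {y | y ∈ x.1} ∧
        ((HasTag x.2.1 0 ∧ ev x.2.2.1 l ∈ ev x.2.2.2.1 l) ∨
        (HasTag x.2.1 1 ∧ ¬ ev x.2.2.1 l ∈ ev x.2.2.2.1 l) ∨
        (HasTag x.2.1 2 ∧ ev x.2.2.1 l = ev x.2.2.2.1 l) ∨
        (HasTag x.2.1 3 ∧ ¬ ev x.2.2.1 l = ev x.2.2.2.1 l) ∨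
        (HasTag x.2.1 4 ∧ code l ∈ x.2.2.2.2.1 ∧ code l ∈ x.2.2.2.2.2) ∨
        (HasTag x.2.1 5 ∧ (code l ∈ x.2.2.2.2.1 ∨ code l ∈ x.2.2.2.2.2)) ∨
        (HasTag x.2.1 6 ∧ ∀ a ∈ {y | y ∈ x.1}, code (l ++ [a]) ∈ x.2.2.2.2.2) ∨
        (HasTag x.2.1 7 ∧ ∃ a ∈ {y | y ∈ x.1}, code (l ++ [a]) ∈ x.2.2.2.2.2))} := by
    fun_prop
  obtain ⟨S, hS, hS'⟩ := hh.exists_code_mem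
  obtain ⟨F, hF, hF'⟩ := exists_node_rec hS
  refine ⟨F, hF, ?_⟩
  intro M n φ
  induction φ with
  | mem s t | nmem s t | eq s t | ne s t =>
    intro l hl hn
    have hl' : l ∈ listsOver {y | y ∈ M} := hl
    have hl'' : ∀ a ∈ l, a ∈ {y | y ∈ M} := hl
    rw [fmlCode, hF', hS', Set.mem_ofPred_eq]
    simp only [hl', hasTag_code, hev', Fml.Sat]
    simp
  | and φ ψ ih₁ ih₂ | or φ ψ ih₁ ih₂ =>
    intro l hl hn
    have hl' : l ∈ listsOver {y | y ∈ M} := hl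
    rw [fmlCode, hF', hS', Fml.Sat, ← ih₁ l hl hn, ← ih₂ l hl hn, Set.mem_ofPred_eq]
    simp only [hl', hasTag_code]
    simp
  | all φ ih | ex φ ih =>
    intro l hl hn
    have hl' : l ∈ listsOver {y | y ∈ M} := hl
    have ih' : ∀ a ∈ M, (code (l ++ [a]) ∈ F M (fmlCode φ) ↔ _) := fun a ha =>
      ih (l ++ [a]) (by simp only [List.mem_append, List.mem_singleton]; rintro b (hb | rfl)
                        exacts [hl b hb, ha]) (by simp [hn])
    rw [fmlCode, hF', hS', Fml.Sat, Set.mem_ofPred_eq]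
    simp only [hl', hasTag_code, snoc_getD hn]
    simp +contextual [ih']
    try exact exists_congr fun a => and_congr_right fun ha => ih' a ha

/-- The class of `Δ₀`-formulas by recursion on formulas: the scope of a quantifier has to begin with
the membership of the bound variable in a term that differs from this variable. -/
theorem isDelta0_iff {n : ℕ} (φ : Fml Ranked.{v} n) :
    φ.IsDelta0 ↔ match φ with
      | .mem _ _ | .nmem _ _ | .eq _ _ | .ne _ _ => True
      | .and φ ψ | .or φ ψ => φ.IsDelta0 ∧ ψ.IsDelta0
      | .all φ => φ.IsDelta0 ∧
          ∃ t ψ, φ = .or (.nmem (.var (Fin.last _)) (Tm.lift t)) ψ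
      | .ex φ => φ.IsDelta0 ∧
          ∃ t ψ, φ = .and (.mem (.var (Fin.last _)) (Tm.lift t)) ψ := by
  constructor
  · intro h
    induction h with
    | lit h => cases h <;> trivial
    | and h₁ h₂ => exact ⟨h₁, h₂⟩
    | or h₁ h₂ => exact ⟨h₁, h₂⟩
    | ball y h => exact ⟨.or (.lit (.nmem _ _)) h, y, _, rfl⟩
    | bex y h => exact ⟨.and (.lit (.mem _ _)) h, y, _, rfl⟩
  · cases φ with
    | mem s t => exact fun _ => .lit (.mem s t)
    | nmem s t => exact fun _ => .lit (.nmem s t)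
    | eq s t => exact fun _ => .lit (.eq s t)
    | ne s t => exact fun _ => .lit (.ne s t)
    | and => exact fun h => .and h.1 h.2
    | or => exact fun h => .or h.1 h.2
    | all =>
      rintro ⟨h, t, ψ, rfl⟩
      cases h with
      | lit h => cases h
      | or _ h => exact .ball t h
    | ex =>
      rintro ⟨h, t, ψ, rfl⟩
      cases h with
      | lit h => cases h
      | and _ h => exact .bex t h

theorem eq_lift_iff {n : ℕ} (t : Tm Ranked.{v} (n + 1)) :
    (∃ t', t = Tm.lift t') ↔ t ≠ .var (Fin.last n) := by
  constructor
  · rintro ⟨i | p, rfl⟩ h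
    · simp only [Tm.lift, Tm.rename, Tm.var.injEq] at h
      exact (Fin.castSucc_lt_last i).ne h
    · simp [Tm.lift, Tm.rename] at h
  · rcases t with i | p
    · refine Fin.lastCases (by simp) (fun j _ => ⟨.var j, rfl⟩) i
    · exact fun _ => ⟨.par p, rfl⟩

theorem PR.isLiteral {n : ℕ} {f : α → Fml Ranked.{v} n} (hf : PR.{v} f) :
    PR.{v} fun a => (f a).IsLiteral := by
  have : PR.{v} fun a => zfst (code (f a)) ∈ code.{v} 4 := by fun_prop
  convert this using 2 with a
  cases f a <;> simp [code_fml, fmlCode] <;>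
  first
  | exact .mem _ _
  | exact .nmem _ _
  | exact .eq _ _
  | exact .ne _ _
  | (intro h; cases h)

theorem PR.isDelta0 {n : ℕ} {f : α → Fml Ranked.{v} n} (hf : PR.{v} f) :
    PR.{v} fun a => (f a).IsDelta0 := by
  let sh : ℕ → ℕ → ZFSet.{v} → ZFSet.{v} → Prop := fun i j x y =>
    HasTag (zfst y) i ∧ HasTag (zfst (zfst (zsnd y))) j ∧
      zfst (zsnd (zfst (zsnd y))) = ZFSet.pair (code 0) x ∧
      zsnd (zsnd (zfst (zsnd y))) ≠ ZFSet.pair (code 0) x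
  have hsh : ∀ {n : ℕ} (t : Tm Ranked.{v} (n + 1)),
      t = .var (Fin.last n) ↔ tmCode t = ZFSet.pair (code 0) (code n) := fun {n} t => by
    rw [← tmCode_injective.eq_iff]
    simp [tmCode]
  have hall : ∀ {n : ℕ} (φ : Fml Ranked.{v} (n + 1)), sh 5 1 (code n) (fmlCode φ) ↔
      ∃ t ψ, φ = .or (.nmem (.var (Fin.last _)) (Tm.lift t)) ψ := by
    intro n φ
    rcases φ with _ | _ | _ | _ | _ | ⟨φ, ψ⟩ | _ | _ <;>
    · try rcases φ with _ | ⟨s, t⟩ | _ | _ | _ | _ | _ | _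
      all_goals simp [sh, fmlCode]
      try rw [eq_lift_iff, hsh, Ne, hsh]
  have hex : ∀ {n : ℕ} (φ : Fml Ranked.{v} (n + 1)), sh 4 0 (code n) (fmlCode φ) ↔
      ∃ t ψ, φ = .and (.mem (.var (Fin.last _)) (Tm.lift t)) ψ := by
    intro n φ
    rcases φ with _ | _ | _ | _ | ⟨φ, ψ⟩ | _ | _ | _ <;>
    · try rcases φ with ⟨s, t⟩ | _ | _ | _ | _ | _ | _ | _
      all_goals simp [sh, fmlCode]
      try rw [eq_lift_iff, hsh, Ne, hsh]
  have hh : PR.{v} fun x : ℕ × ZFSet.{v} × ZFSet.{v} × ZFSet.{v} × ZFSet.{v} × ZFSet.{v} =>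
      code.{v} (x.2.1 ∈ code.{v} 4 ∨ (HasTag x.2.1 4 ∨ HasTag x.2.1 5) ∧
          (∅ ∈ x.2.2.2.2.1 ∧ ∅ ∈ x.2.2.2.2.2) ∨
        HasTag x.2.1 6 ∧ ∅ ∈ x.2.2.2.2.2 ∧ sh 5 1 x.2.2.1 x.2.2.2.1 ∨
        HasTag x.2.1 7 ∧ ∅ ∈ x.2.2.2.2.2 ∧ sh 4 0 x.2.2.1 x.2.2.2.1) := by fun_prop
  obtain ⟨F, hF, hF'⟩ := exists_node_rec hh
  have key : ∀ {n : ℕ} (φ : Fml Ranked.{v} n), F 0 (fmlCode φ) = truth φ.IsDelta0 := by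
    intro n φ
    induction φ <;> rw [isDelta0_iff] <;>
      simp only [fmlCode, hasTag_code, code_mem_code, *, code_prop, empty_mem_truth] <;> simp
  have : PR.{v} fun a => F 0 (code (f a)) :=
    hF.comp (by fun_prop : PR.{v} fun a => ((0 : ℕ), code (f a)))
  refine of_code ?_
  simpa only [code_fml, key, code_prop] using this

attribute [fun_prop] PR.isLiteral PR.isDelta0

theorem Tm.eval_lift {P : Type*} (val : P → ZFSet.{v}) {n : ℕ} (x : Fin n → ZFSet.{v})
    (a : ZFSet.{v}) (t : Tm P n) :
    t.lift.eval val (Fin.snoc (α := fun _ => ZFSet.{v}) x a) = t.eval val x := by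
  cases t <;> simp [Tm.lift, Tm.rename, Tm.eval]

theorem TC.node_left (k x y : ZFSet.{v}) : TC x (ZFSet.pair k (ZFSet.pair x y)) :=
  (TC.pair_left _ _).trans (TC.pair_right _ _)

theorem TC.node_right (k x y : ZFSet.{v}) : TC y (ZFSet.pair k (ZFSet.pair x y)) :=
  (TC.pair_right _ _).trans (TC.pair_right _ _)

theorem Tm.eval_var_last {P : Type*} (val : P → ZFSet.{v}) {n : ℕ} (x : Fin n → ZFSet.{v})
    (a : ZFSet.{v}) :
    (Tm.var (Fin.last n)).eval val (Fin.snoc (α := fun _ => ZFSet.{v}) x a) = a := by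
  simp [Tm.eval]

/-- `Δ₀`-formulas are absolute for transitive sets that contain the parameters. -/
theorem sat_univ_iff_of_isDelta0 {M : Set ZFSet.{v}} (htr : ∀ x ∈ M, ∀ y ∈ x, y ∈ M) {n : ℕ}
    {φ : Fml Ranked.{v} n} (h : φ.IsDelta0) (hM : ∀ y, TC y (fmlCode φ) → y ∈ M)
    {x : Fin n → ZFSet.{v}} (hx : ∀ i, x i ∈ M) :
    φ.Sat Prod.snd Set.univ x ↔ φ.Sat Prod.snd M x := by
  have hsn : ∀ {n : ℕ} {x : Fin n → ZFSet.{v}} (hx : ∀ i, x i ∈ M) {a : ZFSet.{v}} (ha : a ∈ M),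
      ∀ i, (Fin.snoc (α := fun _ => ZFSet.{v}) x a : _) i ∈ M := by
    intro n x hx a ha i
    refine Fin.lastCases (by simpa) (fun j => by simpa using hx j) i
  induction h with
  | lit h => cases h <;> rfl
  | and _ _ ih₁ ih₂ =>
    rw [fmlCode] at hM
    exact and_congr (ih₁ (fun y hy => hM y (hy.trans (TC.node_left _ _ _))) hx)
      (ih₂ (fun y hy => hM y (hy.trans (TC.node_right _ _ _))) hx)
  | or _ _ ih₁ ih₂ =>
    rw [fmlCode] at hM
    exact or_congr (ih₁ (fun y hy => hM y (hy.trans (TC.node_left _ _ _))) hx)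
      (ih₂ (fun y hy => hM y (hy.trans (TC.node_right _ _ _))) hx)
  | ball t h ih | bex t h ih =>
    simp only [Fml.ball, Fml.bex, fmlCode, Fml.imp, Fml.neg] at hM
    have ht : t.eval Prod.snd x ∈ M := by
      rcases t with i | p
      · exact hx i
      · refine hM _ (.trans ?_ ((TC.node_right _ _ _).trans ((TC.node_left _ _ _).trans
          (TC.node_right _ _ _))))
        exact (TC.pair_right (code p.1) _).trans (TC.pair_right _ _)
    have ih' := fun a ha => ih (fun y hy => hM y (hy.trans ((TC.node_right _ _ _).trans
      (TC.node_right _ _ _)))) (hsn hx (a := a) ha)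
    have htr' := htr _ ht
    simp only [Fml.ball, Fml.bex, Fml.Sat, Fml.imp, Fml.neg, Tm.eval_lift, Tm.eval_var_last,
      Set.mem_univ, true_and, true_imp_iff]
    clear hM ih h hsn htr
    grind

/-- Truth of a `Δ₀`-formula in the universe is decided by the set of all sets in the transitive
closure of its code, since this set contains the parameters. -/
theorem hasTrueDelta0_iff (Γ : Sequent.{v}) : HasTrueDelta0 Γ ↔ ∃ φ ∈ Γ, φ.IsDelta0 ∧
    φ.Sat Prod.snd {y | TC y (fmlCode φ)} Fin.elim0 := by
  refine exists_congr fun φ => and_congr_right fun _ => and_congr_right fun h => ?_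
  refine sat_univ_iff_of_isDelta0 (fun x hx y hy => ?_) h (fun y hy => hy) (fun i => i.elim0)
  exact Relation.TransGen.head hy hx

@[fun_prop]
theorem PR.hasTrueDelta0 {f : α → Sequent.{v}} (hf : PR.{v} f) :
    PR.{v} fun a => HasTrueDelta0 (f a) := by
  obtain ⟨T, hT, hT'⟩ := PRS.tc.{v}.exists_code_mem
  obtain ⟨F, hF, hF'⟩ := exists_sat.{v}
  have : PR.{v} fun a => ∃ φ ∈ {φ | φ ∈ f a}, φ.IsDelta0 ∧
      code ([] : List ZFSet.{v}) ∈ F (T (code φ)) (code φ) := by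
    refine bex (by fun_prop) (PR.and (by fun_prop) (PR.zmem
      (PR.code_comp (PR.nil (β := ZFSet.{v}))) (hF.comp
      (f := fun x : α × Fml Ranked.{v} 0 => (T (code.{v} x.2), code.{v} x.2)) ?_)))
    fun_prop
  convert this using 2 with a
  rw [hasTrueDelta0_iff]
  refine exists_congr fun φ => and_congr_right fun _ => and_congr_right fun h => ?_
  rw [code_fml, hF' _ φ [] (by simp) rfl]
  have : {y | y ∈ T (fmlCode φ)} = {y | TC y (fmlCode φ)} := by
    ext y
    exact hT' (fmlCode φ) y
  rw [this]
  refine iff_of_eq (congrArg (fun x => Fml.Sat _ _ x φ) (funext fun i => i.elim0))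

end

section

variable {α β γ δ : Type*} [SetCode.{v} α] [SetCode.{v} β] [SetCode.{v} γ] [SetCode.{v} δ]

/-! ### Parameter-free formulas and definability -/

theorem ofPure_injective {n : ℕ} : Function.Injective (Fml.ofPure (P := Ranked.{v}) (n := n)) := by
  have ht : ∀ {n : ℕ} {s t : Tm Empty n}, (s.ofPure : Tm Ranked.{v} n) = t.ofPure → s = t := by
    rintro n (i | p) (j | q) h
    · simpa [Tm.ofPure] using h
    all_goals contradiction
  intro φ
  induction φ with
  | mem s t | nmem s t | eq s t | ne s t =>
    intro ψ h
    cases ψ <;> simp [Fml.ofPure] at h ⊢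
    exact ⟨ht h.1, ht h.2⟩
  | and φ₁ φ₂ ih₁ ih₂ | or φ₁ φ₂ ih₁ ih₂ =>
    intro ψ h
    cases ψ <;> simp [Fml.ofPure] at h ⊢
    exact ⟨ih₁ h.1, ih₂ h.2⟩
  | all φ ih | ex φ ih =>
    intro ψ h
    cases ψ <;> simp [Fml.ofPure] at h ⊢
    exact ih h

theorem sat_ofPure {n : ℕ} (φ : Fml Empty n) (M : Set ZFSet.{v}) (x : Fin n → ZFSet.{v}) :
    (φ.ofPure : Fml Ranked.{v} n).Sat Prod.snd M x ↔ φ.Sat Empty.elim M x := by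
  have ht : ∀ {n : ℕ} (t : Tm Empty n) (x : Fin n → ZFSet.{v}),
      (t.ofPure : Tm Ranked.{v} n).eval Prod.snd x = t.eval Empty.elim x := by
    rintro n (i | p) x
    · rfl
    · exact p.elim
  induction φ <;> simp only [Fml.ofPure, Fml.Sat, *]

/-- Parameter-free formulas, with the number of their free variables. -/
abbrev PureFml : Type := Σ n, Fml Empty n

instance : SetCode.{v} PureFml :=
  ⟨fun f => ZFSet.pair (code f.1) (fmlCode f.2.ofPure), by
    rintro ⟨n, φ⟩ ⟨m, ψ⟩ h
    simp only [ZFSet.pair_inj, code_inj] at h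
    obtain ⟨rfl, h⟩ := h
    rw [ofPure_injective (fmlCode_injective h)]⟩

theorem code_pureFml {n : ℕ} (φ : Fml Empty n) :
    code.{v} (⟨n, φ⟩ : PureFml) = ZFSet.pair (code n) (fmlCode φ.ofPure) := rfl

theorem PR.arity {f : α → PureFml} (hf : PR.{v} f) : PR.{v} fun a => (f a).1 := by
  refine of_code ?_
  have : PR.{v} fun a => zfst (code (f a)) := by fun_prop
  convert this using 2 with a
  rcases f a with ⟨n, φ⟩
  simp [code_pureFml]

theorem PR.godel {f : α → PureFml} (hf : PR.{v} f) : PR.{v} fun a => (f a).2.godel := by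
  obtain ⟨F, hF, hF'⟩ := exists_godel.{v}
  refine of_code ?_
  have : PR.{v} fun a => F (zsnd (code (f a))) := hF.comp (by fun_prop)
  convert this using 2 with a
  rcases f a with ⟨n, φ⟩
  simp [code_pureFml, hF']

attribute [fun_prop] PR.arity PR.godel

/-- One step in the generation of the codes of parameter-free formulas. -/
def pureStep (X : Set (ℕ × ZFSet.{v})) : Set (ℕ × ZFSet.{v}) :=
  {y | ∃ q ∈ {q : ℕ × ℕ × ℕ × ℕ |
        q ∈ (Set.univ : Set ℕ) ×ˢ (Set.univ : Set ℕ) ×ˢ (Set.univ : Set ℕ) ×ˢ (Set.univ : Set ℕ) ∧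
          q.2.1 < 4 ∧ q.2.2.1 < q.1 ∧ q.2.2.2 < q.1},
        y = (q.1, ZFSet.pair (code q.2.1) (ZFSet.pair (ZFSet.pair (code 0) (code q.2.2.1))
          (ZFSet.pair (code 0) (code q.2.2.2))))} ∪
      ({y | ∃ q ∈ {q : ℕ × (ℕ × ZFSet.{v}) × (ℕ × ZFSet.{v}) |
        q ∈ (Set.univ : Set ℕ) ×ˢ X ×ˢ X ∧ (q.1 = 4 ∨ q.1 = 5) ∧
          q.2.1.1 = q.2.2.1},
        y = (q.2.1.1, ZFSet.pair (code q.1) (ZFSet.pair q.2.1.2 q.2.2.2))} ∪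
      {y | ∃ q ∈ {q : ℕ × ℕ × ZFSet.{v} | q ∈ (Set.univ : Set ℕ) ×ˢ {y | ∃ z ∈ X, y = z} ∧
          (q.1 = 6 ∨ q.1 = 7) ∧ ¬ q.2.1 = 0},
        y = (q.2.1 - 1, ZFSet.pair (code q.1) (ZFSet.pair (code (q.2.1 - 1)) q.2.2))})

/-- The codes of parameter-free formulas of depth less than `k`. -/
def pureStage : ℕ → Set (ℕ × ZFSet.{v})
  | 0 => ∅
  | k + 1 => pureStep (pureStage k)

theorem PR.nat_pred {f : α → ℕ} (hf : PR.{v} f) : PR.{v} fun a => f a - 1 := by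
  refine of_code ?_
  have : PR.{v} fun a => (code (f a)).sUnion := by fun_prop
  convert this using 2 with a
  cases f a with
  | zero => simp [code_nat]
  | succ n => rw [sUnion_nat_succ, Nat.add_sub_cancel]

attribute [fun_prop] PR.nat_pred

theorem PRS.pureStage : PRS.{v} fun k : ℕ => pureStage.{v} k := by
  refine comp (s := fun x : ℕ × ℕ => KPTree.pureStage x.2) (f := fun k : ℕ => (k, k))
    (nat_rec (s := fun _ k => KPTree.pureStage k) (step := fun _ _ X => pureStep X) ?_ ?_
      fun _ _ => by rw [KPTree.pureStage]) (by fun_prop)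
  · exact PRS.empty
  · unfold pureStep
    fun_prop

theorem mem_pureStage_iff {n : ℕ} {z : ZFSet.{v}} :
    (∃ k, (n, z) ∈ pureStage k) ↔ ∃ φ : Fml Empty n, z = fmlCode φ.ofPure := by
  constructor
  · rintro ⟨k, h⟩
    induction k generalizing n z with
    | zero => exact h.elim
    | succ k ih =>
      rcases h with ⟨⟨n, i, a, b⟩, ⟨-, hi, ha, hb⟩, ⟨⟩⟩ |
        ⟨⟨i, ⟨n, z⟩, m, z'⟩, ⟨⟨-, h, h'⟩, hi, e⟩, ⟨⟩⟩ | ⟨⟨i, n, z⟩, ⟨⟨-, _, h, rfl⟩, hi, e⟩, ⟨⟩⟩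
      · simp only at hi ha hb ⊢
        interval_cases i
        · exact ⟨.mem (.var ⟨a, ha⟩) (.var ⟨b, hb⟩), rfl⟩
        · exact ⟨.nmem (.var ⟨a, ha⟩) (.var ⟨b, hb⟩), rfl⟩
        · exact ⟨.eq (.var ⟨a, ha⟩) (.var ⟨b, hb⟩), rfl⟩
        · exact ⟨.ne (.var ⟨a, ha⟩) (.var ⟨b, hb⟩), rfl⟩
      · simp only at e hi
        subst e
        obtain ⟨φ, hφ⟩ := ih h
        obtain ⟨ψ, hψ⟩ := ih h'
        simp only at φ ψ hφ hψ ⊢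
        subst hφ hψ
        rcases hi with rfl | rfl
        · exact ⟨.and φ ψ, rfl⟩
        · exact ⟨.or φ ψ, rfl⟩
      · obtain ⟨φ, hφ⟩ := ih h
        simp only at φ hφ e hi ⊢
        obtain ⟨n, rfl⟩ := Nat.exists_eq_succ_of_ne_zero e
        subst hφ
        rcases hi with rfl | rfl
        · exact ⟨.all φ, rfl⟩
        · exact ⟨.ex φ, rfl⟩
  · suffices ∀ {n : ℕ} (φ : Fml Empty n), ∃ k, ∀ m ≥ k, (n, fmlCode φ.ofPure) ∈ pureStage.{v} m by
      rintro ⟨φ, rfl⟩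
      obtain ⟨k, hk⟩ := this φ
      exact ⟨k, hk k le_rfl⟩
    have ht : ∀ {n : ℕ} (t : Tm Empty n), ∃ i < n, tmCode.{v} t.ofPure =
        ZFSet.pair (code 0) (code i) := by
      rintro n (i | p)
      · exact ⟨i, i.2, rfl⟩
      · exact p.elim
    have hl : ∀ (i : ℕ), i < 4 → ∀ {n : ℕ} (s t : Tm Empty n), ∃ k, ∀ m ≥ k,
        (n, ZFSet.pair (code i) (ZFSet.pair (tmCode.{v} s.ofPure) (tmCode.{v} t.ofPure))) ∈
          pureStage.{v} m := by
      intro i hi n s t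
      obtain ⟨a, ha, hs⟩ := ht s
      obtain ⟨b, hb, ht⟩ := ht t
      refine ⟨1, fun m hm => ?_⟩
      obtain ⟨m, rfl⟩ := Nat.exists_eq_add_of_le' hm
      exact .inl ⟨(n, i, a, b), ⟨by simp, hi, ha, hb⟩, by rw [hs, ht]⟩
    intro n φ
    induction φ with
    | mem s t => exact hl 0 (by simp) s t
    | nmem s t => exact hl 1 (by simp) s t
    | eq s t => exact hl 2 (by simp) s t
    | ne s t => exact hl 3 (by simp) s t
    | @and n φ ψ ih₁ ih₂ | @or n φ ψ ih₁ ih₂ =>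
      obtain ⟨k, hk⟩ := ih₁
      obtain ⟨k', hk'⟩ := ih₂
      refine ⟨k + k' + 1, fun m hm => ?_⟩
      obtain ⟨m, rfl⟩ := Nat.exists_eq_add_of_le' (show 1 ≤ m by omega)
      refine .inr (.inl ⟨(_, (n, fmlCode φ.ofPure), (n, fmlCode ψ.ofPure)), ⟨⟨trivial,
        hk m (by omega), hk' m (by omega)⟩, by first | exact .inl rfl | exact .inr rfl, rfl⟩, rfl⟩)
    | @all n φ ih | @ex n φ ih =>
      obtain ⟨k, hk⟩ := ih
      refine ⟨k + 1, fun m hm => ?_⟩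
      obtain ⟨m, rfl⟩ := Nat.exists_eq_add_of_le' (show 1 ≤ m by omega)
      refine .inr (.inr ⟨(_, n + 1, fmlCode φ.ofPure), ⟨⟨trivial,
        ⟨_, hk m (by omega), rfl⟩⟩, by first | exact .inl rfl | exact .inr rfl, by simp⟩, rfl⟩)

@[fun_prop]
theorem PRS.univ_pureFml : PRS.{v} fun _ : α => (Set.univ : Set PureFml) := by
  have h := PRS.iUnion_nat (α := α) (s := fun k _ => KPTree.pureStage.{v} k)
    (PRS.pureStage.comp (by fun_prop))
  obtain ⟨S, hS, hS'⟩ := h.exists_PR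
  refine of_PR hS fun a z => ?_
  simp only [hS', Set.mem_ofPred_eq, Prod.exists, mem_pureStage_iff, Set.mem_univ, true_and]
  constructor
  · rintro ⟨n, z, ⟨φ, rfl⟩, rfl⟩
    exact ⟨⟨n, φ⟩, rfl⟩
  · rintro ⟨⟨n, φ⟩, rfl⟩
    exact ⟨n, _, ⟨φ, rfl⟩, rfl⟩

/-- A sequence of sentences with primitive recursive Gödel numbers is primitive recursive. -/
theorem PR.of_godel {θ : ℕ → Fml Empty 0} (h : Nat.Primrec fun k => (θ k).godel) :
    PR.{v} fun k => ((θ k).ofPure : Fml Ranked.{v} 0) := by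
  have h1 : PR.{v} fun k => (⟨0, θ k⟩ : PureFml) := by
    refine of_graph (s := fun _ => Set.univ) PRS.univ_pureFml (fun _ => trivial) ?_
    have h2 := (of_nat_primrec h).comp (f := fun x : ℕ × PureFml => x.1) (by fun_prop)
    have : PR.{v} fun x : ℕ × PureFml => x.2.1 = 0 ∧ x.2.2.godel = (θ x.1).godel := by fun_prop
    convert this using 2 with x
    rcases x with ⟨k, n, φ⟩
    refine ⟨fun h => ?_, fun h => ?_⟩
    · have h' : (⟨n, φ⟩ : PureFml) = ⟨0, θ k⟩ := h
      rw [h']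
      exact ⟨rfl, rfl⟩
    · obtain ⟨h, h'⟩ := h
      simp only at h h' ⊢
      subst h
      rw [godel_injective h']
  refine of_code (β := Fml Ranked.{v} 0) ?_
  have : PR.{v} fun k => zsnd (code (⟨0, θ k⟩ : PureFml)) := by fun_prop
  simpa [code_pureFml, code_fml] using this

/-- The definitions of `b` over `M`, as pairs of a formula and a list of parameters. -/
def defns (M : Set ZFSet.{v}) (b : ZFSet.{v}) : Set (PureFml × List ZFSet.{v}) :=
  {d | ∃ (n : ℕ) (φ : Fml Empty (n + 1)) (p : Fin n → ZFSet.{v}),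
    d = (⟨n + 1, φ⟩, List.ofFn p) ∧ Defines M φ p b}

/-- The subset of `M` that a formula with parameters defines is primitive recursive in these data.
-/
theorem exists_defines : ∃ F : ZFSet.{v} × PureFml × List ZFSet.{v} → ZFSet.{v}, PR.{v} F ∧
    ∀ (M : ZFSet.{v}) {n : ℕ} (φ : Fml Empty (n + 1)) (p : Fin n → ZFSet.{v}) (b : ZFSet.{v}),
      Defines {y | y ∈ M} φ p b ↔ (∀ i, p i ∈ M) ∧ b = F (M, ⟨n + 1, φ⟩, List.ofFn p) := by
  obtain ⟨F, hF, hF'⟩ := exists_sat.{v}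
  refine ⟨fun x => x.1.sep fun y => code (x.2.2 ++ [y]) ∈ F x.1 (zsnd (code x.2.1)), ?_, ?_⟩
  · refine PR.zsep (by fun_prop) (PR.zmem (by fun_prop) (hF.comp
      (f := fun x : (ZFSet.{v} × PureFml × List ZFSet.{v}) × ZFSet.{v} =>
        (x.1.1, zsnd (code.{v} x.1.2.1))) ?_))
    fun_prop
  · intro M n φ p b
    refine and_congr_right fun hp => ?_
    rw [ZFSet.ext_iff]
    refine forall_congr' fun y => iff_congr Iff.rfl ?_
    rw [ZFSet.mem_sep]
    refine and_congr_right fun hy => ?_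
    have hl : ∀ a ∈ List.ofFn p ++ [y], a ∈ M := by
      simp only [List.mem_append, List.mem_ofFn, List.mem_singleton]
      rintro a (⟨i, rfl⟩ | rfl)
      exacts [hp i, hy]
    rw [code_pureFml, zsnd_pair, hF' _ _ _ hl (by simp), sat_ofPure, ← snoc_getD (by simp)]
    have : (fun i : Fin n => (List.ofFn p).getD i ∅) = p := by
      ext1 i
      simp
    rw [this]

open Classical in
theorem PRS.defns {s : α → Set ZFSet.{v}} {b : α → ZFSet.{v}} (hs : PRS.{v} s) (hb : PR.{v} b) :
    PRS.{v} fun a => defns (s a) (b a) := by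
  obtain ⟨F, hF, hF'⟩ := exists_defines.{v}
  obtain ⟨S, hS, hS'⟩ := hs.exists_code_mem
  have : PRS.{v} fun a => {d : PureFml × List ZFSet.{v} | d ∈ (Set.univ : Set PureFml) ×ˢ
      KPTree.listsOver (s a) ∧ d.1.1 = d.2.length + 1 ∧ b a = F (S a, d)} := by
    refine PRS.sep (by fun_prop) (PR.and (by fun_prop) (PR.eq (by fun_prop) (hF.comp ?_)))
    fun_prop
  convert this using 2 with a
  have hSa : s a = {y | y ∈ S a} := Set.ext fun y => (hS' a y).symm
  ext ⟨⟨n, φ⟩, l⟩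
  simp only [KPTree.defns, Set.mem_ofPred_eq]
  constructor
  · rintro ⟨n, φ, p, ⟨⟩, h⟩
    rw [hSa, hF'] at h
    refine ⟨⟨trivial, fun a ha => ?_⟩, by simp, h.2⟩
    obtain ⟨i, rfl⟩ := (List.mem_ofFn' _ _).1 ha
    exact hSa ▸ h.1 i
  · rintro ⟨⟨-, h⟩, rfl, h'⟩
    refine ⟨l.length, φ, l.get, by simp, ?_⟩
    rw [hSa, hF']
    refine ⟨fun i => ?_, by simpa using h'⟩
    have := h _ (List.get_mem l i)
    rwa [hSa] at this

theorem PRS.definablePowerset {s : α → Set ZFSet.{v}} (hs : PRS.{v} s) :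
    PRS.{v} fun a => definablePowerset (s a) := by
  obtain ⟨F, hF, hF'⟩ := exists_defines.{v}
  obtain ⟨S, hS, hS'⟩ := hs.exists_code_mem
  have : PRS.{v} fun a => {b | ∃ d ∈ {d : PureFml × List ZFSet.{v} | d ∈ (Set.univ : Set PureFml) ×ˢ
      KPTree.listsOver (s a) ∧ d.1.1 = d.2.length + 1}, b = F (S a, d)} := by
    refine PRS.image (by fun_prop) (hF.comp ?_)
    fun_prop
  convert this using 2 with a
  have hSa : s a = {y | y ∈ S a} := Set.ext fun y => (hS' a y).symm
  ext b
  simp only [KPTree.definablePowerset, Set.mem_ofPred_eq]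
  constructor
  · rintro ⟨n, φ, p, h⟩
    rw [hSa, hF'] at h
    refine ⟨(⟨n + 1, φ⟩, List.ofFn p), ⟨⟨trivial, fun a ha => ?_⟩, by simp⟩, h.2⟩
    obtain ⟨i, rfl⟩ := (List.mem_ofFn' _ _).1 ha
    exact hSa ▸ h.1 i
  · rintro ⟨⟨⟨n, φ⟩, l⟩, ⟨⟨-, h⟩, e⟩, h'⟩
    simp only at e h
    subst e
    refine ⟨l.length, φ, l.get, ?_⟩
    rw [hSa, hF']
    refine ⟨fun i => ?_, by simpa using h'⟩
    have := h _ (List.get_mem l i)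
    rwa [hSa] at this

end

section

variable {α β γ δ : Type*} [SetCode.{v} α] [SetCode.{v} β] [SetCode.{v} γ] [SetCode.{v} δ]

/-! ### The constructible hierarchy is primitive recursive -/

/-- Enumerations of countable sets, coded as functions on `ω`. -/
abbrev Enum : Type (v + 1) := ℕ → ZFSet.{v}

theorem mem_enumCode {e : ℕ → ZFSet.{v}} {z : ZFSet.{v}} :
    z ∈ enumCode e ↔ ∃ n : ℕ, ZFSet.pair (code n) (e n) = z := by
  simp [enumCode, code_nat]

theorem app_enumCode (e : ℕ → ZFSet.{v}) (n : ℕ) : app (enumCode e) (code n) = e n := by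
  refine app_eq (mem_enumCode.2 ⟨n, rfl⟩) fun w hw h => ?_
  obtain ⟨m, rfl⟩ := mem_enumCode.1 hw
  rw [zfst_pair, code_inj] at h
  rw [zsnd_pair, h]

instance : SetCode.{v} Enum.{v} := ⟨enumCode, fun e e' h => by
  funext n
  rw [← app_enumCode e n, h, app_enumCode]⟩

theorem code_enum (e : Enum.{v}) : code.{v} e = enumCode e := rfl

/-- The `n`-th entry; as a function of both arguments it is accessible to `fun_prop`. -/
def Enum.get (e : Enum.{v}) (n : ℕ) : ZFSet.{v} := e n

@[fun_prop]
theorem PR.enum_get {f : α → Enum.{v}} {g : α → ℕ} (hf : PR.{v} f) (hg : PR.{v} g) :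
    PR.{v} fun a => (f a).get (g a) := by
  have : PR.{v} fun a => app (code (f a)) (code (g a)) := by fun_prop
  convert this using 2 with a
  exact (app_enumCode _ _).symm

@[fun_prop]
theorem PRS.enum_range {f : α → Enum.{v}} (hf : PR.{v} f) :
    PRS.{v} fun a => Set.range (f a) := by
  have : PRS.{v} fun a => {x | ∃ n ∈ (Set.univ : Set ℕ), x = (f a).get n} :=
    PRS.image (by fun_prop) (by fun_prop)
  convert this using 2 with a
  ext x
  simp [Enum.get, eq_comm]

theorem LStage_zero (u : Set ZFSet.{v}) : LStage u 0 = u := Ordinal.limitRecOn_zero ..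

theorem LStage_succ (u : Set ZFSet.{v}) (o : Ordinal.{v}) :
    LStage u (o + 1) = definablePowerset (LStage u o) := by
  rw [LStage]
  exact Ordinal.limitRecOn_add_one ..

theorem LStage_limit (u : Set ZFSet.{v}) {o : Ordinal.{v}} (h : Order.IsSuccLimit o) :
    LStage u o = {a | ∃ o' < o, a ∈ LStage u o'} := by
  rw [LStage, Ordinal.limitRecOn_limit _ _ _ _ h]
  ext a
  simp [LStage]

theorem PRS.LStage_aux : PRS.{v} fun x : Enum.{v} × Ordinal.{v} => LStage (Set.range x.1) x.2 := by
  refine ordinal_rec (s := fun (e : Enum.{v}) o => LStage (Set.range e) o)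
    (step := fun _ _ X => KPTree.definablePowerset X) ?_ ?_ ?_ ?_
  · simp only [LStage_zero]
    fun_prop
  · exact PRS.definablePowerset (by fun_prop)
  · exact fun e o => LStage_succ (Set.range e) o
  · exact fun e o h => LStage_limit (Set.range e) h

@[fun_prop]
theorem PRS.LStage {f : α → Enum.{v}} {g : α → Ordinal.{v}} (hf : PR.{v} f) (hg : PR.{v} g) :
    PRS.{v} fun a => LStage (Set.range (f a)) (g a) :=
  LStage_aux.comp (hf.prodMk hg)

@[fun_prop]
theorem PRS.Iio_ordinal {f : α → Ordinal.{v}} (hf : PR.{v} f) :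
    PRS.{v} fun a => Set.Iio (f a) := by
  refine of_PR hf.code_comp fun a z => ?_
  simp [code_ordinal, Ordinal.mem_toZFSet_iff]

@[fun_prop]
theorem PRS.RStage {f : α → Enum.{v}} {g : α → Ordinal.{v}} (hf : PR.{v} f) (hg : PR.{v} g) :
    PRS.{v} fun a => RStage (Set.range (f a)) (g a) := by
  have : PRS.{v} fun x : Enum.{v} × Ordinal.{v} => {c : Ranked.{v} |
      c ∈ Set.Iio (x.2 + 1) ×ˢ {y | ∃ o ∈ Set.Iio (x.2 + 1), y ∈ KPTree.LStage (Set.range x.1) o} ∧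
      ((x.2 = 0 ∧ c.1 = 0 ∧ c.2 ∈ Set.range x.1) ∨
      (c.1 < x.2 ∧ c.2 ∈ KPTree.LStage (Set.range x.1) (c.1 + 1) ∧
        ∀ o ∈ Set.Iio c.1, ¬ c.2 ∈ KPTree.LStage (Set.range x.1) (o + 1)))} := by
    fun_prop
  have := this.comp (hf.prodMk hg)
  convert this using 2 with a
  ext c
  refine ⟨fun h => ⟨?_, h⟩, fun h => h.2⟩
  rcases h with ⟨h, h', h''⟩ | ⟨h, h', h''⟩
  · exact ⟨by simp [h'], 0, by simp, by simpa [LStage_zero] using h''⟩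
  · exact ⟨h.trans (lt_add_one _), c.1 + 1, by simpa using h, h'⟩

/-- The comparison of definitions, for definitions coded with lists of parameters. -/
def defnLt (X : Set (ZFSet.{v} × ZFSet.{v})) (d d' : PureFml × List ZFSet.{v}) : Prop :=
  d.2.length < d'.2.length ∨ (d.2.length = d'.2.length ∧ (d.1.2.godel < d'.1.2.godel ∨
    (d.1 = d'.1 ∧ ∃ x ∈ splits d.2, ∃ y ∈ splits d'.2, x.1 = y.1 ∧ (x.2.1, y.2.1) ∈ X)))

theorem exists_splits_iff {n : ℕ} {p q : Fin n → ZFSet.{v}} {lt : ZFSet.{v} → ZFSet.{v} → Prop} :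
    (∃ x ∈ splits (List.ofFn p), ∃ y ∈ splits (List.ofFn q), x.1 = y.1 ∧ lt x.2.1 y.2.1) ↔
      ∃ i, (∀ j < i, p j = q j) ∧ lt (p i) (q i) := by
  have key : ∀ {r : Fin n → ZFSet.{v}} {l₁ a l₂}, List.ofFn r = l₁ ++ a :: l₂ →
      (∀ (j : Fin n) (h : (j : ℕ) < l₁.length), r j = l₁[(j : ℕ)]) ∧ ∃ h : l₁.length < n,
        r ⟨_, h⟩ = a := by
    intro r l₁ a l₂ h
    have hj : ∀ j : Fin n, r j = (l₁ ++ a :: l₂)[(j : ℕ)]'(by rw [← h]; simp) := fun j => by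
      simp [← h]
    have hn : n = l₁.length + (l₂.length + 1) := by simpa using congrArg List.length h
    refine ⟨fun j h => ?_, by omega, ?_⟩
    · rw [hj, List.getElem_append_left]
    · rw [hj]
      simp
  constructor
  · rintro ⟨⟨l₁, a, l₂⟩, h₁, ⟨l₁', b, l₂'⟩, h₂, e, h⟩
    simp only [splits, Set.mem_ofPred_eq] at e h h₁ h₂
    subst e
    obtain ⟨k₁, hl, e₁⟩ := key h₁
    obtain ⟨k₂, _, e₂⟩ := key h₂
    exact ⟨⟨_, hl⟩, fun j hj => (k₁ j hj).trans (k₂ j hj).symm, by rwa [e₁, e₂]⟩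
  · rintro ⟨i, h, h'⟩
    have hs : ∀ r : Fin n → ZFSet.{v}, ((List.ofFn r).take i, r i, (List.ofFn r).drop (i + 1)) ∈
        splits (List.ofFn r) := fun r => by
      have : r i = (List.ofFn r)[(i : ℕ)]'(by simp) := by simp
      simp only [splits, Set.mem_ofPred_eq]
      rw [this, ← List.drop_eq_getElem_cons, List.take_append_drop]
    refine ⟨_, hs p, _, hs q, ?_, h'⟩
    refine List.ext_getElem (by simp) fun j hj _ => ?_
    simp only [List.length_take, List.length_ofFn, lt_inf_iff] at hj
    simpa using h ⟨j, hj.2⟩ hj.1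

theorem DefnLt_iff {lt : ZFSet.{v} → ZFSet.{v} → Prop} {n m : ℕ} {φ : Fml Empty (n + 1)}
    {p : Fin n → ZFSet.{v}} {ψ : Fml Empty (m + 1)} {q : Fin m → ZFSet.{v}} :
    DefnLt lt φ p ψ q ↔ defnLt {x | lt x.1 x.2} (⟨n + 1, φ⟩, List.ofFn p)
      (⟨m + 1, ψ⟩, List.ofFn q) := by
  simp only [defnLt, List.length_ofFn]
  constructor
  · intro h
    cases h with
    | arity _ _ _ _ h => exact .inl h
    | formula _ _ _ _ h => exact .inr ⟨rfl, .inl h⟩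
    | params _ _ _ i h h' => exact .inr ⟨rfl, .inr ⟨rfl, exists_splits_iff.2 ⟨i, h, h'⟩⟩⟩
  · rintro (h | ⟨rfl, h | ⟨h, h'⟩⟩)
    · exact .arity _ _ _ _ h
    · exact .formula _ _ _ _ h
    · simp only [Sigma.mk.injEq, heq_eq_eq, true_and] at h
      subst h
      obtain ⟨i, h, h'⟩ := exists_splits_iff.1 h'
      exact .params _ _ _ i h h'

theorem LLt_zero (e : ℕ → ZFSet.{v}) (a b : ZFSet.{v}) :
    LLt e 0 a b ↔ b ∈ Set.range e ∧ ∃ i, e i = a ∧ ∀ j, e j = b → i < j := by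
  rw [LLt, Ordinal.limitRecOn_zero]

theorem LLt_succ (e : ℕ → ZFSet.{v}) (o : Ordinal.{v}) (a b : ZFSet.{v}) :
    LLt e (o + 1) a b ↔
      (a ∈ LStage (Set.range e) o ∧ b ∈ LStage (Set.range e) o ∧ LLt e o a b) ∨
      (a ∈ LStage (Set.range e) o ∧ b ∈ LStage (Set.range e) (o + 1) \ LStage (Set.range e) o) ∨
      (a ∈ LStage (Set.range e) (o + 1) \ LStage (Set.range e) o ∧
        b ∈ LStage (Set.range e) (o + 1) \ LStage (Set.range e) o ∧
        ∃ d ∈ defns (LStage (Set.range e) o) a, ∀ d' ∈ defns (LStage (Set.range e) o) b,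
          defnLt {x | LLt e o x.1 x.2} d d') := by
  have : ∀ (M : Set ZFSet.{v}) lt, (∃ d ∈ defns M a, ∀ d' ∈ defns M b, defnLt {x | lt x.1 x.2} d
    d') ↔
      ∃ (n : ℕ) (φ : Fml Empty (n + 1)) (p : Fin n → ZFSet.{v}), Defines M φ p a ∧
            ∀ (m : ℕ) (ψ : Fml Empty (m + 1)) (q : Fin m → ZFSet.{v}), Defines M ψ q b →
              DefnLt lt φ p ψ q := by
    intro M lt
    simp only [DefnLt_iff, defns]
    constructor
    · rintro ⟨_, ⟨n, φ, p, rfl, h⟩, h'⟩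
      exact ⟨n, φ, p, h, fun m ψ q h'' => h' _ ⟨m, ψ, q, rfl, h''⟩⟩
    · rintro ⟨n, φ, p, h, h'⟩
      refine ⟨_, ⟨n, φ, p, rfl, h⟩, ?_⟩
      rintro _ ⟨m, ψ, q, rfl, h''⟩
      exact h' m ψ q h''
  rw [this, LLt, Ordinal.limitRecOn_add_one]
  rfl

theorem LLt_limit (e : ℕ → ZFSet.{v}) {o : Ordinal.{v}} (h : Order.IsSuccLimit o)
    (a b : ZFSet.{v}) : LLt e o a b ↔ ∃ o' < o, LLt e o' a b := by
  rw [LLt, Ordinal.limitRecOn_limit _ _ _ _ h]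
  simp [LLt]

@[fun_prop]
theorem PR.defnLt {X : α → Set (ZFSet.{v} × ZFSet.{v})} {f g : α → PureFml × List ZFSet.{v}}
    (hX : PRS.{v} X) (hf : PR.{v} f) (hg : PR.{v} g) :
    PR.{v} fun a => defnLt (X a) (f a) (g a) := by
  obtain ⟨S, hS, hS'⟩ := hX.exists_cset
  have : PR.{v} fun x : CSet.{v} (ZFSet.{v} × ZFSet.{v}) × (PureFml × List ZFSet.{v}) ×
      (PureFml × List ZFSet.{v}) => KPTree.defnLt x.1.toSet x.2.1 x.2.2 := by
    unfold KPTree.defnLt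
    fun_prop
  have := this.comp (hS.prodMk (hf.prodMk hg))
  simpa only [hS'] using this

attribute [fun_prop] PRS.defns

theorem PRS.LLt_aux : PRS.{v} fun x : Enum.{v} × Ordinal.{v} => {y : ZFSet.{v} × ZFSet.{v} |
    LLt x.1 x.2 y.1 y.2} := by
  refine ordinal_rec (s := fun (e : Enum.{v}) o => {y : ZFSet.{v} × ZFSet.{v} | LLt e o y.1 y.2})
    (step := fun e o X => {y |
      y ∈ (KPTree.LStage (Set.range e) o ∪ KPTree.LStage (Set.range e) (o + 1)) ×ˢ
        (KPTree.LStage (Set.range e) o ∪ KPTree.LStage (Set.range e) (o + 1)) ∧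
      ((y.1 ∈ KPTree.LStage (Set.range e) o ∧ y.2 ∈ KPTree.LStage (Set.range e) o ∧ (y.1, y.2) ∈
        X) ∨
      (y.1 ∈ KPTree.LStage (Set.range e) o ∧ (y.2 ∈ KPTree.LStage (Set.range e) (o + 1) ∧
        ¬ y.2 ∈ KPTree.LStage (Set.range e) o)) ∨
      ((y.1 ∈ KPTree.LStage (Set.range e) (o + 1) ∧ ¬ y.1 ∈ KPTree.LStage (Set.range e) o) ∧
        (y.2 ∈ KPTree.LStage (Set.range e) (o + 1) ∧ ¬ y.2 ∈ KPTree.LStage (Set.range e) o) ∧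
        ∃ d ∈ KPTree.defns (KPTree.LStage (Set.range e) o) y.1,
          ∀ d' ∈ KPTree.defns (KPTree.LStage (Set.range e) o) y.2, KPTree.defnLt X d d'))}) ?_ ?_ ?_
            ?_
  · simp only [LLt_zero]
    have : PRS.{v} fun e : Enum.{v} => {y : ZFSet.{v} × ZFSet.{v} |
        y ∈ Set.range e ×ˢ Set.range e ∧ ∃ i ∈ (Set.univ : Set ℕ), e.get i = y.1 ∧
          ∀ j ∈ (Set.univ : Set ℕ), e.get j = y.2 → i < j} := by
      fun_prop
    convert this using 2 with e
    ext ⟨a, b⟩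
    simp only [Set.mem_ofPred_eq, Set.mem_univ, true_and, true_imp_iff, Enum.get, Set.mem_prod]
    constructor
    · rintro ⟨h, i, h', h''⟩
      exact ⟨⟨⟨i, h'⟩, h⟩, i, h', h''⟩
    · rintro ⟨⟨_, h⟩, h'⟩
      exact ⟨h, h'⟩
  · fun_prop
  · intro e o
    ext ⟨a, b⟩
    simp only [Set.mem_ofPred_eq, LLt_succ, Set.mem_prod, Set.mem_union, Set.mem_sdiff]
    tauto
  · intro e o h
    ext y
    simp [LLt_limit _ h]

@[fun_prop]
theorem PR.LLt {f : α → Enum.{v}} {o : α → Ordinal.{v}} {a b : α → ZFSet.{v}} (hf : PR.{v} f)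
    (ho : PR.{v} o) (ha : PR.{v} a) (hb : PR.{v} b) : PR.{v} fun x => LLt (f x) (o x) (a x) (b x) :=
  PR.mem (s := fun x => {y : ZFSet.{v} × ZFSet.{v} | KPTree.LLt (f x) (o x) y.1 y.2})
    (ha.prodMk hb) (PRS.LLt_aux.comp (hf.prodMk ho))

@[fun_prop]
theorem PR.RLt {f : α → Enum.{v}} {o : α → Ordinal.{v}} {a b : α → Ranked.{v}} (hf : PR.{v} f)
    (ho : PR.{v} o) (ha : PR.{v} a) (hb : PR.{v} b) :
    PR.{v} fun x => RLt (f x) (o x) (a x) (b x) := by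
  unfold KPTree.RLt
  fun_prop

end

section

variable {α β γ δ : Type*} [SetCode.{v} α] [SetCode.{v} β] [SetCode.{v} γ] [SetCode.{v} δ]

/-! ### Search trees are primitive recursive -/

theorem PR.nat_sub {f g : α → ℕ} (hf : PR.{v} f) (hg : PR.{v} g) : PR.{v} fun a => f a - g a := by
  have := (of_nat_primrec Nat.Primrec.sub).comp (hf.nat_pair hg)
  simpa using this

theorem PR.nat_half {f : α → ℕ} (hf : PR.{v} f) : PR.{v} fun a => f a / 2 :=
  (of_nat_primrec (Primrec.nat_iff.1 (Primrec.nat_div.comp .id (.const 2)))).comp hf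

theorem PR.nat_parity {f : α → ℕ} (hf : PR.{v} f) : PR.{v} fun a => f a % 2 :=
  (of_nat_primrec (Primrec.nat_iff.1 (Primrec.nat_mod.comp .id (.const 2)))).comp hf

attribute [fun_prop] PR.nat_sub PR.nat_half PR.nat_parity

theorem PR.mark0 : PR.{v} fun _ : α => mark0.{v} := by
  unfold KPTree.mark0
  fun_prop

theorem PR.mark1 : PR.{v} fun _ : α => mark1.{v} := by
  unfold KPTree.mark1
  fun_prop

attribute [fun_prop] PR.mark0 PR.mark1

open Classical in
@[fun_prop]
theorem PR.candidate {f : α → Enum.{v}} {g : α → List Ranked.{v}} {i : α → ℕ} (hf : PR.{v} f)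
    (hg : PR.{v} g) (hi : PR.{v} i) : PR.{v} fun a => candidate (f a) (g a) (i a) := by
  have : PR.{v} fun a => if i a < 2 * (g a).length then
      if i a % 2 = 0 then ((0 : Ordinal.{v}), (f a).get (i a / 2)) else
        (g a).getD (i a / 2) KPTree.mark0
    else ((0 : Ordinal.{v}), (f a).get (i a - (g a).length)) := by fun_prop
  convert this using 2 with a
  unfold KPTree.candidate
  split_ifs with h h'
  · rfl
  · rw [List.getD_eq_getElem]
  · rfl

/-- The pairs of formulas with conjunction `φ`; there is at most one. -/
def andParts (φ : Fml Ranked.{v} 0) : Set (Fml Ranked.{v} 0 × Fml Ranked.{v} 0) :=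
  {p | φ = .and p.1 p.2}

/-- The pairs of formulas with disjunction `φ`; there is at most one. -/
def orParts (φ : Fml Ranked.{v} 0) : Set (Fml Ranked.{v} 0 × Fml Ranked.{v} 0) :=
  {p | φ = .or p.1 p.2}

/-- The formulas `ψ` with `φ = ∀ x ψ`; there is at most one. -/
def allParts (φ : Fml Ranked.{v} 0) : Set (Fml Ranked.{v} 1) := {ψ | φ = .all ψ}

/-- The formulas `ψ` with `φ = ∃ x ψ`; there is at most one. -/
def exParts (φ : Fml Ranked.{v} 0) : Set (Fml Ranked.{v} 1) := {ψ | φ = .ex ψ}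

section Parts

variable {f : α → Fml Ranked.{v} 0} (hf : PR.{v} f)

/-- Inverting a constructor of formulas is primitive recursive, since the tag of the code can be
tested. -/
theorem PRS.of_tag {t : Fml Ranked.{v} 0 → Set β} (k : ℕ) {F : ZFSet.{v} → ZFSet.{v}}
    (hF : PR.{v} F) (ht : ∀ φ z, (∃ b ∈ t φ, code b = z) ↔
      HasTag (zfst (fmlCode φ)) k ∧ z = F (fmlCode φ)) (hf : PR.{v} f) :
    PRS.{v} fun a => t (f a) := by
  classical
  have : PR.{v} fun a => if HasTag (zfst (code (f a))) k then ({F (code (f a))} : ZFSet.{v}) else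
    ∅ := by
    fun_prop
  refine of_PR this fun a z => ?_
  rw [ht, code_fml]
  split_ifs with h <;> simp [h]

include hf in
@[fun_prop]
theorem PRS.andParts : PRS.{v} fun a => andParts (f a) := by
  refine of_tag 4 (F := zsnd) (by fun_prop) (fun φ z => ?_) hf
  cases φ <;> simp [KPTree.andParts, fmlCode, code_fml, eq_comm]

include hf in
@[fun_prop]
theorem PRS.orParts : PRS.{v} fun a => orParts (f a) := by
  refine of_tag 5 (F := zsnd) (by fun_prop) (fun φ z => ?_) hf
  cases φ <;> simp [KPTree.orParts, fmlCode, code_fml, eq_comm]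

include hf in
@[fun_prop]
theorem PRS.allParts : PRS.{v} fun a => allParts (f a) := by
  refine of_tag 6 (F := fun z => zsnd (zsnd z)) (by fun_prop) (fun φ z => ?_) hf
  cases φ <;> simp [KPTree.allParts, fmlCode, code_fml, eq_comm]

include hf in
@[fun_prop]
theorem PRS.exParts : PRS.{v} fun a => exParts (f a) := by
  refine of_tag 7 (F := fun z => zsnd (zsnd z)) (by fun_prop) (fun φ z => ?_) hf
  cases φ <;> simp [KPTree.exParts, fmlCode, code_fml, eq_comm]

end Parts

/-- The children that the formula `x.2.1` gives rise to at the node `σ` with label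
`x.1 ++ x.2.1 :: x.2.2`, with their labels. -/
def expand (e : Enum.{v}) (α : Ordinal.{v}) (σ : List Ranked.{v})
    (x : Sequent.{v} × Fml Ranked.{v} 0 × Sequent.{v}) : Set (Ranked.{v} × Sequent.{v}) :=
  {y | ∃ p ∈ andParts x.2.1, y ∈ ({(mark0, x.1 ++ x.2.2 ++ [x.2.1, p.1])} ∪
    {(mark1, x.1 ++ x.2.2 ++ [x.2.1, p.2])} : Set (Ranked.{v} × Sequent.{v}))} ∪
  {y | ∃ p ∈ orParts x.2.1, y = (mark0, x.1 ++ x.2.2 ++ [x.2.1,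
    open Classical in if p.1 ∈ x.1 ++ x.2.1 :: x.2.2 then p.2 else p.1])} ∪
  {y | ∃ p ∈ allParts x.2.1, y ∈ {y | ∃ a ∈ RStage (Set.range e) α,
    y = (a, x.1 ++ x.2.2 ++ [x.2.1, p.inst a])}} ∪
  {y | ∃ p ∈ exParts x.2.1, y ∈ {y | ∃ i ∈ {i | i ∈ (Set.univ : Set ℕ) ∧
      ¬ p.inst (candidate e σ i) ∈ x.1 ++ x.2.1 :: x.2.2 ∧
      ∀ j ∈ Set.Iio i, p.inst (candidate e σ j) ∈ x.1 ++ x.2.1 :: x.2.2},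
    y = (mark0, x.1 ++ x.2.2 ++ [x.2.1, p.inst (candidate e σ i)])}} ∪
  {y | ∃ p ∈ {p | p ∈ exParts x.2.1 ∧ ∀ j ∈ (Set.univ : Set ℕ),
      p.inst (candidate e σ j) ∈ x.1 ++ x.2.1 :: x.2.2},
    y = (mark0, x.1 ++ x.2.2 ++ [x.2.1])}

open Classical in
/-- The children of the node `σ` with label `Γ`, with their labels. -/
def children (e : Enum.{v}) (θ : ℕ → Fml Empty 0) (α : Ordinal.{v}) (σ : List Ranked.{v})
    (Γ : Sequent.{v}) : Set (Ranked.{v} × Sequent.{v}) :=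
  {y | ∃ k ∈ {k | k ∈ (Set.univ : Set ℕ) ∧ σ.length = 2 * k},
    y = (mark0, Γ ++ [(θ k).ofPure.neg])} ∪
  if σ.length % 2 = 1 ∧ ¬ HasTrueDelta0 Γ then
    (if ∀ χ ∈ {χ | χ ∈ Γ}, χ.IsLiteral then {(mark0, Γ)} else ∅) ∪
    {y | ∃ x ∈ {x | x ∈ splits Γ ∧ ∀ χ ∈ {χ | χ ∈ x.1}, χ.IsLiteral}, y ∈ expand e α σ x}
  else ∅

theorem searchTree_append_iff {e : Enum.{v}} {θ : ℕ → Fml Empty 0} {α : Ordinal.{v}}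
    {σ : List Ranked.{v}} {a : Ranked.{v}} {Δ : Sequent.{v}} :
    SearchTree e θ α (σ ++ [a]) Δ ↔ ∃ Γ, SearchTree e θ α σ Γ ∧ (a, Δ) ∈ children e θ α σ Γ := by
  have hs : ∀ {Γ : Sequent.{v}} {Γ₁ Γ₂ : Sequent.{v}} {φ : Fml Ranked.{v} 0},
      Γ = Γ₁ ++ φ :: Γ₂ → Odd σ.length → ¬ HasTrueDelta0 Γ → (∀ χ ∈ Γ₁, χ.IsLiteral) →
        (a, Δ) ∈ expand e α σ (Γ₁, φ, Γ₂) → (a, Δ) ∈ children e θ α σ Γ := by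
    rintro _ Γ₁ Γ₂ φ rfl ho h hl he
    refine .inr ?_
    rw [if_pos ⟨Nat.odd_iff.1 ho, h⟩]
    exact .inr ⟨(Γ₁, φ, Γ₂), ⟨rfl, hl⟩, he⟩
  constructor
  · generalize hτ : σ ++ [a] = τ
    intro h
    cases h with
    | root => simp at hτ
    | axm k h hk =>
      obtain ⟨rfl, ⟨⟩⟩ := List.append_inj' hτ rfl
      exact ⟨_, h, .inl ⟨k, ⟨trivial, hk⟩, by rw [neg_ofPure]⟩⟩
    | stall h ho hn hl =>
      obtain ⟨rfl, ⟨⟩⟩ := List.append_inj' hτ rfl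
      refine ⟨_, h, .inr ?_⟩
      rw [if_pos ⟨Nat.odd_iff.1 ho, hn⟩]
      left
      rw [if_pos (by exact hl)]
      rfl
    | conjLeft h ho hn hl =>
      obtain ⟨rfl, ⟨⟩⟩ := List.append_inj' hτ rfl
      exact ⟨_, h, hs rfl ho hn hl (.inl (.inl (.inl (.inl ⟨(_, _), rfl, .inl rfl⟩))))⟩
    | conjRight h ho hn hl =>
      obtain ⟨rfl, ⟨⟩⟩ := List.append_inj' hτ rfl
      exact ⟨_, h, hs rfl ho hn hl (.inl (.inl (.inl (.inl ⟨(_, _), rfl, .inr rfl⟩))))⟩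
    | disjLeft h ho hn hl hm =>
      obtain ⟨rfl, ⟨⟩⟩ := List.append_inj' hτ rfl
      exact ⟨_, h, hs rfl ho hn hl (.inl (.inl (.inl (.inr ⟨(_, _), rfl, by rw [if_neg hm]⟩))))⟩
    | disjRight h ho hn hl hm =>
      obtain ⟨rfl, ⟨⟩⟩ := List.append_inj' hτ rfl
      exact ⟨_, h, hs rfl ho hn hl (.inl (.inl (.inl (.inr ⟨(_, _), rfl, by rw [if_pos hm]⟩))))⟩
    | all a h ho hn hl ha =>
      obtain ⟨rfl, ⟨⟩⟩ := List.append_inj' hτ rfl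
      exact ⟨_, h, hs rfl ho hn hl (.inl (.inl (.inr ⟨_, rfl, _, ha, rfl⟩)))⟩
    | ex i h ho hn hl hi hj =>
      obtain ⟨rfl, ⟨⟩⟩ := List.append_inj' hτ rfl
      exact ⟨_, h, hs rfl ho hn hl (.inl (.inr ⟨_, rfl, i, ⟨trivial, hi, hj⟩, rfl⟩))⟩
    | exDone h ho hn hl hj =>
      obtain ⟨rfl, ⟨⟩⟩ := List.append_inj' hτ rfl
      exact ⟨_, h, hs rfl ho hn hl (.inr ⟨_, ⟨rfl, fun j _ => hj j⟩, rfl⟩)⟩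
  · rintro ⟨Γ, h, ⟨k, ⟨-, hk⟩, ⟨⟩⟩ | hc⟩
    · rw [← neg_ofPure]
      exact .axm k h hk
    · by_cases hi : σ.length % 2 = 1 ∧ ¬ HasTrueDelta0 Γ
      on_goal 2 =>
        rw [if_neg hi] at hc
        exact hc.elim
      rw [if_pos hi] at hc
      obtain ⟨ho, hn⟩ := hi
      rw [← Nat.odd_iff] at ho
      rcases hc with hc | ⟨⟨Γ₁, φ, Γ₂⟩, ⟨h₁, hl⟩, he⟩
      · by_cases hl : ∀ χ ∈ Γ, χ.IsLiteral
        · rw [if_pos (by exact hl)] at hc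
          cases hc
          exact .stall h ho hn hl
        · rw [if_neg (by exact hl)] at hc
          exact hc.elim
      · simp only [splits, Set.mem_ofPred_eq] at h₁ hl
        subst h₁
        rcases he with (((⟨⟨ψ₀, ψ₁⟩, h', ⟨⟨⟩⟩ | ⟨⟨⟩⟩⟩ | ⟨⟨ψ₀, ψ₁⟩, h', ⟨⟩⟩) | ⟨ψ, h', b, hb, ⟨⟩⟩) |
          ⟨ψ, h', i, ⟨-, hi, hj⟩, ⟨⟩⟩) | ⟨ψ, ⟨h', hj⟩, ⟨⟩⟩ <;>
          simp only [andParts, orParts, allParts, exParts, Set.mem_ofPred_eq] at h' <;> subst h'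
        · exact .conjLeft h ho hn hl
        · exact .conjRight h ho hn hl
        · dsimp only
          split_ifs with hm
          · exact .disjRight h ho hn hl hm
          · exact .disjLeft h ho hn hl hm
        · exact .all _ h ho hn hl hb
        · exact .ex i h ho hn hl hi hj
        · exact .exDone h ho hn hl fun j => hj j trivial

theorem searchTree_nil_iff {e : Enum.{v}} {θ : ℕ → Fml Empty 0} {α : Ordinal.{v}}
    {Γ : Sequent.{v}} : SearchTree e θ α [] Γ ↔ Γ = [] := by
  constructor
  · generalize hτ : ([] : List Ranked.{v}) = τ
    intro h
    cases h <;> simp at hτ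
    rfl
  · rintro rfl
    exact .root

@[fun_prop]
theorem PRS.expand {f : α → Enum.{v}} {o : α → Ordinal.{v}} {σ : α → List Ranked.{v}}
    {x : α → Sequent.{v} × Fml Ranked.{v} 0 × Sequent.{v}} (hf : PR.{v} f) (ho : PR.{v} o)
    (hσ : PR.{v} σ) (hx : PR.{v} x) : PRS.{v} fun a => expand (f a) (o a) (σ a) (x a) := by
  have : PRS.{v} fun y : Enum.{v} × Ordinal.{v} × List Ranked.{v} × Sequent.{v} ×
      Fml Ranked.{v} 0 × Sequent.{v} => KPTree.expand y.1 y.2.1 y.2.2.1 y.2.2.2 := by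
    unfold KPTree.expand
    fun_prop
  have := this.comp (hf.prodMk (ho.prodMk (hσ.prodMk hx)))
  exact this

theorem PRS.children {θ : ℕ → Fml Empty 0} (hθ : Nat.Primrec fun k => (θ k).godel) :
    PRS.{v} fun y : Enum.{v} × Ordinal.{v} × List Ranked.{v} × Sequent.{v} =>
      children y.1 θ y.2.1 y.2.2.1 y.2.2.2 := by
  have h (α) [SetCode.{v} α] {f : α → ℕ} (hf : PR.{v} f) :
      PR.{v} fun a => ((θ (f a)).ofPure : Fml Ranked.{v} 0) :=
    (PR.of_godel hθ).comp hf
  unfold KPTree.children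
  fun_prop

/-- The nodes of length `n`, with their labels. -/
def treeLevel (e : Enum.{v}) (θ : ℕ → Fml Empty 0) (α : Ordinal.{v}) (n : ℕ) :
    Set (List Ranked.{v} × Sequent.{v}) := {x | x.1.length = n ∧ SearchTree e θ α x.1 x.2}

theorem PRS.searchTree {θ : ℕ → Fml Empty 0} (hθ : Nat.Primrec fun k => (θ k).godel) :
    PRS.{v} fun y : Enum.{v} × Ordinal.{v} =>
      {x : List Ranked.{v} × Sequent.{v} | SearchTree y.1 θ y.2 x.1 x.2} := by
  have hc {α} [SetCode.{v} α] {f : α → Enum.{v}} {o : α → Ordinal.{v}} {σ : α → List Ranked.{v}}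
    {Γ : α → Sequent.{v}} (hf : PR.{v} f) (ho : PR.{v} o)
    (hσ : PR.{v} σ) (hΓ : PR.{v} Γ) : PRS.{v} fun a => KPTree.children (f a) θ (o a) (σ a) (Γ a) :=
    (PRS.children hθ).comp (hf.prodMk (ho.prodMk (hσ.prodMk hΓ)))
  have h : PRS.{v} fun y : (Enum.{v} × Ordinal.{v}) × ℕ => treeLevel y.1.1 θ y.1.2 y.2 := by
    refine nat_rec (s := fun (c : Enum.{v} × Ordinal.{v}) n => treeLevel c.1 θ c.2 n)
      (step := fun c n X => {y | ∃ x ∈ X, y ∈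
        {y | ∃ z ∈ KPTree.children c.1 θ c.2 x.1 x.2, y = (x.1 ++ [z.1], z.2)}}) ?_ ?_ ?_
    · convert PRS.singleton (f := fun c : Enum.{v} × Ordinal.{v} =>
        (([] : List Ranked.{v}), ([] : Sequent.{v}))) (by fun_prop) using 2 with c
      ext ⟨σ, Γ⟩
      simp only [treeLevel, Set.mem_ofPred_eq, List.length_eq_zero_iff, Set.mem_singleton_iff,
        Prod.mk.injEq]
      exact and_congr_right fun h => by rw [h, searchTree_nil_iff]
    · fun_prop
    · rintro ⟨e, o⟩ n
      ext ⟨σ, Γ⟩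
      simp only [treeLevel, Set.mem_ofPred_eq]
      constructor
      · rintro ⟨hl, h⟩
        obtain rfl | ⟨σ, a, rfl⟩ := List.eq_nil_or_concat' σ
        · simp at hl
        obtain ⟨Δ, h, h'⟩ := searchTree_append_iff.1 h
        exact ⟨(σ, Δ), ⟨by simpa using hl, h⟩, _, h', rfl⟩
      · rintro ⟨⟨σ, Δ⟩, ⟨hl, h⟩, ⟨a, Γ⟩, h', ⟨⟩⟩
        exact ⟨by simpa using hl, searchTree_append_iff.2 ⟨_, h, h'⟩⟩
  have := PRS.iUnion_nat (s := fun n (y : Enum.{v} × Ordinal.{v}) => treeLevel y.1 θ y.2 n)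
    (h.comp (by fun_prop : PR.{v} fun x : ℕ × Enum.{v} × Ordinal.{v} => (x.2, x.1)))
  simpa [treeLevel] using this

theorem PRS.nodes {θ : ℕ → Fml Empty 0} (hθ : Nat.Primrec fun k => (θ k).godel)
    {f : α → Enum.{v}} {o : α → Ordinal.{v}} (hf : PR.{v} f) (ho : PR.{v} o) :
    PRS.{v} fun a => nodes (f a) θ (o a) := by
  have h := (PRS.searchTree hθ).comp (hf.prodMk ho)
  have : PRS.{v} fun a => {σ | ∃ x ∈ {x : List Ranked.{v} × Sequent.{v} |
      SearchTree (f a) θ (o a) x.1 x.2}, σ = x.1} := PRS.image h (by fun_prop)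
  convert this using 2 with a
  ext σ
  simp [KPTree.nodes]

theorem PR.KBLt {θ : ℕ → Fml Empty 0} (hθ : Nat.Primrec fun k => (θ k).godel)
    {f : α → Enum.{v}} {o : α → Ordinal.{v}} {σ τ : α → List Ranked.{v}} (hf : PR.{v} f)
    (ho : PR.{v} o) (hσ : PR.{v} σ) (hτ : PR.{v} τ) :
    PR.{v} fun a => KBLt (f a) θ (o a) (σ a) (τ a) := by
  have h := PRS.nodes hθ hf ho
  have : PR.{v} fun a => σ a ∈ KPTree.nodes (f a) θ (o a) ∧ τ a ∈ KPTree.nodes (f a) θ (o a) ∧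
      ((τ a <+: σ a ∧ ¬ σ a = τ a) ∨ ∃ x ∈ splits (σ a), ∃ y ∈ splits (τ a),
        x.1 = y.1 ∧ KPTree.RLt (f a) (o a) x.2.1 y.2.1) := by fun_prop
  convert this using 2 with a
  refine and_congr_right fun _ => and_congr_right fun _ => or_congr ?_ ?_
  · constructor
    · rintro ⟨a, ρ, h⟩
      rw [h]
      simp
    · rintro ⟨⟨ρ, h⟩, h'⟩
      rcases ρ with _ | ⟨a, ρ⟩
      · simp [← h] at h'
      · exact ⟨a, ρ, h.symm⟩
  · constructor
    · rintro ⟨σ₀, a, b, σ', τ', h, h', hr⟩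
      exact ⟨(σ₀, a, σ'), h, (σ₀, b, τ'), h', rfl, hr⟩
    · rintro ⟨⟨σ₀, a, σ'⟩, h, ⟨_, b, τ'⟩, h', rfl, hr⟩
      exact ⟨σ₀, a, b, σ', τ', h, h', hr⟩

end

section

variable {α β γ δ : Type*} [SetCode.{v} α] [SetCode.{v} β] [SetCode.{v} γ] [SetCode.{v} δ]

/-! ### The term systems are primitive recursive -/

mutual

theorem Term.code_inj : ∀ s t : Term.{v}, s.code = t.code → s = t
  | .zero, .zero, _ => rfl
  | .eps σ, .eps τ, h => by
    simp only [Term.code, ZFSet.pair_inj, true_and] at h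
    rw [(code_injective h : σ = τ)]
  | .sum l, .sum l', h => by
    simp only [Term.code, ZFSet.pair_inj, true_and] at h
    rw [Term.codes_inj l l' h]
  | .zero, .eps _, h => by
    simp only [Term.code, ZFSet.pair_inj, Ordinal.toZFSet_injective.eq_iff] at h
    simp at h
  | .zero, .sum _, h => by
    simp only [Term.code, ZFSet.pair_inj, Ordinal.toZFSet_injective.eq_iff] at h
    simp at h
  | .eps _, .zero, h => by
    simp only [Term.code, ZFSet.pair_inj, Ordinal.toZFSet_injective.eq_iff] at h
    simp at h
  | .eps _, .sum _, h => by
    simp only [Term.code, ZFSet.pair_inj, Ordinal.toZFSet_injective.eq_iff] at h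
    simp at h
  | .sum _, .zero, h => by
    simp only [Term.code, ZFSet.pair_inj, Ordinal.toZFSet_injective.eq_iff] at h
    simp at h
  | .sum _, .eps _, h => by
    simp only [Term.code, ZFSet.pair_inj, Ordinal.toZFSet_injective.eq_iff] at h
    simp at h

theorem Term.codes_inj : ∀ l l' : List (Term.{v} × Ordinal.{v}), Term.codes l = Term.codes l' →
    l = l'
  | [], [], _ => rfl
  | (s, β) :: l, (t, γ) :: l', h => by
    simp only [Term.codes, ZFSet.pair_inj] at h
    rw [Term.code_inj s t h.1.1, Ordinal.toZFSet_injective h.1.2, Term.codes_inj l l' h.2]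
  | [], (_, _) :: _, h => by
    simp only [Term.codes] at h
    exact (pair_ne_empty _ _ h.symm).elim
  | (_, _) :: _, [], h => by
    simp only [Term.codes] at h
    exact (pair_ne_empty _ _ h).elim

end

instance : SetCode.{v} Term.{v} := ⟨Term.code, fun s t => Term.code_inj s t⟩

theorem code_term (t : Term.{v}) : code.{v} t = t.code := rfl

theorem codes_eq (l : List (Term.{v} × Ordinal.{v})) : Term.codes l = code.{v} l := by
  induction l with
  | nil => rfl
  | cons x l ih => rw [Term.codes, ih]; rfl

theorem code_term_zero : code.{v} Term.zero = ZFSet.pair (code 0) ∅ := by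
  rw [code_term, Term.code, code_nat, Nat.cast_zero]

theorem code_term_eps (σ : List Ranked.{v}) :
    code.{v} (Term.eps σ) = ZFSet.pair (code 1) (code σ) := by
  rw [code_term, Term.code, code_nat, Nat.cast_one]
  rfl

theorem code_term_sum (l : List (Term.{v} × Ordinal.{v})) :
    code.{v} (Term.sum l) = ZFSet.pair (code 2) (code l) := by
  rw [code_term, Term.code, code_nat, codes_eq, Nat.cast_ofNat]

@[fun_prop]
theorem PR.term_eps {f : α → List Ranked.{v}} (hf : PR.{v} f) : PR.{v} fun a => Term.eps (f a) := by
  refine of_code ?_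
  simp only [code_term_eps]
  fun_prop

@[fun_prop]
theorem PR.term_sum {f : α → List (Term.{v} × Ordinal.{v})} (hf : PR.{v} f) :
    PR.{v} fun a => Term.sum (f a) := by
  refine of_code ?_
  simp only [code_term_sum]
  fun_prop

/-- The nodes `σ` with `t = ε_σ`; there is at most one. -/
def epsParts (t : Term.{v}) : Set (List Ranked.{v}) := {σ | t = .eps σ}

/-- The sequences of summands of which `t` is the formal sum; there is at most one. -/
def sumParts (t : Term.{v}) : Set (List (Term.{v} × Ordinal.{v})) := {l | t = .sum l}

open Classical in
@[fun_prop]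
theorem PRS.epsParts {f : α → Term.{v}} (hf : PR.{v} f) : PRS.{v} fun a => epsParts (f a) := by
  have : PR.{v} fun a => if HasTag (zfst (code (f a))) 1 then ({zsnd (code (f a))} : ZFSet.{v})
    else ∅ := by fun_prop
  refine of_PR this fun a z => ?_
  cases f a <;> simp [KPTree.epsParts, code_term_zero, code_term_eps, code_term_sum, eq_comm]

open Classical in
@[fun_prop]
theorem PRS.sumParts {f : α → Term.{v}} (hf : PR.{v} f) : PRS.{v} fun a => sumParts (f a) := by
  have : PR.{v} fun a => if HasTag (zfst (code (f a))) 2 then ({zsnd (code (f a))} : ZFSet.{v})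
    else ∅ := by fun_prop
  refine of_PR this fun a z => ?_
  cases f a <;> simp [KPTree.sumParts, code_term_zero, code_term_eps, code_term_sum, eq_comm]

/-- Preliminary terms of depth at most `k`, with indices from `S` and coefficients below `δ`. -/
def preStage (S : Set (List Ranked.{v})) (δ : Ordinal.{v}) : ℕ → Set Term.{v}
  | 0 => ∅
  | k + 1 => {.zero} ∪ ({t | ∃ σ ∈ S, t = .eps σ} ∪
      {t | ∃ l ∈ listsOver (preStage S δ k ×ˢ Set.Iio δ), t = .sum l})

/-- Preliminary terms with indices from `S` and coefficients below `δ`. -/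
def preTerms (S : Set (List Ranked.{v})) (δ : Ordinal.{v}) : Set Term.{v} :=
  {t | ∃ k, t ∈ preStage S δ k}

/-- The clauses for the order of terms, where `X` is the order of the proper subterms. -/
def ltStep (lt : List Ranked.{v} → List Ranked.{v} → Prop) (X : Set (Term.{v} × Term.{v}))
    (s t : Term.{v}) : Prop :=
  (s = .zero ∧ ¬ t = .zero) ∨
  (∃ σ ∈ epsParts s, ∃ τ ∈ epsParts t, lt σ τ) ∨
  (∃ σ ∈ epsParts s, ∃ l ∈ sumParts t, ∃ x ∈ splits l,
    x.1 = [] ∧ ((s, x.2.1.1) ∈ X ∨ s = x.2.1.1)) ∨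
  (∃ l ∈ sumParts s, ∃ τ ∈ epsParts t, ∃ x ∈ splits l, x.1 = [] ∧ (x.2.1.1, t) ∈ X) ∨
  (∃ l ∈ sumParts s, ∃ l' ∈ sumParts t, (l <+: l' ∧ ¬ l = l') ∨
    ∃ x ∈ splits l, ∃ y ∈ splits l', x.1 = y.1 ∧
      ((x.2.1.1, y.2.1.1) ∈ X ∨ (x.2.1.1 = y.2.1.1 ∧ x.2.1.2 < y.2.1.2)))

theorem termLt_of_ltStep {lt : List Ranked.{v} → List Ranked.{v} → Prop}
    {X : Set (Term.{v} × Term.{v})}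
    (hX : ∀ s t, (s, t) ∈ X → TermLt lt s t) {s t : Term.{v}} (h : ltStep lt X s t) :
    TermLt lt s t := by
  rcases h with ⟨rfl, h⟩ | ⟨σ, rfl, τ, rfl, h⟩ | ⟨σ, rfl, _, rfl, ⟨_, ⟨s, β⟩, l⟩, rfl, rfl, h | h⟩ |
    ⟨_, rfl, τ, rfl, ⟨_, ⟨s, β⟩, l⟩, rfl, rfl, h⟩ | ⟨l, rfl, l', rfl, ⟨⟨l', rfl⟩, h⟩ |
    ⟨⟨l₀, ⟨s, β⟩, l₁⟩, rfl, ⟨_, ⟨t, γ⟩, l₂⟩, rfl, rfl, h | h⟩⟩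
  · exact .zero h
  · exact .eps_eps h
  · exact .eps_sum_lt (hX _ _ h)
  · simp only at h
    subst h
    exact .eps_sum_eq
  · exact .sum_eps (hX _ _ h)
  · exact .sum_prefix fun h' => h (by simp [h'])
  · exact .sum_exponent (hX _ _ h)
  · obtain ⟨h, h'⟩ := h
    simp only at h h'
    subst h
    exact .sum_coefficient h'

/-- Stages in the generation of the order of terms. -/
def ltStage (S : Set (List Ranked.{v})) (lt : List Ranked.{v} → List Ranked.{v} → Prop)
    (δ : Ordinal.{v}) : ℕ → Set (Term.{v} × Term.{v})
  | 0 => ∅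
  | k + 1 => {x | x ∈ preTerms S δ ×ˢ preTerms S δ ∧ ltStep lt (ltStage S lt δ k) x.1 x.2}

theorem preTerms_of_sum {S : Set (List Ranked.{v})} {δ : Ordinal.{v}}
    {l : List (Term.{v} × Ordinal.{v})} (h : .sum l ∈ preTerms S δ) {x : Term.{v} × Ordinal.{v}}
    (hx : x ∈ l) : x.1 ∈ preTerms S δ := by
  obtain ⟨k, h⟩ := h
  cases k with
  | zero => exact h.elim
  | succ k =>
    rcases h with h | ⟨σ, -, h⟩ | ⟨l, hl, ⟨⟩⟩
    · cases h
    · cases h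
    · exact ⟨k, (hl x hx).1⟩

theorem exists_ltStage_iff {S : Set (List Ranked.{v})}
    {lt : List Ranked.{v} → List Ranked.{v} → Prop} {δ : Ordinal.{v}} {s t : Term.{v}}
    (hs : s ∈ preTerms S δ) (ht : t ∈ preTerms S δ) :
    (∃ k, (s, t) ∈ ltStage S lt δ k) ↔ TermLt lt s t := by
  constructor
  · rintro ⟨k, h⟩
    clear hs ht
    induction k generalizing s t with
    | zero => exact h.elim
    | succ k ih => exact termLt_of_ltStep (fun s t => ih) h.2
  · intro h
    induction h with
    | zero h => exact ⟨1, ⟨hs, ht⟩, .inl ⟨rfl, h⟩⟩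
    | eps_eps h => exact ⟨1, ⟨hs, ht⟩, .inr (.inl ⟨_, rfl, _, rfl, h⟩)⟩
    | @eps_sum_lt σ t₀ γ l _ ih =>
      obtain ⟨k, h⟩ := ih hs (preTerms_of_sum (x := (t₀, γ)) ht (by simp))
      exact ⟨k + 1, ⟨hs, ht⟩, .inr (.inr (.inl ⟨_, rfl, _, rfl, ([], _, _), rfl, rfl, .inl h⟩))⟩
    | eps_sum_eq =>
      exact ⟨1, ⟨hs, ht⟩, .inr (.inr (.inl ⟨_, rfl, _, rfl, ([], _, _), rfl, rfl, .inr rfl⟩))⟩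
    | @sum_eps s₀ β l τ _ ih =>
      obtain ⟨k, h⟩ := ih (preTerms_of_sum (x := (s₀, β)) hs (by simp)) ht
      exact ⟨k + 1, ⟨hs, ht⟩, .inr (.inr (.inr (.inl ⟨_, rfl, _, rfl, ([], _, _), rfl, rfl, h⟩)))⟩
    | sum_prefix h =>
      exact ⟨1, ⟨hs, ht⟩, .inr
        (.inr (.inr (.inr ⟨_, rfl, _, rfl, .inl ⟨⟨_, rfl⟩, by simpa using h⟩⟩)))⟩
    | @sum_exponent l l₁ l₂ s t β γ _ ih =>
      obtain ⟨k, h⟩ := ih (preTerms_of_sum (x := (s, β)) hs (by simp))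
        (preTerms_of_sum (x := (t, γ)) ht (by simp))
      exact ⟨k + 1, ⟨hs, ht⟩, .inr (.inr (.inr (.inr ⟨_, rfl, _, rfl, .inr ⟨(l, _, _), rfl,
        (l, _, _), rfl, rfl, .inl h⟩⟩)))⟩
    | @sum_coefficient l l₁ l₂ s β γ h =>
      exact ⟨1, ⟨hs, ht⟩, .inr (.inr (.inr (.inr ⟨_, rfl, _, rfl, .inr ⟨(l, _, _), rfl,
        (l, _, _), rfl, rfl, .inr ⟨rfl, h⟩⟩⟩)))⟩

/-- Stages in the generation of the terms. -/
def termStage (S : Set (List Ranked.{v})) (lt : List Ranked.{v} → List Ranked.{v} → Prop)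
    (δ : Ordinal.{v}) : ℕ → Set Term.{v}
  | 0 => ∅
  | k + 1 => {.zero} ∪ ({t | ∃ σ ∈ S, t = .eps σ} ∪ {t | ∃ l ∈ {l |
      l ∈ listsOver (termStage S lt δ k ×ˢ Set.Iio δ) ∧ ¬ l = [] ∧ (∀ x ∈ {x | x ∈ l}, 0 < x.2) ∧
        (∀ x ∈ {x | x ∈ l}, ∀ σ ∈ epsParts x.1, ¬ l = [(.eps σ, 1)]) ∧
        l.IsChain fun x y => TermLt lt y.1 x.1}, t = .sum l})

theorem exists_termStage_iff {S : Set (List Ranked.{v})}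
    {lt : List Ranked.{v} → List Ranked.{v} → Prop} {δ : Ordinal.{v}} {t : Term.{v}} :
    (∃ k, t ∈ termStage S lt δ k) ↔ IsTerm S lt δ t := by
  constructor
  · rintro ⟨k, h⟩
    induction k generalizing t with
    | zero => exact h.elim
    | succ k ih =>
      rcases h with rfl | ⟨σ, hσ, rfl⟩ | ⟨l, ⟨h₁, h₂, h₃, h₄, h₅⟩, rfl⟩
      · exact .zero
      · exact .eps hσ
      · refine .sum h₂ (fun s β h => ih (h₁ _ h).1) (fun s β h => ⟨h₃ _ h, (h₁ _ h).2⟩) ?_ h₅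
        rintro σ rfl
        exact h₄ (.eps σ, 1) (by simp) σ rfl rfl
  · suffices IsTerm S lt δ t → ∃ k, ∀ m ≥ k, t ∈ termStage S lt δ m from fun h =>
      let ⟨k, hk⟩ := this h
      ⟨k, hk k le_rfl⟩
    intro h
    induction h with
    | zero =>
      refine ⟨1, fun m hm => ?_⟩
      obtain ⟨m, rfl⟩ := Nat.exists_eq_add_of_le' hm
      exact .inl rfl
    | eps h =>
      refine ⟨1, fun m hm => ?_⟩
      obtain ⟨m, rfl⟩ := Nat.exists_eq_add_of_le' hm
      exact .inr (.inl ⟨_, h, rfl⟩)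
    | @sum l h₁ h₂ h₃ h₄ h₅ ih =>
      have : ∃ k, ∀ m ≥ k, ∀ x ∈ l, x.1 ∈ termStage S lt δ m := by
        clear h₁ h₂ h₃ h₄ h₅
        induction l with
        | nil => exact ⟨0, by simp⟩
        | cons x l ih' =>
          obtain ⟨k, hk⟩ := ih' fun s β h => ih s β (by simp [h])
          obtain ⟨k', hk'⟩ := ih x.1 x.2 (by simp)
          refine ⟨k + k', fun m hm y hy => ?_⟩
          rcases List.mem_cons.1 hy with rfl | hy
          · exact hk' m (by omega)
          · exact hk m (by omega) y hy
      obtain ⟨k, hk⟩ := this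
      refine ⟨k + 1, fun m hm => ?_⟩
      obtain ⟨m, rfl⟩ := Nat.exists_eq_add_of_le' (show 1 ≤ m by omega)
      exact .inr (.inr ⟨l, ⟨fun x hx => ⟨hk m (by omega) x hx, (h₃ x.1 x.2 hx).2⟩, h₁,
        fun x hx => (h₃ x.1 x.2 hx).1, fun _ _ _ _ => h₄ _, h₅⟩, rfl⟩)

theorem termStage_subset {S : Set (List Ranked.{v})}
    {lt : List Ranked.{v} → List Ranked.{v} → Prop} {δ : Ordinal.{v}} (k : ℕ) {t : Term.{v}}
    (h : t ∈ termStage S lt δ k) : t ∈ preStage S δ k := by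
  induction k generalizing t with
  | zero => exact h
  | succ k ih =>
    rcases h with rfl | ⟨σ, hσ, rfl⟩ | ⟨l, ⟨h₁, -⟩, rfl⟩
    · exact .inl rfl
    · exact .inr (.inl ⟨σ, hσ, rfl⟩)
    · exact .inr (.inr ⟨l, fun x hx => ⟨ih (h₁ x hx).1, (h₁ x hx).2⟩, rfl⟩)

/-- The indices of the terms `ε_σ` in the term system for `c = (e, α)`. -/
def index (θ : ℕ → Fml Empty 0) (c : Enum.{v} × Ordinal.{v}) : Set (List Ranked.{v}) :=
  nodes c.1 θ (Ordinal.omega0 ^ c.2)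

/-- The order of the indices. -/
def indexLt (θ : ℕ → Fml Empty 0) (c : Enum.{v} × Ordinal.{v}) (σ τ : List Ranked.{v}) : Prop :=
  KBLt c.1 θ (Ordinal.omega0 ^ c.2) σ τ

variable {θ : ℕ → Fml Empty 0} (hθ : Nat.Primrec fun k => (θ k).godel)

include hθ

theorem PRS.index : PRS.{v} fun c : Enum.{v} × Ordinal.{v} => index θ c :=
  PRS.nodes hθ (by fun_prop) (by fun_prop)

theorem PR.indexLt : PR.{v} fun x : (Enum.{v} × Ordinal.{v}) × List Ranked.{v} × List Ranked.{v} =>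
    indexLt θ x.1 x.2.1 x.2.2 :=
  PR.KBLt hθ (by fun_prop) (by fun_prop) (by fun_prop) (by fun_prop)

theorem PRS.preTerms : PRS.{v} fun (c : Enum.{v} × Ordinal.{v}) => preTerms (KPTree.index θ c)
    (Ordinal.omega0 ^ c.2) := by
  have h : PRS.{v} fun x : (Enum.{v} × Ordinal.{v}) × ℕ => preStage (KPTree.index θ x.1)
    (Ordinal.omega0 ^ x.1.2) x.2 := by
    refine nat_rec (s := fun (c : Enum.{v} × Ordinal.{v}) k => preStage (KPTree.index θ c)
      (Ordinal.omega0 ^ c.2) k) (step := fun (c : Enum.{v} × Ordinal.{v}) k X =>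
      {.zero} ∪ ({t | ∃ σ ∈ KPTree.index θ c, t = .eps σ} ∪
      {t | ∃ l ∈ KPTree.listsOver (X ×ˢ Set.Iio (Ordinal.omega0 ^ c.2)), t = .sum l})) ?_ ?_ fun _
        _ => by
        rw [preStage]
    · exact PRS.empty
    · have hS' {α : Type (v + 1)} [SetCode.{v} α] {f : α → Enum.{v} × Ordinal.{v}} (hf : PR.{v} f) :
      PRS.{v} fun a => KPTree.index θ (f a) :=
        (PRS.index hθ).comp hf
      fun_prop
  exact PRS.iUnion_nat (s := fun k (c : Enum.{v} × Ordinal.{v}) => preStage (KPTree.index θ c)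
    (Ordinal.omega0 ^ c.2) k)
    (h.comp (by fun_prop : PR.{v} fun x : ℕ × (Enum.{v} × Ordinal.{v}) => (x.2, x.1)))

theorem PRS.termLt : PRS.{v} fun (c : Enum.{v} × Ordinal.{v}) => {x : Term.{v} × Term.{v} |
    x ∈ KPTree.preTerms (KPTree.index θ c) (Ordinal.omega0 ^ c.2) ×ˢ KPTree.preTerms
      (KPTree.index θ c) (Ordinal.omega0 ^ c.2) ∧ TermLt (KPTree.indexLt θ c) x.1 x.2} := by
  have h : PRS.{v} fun x : (Enum.{v} × Ordinal.{v}) × ℕ => ltStage (KPTree.index θ x.1)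
    (KPTree.indexLt θ x.1) (Ordinal.omega0 ^ x.1.2) x.2 := by
    refine nat_rec (s := fun (c : Enum.{v} × Ordinal.{v}) k => ltStage (KPTree.index θ c)
      (KPTree.indexLt θ c) (Ordinal.omega0 ^ c.2) k) (step := fun (c : Enum.{v} × Ordinal.{v}) k
        X =>
      {x | x ∈ KPTree.preTerms (KPTree.index θ c) (Ordinal.omega0 ^ c.2) ×ˢ KPTree.preTerms
        (KPTree.index θ c) (Ordinal.omega0 ^ c.2) ∧
        ltStep (KPTree.indexLt θ c) X x.1 x.2}) ?_ ?_ fun _ _ => by rw [ltStage]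
    · exact PRS.empty
    · have hU {α : Type (v + 1)} [SetCode.{v} α] {f : α → Enum.{v} × Ordinal.{v}} (hf : PR.{v} f) :
          PRS.{v} fun a => KPTree.preTerms (KPTree.index θ (f a)) (Ordinal.omega0 ^ (f a).2) :=
            (PRS.preTerms hθ).comp hf
      have hlt' {α : Type (v + 1)} [SetCode.{v} α] {f : α → Enum.{v} × Ordinal.{v}} {σ τ : α →
        List Ranked.{v}} (hf : PR.{v} f)
          (hσ : PR.{v} σ) (hτ : PR.{v} τ) : PR.{v} fun a => KPTree.indexLt θ (f a) (σ a) (τ a) :=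
        (PR.indexLt hθ).comp (hf.prodMk (hσ.prodMk hτ))
      unfold ltStep
      fun_prop
  have := PRS.iUnion_nat (s := fun k (c : Enum.{v} × Ordinal.{v}) => ltStage (KPTree.index θ c)
    (KPTree.indexLt θ c) (Ordinal.omega0 ^ c.2) k)
    (h.comp (by fun_prop : PR.{v} fun x : ℕ × (Enum.{v} × Ordinal.{v}) => (x.2, x.1)))
  convert this using 2 with c
  ext ⟨s, t⟩
  constructor
  · rintro ⟨⟨hs, ht⟩, h⟩
    exact (exists_ltStage_iff hs ht).2 h
  · rintro ⟨k, h⟩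
    have hst : (s, t) ∈ KPTree.preTerms (KPTree.index θ c) (Ordinal.omega0 ^ c.2) ×ˢ KPTree.preTerms
      (KPTree.index θ c) (Ordinal.omega0 ^ c.2) := by
      cases k with
      | zero => exact h.elim
      | succ k => exact h.1
    exact ⟨hst, (exists_ltStage_iff hst.1 hst.2).1 ⟨k, h⟩⟩

theorem PRS.isTerm : PRS.{v} fun (c : Enum.{v} × Ordinal.{v}) =>
    {t | IsTerm (KPTree.index θ c) (KPTree.indexLt θ c) (Ordinal.omega0 ^ c.2) t} := by
  have h : PRS.{v} fun x : (Enum.{v} × Ordinal.{v}) × ℕ => termStage (KPTree.index θ x.1)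
    (KPTree.indexLt θ x.1) (Ordinal.omega0 ^ x.1.2) x.2 := by
    refine nat_rec (s := fun (c : Enum.{v} × Ordinal.{v}) k => termStage (KPTree.index θ c)
      (KPTree.indexLt θ c) (Ordinal.omega0 ^ c.2) k) (step := fun (c : Enum.{v} × Ordinal.{v}) k
        X =>
      {.zero} ∪ ({t | ∃ σ ∈ KPTree.index θ c, t = .eps σ} ∪ {t | ∃ l ∈ {l |
      l ∈ KPTree.listsOver ({t | t ∈ X ∧ t ∈ KPTree.preTerms (KPTree.index θ c)
        (Ordinal.omega0 ^ c.2)} ×ˢ Set.Iio (Ordinal.omega0 ^ c.2)) ∧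
        ¬ l = [] ∧ (∀ x ∈ {x | x ∈ l}, 0 < x.2) ∧
        (∀ x ∈ {x | x ∈ l}, ∀ σ ∈ KPTree.epsParts x.1, ¬ l = [(.eps σ, 1)]) ∧
        l.IsChain fun x y => (y.1, x.1) ∈ {x : Term.{v} × Term.{v} |
            x ∈ KPTree.preTerms (KPTree.index θ c) (Ordinal.omega0 ^ c.2) ×ˢ KPTree.preTerms
              (KPTree.index θ c) (Ordinal.omega0 ^ c.2) ∧
            TermLt (KPTree.indexLt θ c) x.1 x.2}}, t = .sum l})) ?_ ?_ ?_
    · exact PRS.empty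
    · have hU {α : Type (v + 1)} [SetCode.{v} α] {f : α → Enum.{v} × Ordinal.{v}} (hf : PR.{v} f) :
          PRS.{v} fun a => KPTree.preTerms (KPTree.index θ (f a)) (Ordinal.omega0 ^ (f a).2) :=
            (PRS.preTerms hθ).comp hf
      have hS' {α : Type (v + 1)} [SetCode.{v} α] {f : α → Enum.{v} × Ordinal.{v}} (hf : PR.{v} f) :
        PRS.{v} fun a => KPTree.index θ (f a) :=
        (PRS.index hθ).comp hf
      have h := PRS.termLt hθ
      have hc {α : Type (v + 1)} [SetCode.{v} α] {f : α → Enum.{v} × Ordinal.{v}} {g : α →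
        List (Term.{v} × Ordinal.{v})}
          (hf : PR.{v} f) (hg : PR.{v} g) : PR.{v} fun a => (g a).IsChain fun x y => (y.1, x.1) ∈
            {x : Term.{v} × Term.{v} | x ∈ KPTree.preTerms (KPTree.index θ (f a))
              (Ordinal.omega0 ^ (f a).2) ×ˢ
              KPTree.preTerms (KPTree.index θ (f a)) (Ordinal.omega0 ^ (f a).2) ∧
                TermLt (KPTree.indexLt θ (f a)) x.1 x.2} :=
        PR.isChain hg (PR.mem (by fun_prop) (h.comp (by fun_prop)))
      have h1 {α : Type (v + 1)} [SetCode.{v} α] : PR.{v} fun _ : α => (1 : Ordinal.{v}) := by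
        simpa using PR.natCast (PR.const_nat 1)
      fun_prop
    · intro c k
      rw [termStage]
      congr 2
      ext t
      simp only [Set.mem_ofPred_eq]
      have hk : ∀ t, t ∈ termStage (KPTree.index θ c) (KPTree.indexLt θ c) (Ordinal.omega0 ^ c.2)
        k → t ∈ KPTree.preTerms (KPTree.index θ c) (Ordinal.omega0 ^ c.2) :=
        fun t ht => ⟨k, termStage_subset k ht⟩
      refine exists_congr fun l => and_congr_left fun _ => ?_
      have h1 : {t | t ∈ termStage (KPTree.index θ c) (KPTree.indexLt θ c) (Ordinal.omega0 ^ c.2)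
        k ∧ t ∈ KPTree.preTerms (KPTree.index θ c) (Ordinal.omega0 ^ c.2)} =
          termStage (KPTree.index θ c) (KPTree.indexLt θ c) (Ordinal.omega0 ^ c.2) k := by
        ext t
        exact ⟨fun h => h.1, fun h => ⟨h, hk t h⟩⟩
      rw [h1]
      refine and_congr_right fun hl => and_congr_right fun _ => and_congr_right fun _ =>
        and_congr_right fun _ => ?_
      have : ∀ x ∈ l, x.1 ∈ KPTree.preTerms (KPTree.index θ c) (Ordinal.omega0 ^ c.2) := fun x hx =>
        hk _ (hl x hx).1
      simp only [List.isChain_iff_forall_rel_of_append_cons_cons]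
      constructor
      · intro h x y l₁ l₂ e
        exact ⟨⟨this y (by simp [e]), this x (by simp [e])⟩, h e⟩
      · intro h x y l₁ l₂ e
        exact (h e).2
  have := PRS.iUnion_nat (s := fun k (c : Enum.{v} × Ordinal.{v}) => termStage (KPTree.index θ c)
    (KPTree.indexLt θ c) (Ordinal.omega0 ^ c.2) k)
    (h.comp (by fun_prop : PR.{v} fun x : ℕ × (Enum.{v} × Ordinal.{v}) => (x.2, x.1)))
  simpa only [exists_termStage_iff] using this

theorem PRS.epsTerms : PRS.{v} fun c : Enum.{v} × Ordinal.{v} => epsTerms c.1 θ c.2 :=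
  PRS.isTerm hθ

theorem PRS.epsLt : PRS.{v} fun c : Enum.{v} × Ordinal.{v} =>
    {x : Term.{v} × Term.{v} | EpsLt c.1 θ c.2 x.1 x.2} := by
  have h := PRS.termLt hθ
  have h' := PRS.epsTerms hθ
  have hf {α : Type (v + 1)} [SetCode.{v} α] {f : α → Enum.{v} × Ordinal.{v}} (hf : PR.{v} f) :
    PRS.{v} fun a =>
    KPTree.epsTerms (f a).1 θ (f a).2 := h'.comp hf
  have := PRS.sep (p := fun (c : Enum.{v} × Ordinal.{v}) (x : Term.{v} × Term.{v}) =>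
    x.1 ∈ KPTree.epsTerms c.1 θ c.2 ∧ x.2 ∈ KPTree.epsTerms c.1 θ c.2) h (by fun_prop)
  convert this using 2 with c
  ext ⟨s, t⟩
  have hU : ∀ {s}, s ∈ KPTree.epsTerms c.1 θ c.2 → s ∈ KPTree.preTerms
      (KPTree.nodes c.1 θ (Ordinal.omega0 ^ c.2)) (Ordinal.omega0 ^ c.2) := fun h => by
    obtain ⟨k, h⟩ := exists_termStage_iff.2 h
    exact ⟨k, termStage_subset k h⟩
  constructor
  · rintro ⟨h₁, h₂, h₃⟩
    exact ⟨⟨⟨hU h₁, hU h₂⟩, h₃⟩, h₁, h₂⟩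
  · rintro ⟨⟨-, h₃⟩, h₁, h₂⟩
    exact ⟨h₁, h₂, h₃⟩

end

section

/-! ### The well-orderings of the constructible hierarchy -/

section Transitive

variable {u : Set ZFSet.{v}} (hu : ∀ a ∈ u, ∀ x ∈ a, x ∈ u)

include hu

theorem subset_definablePowerset : u ⊆ definablePowerset u := by
  intro a ha
  refine ⟨1, .mem (.var 1) (.var 0), fun _ => a, fun _ => ha, fun x => ?_⟩
  exact ⟨fun h => ⟨hu a ha x h, h⟩, fun h => h.2⟩

theorem definablePowerset_transitive : ∀ a ∈ definablePowerset u, ∀ x ∈ a,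
    x ∈ definablePowerset u := by
  rintro a ⟨n, φ, p, hp, h⟩ x hx
  exact subset_definablePowerset hu ((h x).1 hx).1

/-- The stages are transitive and increase. Both facts are proved together, since the inclusion in
the next stage uses transitivity. -/
theorem LStage_aux (o : Ordinal.{v}) : (∀ a ∈ LStage u o, ∀ x ∈ a, x ∈ LStage u o) ∧
    ∀ o' ≤ o, LStage u o' ⊆ LStage u o := by
  induction o using Ordinal.limitRecOn with
  | zero =>
    refine ⟨by rwa [LStage_zero], fun o' h => ?_⟩
    rw [nonpos_iff_eq_zero.1 h]
  | add_one o ih =>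
    rw [LStage_succ]
    refine ⟨definablePowerset_transitive ih.1, fun o' h => ?_⟩
    rcases h.lt_or_eq with h | rfl
    · exact (ih.2 o' (by simpa using h)).trans (subset_definablePowerset ih.1)
    · rw [LStage_succ]
  | limit o ho ih =>
    refine ⟨?_, fun o' h => ?_⟩
    · rw [LStage_limit _ ho]
      rintro a ⟨o', h, ha⟩ x hx
      exact ⟨o', h, (ih o' h).1 a ha x hx⟩
    · rcases h.lt_or_eq with h | rfl
      · rw [LStage_limit _ ho]
        exact fun a ha => ⟨o', h, ha⟩
      · exact subset_rfl

theorem LStage_mono {o o' : Ordinal.{v}} (h : o ≤ o') : LStage u o ⊆ LStage u o' :=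
  (LStage_aux hu o').2 o h

end Transitive

/-- The relation `lt` is a well-ordering of `M`. -/
structure WellOrderOn {β : Type*} (lt : β → β → Prop) (M : Set β) : Prop where
  wf : WellFounded lt
  total : ∀ a ∈ M, ∀ b ∈ M, lt a b ∨ a = b ∨ lt b a

theorem WellOrderOn.irrefl {β : Type*} {lt : β → β → Prop} {M : Set β} (h : WellOrderOn lt M)
    (a : β) : ¬ lt a a := h.wf.irrefl.irrefl a

theorem WellOrderOn.trans {β : Type*} {lt : β → β → Prop} {M : Set β} (h : WellOrderOn lt M)
    {a b c : β} (ha : a ∈ M) (hc : c ∈ M) (hab : lt a b) (hbc : lt b c) : lt a c := by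
  rcases h.total a ha c hc with hac | rfl | hca
  · exact hac
  · exact (h.wf.asymmetric _ _ hab hbc).elim
  · exfalso
    obtain ⟨m, hm, hm'⟩ := h.wf.has_min {a, b, c} ⟨a, by simp⟩
    rcases hm with rfl | rfl | rfl
    · exact hm' c (by simp) hca
    · exact hm' a (by simp) hab
    · exact hm' b (by simp) hbc

theorem splits_of_lex {β : Type*} {lt : β → β → Prop} {l l' : List β}
    (h : ∃ x ∈ splits l, ∃ y ∈ splits l', x.1 = y.1 ∧ lt x.2.1 y.2.1) : List.Lex lt l l' := by
  obtain ⟨⟨l₁, a, l₂⟩, rfl, ⟨_, b, l₃⟩, rfl, rfl, h⟩ := h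
  simp only at h ⊢
  induction l₁ with
  | nil => exact .rel h
  | cons c l ih => exact .cons ih

theorem eq_or_splits {β : Type*} {lt : β → β → Prop} {M : Set β}
    (h : ∀ a ∈ M, ∀ b ∈ M, lt a b ∨ a = b ∨ lt b a) {l l' : List β} (hl : l ∈ listsOver M)
    (hl' : l' ∈ listsOver M) (hn : l.length = l'.length) :
    (∃ x ∈ splits l, ∃ y ∈ splits l', x.1 = y.1 ∧ lt x.2.1 y.2.1) ∨ l = l' ∨
      (∃ x ∈ splits l', ∃ y ∈ splits l, x.1 = y.1 ∧ lt x.2.1 y.2.1) := by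
  induction l generalizing l' with
  | nil => exact .inr (.inl (List.length_eq_zero_iff.1 hn.symm).symm)
  | cons a l ih =>
    cases l' with
    | nil => simp at hn
    | cons b l' =>
      rcases h a (hl a (by simp)) b (hl' b (by simp)) with hab | rfl | hab
      · exact .inl ⟨([], a, l), rfl, ([], b, l'), rfl, rfl, hab⟩
      · rcases ih (fun x hx => hl x (by simp [hx])) (fun x hx => hl' x (List.mem_cons_of_mem _ hx))
          (by simpa using hn) with ⟨⟨l₁, c, l₂⟩, rfl, ⟨_, d, l₃⟩, rfl, rfl, h⟩ | rfl |
            ⟨⟨l₁, c, l₂⟩, rfl, ⟨_, d, l₃⟩, rfl, rfl, h⟩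
        · exact .inl ⟨(a :: l₁, c, l₂), rfl, (a :: l₁, d, l₃), rfl, rfl, h⟩
        · exact .inr (.inl rfl)
        · exact .inr (.inr ⟨(a :: l₁, c, l₂), rfl, (a :: l₁, d, l₃), rfl, rfl, h⟩)
      · exact .inr (.inr ⟨([], b, l'), rfl, ([], a, l), rfl, rfl, hab⟩)

theorem defnLt_wf {lt : ZFSet.{v} → ZFSet.{v} → Prop} (h : WellFounded lt) :
    WellFounded (defnLt {x | lt x.1 x.2}) := by
  have : WellFounded (InvImage (Prod.Lex (· < ·) (Prod.Lex (· < ·) (List.Shortlex lt)))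
      fun d : PureFml × List ZFSet.{v} => (d.2.length, d.1.2.godel, d.2)) :=
    InvImage.wf _ (WellFounded.prod_lex wellFounded_lt
      (WellFounded.prod_lex wellFounded_lt (List.Shortlex.wf h)))
  refine Subrelation.wf (fun {d d'} hd => ?_) this
  rcases hd with h | ⟨h, h' | ⟨h', h''⟩⟩
  · exact Prod.Lex.left _ _ h
  · simp only [InvImage, h]
    exact Prod.Lex.right _ (Prod.Lex.left _ _ h')
  · have hg : d.1.2.godel = d'.1.2.godel := by rw [h']
    simp only [InvImage, h, hg]
    exact Prod.Lex.right _ (Prod.Lex.right _ (List.Shortlex.of_lex h (splits_of_lex h'')))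

theorem defnLt_total {lt : ZFSet.{v} → ZFSet.{v} → Prop} {M : Set ZFSet.{v}}
    (h : WellOrderOn lt M) {a b : ZFSet.{v}} {d d' : PureFml × List ZFSet.{v}}
    (hd : d ∈ defns M a) (hd' : d' ∈ defns M b) :
    defnLt {x | lt x.1 x.2} d d' ∨ d = d' ∨ defnLt {x | lt x.1 x.2} d' d := by
  obtain ⟨n, φ, p, rfl, hp, -⟩ := hd
  obtain ⟨m, ψ, q, rfl, hq, -⟩ := hd'
  have hl : ∀ {n : ℕ} {p : Fin n → ZFSet.{v}}, (∀ i, p i ∈ M) → List.ofFn p ∈ listsOver M :=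
    fun hp a ha => by
      obtain ⟨i, rfl⟩ := (List.mem_ofFn' _ _).1 ha
      exact hp i
  rcases lt_trichotomy n m with h' | rfl | h'
  · exact .inl (.inl (by simpa using h'))
  · rcases lt_trichotomy φ.godel ψ.godel with h' | h' | h'
    · exact .inl (.inr ⟨by simp, .inl h'⟩)
    · rw [godel_injective h']
      rcases eq_or_splits h.total (hl hp) (hl hq) (by simp) with h' | h' | h'
      · exact .inl (.inr ⟨by simp, .inr ⟨rfl, h'⟩⟩)
      · exact .inr (.inl (by rw [h']))
      · exact .inr (.inr (.inr ⟨by simp, .inr ⟨rfl, h'⟩⟩))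
    · exact .inr (.inr (.inr ⟨by simp, .inl h'⟩))
  · exact .inr (.inr (.inl (by simpa using h')))

theorem defns_unique {M : Set ZFSet.{v}} {a b : ZFSet.{v}} {d : PureFml × List ZFSet.{v}}
    (h : d ∈ defns M a) (h' : d ∈ defns M b) : a = b := by
  obtain ⟨n, φ, p, rfl, hp⟩ := h
  obtain ⟨m, ψ, q, h, hq⟩ := h'
  simp only [Prod.mk.injEq, Sigma.mk.injEq, add_left_inj] at h
  obtain ⟨⟨rfl, h⟩, h'⟩ := h
  rw [heq_eq_eq] at h
  subst h
  rw [List.ofFn_inj] at h'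
  subst h'
  ext x
  rw [hp.2, hq.2]

section LLt

variable {e : Enum.{v}} (he : ∀ n, ∀ x ∈ e n, x ∈ Set.range e)

include he

theorem range_transitive : ∀ a ∈ Set.range e, ∀ x ∈ a, x ∈ Set.range e := by
  rintro _ ⟨n, rfl⟩
  exact he n

theorem LLt.mem {o : Ordinal.{v}} {a b : ZFSet.{v}} (h : LLt e o a b) :
    a ∈ LStage (Set.range e) o ∧ b ∈ LStage (Set.range e) o := by
  have hm := fun {o o' : Ordinal.{v}} => LStage_mono (o := o) (o' := o') (range_transitive he)
  induction o using Ordinal.limitRecOn with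
  | zero =>
    rw [LLt_zero] at h
    rw [LStage_zero]
    obtain ⟨hb, i, rfl, -⟩ := h
    exact ⟨⟨i, rfl⟩, hb⟩
  | add_one o ih =>
    have := hm (show o ≤ o + 1 by simp)
    rw [LLt_succ] at h
    rcases h with ⟨ha, hb, -⟩ | ⟨ha, hb⟩ | ⟨ha, hb, -⟩
    · exact ⟨this ha, this hb⟩
    · exact ⟨this ha, hb.1⟩
    · exact ⟨ha.1, hb.1⟩
  | limit o ho ih =>
    obtain ⟨o', h', h⟩ := (LLt_limit e ho a b).1 h
    exact ⟨hm h'.le (ih o' h' h).1, hm h'.le (ih o' h' h).2⟩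

/-- The ordering of a later stage is an end-extension of the ordering of an earlier one. -/
theorem LLt_iff_of_le {o o' : Ordinal.{v}} (h : o ≤ o') {a b : ZFSet.{v}}
    (hb : b ∈ LStage (Set.range e) o) : LLt e o' a b ↔ LLt e o a b := by
  have hm := fun {o o' : Ordinal.{v}} => LStage_mono (o := o) (o' := o') (range_transitive he)
  induction o' using Ordinal.limitRecOn generalizing o with
  | zero => rw [nonpos_iff_eq_zero.1 h]
  | add_one o' ih =>
    rcases h.lt_or_eq with h | rfl
    · have h : o ≤ o' := by simpa using h
      have hb' := hm h hb
      rw [LLt_succ, propext (ih h hb)]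
      constructor
      · rintro (⟨-, -, h⟩ | ⟨-, -, h⟩ | ⟨-, ⟨-, h⟩, -⟩)
        · exact h
        · exact (h hb').elim
        · exact (h hb').elim
      · exact fun h' => .inl ⟨hm h (LLt.mem he h').1, hb', h'⟩
    · rfl
  | limit o' ho ih =>
    rcases h.lt_or_eq with h | rfl
    · rw [LLt_limit e ho]
      constructor
      · rintro ⟨o'', h', h''⟩
        rcases le_total o o'' with h₁ | h₁
        · exact (ih o'' h' h₁ hb).1 h''
        · exact (ih o h h₁ (LLt.mem he h'').2).2 h''
      · exact fun h' => ⟨o, h, h'⟩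
    · rfl

theorem acc_LLt_of_le {o o' : Ordinal.{v}} (h : o ≤ o') {a : ZFSet.{v}} (ha : Acc (LLt e o) a)
    (ha' : a ∈ LStage (Set.range e) o) : Acc (LLt e o') a := by
  induction ha with
  | intro a _ ih =>
    refine ⟨_, fun b hb => ?_⟩
    rw [LLt_iff_of_le he h ha'] at hb
    exact ih b hb (LLt.mem he hb).1

theorem wellOrderOn_LLt (o : Ordinal.{v}) : WellOrderOn (LLt e o) (LStage (Set.range e) o) := by
  have hacc : ∀ {o : Ordinal.{v}} {a : ZFSet.{v}}, a ∉ LStage (Set.range e) o → Acc (LLt e o) a :=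
    fun h => ⟨_, fun b hb => (h (LLt.mem he hb).2).elim⟩
  induction o using Ordinal.limitRecOn with
  | zero =>
    constructor
    · classical
      let f : ZFSet.{v} → ℕ := fun a => if h : ∃ n, e n = a then Nat.find h else 0
      refine Subrelation.wf (fun {a b} h => ?_) (InvImage.wf f wellFounded_lt)
      rw [LLt_zero] at h
      obtain ⟨hb, i, rfl, h⟩ := h
      have hb' : ∃ n, e n = b := hb
      have ha' : ∃ n, e n = e i := ⟨i, rfl⟩
      simp only [InvImage, f, hb', ha', dite_true]
      exact (Nat.find_min' ha' rfl).trans_lt (h _ (Nat.find_spec hb'))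
    · rw [LStage_zero]
      intro a ha b hb
      classical
      have ha' : ∃ n, e n = a := ha
      have hb' : ∃ n, e n = b := hb
      rcases lt_trichotomy (Nat.find ha') (Nat.find hb') with h | h | h
      · refine .inl ((LLt_zero _ _ _).2 ⟨hb, _, Nat.find_spec ha', fun j hj => ?_⟩)
        exact h.trans_le (Nat.find_min' hb' hj)
      · right
        left
        rw [← Nat.find_spec ha', h, Nat.find_spec hb']
      · refine .inr (.inr ((LLt_zero _ _ _).2 ⟨ha, _, Nat.find_spec hb', fun j hj => ?_⟩))
        exact h.trans_le (Nat.find_min' ha' hj)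
  | add_one o ih =>
    have hold : ∀ a ∈ LStage (Set.range e) o, Acc (LLt e (o + 1)) a := fun a ha =>
      acc_LLt_of_le he (by simp) (ih.wf.apply a) ha
    constructor
    · -- a descending sequence of new elements yields a descending sequence of definitions
      have hnew : ∀ d a, d ∈ defns (LStage (Set.range e) o) a →
          a ∉ LStage (Set.range e) o → Acc (LLt e (o + 1)) a := by
        intro d
        induction d using (defnLt_wf ih.wf).induction with
        | _ d ihd =>
          intro b hb hb'
          refine ⟨_, fun a ha => ?_⟩
          rw [LLt_succ] at ha
          rcases ha with ⟨_, h, -⟩ | ⟨h, -⟩ | ⟨h, -, d', hd', h'⟩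
          · exact (hb' h).elim
          · exact hold a h
          · exact ihd d' (h' d hb) a hd' h.2
      refine ⟨fun a => ?_⟩
      by_cases ha : a ∈ LStage (Set.range e) o
      · exact hold a ha
      · by_cases ha' : a ∈ LStage (Set.range e) (o + 1)
        · rw [LStage_succ] at ha'
          obtain ⟨n, φ, p, h⟩ := ha'
          exact hnew _ a ⟨n, φ, p, rfl, h⟩ ha
        · exact hacc ha'
    · intro a ha b hb
      by_cases ha' : a ∈ LStage (Set.range e) o <;> by_cases hb' : b ∈ LStage (Set.range e) o
      · rw [LLt_iff_of_le he (by simp) ha', LLt_iff_of_le he (by simp) hb']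
        exact ih.total a ha' b hb'
      · exact .inl ((LLt_succ _ _ _ _).2 (.inr (.inl ⟨ha', hb, hb'⟩)))
      · exact .inr (.inr ((LLt_succ _ _ _ _).2 (.inr (.inl ⟨hb', ha, ha'⟩))))
      · by_cases hab : a = b
        · exact .inr (.inl hab)
        have hd : ∀ c ∈ LStage (Set.range e) (o + 1),
            ∃ d, d ∈ defns (LStage (Set.range e) o) c := by
          intro c hc
          rw [LStage_succ] at hc
          obtain ⟨n, φ, p, h⟩ := hc
          exact ⟨_, n, φ, p, rfl, h⟩
        obtain ⟨d, hd⟩ := hd a ha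
        obtain ⟨m, hm, hmin⟩ := (defnLt_wf ih.wf).has_min
          (defns (LStage (Set.range e) o) a ∪ defns (LStage (Set.range e) o) b) ⟨d, .inl hd⟩
        have key : ∀ {a b}, a ≠ b → m ∈ defns (LStage (Set.range e) o) a →
            (∀ d ∈ defns (LStage (Set.range e) o) b, ¬ defnLt {x | LLt e o x.1 x.2} d m) →
              ∀ d ∈ defns (LStage (Set.range e) o) b, defnLt {x | LLt e o x.1 x.2} m d := by
          intro a b hab hm hmin d hd
          rcases defnLt_total ih hm hd with h | rfl | h
          · exact h
          · exact (hab (defns_unique hm hd)).elim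
          · exact (hmin d hd h).elim
        rcases hm with hm | hm
        · exact .inl ((LLt_succ _ _ _ _).2 (.inr (.inr ⟨⟨ha, ha'⟩, ⟨hb, hb'⟩, m, hm,
            key hab hm fun d hd => hmin d (.inr hd)⟩)))
        · exact .inr (.inr ((LLt_succ _ _ _ _).2 (.inr (.inr ⟨⟨hb, hb'⟩, ⟨ha, ha'⟩, m, hm,
            key (Ne.symm hab) hm fun d hd => hmin d (.inl hd)⟩))))
  | limit o ho ih =>
    constructor
    · refine ⟨fun a => ?_⟩
      by_cases ha : a ∈ LStage (Set.range e) o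
      · rw [LStage_limit _ ho] at ha
        obtain ⟨o', h, ha⟩ := ha
        exact acc_LLt_of_le he h.le ((ih o' h).wf.apply a) ha
      · exact hacc ha
    · intro a ha b hb
      rw [LStage_limit _ ho] at ha hb
      obtain ⟨o₁, h₁, ha⟩ := ha
      obtain ⟨o₂, h₂, hb⟩ := hb
      have hm := fun {o o' : Ordinal.{v}} => LStage_mono (o := o) (o' := o') (range_transitive he)
      have h := max_lt h₁ h₂
      have ha' := hm (le_max_left o₁ o₂) ha
      have hb' := hm (le_max_right o₁ o₂) hb
      rw [LLt_iff_of_le he h.le ha', LLt_iff_of_le he h.le hb']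
      exact (ih _ h).total a ha' b hb'

theorem RStage_mem {o : Ordinal.{v}} {c : Ranked.{v}} (h : c ∈ RStage (Set.range e) o) :
    c.2 ∈ LStage (Set.range e) o := by
  rcases h with ⟨rfl, h, h'⟩ | ⟨h, h', -⟩
  · rwa [LStage_zero]
  · exact LStage_mono (range_transitive he) (by simpa using h) h'

omit he in
theorem RStage_ext {o : Ordinal.{v}} {c d : Ranked.{v}} (hc : c ∈ RStage (Set.range e) o)
    (hd : d ∈ RStage (Set.range e) o) (h : c.2 = d.2) : c = d := by
  refine Prod.ext ?_ h
  rcases hc with ⟨rfl, hc, -⟩ | ⟨hc, hc', hc''⟩ <;> rcases hd with ⟨ho, hd, -⟩ | ⟨hd, hd', hd''⟩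
  · rw [hc, hd]
  · simp at hd
  · simp [ho] at hc
  · rcases lt_trichotomy c.1 d.1 with h' | h' | h'
    · exact (hd'' _ h' (h ▸ hc')).elim
    · exact h'
    · exact (hc'' _ h' (h ▸ hd')).elim

theorem wellOrderOn_RLt (o : Ordinal.{v}) : WellOrderOn (RLt e o) (RStage (Set.range e) o) := by
  constructor
  · exact Subrelation.wf (fun h => h.2.2) (InvImage.wf Prod.snd (wellOrderOn_LLt he o).wf)
  · intro c hc d hd
    rcases (wellOrderOn_LLt he o).total _ (RStage_mem he hc) _ (RStage_mem he hd) with h | h | h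
    · exact .inl ⟨hc, hd, h⟩
    · exact .inr (.inl (RStage_ext hc hd h))
    · exact .inr (.inr ⟨hd, hc, h⟩)

theorem RStage_mono {o o' : Ordinal.{v}} (h : o ≤ o') :
    RStage (Set.range e) o ⊆ RStage (Set.range e) o' := by
  rintro c (⟨rfl, hc, hc'⟩ | ⟨hc, hc', hc''⟩)
  · rcases eq_or_ne o' 0 with rfl | h
    · exact .inl ⟨rfl, hc, hc'⟩
    · refine .inr ⟨by rw [hc]; exact pos_iff_ne_zero.2 h, ?_, fun γ hγ => by simp [hc] at hγ⟩
      refine LStage_mono (o := 0) (range_transitive he) (zero_le) ?_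
      rwa [LStage_zero]
  · exact .inr ⟨hc.trans_le h, hc', hc''⟩

theorem RLt_iff_of_le {o o' : Ordinal.{v}} (h : o ≤ o') {c d : Ranked.{v}}
    (hc : c ∈ RStage (Set.range e) o) (hd : d ∈ RStage (Set.range e) o) :
    RLt e o' c d ↔ RLt e o c d := by
  simp only [RLt, hc, hd, RStage_mono he h hc, RStage_mono he h hd, true_and]
  exact LLt_iff_of_le he h (RStage_mem he hd)

omit he in
theorem RStage_of_lt {o o' : Ordinal.{v}} {c : Ranked.{v}} (h : c ∈ RStage (Set.range e) o)
    (h' : c.1 < o') (ho : o ≠ 0) : c ∈ RStage (Set.range e) o' := by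
  rcases h with ⟨h, -⟩ | ⟨-, h⟩
  · exact (ho h).elim
  · exact .inr ⟨h', h⟩

end LLt

/-! ### The Kleene-Brouwer ordering -/

/-- The Kleene-Brouwer ordering of lists, for an ordering `r` of the entries. -/
inductive KB {β : Type*} (r : β → β → Prop) : List β → List β → Prop
  | nil {a : β} {l : List β} : KB r (a :: l) []
  | rel {a b : β} {l l' : List β} : r a b → KB r (a :: l) (b :: l')
  | cons {a : β} {l l' : List β} : KB r l l' → KB r (a :: l) (a :: l')

theorem kb_iff {β : Type*} {r : β → β → Prop} {l l' : List β} : KB r l l' ↔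
    (∃ a ρ, l = l' ++ a :: ρ) ∨ ∃ l₀ a b l₁ l₂, l = l₀ ++ a :: l₁ ∧ l' = l₀ ++ b :: l₂ ∧ r a b := by
  constructor
  · intro h
    induction h with
    | nil => exact .inl ⟨_, _, rfl⟩
    | rel h => exact .inr ⟨[], _, _, _, _, rfl, rfl, h⟩
    | @cons c _ _ _ ih =>
      rcases ih with ⟨a, ρ, rfl⟩ | ⟨l₀, a, b, l₁, l₂, rfl, rfl, h⟩
      · exact .inl ⟨a, ρ, rfl⟩
      · exact .inr ⟨c :: l₀, a, b, l₁, l₂, rfl, rfl, h⟩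
  · rintro (⟨a, ρ, rfl⟩ | ⟨l₀, a, b, l₁, l₂, rfl, rfl, h⟩)
    · induction l' with
      | nil => exact .nil
      | cons c l ih => exact .cons ih
    · induction l₀ with
      | nil => exact .rel h
      | cons c l ih => exact .cons ih

theorem KB.irrefl {β : Type*} {r : β → β → Prop} (hr : ∀ a, ¬ r a a) (l : List β) : ¬ KB r l l := by
  induction l with
  | nil => rintro ⟨⟩
  | cons a l ih =>
    rintro (_ | h | h)
    · exact hr a h
    · exact ih h

theorem KB.trans {β : Type*} {r : β → β → Prop} (hr : ∀ a b c, r a b → r b c → r a c)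
    {l l' l'' : List β} (h : KB r l l') (h' : KB r l' l'') : KB r l l'' := by
  induction h generalizing l'' with
  | nil => cases h'
  | rel h =>
    cases h' with
    | nil => exact .nil
    | rel h' => exact .rel (hr _ _ _ h h')
    | cons => exact .rel h
  | cons _ ih =>
    cases h' with
    | nil => exact .nil
    | rel h' => exact .rel h'
    | cons h' => exact .cons (ih h')

theorem KB.total {β : Type*} {r : β → β → Prop} {M : Set β}
    (hr : ∀ a ∈ M, ∀ b ∈ M, r a b ∨ a = b ∨ r b a) {l l' : List β} (hl : l ∈ listsOver M)
    (hl' : l' ∈ listsOver M) : KB r l l' ∨ l = l' ∨ KB r l' l := by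
  induction l generalizing l' with
  | nil =>
    cases l' with
    | nil => exact .inr (.inl rfl)
    | cons b l' => exact .inr (.inr .nil)
  | cons a l ih =>
    cases l' with
    | nil => exact .inl .nil
    | cons b l' =>
      rcases hr a (hl a (by simp)) b (hl' b (by simp)) with h | rfl | h
      · exact .inl (.rel h)
      · rcases ih (l' := l') (fun x hx => hl x (by simp [hx])) (fun x hx => hl' x (by simp [hx]))
          with h | rfl | h
        · exact .inl (.cons h)
        · exact .inr (.inl rfl)
        · exact .inr (.inr (.cons h))
      · exact .inr (.inr (.rel h))

end

section

/-! ### Nodes and labels of the search trees -/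

section Tree

variable {e : Enum.{v}} {θ : ℕ → Fml Empty 0} {o o' : Ordinal.{v}}

/-- The formula that is expanded stays in the label. -/
theorem expand_mem {σ : List Ranked.{v}} {Γ₁ Γ₂ : Sequent.{v}} {φ : Fml Ranked.{v} 0}
    {y : Ranked.{v} × Sequent.{v}} (h : y ∈ expand e o σ (Γ₁, φ, Γ₂)) :
    ∃ Δ, y.2 = Γ₁ ++ Γ₂ ++ φ :: Δ := by
  rcases h with (((⟨p, -, rfl | rfl⟩ | ⟨p, -, rfl⟩) | ⟨p, -, a, -, rfl⟩) | ⟨p, -, i, -, rfl⟩) | ⟨p,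
    -, rfl⟩ <;>
  exact ⟨_, rfl⟩

/-- The first formula of a sequent that is not a literal is unique. -/
theorem first_unique {Γ₁ Γ₂ Γ₁' Γ₂' : Sequent.{v}} {φ φ' : Fml Ranked.{v} 0}
    (h : Γ₁ ++ φ :: Γ₂ = Γ₁' ++ φ' :: Γ₂') (h₁ : ∀ χ ∈ Γ₁, χ.IsLiteral)
    (h₁' : ∀ χ ∈ Γ₁', χ.IsLiteral) (hφ : ¬ φ.IsLiteral) (hφ' : ¬ φ'.IsLiteral) :
    Γ₁ = Γ₁' ∧ φ = φ' ∧ Γ₂ = Γ₂' := by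
  induction Γ₁ generalizing Γ₁' with
  | nil =>
    cases Γ₁' with
    | nil => simpa using h
    | cons a l =>
      simp only [List.nil_append, List.cons_append, List.cons.injEq] at h
      exact (hφ (h.1 ▸ h₁' a (by simp))).elim
  | cons a l ih =>
    cases Γ₁' with
    | nil =>
      simp only [List.nil_append, List.cons_append, List.cons.injEq] at h
      exact (hφ' (h.1 ▸ h₁ a (by simp))).elim
    | cons b l' =>
      simp only [List.cons_append, List.cons.injEq] at h
      obtain ⟨rfl, h⟩ := h
      have := ih h (fun χ hχ => h₁ χ (by simp [hχ])) (fun χ hχ => h₁' χ (by simp [hχ]))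
      simpa using this

theorem not_isLiteral_of_expand {σ : List Ranked.{v}} {Γ₁ Γ₂ : Sequent.{v}} {φ : Fml Ranked.{v} 0}
    {y : Ranked.{v} × Sequent.{v}} (h : y ∈ expand e o σ (Γ₁, φ, Γ₂)) : ¬ φ.IsLiteral := by
  intro hφ
  cases hφ <;>
  rcases h with (((⟨p, h, -⟩ | ⟨p, h, -⟩) | ⟨p, h, -⟩) | ⟨p, h, -⟩) | ⟨p, ⟨h, -⟩, -⟩ <;> cases h

theorem children_even {σ : List Ranked.{v}} {Γ : Sequent.{v}} {k : ℕ} (hσ : σ.length = 2 * k)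
    {y : Ranked.{v} × Sequent.{v}} :
    y ∈ children e θ o σ Γ ↔ y = (mark0, Γ ++ [(θ k).ofPure.neg]) := by
  have h : ¬ (σ.length % 2 = 1 ∧ ¬ HasTrueDelta0 Γ) := fun h => by omega
  rw [children, if_neg h, Set.union_empty]
  constructor
  · rintro ⟨k', ⟨-, hk⟩, rfl⟩
    rw [show k' = k by omega]
  · exact fun h => ⟨k, ⟨trivial, hσ⟩, h⟩

theorem children_odd {σ : List Ranked.{v}} {Γ : Sequent.{v}} (hσ : σ.length % 2 = 1)
    {y : Ranked.{v} × Sequent.{v}} : y ∈ children e θ o σ Γ ↔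
      ¬ HasTrueDelta0 Γ ∧ (((∀ χ ∈ Γ, χ.IsLiteral) ∧ y = (mark0, Γ)) ∨ ∃ Γ₁ φ Γ₂,
        Γ = Γ₁ ++ φ :: Γ₂ ∧ (∀ χ ∈ Γ₁, χ.IsLiteral) ∧ y ∈ expand e o σ (Γ₁, φ, Γ₂)) := by
  have h0 : y ∉ {y : Ranked.{v} × Sequent.{v} | ∃ k ∈ {k | k ∈ (Set.univ : Set ℕ) ∧ σ.length = 2 *
    k},
      y = (mark0, Γ ++ [(θ k).ofPure.neg])} := by
    rintro ⟨k, ⟨-, hk⟩, -⟩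
    omega
  rw [children, Set.mem_union, or_iff_right h0]
  by_cases h : HasTrueDelta0 Γ
  · simp [h]
  rw [if_pos ⟨hσ, h⟩, Set.mem_union]
  refine ⟨fun hy => ⟨h, ?_⟩, fun hy => ?_⟩
  · rcases hy with hy | ⟨⟨Γ₁, φ, Γ₂⟩, ⟨h₁, h₂⟩, hy⟩
    · by_cases hl : ∀ χ ∈ Γ, χ.IsLiteral
      · rw [if_pos (by exact hl)] at hy
        exact .inl ⟨hl, hy⟩
      · rw [if_neg (by exact hl)] at hy
        exact hy.elim
    · exact .inr ⟨Γ₁, φ, Γ₂, h₁, h₂, hy⟩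
  · rcases hy with ⟨-, ⟨hl, hy⟩ | ⟨Γ₁, φ, Γ₂, h₁, h₂, hy⟩⟩
    · left
      rw [if_pos (by exact hl)]
      exact hy
    · exact .inr ⟨(Γ₁, φ, Γ₂), ⟨h₁, h₂⟩, hy⟩

theorem mark0_ne_mark1 : mark0.{v} ≠ mark1 := by
  intro h
  have := (Prod.ext_iff.1 h).2
  simp only [mark0, mark1] at this
  have h' : (∅ : ZFSet.{v}) ∈ ({∅} : ZFSet.{v}) := ZFSet.mem_singleton.2 rfl
  rw [← this] at h'
  exact ZFSet.notMem_empty ∅ h'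

theorem expand_unique {σ : List Ranked.{v}} {x : Sequent.{v} × Fml Ranked.{v} 0 × Sequent.{v}}
    {a : Ranked.{v}} {Δ Δ' : Sequent.{v}} (h : (a, Δ) ∈ expand e o σ x)
    (h' : (a, Δ') ∈ expand e o σ x) : Δ = Δ' := by
  obtain ⟨Γ₁, φ, Γ₂⟩ := x
  simp only [expand, Set.mem_union, Set.mem_ofPred_eq, andParts, orParts, allParts, exParts,
    Prod.mk.injEq, Set.mem_singleton_iff, Set.mem_univ, true_and, true_imp_iff, Set.mem_Iio] at h h'
  cases φ with
  | mem | nmem | eq | ne => simp at h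
  | and ψ₀ ψ₁ =>
    simp only [Fml.and.injEq, Prod.exists, reduceCtorEq, false_and, exists_false,
      or_false] at h h'
    obtain ⟨_, _, ⟨rfl, rfl⟩, h⟩ := h
    obtain ⟨_, _, ⟨rfl, rfl⟩, h'⟩ := h'
    rcases h with ⟨rfl, rfl⟩ | ⟨rfl, rfl⟩ <;> rcases h' with ⟨h, rfl⟩ | ⟨h, rfl⟩
    · rfl
    · exact (mark0_ne_mark1 h).elim
    · exact (mark0_ne_mark1 h.symm).elim
    · rfl
  | or ψ₀ ψ₁ =>
    simp only [Fml.or.injEq, Prod.exists, reduceCtorEq, false_and, exists_false,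
      or_false, false_or] at h h'
    obtain ⟨_, _, ⟨rfl, rfl⟩, -, rfl⟩ := h
    obtain ⟨_, _, ⟨rfl, rfl⟩, -, rfl⟩ := h'
    rfl
  | all ψ =>
    simp only [Fml.all.injEq, Prod.exists, reduceCtorEq, false_and, exists_false,
      or_false, false_or] at h h'
    obtain ⟨_, rfl, _, _, -, rfl, rfl⟩ := h
    obtain ⟨_, rfl, _, _, -, h, rfl⟩ := h'
    cases h
    rfl
  | ex ψ =>
    simp only [Fml.ex.injEq, Prod.exists, reduceCtorEq, false_and, exists_false,
      or_false, false_or] at h h'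
    rcases h with ⟨_, rfl, i, ⟨hi, hj⟩, -, rfl⟩ | ⟨_, ⟨rfl, hj⟩, -, rfl⟩ <;>
    rcases h' with ⟨_, rfl, i', ⟨hi', hj'⟩, -, rfl⟩ | ⟨_, ⟨rfl, hj'⟩, -, rfl⟩
    · rcases lt_trichotomy i i' with h | rfl | h
      · exact (hi (hj' _ h)).elim
      · rfl
      · exact (hi' (hj _ h)).elim
    · exact (hi (hj' _)).elim
    · exact (hi' (hj _)).elim
    · rfl

theorem searchTree_unique {σ : List Ranked.{v}} {Γ Γ' : Sequent.{v}}
    (h : SearchTree e θ o σ Γ) (h' : SearchTree e θ o σ Γ') : Γ = Γ' := by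
  induction σ using List.reverseRecOn generalizing Γ Γ' with
  | nil => rw [searchTree_nil_iff.1 h, searchTree_nil_iff.1 h']
  | append_singleton σ a ih =>
    obtain ⟨Δ, h, hc⟩ := searchTree_append_iff.1 h
    obtain ⟨Δ', h', hc'⟩ := searchTree_append_iff.1 h'
    obtain rfl := ih h h'
    rcases Nat.even_or_odd' σ.length with ⟨k, hk | hk⟩
    · rw [children_even hk] at hc hc'
      cases hc
      cases hc'
      rfl
    · rw [children_odd (by omega)] at hc hc'
      rcases hc with ⟨-, ⟨hl, hc⟩ | ⟨Γ₁, φ, Γ₂, rfl, hl, hc⟩⟩ <;>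
      rcases hc' with ⟨-, ⟨hl', hc'⟩ | ⟨Γ₁', φ', Γ₂', h₁, hl', hc'⟩⟩
      · cases hc
        cases hc'
        rfl
      · exact (not_isLiteral_of_expand hc' (hl _ (by simp [h₁]))).elim
      · exact (not_isLiteral_of_expand hc (hl' _ (by simp))).elim
      · obtain ⟨rfl, rfl, rfl⟩ := first_unique h₁ hl hl' (not_isLiteral_of_expand hc)
          (not_isLiteral_of_expand hc')
        exact expand_unique hc hc'

theorem nodes_of_prefix {p σ : List Ranked.{v}} (h : p <+: σ) (hσ : σ ∈ nodes e θ o) :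
    p ∈ nodes e θ o := by
  obtain ⟨ρ, rfl⟩ := h
  induction ρ using List.reverseRecOn with
  | nil => simpa using hσ
  | append_singleton ρ a ih =>
    obtain ⟨Γ, h⟩ := hσ
    rw [← List.append_assoc, searchTree_append_iff] at h
    obtain ⟨Δ, h, -⟩ := h
    exact ih ⟨Δ, h⟩

/-- The stage enters the definition of the tree only through the children of universal formulas,
which extend the node by elements of the stage. -/
theorem searchTree_imp {P : Ranked.{v} → Prop} (h : ∀ c, P c → c ∈ RStage (Set.range e) o →
    c ∈ RStage (Set.range e) o') {σ : List Ranked.{v}} {Γ : Sequent.{v}} (hσ : ∀ c ∈ σ, P c)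
    (hΓ : SearchTree e θ o σ Γ) : SearchTree e θ o' σ Γ := by
  induction hΓ with
  | root => exact .root
  | axm k h hk ih => exact .axm k (ih fun c hc => hσ c (by simp [hc])) hk
  | stall h ho hn hl ih => exact .stall (ih fun c hc => hσ c (by simp [hc])) ho hn hl
  | conjLeft h ho hn hl ih => exact .conjLeft (ih fun c hc => hσ c (by simp [hc])) ho hn hl
  | conjRight h ho hn hl ih => exact .conjRight (ih fun c hc => hσ c (by simp [hc])) ho hn hl
  | disjLeft h ho hn hl hm ih => exact .disjLeft (ih fun c hc => hσ c (by simp [hc])) ho hn hl hm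
  | disjRight h ho hn hl hm ih => exact .disjRight (ih fun c hc => hσ c (by simp [hc])) ho hn hl hm
  | all a _ ho hn hl ha ih =>
    exact .all a (ih fun c hc => hσ c (by simp [hc])) ho hn hl (h a (hσ a (by simp)) ha)
  | ex i h ho hn hl hi hj ih => exact .ex i (ih fun c hc => hσ c (by simp [hc])) ho hn hl hi hj
  | exDone h ho hn hl hj ih => exact .exDone (ih fun c hc => hσ c (by simp [hc])) ho hn hl hj

variable (he : ∀ n, ∀ x ∈ e n, x ∈ Set.range e)

include he

theorem nodes_mono (h : o ≤ o') : nodes e θ o ⊆ nodes e θ o' := by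
  rintro σ ⟨Γ, hΓ⟩
  exact ⟨Γ, searchTree_imp (P := fun _ => True) (fun c _ hc => RStage_mono he h hc)
    (fun _ _ => trivial) hΓ⟩

omit he in
/-- A node belongs to an earlier tree if the ordinals in its entries are small enough. -/
theorem nodes_of_lt (ho : o ≠ 0) {σ : List Ranked.{v}} (hσ : σ ∈ nodes e θ o)
    (h : ∀ c ∈ σ, c.1 < o') : σ ∈ nodes e θ o' := by
  obtain ⟨Γ, hΓ⟩ := hσ
  exact ⟨Γ, searchTree_imp (P := fun c => c.1 < o') (fun c hc hc' => RStage_of_lt hc' hc ho) h hΓ⟩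

variable (h0 : ∅ ∈ Set.range e) (h1 : {∅} ∈ Set.range e)

theorem mem_RStage_of_mem {a : ZFSet.{v}} (h : a ∈ Set.range e) :
    (0, a) ∈ RStage (Set.range e) o :=
  RStage_mono he zero_le (.inl ⟨rfl, rfl, h⟩)

include h0 h1

theorem nodes_listsOver {σ : List Ranked.{v}} (hσ : σ ∈ nodes e θ o) :
    σ ∈ listsOver (RStage (Set.range e) o) := by
  have hm0 : mark0 ∈ RStage (Set.range e) o := mem_RStage_of_mem he h0
  have hm1 : mark1 ∈ RStage (Set.range e) o := mem_RStage_of_mem he h1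
  have key : ∀ {σ : List Ranked.{v}} {a : Ranked.{v}}, σ ∈ listsOver (RStage (Set.range e) o) →
      a ∈ RStage (Set.range e) o → σ ++ [a] ∈ listsOver (RStage (Set.range e) o) := by
    intro σ a hσ ha b hb
    rcases List.mem_append.1 hb with hb | hb
    · exact hσ b hb
    · rw [List.mem_singleton.1 hb]
      exact ha
  obtain ⟨Γ, h⟩ := hσ
  induction h with
  | root => exact fun a ha => by simp at ha
  | axm k h hk ih => exact key ih hm0
  | stall h ho hn hl ih => exact key ih hm0
  | conjLeft h ho hn hl ih => exact key ih hm0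
  | conjRight h ho hn hl ih => exact key ih hm1
  | disjLeft h ho hn hl hm ih => exact key ih hm0
  | disjRight h ho hn hl hm ih => exact key ih hm0
  | all a _ ho hn hl ha ih => exact key ih ha
  | ex i h ho hn hl hi hj ih => exact key ih hm0
  | exDone h ho hn hl hj ih => exact key ih hm0

omit he h0 h1 in
theorem KBLt_iff {σ τ : List Ranked.{v}} : KBLt e θ o σ τ ↔
    σ ∈ nodes e θ o ∧ τ ∈ nodes e θ o ∧ KB (RLt e o) σ τ := by
  rw [kb_iff, KBLt]

omit h0 h1 in
theorem KBLt_irrefl (σ : List Ranked.{v}) : ¬ KBLt e θ o σ σ := fun h =>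
  KB.irrefl (wellOrderOn_RLt he o).irrefl σ (KBLt_iff.1 h).2.2

omit h0 h1 in
theorem RLt_trans {a b c : Ranked.{v}} (hab : RLt e o a b) (hbc : RLt e o b c) : RLt e o a c :=
  (wellOrderOn_RLt he o).trans hab.1 hbc.2.1 hab hbc

omit h0 h1 in
theorem KBLt_trans {σ τ ρ : List Ranked.{v}} (h : KBLt e θ o σ τ) (h' : KBLt e θ o τ ρ) :
    KBLt e θ o σ ρ := by
  rw [KBLt_iff] at *
  exact ⟨h.1, h'.2.1, KB.trans (r := RLt e o) (fun a b c => RLt_trans he) h.2.2 h'.2.2⟩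

theorem KBLt_total {σ τ : List Ranked.{v}} (hσ : σ ∈ nodes e θ o)
    (hτ : τ ∈ nodes e θ o) : KBLt e θ o σ τ ∨ σ = τ ∨ KBLt e θ o τ σ := by
  simp only [KBLt_iff, hσ, hτ, true_and]
  exact KB.total (wellOrderOn_RLt he o).total (nodes_listsOver he h0 h1 hσ)
    (nodes_listsOver he h0 h1 hτ)

omit h0 h1 in
theorem KBLt_mono (h : o ≤ o') {σ τ : List Ranked.{v}} (hst : KBLt e θ o σ τ) :
    KBLt e θ o' σ τ := by
  obtain ⟨hσ, hτ, h' | ⟨σ₀, a, b, σ', τ', h₁, h₂, hr⟩⟩ := hst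
  · exact ⟨nodes_mono he h hσ, nodes_mono he h hτ, .inl h'⟩
  · exact ⟨nodes_mono he h hσ, nodes_mono he h hτ, .inr ⟨σ₀, a, b, σ', τ', h₁, h₂,
      (RLt_iff_of_le he h hr.1 hr.2.1).2 hr⟩⟩

end Tree

end

section

/-! ### The order of terms -/

/-- A term as a sum: `0` is the empty sum, and `ε_σ` stands for `Ω^{ε_σ}·1`. -/
def Term.toSum : Term.{v} → List (Term.{v} × Ordinal.{v})
  | .zero => []
  | .eps σ => [(.eps σ, 1)]
  | .sum l => l

/-- The order of pairs of exponents and coefficients. -/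
def PairLt (lt : List Ranked.{v} → List Ranked.{v} → Prop) (x y : Term.{v} × Ordinal.{v}) : Prop :=
  TermLt lt x.1 y.1 ∨ (x.1 = y.1 ∧ x.2 < y.2)

section Order

variable {S S' : Set (List Ranked.{v})} {lt lt' : List Ranked.{v} → List Ranked.{v} → Prop}
  {δ δ' : Ordinal.{v}}

theorem eps_lt_eps_iff {σ τ : List Ranked.{v}} : TermLt lt (.eps σ) (.eps τ) ↔ lt σ τ := by
  constructor
  · rintro ⟨⟩
    assumption
  · exact .eps_eps

theorem not_lt_zero {s : Term.{v}} : ¬ TermLt lt s .zero := by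
  intro h
  generalize ht : Term.zero = t at h
  cases h <;> cases ht
  contradiction

theorem sum_lt_eps {s : Term.{v}} {β : Ordinal.{v}} {l : List (Term.{v} × Ordinal.{v})}
    {τ : List Ranked.{v}} (h : TermLt lt (.sum ((s, β) :: l)) (.eps τ)) : TermLt lt s (.eps τ) := by
  generalize ht : Term.eps τ = t at h
  generalize hs : Term.sum ((s, β) :: l) = s' at h
  cases h <;> cases ht <;> cases hs
  assumption

theorem lex_cons_iff {β : Type*} {r : β → β → Prop} {a b : β} {l l' : List β} :
    List.Lex r (a :: l) (b :: l') ↔ r a b ∨ (a = b ∧ List.Lex r l l') := by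
  constructor
  · rintro (_ | h | h)
    · exact .inl h
    · exact .inr ⟨rfl, h⟩
  · rintro (h | ⟨rfl, h⟩)
    · exact .rel h
    · exact .cons h

theorem lex_append_left {β : Type*} {r : β → β → Prop} {l l₁ l₂ : List β}
    (h : List.Lex r l₁ l₂) : List.Lex r (l ++ l₁) (l ++ l₂) := by
  induction l with
  | nil => exact h
  | cons a l ih => exact .cons ih

theorem sum_lt_sum_iff {l l' : List (Term.{v} × Ordinal.{v})} :
    TermLt lt (.sum l) (.sum l') ↔ List.Lex (PairLt lt) l l' := by
  constructor
  · intro h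
    generalize hs : Term.sum l = s at h
    generalize ht : Term.sum l' = t at h
    cases h with
    | zero | eps_eps | eps_sum_lt | eps_sum_eq => cases hs
    | sum_eps => cases ht
    | @sum_prefix l l' h =>
      cases hs
      cases ht
      obtain ⟨a, l', rfl⟩ := List.exists_cons_of_ne_nil h
      simpa using lex_append_left (l := l) (r := PairLt lt) (.nil (a := a) (l := l'))
    | sum_exponent h =>
      cases hs
      cases ht
      exact lex_append_left (.rel (.inl h))
    | sum_coefficient h =>
      cases hs
      cases ht
      exact lex_append_left (.rel (.inr ⟨rfl, h⟩))
  · intro h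
    have key : (∃ l'', l'' ≠ [] ∧ l' = l ++ l'') ∨
        ∃ l₀ x y l₁ l₂, l = l₀ ++ x :: l₁ ∧ l' = l₀ ++ y :: l₂ ∧ PairLt lt x y := by
      induction h with
      | nil => exact .inl ⟨_, by simp, rfl⟩
      | rel h => exact .inr ⟨[], _, _, _, _, rfl, rfl, h⟩
      | @cons a _ _ _ ih =>
        rcases ih with ⟨l'', h, rfl⟩ | ⟨l₀, x, y, l₁, l₂, rfl, rfl, h⟩
        · exact .inl ⟨l'', h, rfl⟩
        · exact .inr ⟨a :: l₀, x, y, l₁, l₂, rfl, rfl, h⟩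
    rcases key with ⟨l'', h', rfl⟩ | ⟨l₀, ⟨s, β⟩, ⟨t, γ⟩, l₁, l₂, rfl, rfl, h | ⟨h, h'⟩⟩
    · exact .sum_prefix h'
    · exact .sum_exponent h
    · simp only at h h'
      subst h
      exact .sum_coefficient h'

/-- The order of `ε(S)` is the lexicographic order of sums. -/
theorem termLt_iff_lex {s t : Term.{v}} (hs : IsTerm S lt δ s) (ht : IsTerm S lt δ t) :
    TermLt lt s t ↔ List.Lex (PairLt lt) s.toSum t.toSum := by
  cases hs with
  | zero =>
    cases ht with
    | zero => exact ⟨fun h => by cases h; contradiction, fun h => by cases h⟩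
    | eps h => exact ⟨fun _ => .nil, fun _ => .zero (by simp)⟩
    | @sum l h =>
      obtain ⟨a, l', rfl⟩ := List.exists_cons_of_ne_nil h
      exact ⟨fun _ => .nil, fun _ => .zero (by simp)⟩
  | @eps σ h =>
    cases ht with
    | zero => exact ⟨fun h => (not_lt_zero h).elim, fun h => by cases h⟩
    | @eps τ h =>
      rw [Term.toSum, Term.toSum, lex_cons_iff]
      constructor
      · exact fun h => .inl (.inl h)
      · rintro ((h | ⟨-, h⟩) | ⟨-, h⟩)
        · exact h
        · simp at h
        · cases h
    | @sum l h₁ h₂ h₃ h₄ h₅ =>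
      obtain ⟨⟨t₀, γ⟩, l, rfl⟩ := List.exists_cons_of_ne_nil h₁
      rw [Term.toSum, Term.toSum, lex_cons_iff]
      constructor
      · intro h
        cases h with
        | eps_sum_lt h => exact .inl (.inl h)
        | eps_sum_eq =>
          have h := Order.one_le_iff_pos.2 (h₃ (.eps σ) γ (by simp)).1
          rcases h.eq_or_lt with rfl | h
          · refine .inr ⟨rfl, ?_⟩
            cases l with
            | nil => exact (h₄ _ rfl).elim
            | cons => exact .nil
          · exact .inl (.inr ⟨rfl, h⟩)
      · rintro ((h | ⟨rfl, h⟩) | ⟨h, -⟩)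
        · exact .eps_sum_lt h
        · exact .eps_sum_eq
        · cases h
          exact .eps_sum_eq
  | @sum l h₁ h₂ h₃ h₄ h₅ =>
    obtain ⟨⟨s₀, β⟩, l, rfl⟩ := List.exists_cons_of_ne_nil h₁
    cases ht with
    | zero => exact ⟨fun h => (not_lt_zero h).elim, fun h => by cases h⟩
    | @eps τ h =>
      rw [Term.toSum, Term.toSum, lex_cons_iff]
      constructor
      · exact fun h => .inl (.inl (sum_lt_eps h))
      · rintro ((h | ⟨-, h⟩) | ⟨-, h⟩)
        · exact .sum_eps h
        · have := (h₃ s₀ β (by simp)).1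
          simp only [Order.lt_one_iff] at h
          exact (this.ne' h).elim
        · cases h
    | sum => exact sum_lt_sum_iff

theorem toSum_injective {s t : Term.{v}} (hs : IsTerm S lt δ s) (ht : IsTerm S lt δ t)
    (h : s.toSum = t.toSum) : s = t := by
  cases hs with
  | zero =>
    cases ht with
    | zero => rfl
    | eps => cases h
    | sum h' => exact (h' h.symm).elim
  | eps =>
    cases ht with
    | zero => cases h
    | eps => cases h; rfl
    | sum _ _ _ h' => exact (h' _ h.symm).elim
  | sum h₁ _ _ h₂ =>
    cases ht with
    | zero => exact (h₁ h).elim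
    | eps => exact (h₂ _ h).elim
    | sum => exact congrArg Term.sum h

theorem IsTerm.of_mem_toSum {t : Term.{v}} (ht : IsTerm S lt δ t) {x : Term.{v} × Ordinal.{v}}
    (hx : x ∈ t.toSum) : IsTerm S lt δ x.1 := by
  cases ht with
  | zero => cases hx
  | eps h =>
    rw [List.mem_singleton.1 hx]
    exact .eps h
  | sum _ h => exact h _ _ hx

theorem IsTerm.chain {t : Term.{v}} (ht : IsTerm S lt δ t) :
    t.toSum.IsChain fun x y => TermLt lt y.1 x.1 := by
  cases ht with
  | zero => simp [Term.toSum]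
  | eps h => simp [Term.toSum]
  | sum _ _ _ _ h => exact h

theorem sizeOf_of_mem_toSum {t : Term.{v}} {x : Term.{v} × Ordinal.{v}} (hx : x ∈ t.toSum) :
    sizeOf x.1 < sizeOf t ∨ ∃ σ, t = .eps σ ∧ x = (.eps σ, 1) := by
  cases t with
  | zero => cases hx
  | eps => exact .inr ⟨_, rfl, List.mem_singleton.1 hx⟩
  | sum l =>
    left
    have := List.sizeOf_lt_of_mem (show x ∈ l from hx)
    obtain ⟨s, β⟩ := x
    simp only [Prod.mk.sizeOf_spec, Term.sum.sizeOf_spec] at *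
    omega

theorem lex_irrefl {β : Type*} {r : β → β → Prop} {l : List β} (h : ∀ a ∈ l, ¬ r a a) :
    ¬ List.Lex r l l := by
  induction l with
  | nil => rintro ⟨⟩
  | cons a l ih =>
    rw [lex_cons_iff]
    rintro (h' | ⟨-, h'⟩)
    · exact h a (by simp) h'
    · exact ih (fun a ha => h a (by simp [ha])) h'

theorem lex_trans {β : Type*} {r : β → β → Prop} {l l' l'' : List β}
    (h : ∀ a ∈ l, ∀ b ∈ l', ∀ c ∈ l'', r a b → r b c → r a c) (h₁ : List.Lex r l l')
    (h₂ : List.Lex r l' l'') : List.Lex r l l'' := by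
  induction h₁ generalizing l'' with
  | nil =>
    cases h₂ <;> exact .nil
  | rel h₁ =>
    cases h₂ with
    | cons => exact .rel h₁
    | rel h₂ => exact .rel (h _ (by simp) _ (by simp) _ (by simp) h₁ h₂)
  | cons _ ih =>
    cases h₂ with
    | cons h₂ =>
      exact .cons (ih (fun a ha b hb c hc =>
        h a (by simp [ha]) b (by simp [hb]) c (by simp [hc])) h₂)
    | rel h₂ => exact .rel h₂

theorem lex_total {β : Type*} {r : β → β → Prop} {l l' : List β}
    (h : ∀ a ∈ l, ∀ b ∈ l', r a b ∨ a = b ∨ r b a) :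
    List.Lex r l l' ∨ l = l' ∨ List.Lex r l' l := by
  induction l generalizing l' with
  | nil =>
    cases l' with
    | nil => exact .inr (.inl rfl)
    | cons => exact .inl .nil
  | cons a l ih =>
    cases l' with
    | nil => exact .inr (.inr .nil)
    | cons b l' =>
      rcases h a (by simp) b (by simp) with h' | rfl | h'
      · exact .inl (.rel h')
      · rcases ih (l' := l') fun a ha b hb => h a (by simp [ha]) b (by simp [hb]) with h' | rfl | h'
        · exact .inl (.cons h')
        · exact .inr (.inl rfl)
        · exact .inr (.inr (.cons h'))
      · exact .inr (.inr (.rel h'))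

theorem termLt_irrefl (hlt : ∀ σ, ¬ lt σ σ) {t : Term.{v}} (ht : IsTerm S lt δ t) :
    ¬ TermLt lt t t := by
  induction h : sizeOf t using Nat.strong_induction_on generalizing t with
  | _ n ih =>
    subst h
    rw [termLt_iff_lex ht ht]
    refine lex_irrefl fun x hx => ?_
    rintro (h | ⟨-, h⟩)
    · rcases sizeOf_of_mem_toSum hx with h' | ⟨σ, rfl, rfl⟩
      · exact ih _ h' (ht.of_mem_toSum hx) rfl h
      · exact hlt σ (eps_lt_eps_iff.1 h)
    · exact lt_irrefl _ h

theorem termLt_trans (hlt : ∀ σ τ ρ, lt σ τ → lt τ ρ → lt σ ρ) {r s t : Term.{v}}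
    (hr : IsTerm S lt δ r) (hs : IsTerm S lt δ s) (ht : IsTerm S lt δ t)
    (hrs : TermLt lt r s) (hst : TermLt lt s t) : TermLt lt r t := by
  induction h : sizeOf r + sizeOf s + sizeOf t using Nat.strong_induction_on
    generalizing r s t with
  | _ n ih =>
    subst h
    rw [termLt_iff_lex hr hs] at hrs
    rw [termLt_iff_lex hs ht] at hst
    rw [termLt_iff_lex hr ht]
    refine lex_trans (fun x hx y hy z hz hxy hyz => ?_) hrs hst
    have hx' := hr.of_mem_toSum hx
    have hy' := hs.of_mem_toSum hy
    have hz' := ht.of_mem_toSum hz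
    rcases hxy with hxy | ⟨hxy, hxy'⟩ <;> rcases hyz with hyz | ⟨hyz, hyz'⟩
    · left
      have key : sizeOf x.1 + sizeOf y.1 + sizeOf z.1 < sizeOf r + sizeOf s + sizeOf t →
          TermLt lt x.1 z.1 := fun h => ih _ h hx' hy' hz' hxy hyz rfl
      rcases sizeOf_of_mem_toSum hx with h₁ | ⟨σ, rfl, rfl⟩ <;>
      rcases sizeOf_of_mem_toSum hy with h₂ | ⟨τ, rfl, rfl⟩ <;>
      rcases sizeOf_of_mem_toSum hz with h₃ | ⟨ρ, rfl, rfl⟩ <;>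
      first
      | exact key (by (try simp only); omega)
      | exact eps_lt_eps_iff.2 (hlt _ _ _ (eps_lt_eps_iff.1 hxy) (eps_lt_eps_iff.1 hyz))
    · exact .inl (hyz ▸ hxy)
    · exact .inl (hxy ▸ hyz)
    · exact .inr ⟨hxy.trans hyz, hxy'.trans hyz'⟩

theorem termLt_total (hlt : ∀ σ ∈ S, ∀ τ ∈ S, lt σ τ ∨ σ = τ ∨ lt τ σ) {s t : Term.{v}}
    (hs : IsTerm S lt δ s) (ht : IsTerm S lt δ t) : TermLt lt s t ∨ s = t ∨ TermLt lt t s := by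
  induction h : sizeOf s + sizeOf t using Nat.strong_induction_on generalizing s t with
  | _ n ih =>
    subst h
    rw [termLt_iff_lex hs ht, termLt_iff_lex ht hs]
    refine (lex_total fun x hx y hy => ?_).imp_right (.imp_left (toSum_injective hs ht))
    have hx' := hs.of_mem_toSum hx
    have hy' := ht.of_mem_toSum hy
    have key : TermLt lt x.1 y.1 ∨ x.1 = y.1 ∨ TermLt lt y.1 x.1 := by
      have key : sizeOf x.1 + sizeOf y.1 < sizeOf s + sizeOf t →
          TermLt lt x.1 y.1 ∨ x.1 = y.1 ∨ TermLt lt y.1 x.1 := fun h => ih _ h hx' hy' rfl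
      rcases sizeOf_of_mem_toSum hx with h₁ | ⟨σ, rfl, rfl⟩ <;>
      rcases sizeOf_of_mem_toSum hy with h₂ | ⟨τ, rfl, rfl⟩ <;>
      first
      | exact key (by (try simp only); omega)
      | skip
      simp only [eps_lt_eps_iff, Term.eps.injEq]
      have hS : ∀ {σ}, IsTerm S lt δ (.eps σ) → σ ∈ S := by
        rintro σ ⟨⟩
        assumption
      exact hlt _ (hS hs) _ (hS ht)
    rcases key with h | h | h
    · exact .inl (.inl h)
    · rcases lt_trichotomy x.2 y.2 with h' | h' | h'
      · exact .inl (.inr ⟨h, h'⟩)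
      · exact .inr (.inl (Prod.ext h h'))
      · exact .inr (.inr (.inr ⟨h.symm, h'⟩))
    · exact .inr (.inr (.inl h))

theorem TermLt.mono (hlt : ∀ σ τ, lt σ τ → lt' σ τ) {s t : Term.{v}} (h : TermLt lt s t) :
    TermLt lt' s t := by
  induction h with
  | zero h => exact .zero h
  | eps_eps h => exact .eps_eps (hlt _ _ h)
  | eps_sum_lt _ ih => exact .eps_sum_lt ih
  | eps_sum_eq => exact .eps_sum_eq
  | sum_eps _ ih => exact .sum_eps ih
  | sum_prefix h => exact .sum_prefix h
  | sum_exponent _ ih => exact .sum_exponent ih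
  | sum_coefficient h => exact .sum_coefficient h

theorem IsTerm.mono (hS : S ⊆ S') (hlt : ∀ σ τ, lt σ τ → lt' σ τ) (hδ : δ ≤ δ') {t : Term.{v}}
    (h : IsTerm S lt δ t) : IsTerm S' lt' δ' t := by
  induction h with
  | zero => exact .zero
  | eps h => exact .eps (hS h)
  | sum h₁ _ h₃ h₄ h₅ ih =>
    exact .sum h₁ ih (fun s β h => ⟨(h₃ s β h).1, (h₃ s β h).2.trans_le hδ⟩) h₄
      (h₅.imp fun _ _ h => h.mono hlt)

end Order

/-- All ordinals that occur in the term are below `δ`. -/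
inductive TermBelow (δ : Ordinal.{v}) : Term.{v} → Prop
  | zero : TermBelow δ .zero
  | eps {σ : List Ranked.{v}} : (∀ c ∈ σ, c.1 < δ) → TermBelow δ (.eps σ)
  | sum {l : List (Term.{v} × Ordinal.{v})} : (∀ s β, (s, β) ∈ l → TermBelow δ s) →
      (∀ s β, (s, β) ∈ l → β < δ) → TermBelow δ (.sum l)

theorem TermBelow.mono {δ δ' : Ordinal.{v}} (h : δ ≤ δ') {t : Term.{v}} (ht : TermBelow δ t) :
    TermBelow δ' t := by
  induction ht with
  | zero => exact .zero
  | eps hσ => exact .eps fun c hc => (hσ c hc).trans_le h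
  | sum _ hl ih => exact .sum ih fun s β hs => (hl s β hs).trans_le h

theorem rank_lt_pair_left (x y : ZFSet.{v}) : x.rank < (ZFSet.pair x y).rank := by
  rw [ZFSet.pair]
  simp

theorem rank_lt_pair_right (x y : ZFSet.{v}) : y.rank < (ZFSet.pair x y).rank := by
  rw [ZFSet.pair]
  simp

theorem rank_lt_of_mem_list {α : Type*} [SetCode.{v} α] {l : List α} {a : α} (h : a ∈ l) :
    (code.{v} a).rank < (code.{v} l).rank := by
  induction l with
  | nil => cases h
  | cons b l ih =>
    rw [code_cons]
    rcases List.mem_cons.1 h with rfl | h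
    · exact rank_lt_pair_left _ _
    · exact (ih h).trans (rank_lt_pair_right _ _)

theorem rank_ordinal_code (o : Ordinal.{v}) : (code.{v} o).rank = o := Ordinal.rank_toZFSet o

theorem termBelow_of_rank_le {δ : Ordinal.{v}} : ∀ t : Term.{v}, (code.{v} t).rank ≤ δ →
    TermBelow δ t
  | .zero, _ => .zero
  | .eps σ, h => .eps fun c hc => by
    rw [code_term_eps] at h
    have h₁ := rank_lt_pair_left (code.{v} c.1) c.2
    rw [rank_ordinal_code] at h₁
    exact ((h₁.trans (rank_lt_of_mem_list hc)).trans (rank_lt_pair_right _ _)).trans_le h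
  | .sum l, h => by
    rw [code_term_sum] at h
    have h₁ : ∀ x ∈ l, (code.{v} x).rank < δ := fun x hx =>
      ((rank_lt_of_mem_list hx).trans (rank_lt_pair_right _ _)).trans_le h
    refine .sum (fun s β hs => ?_) fun s β hs => ?_
    · exact termBelow_of_rank_le s ((rank_lt_pair_left _ _).trans (h₁ _ hs)).le
    · have := (rank_lt_pair_right (code s) (code.{v} β)).trans (h₁ _ hs)
      rwa [rank_ordinal_code] at this
termination_by t => sizeOf t
decreasing_by
  have := List.sizeOf_lt_of_mem hs
  simp only [Prod.mk.sizeOf_spec, Term.sum.sizeOf_spec] at *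
  omega

end

section

/-! ### The compatible family of term systems -/

theorem omega_opow_ne_zero (o : Ordinal.{v}) : Ordinal.omega0.{v} ^ o ≠ 0 :=
  Ordinal.opow_ne_zero _ Ordinal.omega0_ne_zero

section Systems

variable {e : Enum.{v}} {θ : ℕ → Fml Empty 0} {o o' : Ordinal.{v}}
  (he : ∀ n, ∀ x ∈ e n, x ∈ Set.range e) (h0 : ∅ ∈ Set.range e) (h1 : {∅} ∈ Set.range e)
  {r s t : Term.{v}}

include he

theorem epsLt_irrefl (t : Term.{v}) : ¬ EpsLt e θ o t t := fun h =>
  termLt_irrefl (fun σ => KBLt_irrefl he σ) h.1 h.2.2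

theorem epsLt_trans (h : EpsLt e θ o r s) (h' : EpsLt e θ o s t) : EpsLt e θ o r t :=
  ⟨h.1, h'.2.1, termLt_trans (lt := KBLt e θ (Ordinal.omega0 ^ o)) (fun _ _ _ => KBLt_trans he) h.1
    h.2.1 h'.2.1 h.2.2 h'.2.2⟩

theorem epsTerms_mono (h : o ≤ o') : epsTerms e θ o ⊆ epsTerms e θ o' := fun _ ht =>
  IsTerm.mono (nodes_mono he (Ordinal.opow_le_opow_right Ordinal.omega0_pos h))
    (fun _ _ => KBLt_mono he (Ordinal.opow_le_opow_right Ordinal.omega0_pos h))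
    (Ordinal.opow_le_opow_right Ordinal.omega0_pos h) ht

theorem epsLt_mono (h : o ≤ o') (hst : EpsLt e θ o s t) : EpsLt e θ o' s t :=
  ⟨epsTerms_mono he h hst.1, epsTerms_mono he h hst.2.1, hst.2.2.mono fun _ _ =>
    KBLt_mono he (Ordinal.opow_le_opow_right Ordinal.omega0_pos h)⟩

include h0 h1

theorem epsLt_total (hs : s ∈ epsTerms e θ o) (ht : t ∈ epsTerms e θ o) :
    EpsLt e θ o s t ∨ s = t ∨ EpsLt e θ o t s := by
  have h := termLt_total (fun σ hσ τ hτ => KBLt_total he h0 h1 hσ hτ) hs ht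
  simpa only [EpsLt, hs, ht, true_and] using h

theorem epsLt_iff_of_le (h : o ≤ o') (hs : s ∈ epsTerms e θ o) (ht : t ∈ epsTerms e θ o) :
    EpsLt e θ o' s t ↔ EpsLt e θ o s t := by
  refine ⟨fun hst => ?_, epsLt_mono he h⟩
  rcases epsLt_total he h0 h1 hs ht with h' | rfl | h'
  · exact h'
  · exact (epsLt_irrefl he _ hst).elim
  · exact (epsLt_irrefl he _ (epsLt_trans he hst (epsLt_mono he h h'))).elim

/-- A term of a later system belongs to an earlier one if its ordinals are small enough. -/
theorem epsTerms_of_below (h : o ≤ o') (ht : t ∈ epsTerms e θ o')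
    (hb : TermBelow (Ordinal.omega0 ^ o) t) : t ∈ epsTerms e θ o := by
  have ho := Ordinal.opow_le_opow_right Ordinal.omega0_pos h
  induction ht with
  | zero => exact IsTerm.zero
  | eps hσ =>
    cases hb with
    | eps hb => exact IsTerm.eps (nodes_of_lt (omega_opow_ne_zero o') hσ hb)
  | @sum l h₁ h₂ h₃ h₄ h₅ ih =>
    cases hb with
    | sum hb hb' =>
      have hl : ∀ x ∈ l, x.1 ∈ epsTerms e θ o := fun x hx => ih x.1 x.2 hx (hb _ _ hx)
      refine IsTerm.sum h₁ (fun s β hs => hl _ hs) (fun s β hs => ⟨(h₃ s β hs).1, hb' s β hs⟩) h₄ ?_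
      rw [List.isChain_iff_forall_rel_of_append_cons_cons] at h₅ ⊢
      intro x y l₁ l₂ hl'
      have hx : x ∈ l := by simp [hl']
      have hy : y ∈ l := by simp [hl']
      exact ((epsLt_iff_of_le he h0 h1 h (hl y hy) (hl x hx)).1
        ⟨h₂ _ _ hy, h₂ _ _ hx, h₅ hl'⟩).2.2

/-- The ordinals that occur in a term are below the rank `ρ` of its code, and `ρ ≤ ω ^ ρ`. -/
theorem mem_epsTerms_rank (ht : t ∈ epsTerms e θ o) : t ∈ epsTerms e θ (code.{v} t).rank := by
  rcases le_total o (code.{v} t).rank with h | h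
  · exact epsTerms_mono he h ht
  · exact epsTerms_of_below he h0 h1 h ht
      (termBelow_of_rank_le t (Ordinal.right_le_opow _ Ordinal.one_lt_omega0))

omit he h0 h1 in
/-- Finitely many bounds below a nonzero ordinal can be merged. -/
theorem exists_lt_of_forall_list {α : Type*} {p : Ordinal.{v} → α → Prop}
    (hp : ∀ a b x, a ≤ b → p a x → p b x) (ho : 0 < o) (l : List α)
    (h : ∀ x ∈ l, ∃ a < o, p a x) : ∃ a < o, ∀ x ∈ l, p a x := by
  induction l with
  | nil => exact ⟨0, ho, by simp⟩
  | cons x l ih =>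
    obtain ⟨a, ha, hl⟩ := ih fun y hy => h y (by simp [hy])
    obtain ⟨b, hb, hx⟩ := h x (by simp)
    refine ⟨max a b, max_lt ha hb, fun y hy => ?_⟩
    rcases List.mem_cons.1 hy with rfl | hy
    · exact hp _ _ _ (le_max_right _ _) hx
    · exact hp _ _ _ (le_max_left _ _) (hl y hy)

/-- At limits, the finitely many ordinals in a term are below some `ω ^ a` with `a < o`. -/
theorem exists_termBelow (ho : Order.IsSuccLimit o) (ht : t ∈ epsTerms e θ o) :
    ∃ a < o, TermBelow (Ordinal.omega0 ^ a) t := by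
  have hpos : 0 < o := ho.bot_lt
  induction ht with
  | zero => exact ⟨0, hpos, .zero⟩
  | @eps σ hσ =>
    have := exists_lt_of_forall_list (o := o) (p := fun a (c : Ranked.{v}) =>
      c.1 < Ordinal.omega0 ^ a)
      (fun a b x h hx => hx.trans_le (Ordinal.opow_le_opow_right Ordinal.omega0_pos h)) hpos σ ?_
    · obtain ⟨a, ha, h⟩ := this
      exact ⟨a, ha, .eps h⟩
    · intro c hc
      rw [← Ordinal.lt_opow_of_isSuccLimit Ordinal.omega0_ne_zero ho]
      rcases nodes_listsOver he h0 h1 hσ c hc with ⟨h, -⟩ | ⟨h, -⟩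
      · exact (omega_opow_ne_zero o h).elim
      · exact h
  | @sum l h₁ h₂ h₃ h₄ h₅ ih =>
    have := exists_lt_of_forall_list (o := o) (p := fun a (x : Term.{v} × Ordinal.{v}) =>
        TermBelow (Ordinal.omega0 ^ a) x.1 ∧ x.2 < Ordinal.omega0 ^ a)
      (fun a b x h hx => ⟨hx.1.mono (Ordinal.opow_le_opow_right Ordinal.omega0_pos h),
        hx.2.trans_le (Ordinal.opow_le_opow_right Ordinal.omega0_pos h)⟩) hpos l ?_
    · obtain ⟨a, ha, h⟩ := this
      exact ⟨a, ha, .sum (fun s β hs => (h _ hs).1) fun s β hs => (h _ hs).2⟩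
    · intro x hx
      obtain ⟨a, ha, h⟩ := ih x.1 x.2 hx
      obtain ⟨b, hb, h'⟩ := (Ordinal.lt_opow_of_isSuccLimit Ordinal.omega0_ne_zero ho).1
        (h₃ x.1 x.2 hx).2
      exact ⟨max a b, max_lt ha hb,
        h.mono (Ordinal.opow_le_opow_right Ordinal.omega0_pos (le_max_left _ _)),
        h'.trans_le (Ordinal.opow_le_opow_right Ordinal.omega0_pos (le_max_right _ _))⟩

theorem epsTerms_limit (ho : Order.IsSuccLimit o) :
    t ∈ epsTerms e θ o ↔ ∃ a < o, t ∈ epsTerms e θ a := by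
  constructor
  · intro ht
    obtain ⟨a, ha, h⟩ := exists_termBelow he h0 h1 ho ht
    exact ⟨a, ha, epsTerms_of_below he h0 h1 ha.le ht h⟩
  · rintro ⟨a, ha, h⟩
    exact epsTerms_mono he ha.le h

end Systems

section Functions

variable {θ : ℕ → Fml Empty 0} (hθ : Nat.Primrec fun k => (θ k).godel)

include hθ

theorem exists_epsSystem : ∃ T : (Fin 2 → ZFSet.{v}) → ZFSet.{v}, SetPrimrec T ∧
    ∀ (e : Enum.{v}) (o : Ordinal.{v}), IsEpsSystem e θ o (T ![enumCode e, o.toZFSet]) := by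
  obtain ⟨X, hX, hX'⟩ := PRS.epsTerms hθ
  obtain ⟨R, hR, hR'⟩ := PRS.epsLt hθ
  refine ⟨fun x => ZFSet.pair (X (ZFSet.pair (x 0) (x 1))) (R (ZFSet.pair (x 0) (x 1))),
    (hX.comp₁ (SetPrimrec.pair (.proj 0) (.proj 1))).pair
      (hR.comp₁ (SetPrimrec.pair (.proj 0) (.proj 1))), fun e o => ?_⟩
  refine ⟨X (code (e, o)), R (code (e, o)), rfl, fun z => ?_, fun z => ?_⟩
  · rw [hX']
    simp only [code_term, eq_comm]
  · rw [hR']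
    simp only [Prod.exists, Set.mem_ofPred_eq, code_prod, code_term, eq_comm]

/-- The rank is computed by a search below the set-theoretic rank. -/
theorem exists_epsRank : ∃ rk : (Fin 2 → ZFSet.{v}) → ZFSet.{v}, SetPrimrec rk ∧
    ∀ (e : Enum.{v}) (s : ZFSet.{v}),
      (∀ o ≤ s.rank, IsLeast {o | ∃ t ∈ epsTerms e θ (o + 1), code t = s} o →
        rk ![enumCode e, s] = o.toZFSet) ∧
      ((¬ ∃ o ≤ s.rank, ∃ t ∈ epsTerms e θ (o + 1), code t = s) → rk ![enumCode e, s] = {{∅}}) := by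
  have ht {α : Type (v + 1)} [SetCode.{v} α] {f : α → Enum.{v}} {g : α → Ordinal.{v}}
      (hf : PR.{v} f) (hg : PR.{v} g) : PRS.{v} fun a => epsTerms (f a) θ (g a) :=
    (PRS.epsTerms hθ).comp (hf.prodMk hg)
  have hs : PRS.{v} fun x : Enum.{v} × ZFSet.{v} => {o | o ∈ Set.Iio (x.2.rank + 1) ∧
      (∃ t ∈ epsTerms x.1 θ (o + 1), code t = x.2) ∧
      ∀ o' ∈ Set.Iio o, ¬ ∃ t ∈ epsTerms x.1 θ (o' + 1), code t = x.2} := by fun_prop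
  obtain ⟨S, hS, hS'⟩ := hs.exists_PR
  have hF : PR.{v} fun x : Enum.{v} × ZFSet.{v} => open Classical in
      if ∃ z ∈ {z | z ∈ S x}, True then (S x).sUnion else ({{∅}} : ZFSet.{v}) := by fun_prop
  obtain ⟨F, hF, hF'⟩ := hF
  refine ⟨fun x => F (ZFSet.pair (x 0) (x 1)), hF.comp₁ (SetPrimrec.pair (.proj 0) (.proj 1)),
    fun e s => ⟨fun o ho hl => ?_, fun hn => ?_⟩⟩
  all_goals
    have hF := hF' (e, s)
    change F (ZFSet.pair (enumCode e) s) = _ at hF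
    change F (ZFSet.pair (enumCode e) s) = _
    rw [hF, code_zfset]
    beta_reduce
  · have : S (e, s) = {o.toZFSet} := by
      ext z
      rw [hS', ZFSet.mem_singleton]
      constructor
      · rintro ⟨o', ⟨h₁, h₂, h₃⟩, rfl⟩
        rw [le_antisymm (not_lt.1 fun h => h₃ o h hl.1) (hl.2 h₂)]
        rfl
      · rintro rfl
        exact ⟨o, ⟨Order.lt_add_one_iff.2 ho, hl.1, fun o' h h' => (hl.2 h').not_gt h⟩, rfl⟩
    rw [if_pos ⟨o.toZFSet, by simp [this], trivial⟩, this, ZFSet.sUnion_singleton]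
  · rw [if_neg]
    rintro ⟨z, hz, -⟩
    obtain ⟨o, ⟨h₁, h₂, -⟩, -⟩ := (hS' _ _).1 hz
    exact hn ⟨o, Order.lt_add_one_iff.1 h₁, h₂⟩

end Functions

section Model

variable {W : Set ZFSet.{v}} (hW : IsTransitiveModel W) {α : Type*} {β : Type*} [SetCode.{v} α]
  [SetCode.{v} β]

include hW

theorem IsTransitiveModel.code_mem {f : α → β} (hf : PR.{v} f) {a : α} (ha : code a ∈ W) :
    code (f a) ∈ W := by
  obtain ⟨F, hF, hF'⟩ := hf
  rw [← hF']
  exact hW.closed 1 _ hF (fun _ => code a) fun _ => ha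

theorem IsTransitiveModel.exists_cset {s : α → Set β} (hs : PRS.{v} s) {a : α} (ha : code a ∈ W) :
    ∃ S : CSet.{v} β, code S ∈ W ∧ S.toSet = s a := by
  obtain ⟨S, hS, hS'⟩ := hs.exists_cset
  exact ⟨S a, hW.code_mem hS ha, hS' a⟩

theorem IsTransitiveModel.pair_mem {a : α} {b : β} (ha : code a ∈ W) (hb : code b ∈ W) :
    code (a, b) ∈ W :=
  hW.closed 2 _ (SetPrimrec.pair (.proj 0) (.proj 1)) ![code a, code b] (by
    intro i
    fin_cases i <;> assumption)

end Model

end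

section

/-! ### From sets of terms without minimal element to sets of nodes without minimal element -/

theorem PR.toSum {α : Type*} [SetCode.{v} α] {f : α → Term.{v}} (hf : PR.{v} f) :
    PR.{v} fun a => (f a).toSum := by
  have : PR.{v} fun a => open Classical in if HasTag (zfst (code (f a))) 0 then (∅ : ZFSet.{v}) else
      if HasTag (zfst (code (f a))) 1 then ZFSet.pair (ZFSet.pair (code (f a)) (code 1)) ∅ else
        zsnd (code (f a)) := by fun_prop
  refine of_code ?_
  convert this using 2 with a
  cases f a <;> simp [Term.toSum, code_term_zero, code_term_eps, code_term_sum]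
  simp [code_nat, code_ordinal]

attribute [fun_prop] PR.toSum

section Derived

variable (e : Enum.{v}) (θ : ℕ → Fml Empty 0) (o : Ordinal.{v})

/-- The weak order of `ε(S_{ω^α}^u)`. -/
def EpsLe (s t : Term.{v}) : Prop := s = t ∨ EpsLt e θ o s t

/-- Arbitrarily small elements of `U` start with the summands in `p`. -/
def Recurs (U : Set Term.{v}) (p : List (Term.{v} × Ordinal.{v})) : Prop :=
  ∀ t ∈ U, ∃ q ∈ U, EpsLe e θ o q t ∧ p <+: q.toSum

/-- The exponents in elements of `U` that follow a list of summands that recurs. -/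
def exponents (U : Set Term.{v}) : Set Term.{v} :=
  {t | t ∈ epsTerms e θ o ∧ ∃ q ∈ U, ∃ x ∈ splits q.toSum, Recurs e θ o U x.1 ∧
    t = x.2.1.1}

/-- A nonempty set of terms without minimal element. -/
structure Descending (U : Set Term.{v}) : Prop where
  subset : ∀ t ∈ U, t ∈ epsTerms e θ o
  nonempty : ∃ t, t ∈ U
  lt : ∀ t ∈ U, ∃ s ∈ U, EpsLt e θ o s t

variable {e θ o}

theorem lex_of_append {β : Type*} {r : β → β → Prop} {l l₁ l₂ : List β} (hr : ∀ a ∈ l, ¬ r a a)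
    (h : List.Lex r (l ++ l₁) (l ++ l₂)) : List.Lex r l₁ l₂ := by
  induction l with
  | nil => exact h
  | cons a l ih =>
    rcases lex_cons_iff.1 h with h | ⟨-, h⟩
    · exact (hr a (by simp) h).elim
    · exact ih (fun a ha => hr a (by simp [ha])) h

variable (he : ∀ n, ∀ x ∈ e n, x ∈ Set.range e) (h0 : ∅ ∈ Set.range e) (h1 : {∅} ∈ Set.range e)

include he

/-- Common initial summands can be cancelled. -/
theorem EpsLt.lex_tail {s t : Term.{v}} (h : EpsLt e θ o s t)
    {p l₁ l₂ : List (Term.{v} × Ordinal.{v})} (hs : s.toSum = p ++ l₁) (ht : t.toSum = p ++ l₂) :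
    List.Lex (PairLt (KBLt e θ (Ordinal.omega0 ^ o))) l₁ l₂ := by
  have h' := (termLt_iff_lex h.1 h.2.1).1 h.2.2
  rw [hs, ht] at h'
  refine lex_of_append (fun a ha => ?_) h'
  have := IsTerm.of_mem_toSum h.1 (x := a) (by simp [hs, ha])
  rintro (h | ⟨-, h⟩)
  · exact termLt_irrefl (fun σ => KBLt_irrefl he σ) this h
  · exact lt_irrefl _ h

theorem EpsLe.trans_lt {r s t : Term.{v}} (h : EpsLe e θ o r s) (h' : EpsLt e θ o s t) :
    EpsLt e θ o r t := by
  rcases h with rfl | h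
  · exact h'
  · exact epsLt_trans he h h'

variable {U : Set Term.{v}} (hU : Descending e θ o U)

include hU

/-- Below each element of a descending set there is one that properly extends a given recurring
list of summands. -/
theorem Descending.exists_next {p : List (Term.{v} × Ordinal.{v})} (hp : Recurs e θ o U p)
    {t : Term.{v}} (ht : t ∈ U) :
    ∃ q ∈ U, EpsLt e θ o q t ∧ ∃ x l, q.toSum = p ++ x :: l := by
  obtain ⟨t', ht', htt'⟩ := hU.lt t ht
  obtain ⟨q, hq, hqt, l, hl⟩ := hp t' ht'
  have hqt' := hqt.trans_lt he htt'
  cases l with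
  | cons x l => exact ⟨q, hq, hqt', x, l, hl.symm⟩
  | nil =>
    obtain ⟨q₁, hq₁, hqq₁⟩ := hU.lt q hq
    obtain ⟨q₂, hq₂, hqq₂, l, hl'⟩ := hp q₁ hq₁
    have := (hqq₂.trans_lt he hqq₁).lex_tail he hl'.symm hl.symm
    cases this

omit he in
theorem Descending.mem_exponents {p : List (Term.{v} × Ordinal.{v})} (hp : Recurs e θ o U p)
    {q : Term.{v}} (hq : q ∈ U) {x : Term.{v} × Ordinal.{v}} {l : List (Term.{v} × Ordinal.{v})}
    (hx : q.toSum = p ++ x :: l) : x.1 ∈ exponents e θ o U :=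
  ⟨IsTerm.of_mem_toSum (hU.subset q hq) (by simp [hx]), q, hq, (p, x, l), hx, hp, rfl⟩

omit he hU in
theorem recurs_nil : Recurs e θ o U [] := fun t ht =>
  ⟨t, ht, .inl rfl, List.nil_prefix⟩

include h0 h1

/-- The exponents after recurring lists of summands have no minimal element. Otherwise let `s` be
minimal, after the list `p`, and let `β` be the least coefficient that occurs with `s` after `p`.
Then `p` with `Ω^s·β` recurs, and the exponents that follow it are smaller than `s`. -/
theorem Descending.exponents : Descending e θ o (exponents e θ o U) := by
  refine ⟨fun t ht => ht.1, ?_, ?_⟩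
  · obtain ⟨t, ht⟩ := hU.nonempty
    obtain ⟨q, hq, -, x, l, hx⟩ := hU.exists_next he recurs_nil ht
    exact ⟨x.1, hU.mem_exponents recurs_nil hq hx⟩
  · by_contra! hmin
    obtain ⟨s, ⟨hsE, q, hq, ⟨p, ⟨_, β⟩, l⟩, hx, hp, rfl⟩, hmin⟩ := hmin
    -- the least coefficient that occurs with the exponent `s` after `p`
    have hex : ∃ β, ∃ q ∈ U, ∃ l, q.toSum = p ++ (s, β) :: l := ⟨β, q, hq, l, hx⟩
    obtain ⟨β, ⟨q, hq, l, hx⟩, hβ⟩ := WellFounded.has_min (wellFounded_lt (α := Ordinal.{v}))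
      {β | ∃ q ∈ U, ∃ l, q.toSum = p ++ (s, β) :: l} hex
    have hp' : Recurs e θ o U (p ++ [(s, β)]) := by
      intro t ht
      have key : ∀ t ∈ U, EpsLe e θ o t q → ∃ q' ∈ U, EpsLe e θ o q' t ∧
          p ++ [(s, β)] <+: q'.toSum := by
        intro t ht htq
        obtain ⟨q', hq', hqt', ⟨r, γ⟩, l', hx'⟩ := hU.exists_next he hp ht
        refine ⟨q', hq', .inr hqt', ?_⟩
        have hlt : EpsLt e θ o q' q := by
          rcases htq with rfl | h
          · exact hqt'
          · exact epsLt_trans he hqt' h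
        have hr := hU.mem_exponents hp hq' hx'
        rcases lex_cons_iff.1 (hlt.lex_tail he hx' hx) with (h | ⟨h, h'⟩) | ⟨h, -⟩
        · exact (hmin r hr ⟨hr.1, hsE, h⟩).elim
        · simp only at h h'
          subst h
          exact (hβ γ ⟨q', hq', l', hx'⟩ h').elim
        · rw [hx', h]
          exact ⟨l', by simp⟩
      rcases epsLt_total he h0 h1 (hU.subset t ht) (hU.subset q hq) with h | h | h
      · exact key t ht (.inr h)
      · exact key t ht (.inl h)
      · obtain ⟨q', hq', hqq', h'⟩ := key q hq (.inl rfl)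
        exact ⟨q', hq', .inr (hqq'.trans_lt he h), h'⟩
    obtain ⟨q', hq', -, ⟨r, γ⟩, l', hx'⟩ := hU.exists_next he hp' hq
    have hr := hU.mem_exponents hp' hq' hx'
    refine hmin r hr ⟨hr.1, hsE, ?_⟩
    have hchain := IsTerm.chain (hU.subset q' hq')
    rw [List.isChain_iff_forall_rel_of_append_cons_cons] at hchain
    exact hchain (l₁ := p) (l₂ := l') (a := (s, β)) (b := (r, γ)) (by simp [hx'])

omit he h0 h1 hU

/-- The iterated sets of exponents. -/
def iterExponents (e : Enum.{v}) (θ : ℕ → Fml Empty 0) (o : Ordinal.{v}) (U : Set Term.{v}) :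
    ℕ → Set Term.{v}
  | 0 => U
  | n + 1 => exponents e θ o (iterExponents e θ o U n)

include he h0 h1 hU

theorem Descending.iter (n : ℕ) : Descending e θ o (iterExponents e θ o U n) := by
  induction n with
  | zero => exact hU
  | succ n ih => exact ih.exponents he h0 h1

/-- Each element of an iterated set of exponents lies above some `ε_σ` that belongs to one. -/
theorem Descending.exists_eps {n : ℕ} {t : Term.{v}} (ht : t ∈ iterExponents e θ o U n) :
    ∃ m σ, .eps σ ∈ iterExponents e θ o U m ∧ EpsLe e θ o (.eps σ) t := by
  have hn := hU.iter he h0 h1 n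
  have hE := hn.subset t ht
  induction hE generalizing n with
  | zero =>
    obtain ⟨s, -, h⟩ := hn.lt _ ht
    exact (not_lt_zero h.2.2).elim
  | @eps σ _ => exact ⟨n, σ, ht, .inl rfl⟩
  | @sum l h₁ h₂ h₃ h₄ h₅ ih =>
    obtain ⟨⟨s, β⟩, l, rfl⟩ := List.exists_cons_of_ne_nil h₁
    have hs := hn.mem_exponents recurs_nil ht (x := (s, β)) (l := l) rfl
    obtain ⟨m, σ, hσ, h⟩ := ih s β (by simp) (n := n + 1) hs (hU.iter he h0 h1 (n + 1))
    refine ⟨m, σ, hσ, .inr ⟨(hU.iter he h0 h1 m).subset _ hσ, hn.subset _ ht, ?_⟩⟩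
    rcases h with rfl | h
    · exact .eps_sum_eq
    · exact .eps_sum_lt h.2.2

/-- The nodes `σ` such that `ε_σ` belongs to an iterated set of exponents form a set without
minimal element. -/
theorem Descending.exists_kblt :
    (∃ n σ, .eps σ ∈ iterExponents e θ o U n) ∧
      ∀ n σ, .eps σ ∈ iterExponents e θ o U n →
        ∃ m τ, .eps τ ∈ iterExponents e θ o U m ∧ KBLt e θ (Ordinal.omega0 ^ o) τ σ := by
  constructor
  · obtain ⟨t, ht⟩ := hU.nonempty
    obtain ⟨m, σ, h, -⟩ := hU.exists_eps he h0 h1 (n := 0) ht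
    exact ⟨m, σ, h⟩
  · intro n σ hσ
    obtain ⟨t, ht, htσ⟩ := (hU.iter he h0 h1 n).lt _ hσ
    obtain ⟨m, τ, hτ, h⟩ := hU.exists_eps he h0 h1 ht
    exact ⟨m, τ, hτ, eps_lt_eps_iff.1 (h.trans_lt he htσ).2.2⟩

end Derived

section Function

variable {θ : ℕ → Fml Empty 0} (hθ : Nat.Primrec fun k => (θ k).godel)

include hθ

theorem PRS.iterExponents : PRS.{v} fun x : ((Enum.{v} × Ordinal.{v}) × CSet.{v} Term.{v}) × ℕ =>
    iterExponents x.1.1.1 θ x.1.1.2 x.1.2.toSet x.2 := by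
  have hE {α : Type (v + 1)} [SetCode.{v} α] {f : α → Enum.{v} × Ordinal.{v}} (hf : PR.{v} f) :
      PRS.{v} fun a => KPTree.epsTerms (f a).1 θ (f a).2 := (PRS.epsTerms hθ).comp hf
  have hle {α : Type (v + 1)} [SetCode.{v} α] {f : α → Enum.{v} × Ordinal.{v}} {s t : α → Term.{v}}
      (hf : PR.{v} f) (hs : PR.{v} s) (ht : PR.{v} t) :
      PR.{v} fun a => EpsLe (f a).1 θ (f a).2 (s a) (t a) := by
    have h := PR.mem (hs.prodMk ht) ((PRS.epsLt hθ).comp hf)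
    exact (hs.eq ht).or h
  refine nat_rec (s := fun (c : (Enum.{v} × Ordinal.{v}) × CSet.{v} Term.{v}) n =>
    KPTree.iterExponents c.1.1 θ c.1.2 c.2.toSet n)
    (step := fun (c : (Enum.{v} × Ordinal.{v}) × CSet.{v} Term.{v}) _ U =>
      exponents c.1.1 θ c.1.2 U) ?_ ?_ fun _ _ => rfl
  · exact PRS.toSet (by fun_prop)
  · unfold exponents Recurs
    fun_prop

end Function

/-- In a transitive model, a nonempty set of terms without minimal element gives rise to a nonempty
set of nodes without minimal element. -/
theorem exists_descending_nodes {θ : ℕ → Fml Empty 0} (hθ : Nat.Primrec fun k => (θ k).godel)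
    {e : Enum.{v}} (he : ∀ n, ∀ x ∈ e n, x ∈ Set.range e) (h0 : ∅ ∈ Set.range e)
    (h1 : {∅} ∈ Set.range e) {W : Set ZFSet.{v}} (hW : IsTransitiveModel W) (heW : code e ∈ W)
    {o : Ordinal.{v}} (ho : code o ∈ W) {A : CSet.{v} Term.{v}} (hA : code A ∈ W)
    (hsub : ∀ t ∈ A.toSet, t ∈ epsTerms e θ o) (hne : ∃ t, t ∈ A.toSet)
    (hlt : ∀ t ∈ A.toSet, ∃ s ∈ A.toSet, EpsLt e θ o s t) :
    ∃ B : CSet.{v} (List Ranked.{v}), code B ∈ W ∧ (∃ σ, σ ∈ B.toSet) ∧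
      ∀ σ ∈ B.toSet, ∃ τ ∈ B.toSet, KBLt e θ (Ordinal.omega0 ^ o) τ σ := by
  have hE {α : Type (v + 1)} [SetCode.{v} α] {f : α → Enum.{v} × Ordinal.{v}} (hf : PR.{v} f) :
      PRS.{v} fun a => KPTree.epsTerms (f a).1 θ (f a).2 := (PRS.epsTerms hθ).comp hf
  have hdesc : Descending e θ o A.toSet := ⟨hsub, hne, hlt⟩
  have hI {α : Type (v + 1)} [SetCode.{v} α] {f : α → Enum.{v} × Ordinal.{v}}
      {g : α → CSet.{v} Term.{v}} {n : α → ℕ} (hf : PR.{v} f) (hg : PR.{v} g) (hn : PR.{v} n) :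
      PRS.{v} fun a => iterExponents (f a).1 θ (f a).2 (g a).toSet (n a) :=
    (PRS.iterExponents hθ).comp ((hf.prodMk hg).prodMk hn)
  have hN {α : Type (v + 1)} [SetCode.{v} α] {f : α → Enum.{v} × Ordinal.{v}} (hf : PR.{v} f) :
      PRS.{v} fun a => nodes (f a).1 θ (Ordinal.omega0 ^ (f a).2) := (PRS.index hθ).comp hf
  obtain ⟨B, hBW, hB⟩ := hW.exists_cset
    (s := fun x : (Enum.{v} × Ordinal.{v}) × CSet.{v} Term.{v} =>
      {σ | σ ∈ nodes x.1.1 θ (Ordinal.omega0 ^ x.1.2) ∧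
      ∃ n ∈ (Set.univ : Set ℕ), .eps σ ∈ iterExponents x.1.1 θ x.1.2 x.2.toSet n})
    (a := ((e, o), A)) (by fun_prop) (hW.pair_mem (hW.pair_mem heW ho) hA)
  simp only at hB
  obtain ⟨⟨n, σ, hσ⟩, hB'⟩ := hdesc.exists_kblt he h0 h1
  have hmem : ∀ {n σ}, .eps σ ∈ iterExponents e θ o A.toSet n → σ ∈ B.toSet := by
    intro n σ h
    rw [hB]
    refine ⟨?_, n, trivial, h⟩
    have := (hdesc.iter he h0 h1 n).subset _ h
    cases this
    assumption
  refine ⟨B, hBW, ⟨σ, hmem hσ⟩, fun σ hσ => ?_⟩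
  rw [hB] at hσ
  obtain ⟨-, n, -, hσ⟩ := hσ
  obtain ⟨m, τ, hτ, h⟩ := hB' n σ hσ
  exact ⟨τ, hmem hτ, h⟩

end

section

/-! ### Branches through sets of nodes without minimal element -/

section Branch

/-- Arbitrarily small elements of `B` in the Kleene-Brouwer ordering extend `p`. -/
def Dense {β : Type*} (r : β → β → Prop) (B : Set (List β)) (p : List β) : Prop :=
  ∀ τ ∈ B, ∃ q ∈ B, (q = τ ∨ KB r q τ) ∧ p <+: q

theorem KB.of_append {β : Type*} {r : β → β → Prop} (hr : ∀ a, ¬ r a a) {p l l' : List β}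
    (h : KB r (p ++ l) (p ++ l')) : KB r l l' := by
  induction p with
  | nil => exact h
  | cons a p ih =>
    rcases h with _ | h | h
    · exact (hr a h).elim
    · exact ih h

variable {β : Type*} {r : β → β → Prop} {M : Set β} (hr : WellOrderOn r M)
  (htr : ∀ a b c, r a b → r b c → r a c) {B : Set (List β)} (hB : ∀ σ ∈ B, σ ∈ listsOver M)
  (hne : ∃ σ, σ ∈ B) (hlt : ∀ σ ∈ B, ∃ τ ∈ B, KB r τ σ)

theorem dense_nil : Dense r B [] := fun τ hτ => ⟨τ, hτ, .inl rfl, List.nil_prefix⟩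

theorem Dense.of_prefix {p p' : List β} (h : Dense r B p) (hp : p' <+: p) : Dense r B p' := by
  intro τ hτ
  obtain ⟨q, hq, hqτ, hpq⟩ := h τ hτ
  exact ⟨q, hq, hqτ, hp.trans hpq⟩

include hr htr hB hne hlt

omit hr hB hne in
theorem Dense.exists_lt {p : List β} (h : Dense r B p) {τ : List β} (hτ : τ ∈ B) :
    ∃ q ∈ B, KB r q τ ∧ p <+: q := by
  obtain ⟨ρ, hρ, hρτ⟩ := hlt τ hτ
  obtain ⟨q, hq, hqρ, hpq⟩ := h ρ hρ
  refine ⟨q, hq, ?_, hpq⟩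
  rcases hqρ with rfl | hqρ
  · exact hρτ
  · exact hqρ.trans htr hρτ

/-- A dense list has a dense extension by one entry, namely by the least entry that occurs after it
in elements of `B`. -/
theorem Dense.exists_append {p : List β} (h : Dense r B p) : ∃ a, Dense r B (p ++ [a]) := by
  -- an element of `B` below a proper extension of `p` that extends `p` is a proper extension
  have hext : ∀ {q₀ a l}, q₀ = p ++ a :: l → ∀ {q}, KB r q q₀ → p <+: q →
      ∃ c l', q = p ++ c :: l' ∧ (r c a ∨ c = a) := by
    rintro _ a l rfl q hq ⟨l', rfl⟩
    have := hq.of_append hr.irrefl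
    cases this with
    | rel h => exact ⟨_, _, rfl, .inl h⟩
    | cons h => exact ⟨_, _, rfl, .inr rfl⟩
  have hex : ∃ a, ∃ q ∈ B, ∃ l, q = p ++ a :: l := by
    obtain ⟨σ, hσ⟩ := hne
    obtain ⟨q, hq, -, l, rfl⟩ := h.exists_lt htr hlt hσ
    cases l with
    | cons a l => exact ⟨a, _, hq, l, rfl⟩
    | nil =>
      obtain ⟨q', hq', hlt', l, rfl⟩ := h.exists_lt htr hlt hq
      have := hlt'.of_append hr.irrefl
      cases this
      exact ⟨_, _, hq', _, rfl⟩
  obtain ⟨a, ⟨q₀, hq₀, l₀, hl₀⟩, ha⟩ := hr.wf.has_min {a | ∃ q ∈ B, ∃ l, q = p ++ a :: l} hex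
  refine ⟨a, fun τ hτ => ?_⟩
  have key : ∀ τ ∈ B, (τ = q₀ ∨ KB r τ q₀) → ∃ q ∈ B, KB r q τ ∧ p ++ [a] <+: q := by
    intro τ hτ hle
    obtain ⟨q, hq, hqτ, hpq⟩ := h.exists_lt htr hlt hτ
    refine ⟨q, hq, hqτ, ?_⟩
    have hq₀ : KB r q q₀ := by
      rcases hle with rfl | hle
      · exact hqτ
      · exact hqτ.trans htr hle
    obtain ⟨c, l', rfl, hc | rfl⟩ := hext hl₀ hq₀ hpq
    · exact (ha c ⟨_, hq, l', rfl⟩ hc).elim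
    · exact ⟨l', by simp⟩
  rcases KB.total hr.total (hB τ hτ) (hB q₀ hq₀) with h' | h' | h'
  · obtain ⟨q, hq, h₁, h₂⟩ := key τ hτ (.inr h')
    exact ⟨q, hq, .inr h₁, h₂⟩
  · obtain ⟨q, hq, h₁, h₂⟩ := key τ hτ (.inl h')
    exact ⟨q, hq, .inr h₁, h₂⟩
  · obtain ⟨q, hq, h₁, h₂⟩ := key q₀ hq₀ (.inl rfl)
    exact ⟨q, hq, .inr (h₁.trans htr h'), h₂⟩

/-- Below an extension of `p` by `a`, no list extends `p` by an entry greater than `a`. -/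
theorem Dense.unique {p : List β} {a b : β} (ha : Dense r B (p ++ [a]))
    (hb : Dense r B (p ++ [b])) : a = b := by
  have key : ∀ {a b : β}, Dense r B (p ++ [a]) → Dense r B (p ++ [b]) → ¬ r a b := by
    intro a b ha hb hab
    obtain ⟨σ, hσ⟩ := hne
    obtain ⟨q, hq, -, l, rfl⟩ := ha.exists_lt htr hlt hσ
    obtain ⟨q', hq', h, l', rfl⟩ := hb.exists_lt htr hlt hq
    rw [List.append_assoc, List.append_assoc] at h
    have := h.of_append hr.irrefl
    cases this with
    | rel h => exact hr.irrefl _ (htr _ _ _ hab h)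
    | cons => exact hr.irrefl _ hab
  have hmem : ∀ {a : β}, Dense r B (p ++ [a]) → a ∈ M := by
    intro a ha
    obtain ⟨σ, hσ⟩ := hne
    obtain ⟨q, hq, -, l, rfl⟩ := ha.exists_lt htr hlt hσ
    exact hB _ hq a (by simp)
  rcases hr.total a (hmem ha) b (hmem hb) with h | h | h
  · exact (key ha hb h).elim
  · exact h
  · exact (key hb ha h).elim

theorem Dense.eq_of_length {p q : List β} (hp : Dense r B p) (hq : Dense r B q)
    (h : p.length = q.length) : p = q := by
  induction p using List.reverseRecOn generalizing q with
  | nil => exact (List.length_eq_zero_iff.1 h.symm).symm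
  | append_singleton p a ih =>
    induction q using List.reverseRecOn with
    | nil => simp at h
    | append_singleton q b _ =>
      obtain rfl := ih (hp.of_prefix ⟨_, rfl⟩) (hq.of_prefix ⟨_, rfl⟩) (by simpa using h)
      rw [Dense.unique hr htr hB hne hlt hp hq]

/-- The lists that are extended by arbitrarily small elements of `B` form an infinite branch. -/
theorem exists_branch : ∃ f : ℕ → β, ∀ p, Dense r B p ↔ ∃ n, p = (List.range n).map f := by
  have : Nonempty β := ⟨(dense_nil.exists_append hr htr hB hne hlt).choose⟩
  choose! g hg using fun p (h : Dense r B p) => h.exists_append hr htr hB hne hlt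
  let G : ℕ → List β := fun n => Nat.rec [] (fun _ p => p ++ [g p]) n
  have hG : ∀ n, Dense r B (G n) := by
    intro n
    induction n with
    | zero => exact dense_nil
    | succ n ih => exact hg _ ih
  have hG' : ∀ n, G n = (List.range n).map fun n => g (G n) := by
    intro n
    induction n with
    | zero => rfl
    | succ n ih => rw [List.range_succ, List.map_append, ← ih]; rfl
  refine ⟨fun n => g (G n), fun p => ⟨fun hp => ⟨p.length, ?_⟩, ?_⟩⟩
  · rw [← hG']
    refine hp.eq_of_length hr htr hB hne hlt (hG _) ?_
    rw [hG']
    simp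
  · rintro ⟨n, rfl⟩
    rw [← hG']
    exact hG n

end Branch

end

section

/-! ### The formulas on an infinite branch are false -/

section Sat

variable {P : Type*} {val : P → ZFSet.{v}} {M : Set ZFSet.{v}}

theorem sat_neg {n : ℕ} (φ : Fml P n) (x : Fin n → ZFSet.{v}) :
    φ.neg.Sat val M x ↔ ¬ φ.Sat val M x := by
  induction φ with
  | mem | nmem | eq | ne => simp [Fml.neg, Fml.Sat]
  | and φ ψ ih₁ ih₂ => simp only [Fml.neg, Fml.Sat, ih₁, ih₂]; tauto
  | or φ ψ ih₁ ih₂ => simp only [Fml.neg, Fml.Sat, ih₁, ih₂]; tauto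
  | all φ ih => simp only [Fml.neg, Fml.Sat, ih]; push Not; rfl
  | ex φ ih => simp only [Fml.neg, Fml.Sat, ih]; push Not; rfl

theorem eval_inst (a : P) {n : ℕ} (t : Tm P (n + 1)) (x : Fin n → ZFSet.{v}) :
    (t.inst a).eval val x = t.eval val (Fin.cons (val a) x : Fin (n + 1) → ZFSet.{v}) := by
  cases t with
  | var i => cases i using Fin.cases <;> simp [Tm.inst, Tm.eval]
  | par p => rfl

theorem sat_inst (a : P) : ∀ {n : ℕ} (φ : Fml P (n + 1)) (x : Fin n → ZFSet.{v}),
    (φ.inst a).Sat val M x ↔ φ.Sat val M (Fin.cons (val a) x : Fin (n + 1) → ZFSet.{v})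
  | _, .mem s t, x => by simp only [Fml.inst, Fml.Sat, eval_inst]
  | _, .nmem s t, x => by simp only [Fml.inst, Fml.Sat, eval_inst]
  | _, .eq s t, x => by simp only [Fml.inst, Fml.Sat, eval_inst]
  | _, .ne s t, x => by simp only [Fml.inst, Fml.Sat, eval_inst]
  | _, .and φ ψ, x => by simp only [Fml.inst, Fml.Sat, sat_inst a φ, sat_inst a ψ]
  | _, .or φ ψ, x => by simp only [Fml.inst, Fml.Sat, sat_inst a φ, sat_inst a ψ]
  | _, .all φ, x => by
    simp only [Fml.inst, Fml.Sat, sat_inst a φ, Fin.cons_snoc_eq_snoc_cons]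
  | _, .ex φ, x => by
    simp only [Fml.inst, Fml.Sat, sat_inst a φ, Fin.cons_snoc_eq_snoc_cons]

/-- The number of connectives and quantifiers. -/
def Fml.size : ∀ {n : ℕ}, Fml P n → ℕ
  | _, .mem _ _ => 0
  | _, .nmem _ _ => 0
  | _, .eq _ _ => 0
  | _, .ne _ _ => 0
  | _, .and φ ψ => φ.size + ψ.size + 1
  | _, .or φ ψ => φ.size + ψ.size + 1
  | _, .all φ => φ.size + 1
  | _, .ex φ => φ.size + 1

theorem size_inst (a : P) : ∀ {n : ℕ} (φ : Fml P (n + 1)), (φ.inst a).size = φ.size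
  | _, .mem s t => by simp only [Fml.inst, Fml.size]
  | _, .nmem s t => by simp only [Fml.inst, Fml.size]
  | _, .eq s t => by simp only [Fml.inst, Fml.size]
  | _, .ne s t => by simp only [Fml.inst, Fml.size]
  | _, .and φ ψ => by simp only [Fml.inst, Fml.size, size_inst a φ, size_inst a ψ]
  | _, .or φ ψ => by simp only [Fml.inst, Fml.size, size_inst a φ, size_inst a ψ]
  | _, .all φ => by simp only [Fml.inst, Fml.size, size_inst a φ]
  | _, .ex φ => by simp only [Fml.inst, Fml.size, size_inst a φ]

end Sat

section Branch

/-- The nodes `f 0, …, f (n-1)` with labels `Γ n` form an infinite branch of the search tree. -/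
structure IsBranch (e : Enum.{v}) (θ : ℕ → Fml Empty 0) (o : Ordinal.{v}) (f : ℕ → Ranked.{v})
    (Γ : ℕ → Sequent.{v}) : Prop where
  step : ∀ n, (f n, Γ (n + 1)) ∈ children e θ o ((List.range n).map f) (Γ n)

theorem exists_isBranch {e : Enum.{v}} {θ : ℕ → Fml Empty 0} {o : Ordinal.{v}} {f : ℕ → Ranked.{v}}
    (h : ∀ n, (List.range n).map f ∈ nodes e θ o) : ∃ Γ, IsBranch e θ o f Γ := by
  choose Γ hΓ using h
  refine ⟨Γ, ⟨fun n => ?_⟩⟩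
  have h := hΓ (n + 1)
  rw [List.range_succ, List.map_append, List.map_singleton, searchTree_append_iff] at h
  obtain ⟨Δ, h₁, h₂⟩ := h
  rwa [searchTree_unique (hΓ n) h₁]

variable {e : Enum.{v}} {θ : ℕ → Fml Empty 0} {o : Ordinal.{v}} {f : ℕ → Ranked.{v}}
  {Γ : ℕ → Sequent.{v}} (h : IsBranch e θ o f Γ)

include h

theorem IsBranch.even (k : ℕ) : Γ (2 * k + 1) = Γ (2 * k) ++ [(θ k).ofPure.neg] := by
  have := h.step (2 * k)
  rw [children_even (k := k) (by simp)] at this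
  exact (Prod.ext_iff.1 this).2

theorem IsBranch.odd {n : ℕ} (hn : n % 2 = 1) :
    ¬ HasTrueDelta0 (Γ n) ∧ (((∀ χ ∈ Γ n, χ.IsLiteral) ∧ Γ (n + 1) = Γ n) ∨ ∃ Γ₁ φ Γ₂,
        Γ n = Γ₁ ++ φ :: Γ₂ ∧ (∀ χ ∈ Γ₁, χ.IsLiteral) ∧
          (f n, Γ (n + 1)) ∈ expand e o ((List.range n).map f) (Γ₁, φ, Γ₂)) := by
  have := h.step n
  rw [children_odd (by simpa using hn)] at this
  refine ⟨this.1, this.2.imp_left fun h => ⟨h.1, (Prod.ext_iff.1 h.2).2⟩⟩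

theorem IsBranch.mem_succ {n : ℕ} {φ : Fml Ranked.{v} 0} (hφ : φ ∈ Γ n) : φ ∈ Γ (n + 1) := by
  rcases Nat.even_or_odd' n with ⟨k, rfl | rfl⟩
  · rw [h.even]
    simp [hφ]
  · rcases (h.odd (n := 2 * k + 1) (by omega)).2 with ⟨-, h'⟩ | ⟨Γ₁, χ, Γ₂, h₁, -, h'⟩
    · rwa [h']
    · obtain ⟨Δ, h'⟩ := expand_mem h'
      simp only at h'
      rw [h₁] at hφ
      rw [h']
      simp only [List.mem_append, List.mem_cons] at hφ ⊢
      tauto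

theorem IsBranch.mem_of_le {n m : ℕ} (hnm : n ≤ m) {φ : Fml Ranked.{v} 0} (hφ : φ ∈ Γ n) :
    φ ∈ Γ m := by
  induction m, hnm using Nat.le_induction with
  | base => exact hφ
  | succ m _ ih => exact h.mem_succ ih

open Classical in
/-- Each formula on the branch that is not a literal is expanded later on. -/
theorem IsBranch.exists_expand {n : ℕ} {φ : Fml Ranked.{v} 0} (hφ : φ ∈ Γ n)
    (hl : ¬ φ.IsLiteral) : ∃ m ≥ n, ∃ Γ₁ Γ₂, Γ m = Γ₁ ++ φ :: Γ₂ ∧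
      (f m, Γ (m + 1)) ∈ expand e o ((List.range m).map f) (Γ₁, φ, Γ₂) := by
  obtain ⟨Γ₁, Γ₂, hΓ⟩ := List.mem_iff_append.1 hφ
  -- induction on the number of formulas before `φ` that are not literals
  induction hk : Γ₁.countP (fun χ => ¬ χ.IsLiteral) generalizing n Γ₁ Γ₂ with
  | zero =>
    have key : ∀ {n Γ₂}, n % 2 = 1 → Γ n = Γ₁ ++ φ :: Γ₂ →
        (f n, Γ (n + 1)) ∈ expand e o ((List.range n).map f) (Γ₁, φ, Γ₂) := by
      intro n Γ₂ hn hΓ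
      have hl₁ : ∀ χ ∈ Γ₁, χ.IsLiteral := by simpa using hk
      rcases (h.odd hn).2 with ⟨h', -⟩ | ⟨Γ₁', χ, Γ₂', h₁, h₂, h'⟩
      · exact (hl (h' φ (by simp [hΓ]))).elim
      · obtain ⟨rfl, rfl, rfl⟩ := first_unique (hΓ.symm.trans h₁) hl₁ h₂ hl
          (not_isLiteral_of_expand h')
        exact h'
    rcases Nat.even_or_odd' n with ⟨k, rfl | rfl⟩
    · have hΓ' : Γ (2 * k + 1) = Γ₁ ++ φ :: (Γ₂ ++ [(θ k).ofPure.neg]) := by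
        rw [h.even, hΓ]
        simp
      exact ⟨2 * k + 1, by omega, _, _, hΓ', key (by omega) hΓ'⟩
    · exact ⟨2 * k + 1, le_rfl, _, _, hΓ, key (by omega) hΓ⟩
  | succ k ih =>
    have key : ∀ {n Γ₂}, n % 2 = 1 → Γ n = Γ₁ ++ φ :: Γ₂ → ∃ Δ₁ Δ₂, Γ (n + 1) = Δ₁ ++ φ :: Δ₂ ∧
        Δ₁.countP (fun χ => ¬ χ.IsLiteral) = k := by
      intro n Γ₂ hn hΓ
      obtain ⟨χ', hχ', hχ''⟩ : ∃ χ ∈ Γ₁, ¬ χ.IsLiteral := by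
        by_contra! hc
        rw [List.countP_eq_zero.2 (by simpa using hc)] at hk
        omega
      rcases (h.odd hn).2 with ⟨h', -⟩ | ⟨Γ₁', χ, Γ₂', h₁, h₂, h'⟩
      · exact (hl (h' φ (by simp [hΓ]))).elim
      have hχ := not_isLiteral_of_expand h'
      obtain ⟨Δ, hΔ⟩ := expand_mem h'
      simp only at hΔ
      rw [hΓ] at h₁
      rcases List.append_eq_append_iff.1 h₁ with ⟨l, rfl, hl'⟩ | ⟨l, rfl, hl'⟩
      · exact (hχ'' (h₂ χ' (by simp [hχ']))).elim
      · cases l with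
        | nil => simp at hχ'; exact (hχ'' (h₂ χ' hχ')).elim
        | cons c l =>
          simp only [List.cons_append, List.cons.injEq] at hl'
          obtain ⟨rfl, rfl⟩ := hl'
          refine ⟨Γ₁' ++ l, Γ₂ ++ χ :: Δ, by simp [hΔ], ?_⟩
          simp only [List.countP_append, List.countP_cons, hχ, not_false_eq_true, decide_true,
            if_true] at hk ⊢
          omega
    rcases Nat.even_or_odd' n with ⟨m, rfl | rfl⟩
    · have hΓ' : Γ (2 * m + 1) = Γ₁ ++ φ :: (Γ₂ ++ [(θ m).ofPure.neg]) := by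
        rw [h.even, hΓ]
        simp
      obtain ⟨Δ₁, Δ₂, hΔ, hk'⟩ := key (by omega) hΓ'
      obtain ⟨m', hm', h'⟩ := ih (by simp [hΔ]) _ _ hΔ hk'
      exact ⟨m', by omega, h'⟩
    · obtain ⟨Δ₁, Δ₂, hΔ, hk'⟩ := key (by omega) hΓ
      obtain ⟨m', hm', h'⟩ := ih (by simp [hΔ]) _ _ hΔ hk'
      exact ⟨m', by omega, h'⟩

/-- `Δ₀`-formulas on the branch are false. -/
theorem IsBranch.not_sat_of_isDelta0 {n : ℕ} {φ : Fml Ranked.{v} 0} (hφ : φ ∈ Γ n)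
    (hd : φ.IsDelta0) : ¬ φ.Sat Prod.snd Set.univ Fin.elim0 := fun hs =>
  (h.odd (n := 2 * n + 1) (by omega)).1 ⟨φ, h.mem_of_le (by omega) hφ, hd, hs⟩

omit h in
/-- The list of all candidates for witnesses along the branch. -/
def limitCandidate (e : Enum.{v}) (f : ℕ → Ranked.{v}) (i : ℕ) : Ranked.{v} :=
  if i % 2 = 0 then (0, e (i / 2)) else f (i / 2)

omit h in
theorem candidate_eq {i n : ℕ} (hi : i < 2 * n) :
    candidate e ((List.range n).map f) i = limitCandidate e f i := by
  rw [candidate, limitCandidate, dif_pos (by simpa using hi)]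
  simp

/-- All instances of an existential formula on the branch with candidates as witnesses occur on
the branch. -/
theorem IsBranch.exists_inst_mem {n : ℕ} {ψ : Fml Ranked.{v} 1} (hψ : .ex ψ ∈ Γ n) (i : ℕ) :
    ∃ m, ψ.inst (limitCandidate e f i) ∈ Γ m := by
  induction i using Nat.strong_induction_on with
  | _ i ih =>
    obtain ⟨N, hN⟩ : ∃ N, ∀ j < i, ψ.inst (limitCandidate e f j) ∈ Γ N := by
      choose! g hg using ih
      refine ⟨(Finset.range i).sup g, fun j hj => h.mem_of_le ?_ (hg j hj)⟩
      exact Finset.le_sup (Finset.mem_range.2 hj)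
    obtain ⟨m, hm, Γ₁, Γ₂, hΓ, h'⟩ := h.exists_expand (n := n + N + i + 1)
      (h.mem_of_le (by omega) hψ) (by rintro ⟨⟩)
    have hc : ∀ j ≤ i, candidate e ((List.range m).map f) j = limitCandidate e f j := fun j hj =>
      candidate_eq (by omega)
    rcases h' with (((⟨_, ⟨⟩, -⟩ | ⟨_, ⟨⟩, -⟩) | ⟨_, ⟨⟩, -⟩) | ⟨_, ⟨⟩, i', ⟨-, h₁, h₂⟩, h'⟩) |
      ⟨_, ⟨⟨⟩, h'⟩, -⟩
    · simp only at h₁ h₂ h'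
      rw [← hΓ] at h₁ h₂
      rcases lt_trichotomy i' i with hi | rfl | hi
      · rw [hc i' hi.le] at h₁
        exact (h₁ (h.mem_of_le (by omega) (hN i' hi))).elim
      · refine ⟨m + 1, ?_⟩
        have h' := (Prod.ext_iff.1 h').2
        simp only at h'
        rw [h', hc i' le_rfl]
        simp
      · have := h₂ i hi
        rw [hc i le_rfl] at this
        exact ⟨m, this⟩
    · have := h' i trivial
      rw [← hΓ, hc i le_rfl] at this
      exact ⟨m, this⟩

/-- All formulas on the branch are false in the structure that consists of `u` and the entries of
the branch. -/
theorem IsBranch.not_sat {n : ℕ} {φ : Fml Ranked.{v} 0} (hφ : φ ∈ Γ n) :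
    ¬ φ.Sat Prod.snd (Set.range e ∪ Set.range fun n => (f n).2) Fin.elim0 := by
  induction hs : φ.size using Nat.strong_induction_on generalizing φ n with
  | _ s ih =>
    subst hs
    have hlit : φ.IsLiteral → ¬ φ.Sat Prod.snd (Set.range e ∪ Set.range fun n => (f n).2)
      Fin.elim0 := by
      intro hl hs
      refine h.not_sat_of_isDelta0 hφ (.lit hl) ?_
      cases hl <;> exact hs
    have hx : ∀ a : ZFSet.{v}, (Fin.snoc (α := fun _ => ZFSet.{v}) Fin.elim0 a : Fin 1 →
      ZFSet.{v}) =
        Fin.cons a Fin.elim0 := by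
      intro a
      funext i
      fin_cases i
      rfl
    cases φ with
    | mem => exact hlit (.mem _ _)
    | nmem => exact hlit (.nmem _ _)
    | eq => exact hlit (.eq _ _)
    | ne => exact hlit (.ne _ _)
    | and ψ₀ ψ₁ =>
      obtain ⟨m, hm, Γ₁, Γ₂, hΓ, h'⟩ := h.exists_expand hφ (by rintro ⟨⟩)
      rintro ⟨hs₀, hs₁⟩
      rcases h' with (((⟨⟨a, b⟩, hp, h' | h'⟩ | ⟨_, ⟨⟩, -⟩) | ⟨_, ⟨⟩, -⟩) | ⟨_, ⟨⟩, -⟩) | ⟨_,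
        ⟨⟨⟩, -⟩, -⟩ <;>
        obtain ⟨rfl, rfl⟩ : ψ₀ = a ∧ ψ₁ = b := by simpa [andParts] using hp
      · have h' := (Prod.ext_iff.1 h').2
        simp only at h'
        exact ih ψ₀.size (by simp only [Fml.size]; omega) (n := m + 1) (by simp [h']) rfl hs₀
      · have h' := (Prod.ext_iff.1 h').2
        simp only at h'
        exact ih ψ₁.size (by simp only [Fml.size]; omega) (n := m + 1) (by simp [h']) rfl hs₁
    | or ψ₀ ψ₁ =>
      have key : ∀ {n}, .or ψ₀ ψ₁ ∈ Γ n →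
          ∃ m ≥ n, (ψ₀ ∈ Γ m ∧ ψ₁ ∈ Γ (m + 1)) ∨ ψ₀ ∈ Γ (m + 1) := by
        intro n hφ
        obtain ⟨m, hm, Γ₁, Γ₂, hΓ, h'⟩ := h.exists_expand hφ (by rintro ⟨⟩)
        rcases h' with (((⟨_, ⟨⟩, -⟩ | ⟨⟨a, b⟩, hp, h'⟩) | ⟨_, ⟨⟩, -⟩) | ⟨_, ⟨⟩, -⟩) | ⟨_, ⟨⟨⟩, -⟩,
          -⟩
        obtain ⟨rfl, rfl⟩ : ψ₀ = a ∧ ψ₁ = b := by simpa [orParts] using hp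
        have h' := (Prod.ext_iff.1 h').2
        simp only at h'
        refine ⟨m, hm, ?_⟩
        split_ifs at h' with hc
        · exact .inl ⟨by rw [hΓ]; exact hc, by simp [h']⟩
        · exact .inr (by simp [h'])
      obtain ⟨m, hm, h₀⟩ : ∃ m ≥ n, ψ₀ ∈ Γ m := by
        obtain ⟨m, hm, h' | h'⟩ := key hφ
        · exact ⟨m, hm, h'.1⟩
        · exact ⟨m + 1, by omega, h'⟩
      rintro (hs₀ | hs₁)
      · exact ih ψ₀.size (by simp only [Fml.size]; omega) h₀ rfl hs₀
      · obtain ⟨m', hm', Γ₁, Γ₂, hΓ, h'⟩ := h.exists_expand (h.mem_of_le hm hφ) (by rintro ⟨⟩)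
        rcases h' with (((⟨_, ⟨⟩, -⟩ | ⟨⟨a, b⟩, hp, h'⟩) | ⟨_, ⟨⟩, -⟩) | ⟨_, ⟨⟩, -⟩) | ⟨_, ⟨⟨⟩, -⟩,
          -⟩
        obtain ⟨rfl, rfl⟩ : ψ₀ = a ∧ ψ₁ = b := by simpa [orParts] using hp
        have h' := (Prod.ext_iff.1 h').2
        simp only at h'
        rw [← hΓ, if_pos (h.mem_of_le hm' h₀)] at h'
        exact ih ψ₁.size (by simp only [Fml.size]; omega) (n := m' + 1) (by simp [h']) rfl hs₁
    | all ψ =>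
      obtain ⟨m, hm, Γ₁, Γ₂, hΓ, h'⟩ := h.exists_expand hφ (by rintro ⟨⟩)
      intro hs
      rcases h' with (((⟨_, ⟨⟩, -⟩ | ⟨_, ⟨⟩, -⟩) | ⟨_, ⟨⟩, a, -, h'⟩) | ⟨_, ⟨⟩, -⟩) | ⟨_, ⟨⟨⟩, -⟩,
        -⟩
      obtain ⟨rfl, h'⟩ := Prod.ext_iff.1 h'
      simp only at h'
      refine ih ψ.size (by simp only [Fml.size]; omega) (n := m + 1) (φ := ψ.inst (f m))
        (by simp [h']) (size_inst _ _) ?_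
      rw [sat_inst, ← hx]
      exact hs _ (.inr ⟨m, rfl⟩)
    | ex ψ =>
      rintro ⟨b, hb, hs⟩
      obtain ⟨i, rfl⟩ : ∃ i, (limitCandidate e f i).2 = b := by
        rcases hb with ⟨k, rfl⟩ | ⟨k, rfl⟩
        · exact ⟨2 * k, by simp [limitCandidate]⟩
        · refine ⟨2 * k + 1, ?_⟩
          rw [limitCandidate, if_neg (by omega), show (2 * k + 1) / 2 = k by omega]
      obtain ⟨m, hm⟩ := h.exists_inst_mem hφ i
      refine ih ψ.size (by simp only [Fml.size]; omega) hm (size_inst _ _) ?_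
      rw [sat_inst, ← hx]
      exact hs

/-- The structure read off from an infinite branch satisfies the axioms. -/
theorem IsBranch.sat_axiom (k : ℕ) :
    (θ k).Sat Empty.elim (Set.range e ∪ Set.range fun n => (f n).2) Fin.elim0 := by
  have := h.not_sat (n := 2 * k + 1) (φ := (θ k).ofPure.neg) (by simp [h.even])
  rwa [sat_neg, not_not, sat_ofPure] at this

end Branch

end

section

/-! ### The collapse of a structure -/

/-- The Mostowski collapse of `(m, ∈)` is primitive recursive. -/
theorem exists_collapse : ∃ c : ZFSet.{v} → ZFSet.{v} → ZFSet.{v},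
    (PR.{v} fun x : ZFSet.{v} × ZFSet.{v} => c x.1 x.2) ∧
      ∀ m x z, z ∈ c m x ↔ ∃ y ∈ x, y ∈ m ∧ c m y = z := by
  have hs : PRS.{v} fun x : ZFSet.{v} × ZFSet.{v} × ZFSet.{v} =>
      {w | ∃ y ∈ {y | y ∈ {y | y ∈ x.2.1} ∧ y ∈ x.1}, w = app x.2.2 y} := by fun_prop
  obtain ⟨H, hH, hH'⟩ := hs.exists_PR
  refine ⟨fun m => covValue fun x G => H (m, x, G),
    PR.covValue (H := fun m x G => H (m, x, G)) hH, fun m x z => ?_⟩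
  beta_reduce
  rw [covValue, hH']
  simp only [Set.mem_ofPred_eq, code_zfset, exists_eq_right]
  constructor
  · rintro ⟨y, ⟨hy, hm⟩, rfl⟩
    exact ⟨y, hy, hm, (app_bigUnion_courseOfValues (.single hy)).symm⟩
  · rintro ⟨y, hy, hm, rfl⟩
    exact ⟨y, ⟨hy, hm⟩, (app_bigUnion_courseOfValues (.single hy)).symm⟩

section SatLemmas

variable {P : Type*} {val : P → ZFSet.{v}} {M : Set ZFSet.{v}} {n : ℕ}

theorem sat_ball {y : Tm P n} {ψ : Fml P (n + 1)} {x : Fin n → ZFSet.{v}} :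
    (Fml.ball y ψ).Sat val M x ↔
      ∀ a ∈ M, a ∈ y.eval val x → ψ.Sat val M (Fin.snoc (α := fun _ => ZFSet.{v}) x a) := by
  simp only [Fml.ball, Fml.Sat, Fml.imp, Fml.neg, Tm.eval_lift, Tm.eval_var_last]
  exact forall₂_congr fun a _ => imp_iff_not_or.symm

theorem sat_bex {y : Tm P n} {ψ : Fml P (n + 1)} {x : Fin n → ZFSet.{v}} :
    (Fml.bex y ψ).Sat val M x ↔
      ∃ a ∈ M, a ∈ y.eval val x ∧ ψ.Sat val M (Fin.snoc (α := fun _ => ZFSet.{v}) x a) := by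
  simp only [Fml.bex, Fml.Sat, Tm.eval_lift, Tm.eval_var_last]

theorem sat_imp {φ ψ : Fml P n} {x : Fin n → ZFSet.{v}} :
    (φ.imp ψ).Sat val M x ↔ (φ.Sat val M x → ψ.Sat val M x) := by
  simp only [Fml.imp, Fml.Sat, sat_neg]
  exact imp_iff_not_or.symm

theorem sat_allN : ∀ (k : ℕ) (φ : Fml P k), (Fml.allN k φ).Sat val M Fin.elim0 ↔
    ∀ p : Fin k → ZFSet.{v}, (∀ i, p i ∈ M) → φ.Sat val M p
  | 0, φ => by
    rw [Fml.allN]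
    refine ⟨fun h p _ => ?_, fun h => h _ fun i => i.elim0⟩
    rwa [Subsingleton.elim p Fin.elim0]
  | k + 1, φ => by
    rw [Fml.allN, sat_allN k]
    simp only [Fml.Sat]
    constructor
    · intro h p hp
      have := h (Fin.init p) (fun i => hp _) (p (Fin.last k)) (hp _)
      rwa [Fin.snoc_init_self] at this
    · intro h p hp a ha
      refine h _ fun i => ?_
      induction i using Fin.lastCases with
      | last => simpa using ha
      | cast i => simpa using hp i

theorem eval_rename {m : ℕ} (f : Fin n → Fin m) (t : Tm P n) (x : Fin m → ZFSet.{v}) :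
    (t.rename f).eval val x = t.eval val (x ∘ f) := by
  cases t <;> rfl

theorem snoc_comp_snoc {m : ℕ} (f : Fin n → Fin m) (x : Fin m → ZFSet.{v}) (a : ZFSet.{v}) :
    (Fin.snoc (α := fun _ => ZFSet.{v}) x a ∘ Fin.snoc (α := fun _ => Fin (m + 1))
      (fun i => (f i).castSucc) (Fin.last m)) = Fin.snoc (α := fun _ => ZFSet.{v}) (x ∘ f) a := by
  funext i
  induction i using Fin.lastCases with
  | last => simp
  | cast i => simp

theorem sat_rename {m : ℕ} (f : Fin n → Fin m) (φ : Fml P n) (x : Fin m → ZFSet.{v}) :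
    (φ.rename f).Sat val M x ↔ φ.Sat val M (x ∘ f) := by
  induction φ generalizing m with
  | mem | nmem | eq | ne => simp only [Fml.rename, Fml.Sat, eval_rename]
  | and φ ψ ih₁ ih₂ => simp only [Fml.rename, Fml.Sat, ih₁, ih₂]
  | or φ ψ ih₁ ih₂ => simp only [Fml.rename, Fml.Sat, ih₁, ih₂]
  | all φ ih => simp only [Fml.rename, Fml.Sat, ih, snoc_comp_snoc]
  | ex φ ih => simp only [Fml.rename, Fml.Sat, ih, snoc_comp_snoc]

theorem rename_lift {m : ℕ} (f : Fin n → Fin m) (t : Tm P n) :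
    t.lift.rename (Fin.snoc (α := fun _ => Fin (m + 1)) (fun i => (f i).castSucc) (Fin.last m)) =
      (t.rename f).lift := by
  cases t with
  | var i =>
    simp only [Tm.lift, Tm.rename]
    rw [Fin.snoc_castSucc]
  | par => rfl

theorem rename_var_last {m : ℕ} (f : Fin n → Fin m) :
    (Tm.var (Fin.last n) : Tm P (n + 1)).rename (Fin.snoc (α := fun _ => Fin (m + 1))
      (fun i => (f i).castSucc) (Fin.last m)) = Tm.var (Fin.last m) := by
  rw [Tm.rename, Fin.snoc_last]

theorem isDelta0_rename {m : ℕ} (f : Fin n → Fin m) {φ : Fml P n} (h : φ.IsDelta0) :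
    (φ.rename f).IsDelta0 := by
  induction h generalizing m with
  | lit h => cases h <;> exact .lit (by constructor)
  | and _ _ ih₁ ih₂ => exact .and (ih₁ f) (ih₂ f)
  | or _ _ ih₁ ih₂ => exact .or (ih₁ f) (ih₂ f)
  | ball y _ ih =>
    have := Fml.IsDelta0.ball (y.rename f) (ih (Fin.snoc (α := fun _ => Fin (m + 1))
      (fun i => (f i).castSucc) (Fin.last m)))
    simpa only [Fml.ball, Fml.imp, Fml.neg, Fml.rename, rename_lift, rename_var_last]
      using this
  | bex y _ ih =>
    have := Fml.IsDelta0.bex (y.rename f) (ih (Fin.snoc (α := fun _ => Fin (m + 1))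
      (fun i => (f i).castSucc) (Fin.last m)))
    simpa only [Fml.bex, Fml.rename, rename_lift, rename_var_last] using this

end SatLemmas

section Collapse

variable {m : ZFSet.{v}} {c : ZFSet.{v} → ZFSet.{v}}
  (hc : ∀ x z, z ∈ c x ↔ ∃ y ∈ x, y ∈ m ∧ c y = z)
  (hext : axExtensionality.Sat Empty.elim {x | x ∈ m} Fin.elim0)

include hc

include hext in
theorem collapse_injOn {x y : ZFSet.{v}} (hx : x ∈ m) (hy : y ∈ m) (h : c x = c y) : x = y := by
  induction x using ZFSet.inductionOn generalizing y with
  | _ x ih =>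
    have hxy : ∀ z ∈ m, z ∈ x ↔ z ∈ y := by
      intro z hz
      constructor
      · intro hzx
        have : c z ∈ c y := h ▸ (hc x (c z)).2 ⟨z, hzx, hz, rfl⟩
        obtain ⟨w, hw, hwm, hwz⟩ := (hc _ _).1 this
        rwa [ih z hzx hz hwm hwz.symm]
      · intro hzy
        have : c z ∈ c x := h ▸ (hc y (c z)).2 ⟨z, hzy, hz, rfl⟩
        obtain ⟨w, hw, hwm, hwz⟩ := (hc _ _).1 this
        rwa [← ih w hw hwm hz hwz]
    simp only [axExtensionality, Fml.Sat, sat_imp, sat_ball] at hext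
    exact hext x hx y hy ⟨fun z hz hzx => (hxy z hz).1 hzx, fun z hz hzy => (hxy z hz).2 hzy⟩

include hext in
theorem collapse_mem_iff {x y : ZFSet.{v}} (hx : x ∈ m) : c x ∈ c y ↔ x ∈ y := by
  rw [hc]
  constructor
  · rintro ⟨z, hz, hzm, h⟩
    rwa [← collapse_injOn hc hext hzm hx h]
  · exact fun h => ⟨x, h, hx, rfl⟩

include hext in
/-- For an extensional structure, the collapse is an isomorphism. -/
theorem sat_collapse {n : ℕ} (φ : Fml Empty n) {x : Fin n → ZFSet.{v}} (hx : ∀ i, x i ∈ m) :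
    φ.Sat Empty.elim {y | ∃ x ∈ m, c x = y} (c ∘ x) ↔ φ.Sat Empty.elim {x | x ∈ m} x := by
  have he : ∀ {n : ℕ} (t : Tm Empty n) (x : Fin n → ZFSet.{v}),
      t.eval Empty.elim (c ∘ x) = c (t.eval Empty.elim x) := by
    intro n t x
    cases t with
    | var i => rfl
    | par p => exact p.elim
  have hm : ∀ {n : ℕ} (t : Tm Empty n) {x : Fin n → ZFSet.{v}}, (∀ i, x i ∈ m) →
      t.eval Empty.elim x ∈ m := by
    intro n t x hx
    cases t with
    | var i => exact hx i
    | par p => exact p.elim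
  have hsnoc : ∀ {n : ℕ} {x : Fin n → ZFSet.{v}} {a : ZFSet.{v}}, (∀ i, x i ∈ m) → a ∈ m →
      ∀ i, Fin.snoc (α := fun _ => ZFSet.{v}) x a i ∈ m := by
    intro n x a hx ha i
    induction i using Fin.lastCases with
    | last => simpa using ha
    | cast i => simpa using hx i
  have hcs : ∀ {n : ℕ} (x : Fin n → ZFSet.{v}) (a : ZFSet.{v}),
      Fin.snoc (α := fun _ => ZFSet.{v}) (c ∘ x) (c a) =
        c ∘ Fin.snoc (α := fun _ => ZFSet.{v}) x a := fun x a => (Fin.comp_snoc c x a).symm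
  induction φ with
  | mem s t => simp only [Fml.Sat, he, collapse_mem_iff hc hext (hm s hx)]
  | nmem s t => simp only [Fml.Sat, he, collapse_mem_iff hc hext (hm s hx)]
  | eq s t =>
    simp only [Fml.Sat, he]
    exact ⟨collapse_injOn hc hext (hm s hx) (hm t hx), fun h => by rw [h]⟩
  | ne s t =>
    simp only [Fml.Sat, he]
    exact not_congr ⟨collapse_injOn hc hext (hm s hx) (hm t hx), fun h => by rw [h]⟩
  | and φ ψ ih₁ ih₂ => exact and_congr (ih₁ hx) (ih₂ hx)
  | or φ ψ ih₁ ih₂ => exact or_congr (ih₁ hx) (ih₂ hx)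
  | all φ ih =>
    simp only [Fml.Sat]
    constructor
    · intro h a ha
      have := h (c a) ⟨a, ha, rfl⟩
      rw [hcs] at this
      exact (ih (hsnoc hx ha)).1 this
    · rintro h _ ⟨a, ha, rfl⟩
      rw [hcs]
      exact (ih (hsnoc hx ha)).2 (h a ha)
  | ex φ ih =>
    simp only [Fml.Sat]
    constructor
    · rintro ⟨_, ⟨a, ha, rfl⟩, h⟩
      rw [hcs] at h
      exact ⟨a, ha, (ih (hsnoc hx ha)).1 h⟩
    · rintro ⟨a, ha, h⟩
      refine ⟨c a, ⟨a, ha, rfl⟩, ?_⟩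
      rw [hcs]
      exact (ih (hsnoc hx ha)).2 h

/-- The collapse is the identity on transitive parts. -/
theorem collapse_eq_self {u : Set ZFSet.{v}} (hu : ∀ x ∈ u, ∀ y ∈ x, y ∈ u) (hm : ∀ x ∈ u, x ∈ m)
    {x : ZFSet.{v}} (hx : x ∈ u) : c x = x := by
  induction x using ZFSet.inductionOn with
  | _ x ih =>
    ext z
    rw [hc]
    constructor
    · rintro ⟨y, hy, -, rfl⟩
      rwa [ih y hy (hu x hx y hy)]
    · exact fun hz => ⟨z, hz, hm z (hu x hx z hz), ih z hz (hu x hx z hz)⟩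

end Collapse

end

section

/-! ### From the axioms of the search trees to admissibility -/

section Schemes

variable {M : Set ZFSet.{v}}

/-- Extension of an assignment by the value of the last variable. -/
abbrev push {n : ℕ} (x : Fin n → ZFSet.{v}) (a : ZFSet.{v}) : Fin (n + 1) → ZFSet.{v} :=
  Fin.snoc (α := fun _ => ZFSet.{v}) x a

theorem push_apply {n : ℕ} (x : Fin n → ZFSet.{v}) (a : ZFSet.{v}) (i : Fin (n + 1)) :
    push x a i = if h : (i : ℕ) < n then x ⟨i, h⟩ else a := by
  rw [push, Fin.snoc]
  rfl

theorem push_mem {n : ℕ} {x : Fin n → ZFSet.{v}} (hx : ∀ i, x i ∈ M) {a : ZFSet.{v}} (ha : a ∈ M)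
    (i : Fin (n + 1)) : push x a i ∈ M := by
  rw [push_apply]
  split_ifs
  · exact hx _
  · exact ha

theorem sat_skip {n j : ℕ} (φ : Fml Empty n) (x : Fin (n + 1) → ZFSet.{v}) :
    (skip j φ).Sat Empty.elim M x ↔
      φ.Sat Empty.elim M fun i => if (i : ℕ) < j then x i.castSucc else x i.succ := by
  rw [skip, sat_rename]
  refine iff_of_eq (congrArg (fun y => Fml.Sat _ _ y φ) (funext fun i => ?_))
  simp only [Function.comp_apply]
  split_ifs <;> rfl

theorem sat_axSeparation {k : ℕ} {θ : Fml Empty (k + 2)} :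
    (axSeparation k θ).Sat Empty.elim M Fin.elim0 ↔ ∀ p : Fin k → ZFSet.{v}, (∀ i, p i ∈ M) →
      ∀ x ∈ M, ∃ y ∈ M, (∀ z ∈ M, z ∈ x → θ.Sat Empty.elim M (push (push p x) z) → z ∈ y) ∧
        ∀ z ∈ M, z ∈ y → z ∈ x ∧ θ.Sat Empty.elim M (push (push p x) z) := by
  rw [axSeparation, sat_allN]
  simp only [Fml.Sat, sat_ball, sat_imp, sat_skip, x_, Tm.eval]
  have key : ∀ (p : Fin k → ZFSet.{v}) (x y z : ZFSet.{v}), (fun i : Fin (k + 2) =>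
      if (i : ℕ) < k + 1 then push (push (push p x) y) z i.castSucc
      else push (push (push p x) y) z i.succ) = push (push p x) z := by
    intro p x y z
    funext i
    simp only [push_apply, Fin.val_castSucc, Fin.val_succ]
    split_ifs <;> first | rfl | omega
  simp only [push] at key
  simp only [key]
  simp [Fin.snoc]

theorem sat_axCollection {k : ℕ} {θ : Fml Empty (k + 3)} :
    (axCollection k θ).Sat Empty.elim M Fin.elim0 ↔ ∀ p : Fin k → ZFSet.{v}, (∀ i, p i ∈ M) →
      ∀ x ∈ M, (∀ y ∈ M, y ∈ x → ∃ z ∈ M, θ.Sat Empty.elim M (push (push (push p x) y) z)) →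
        ∃ w ∈ M, ∀ y ∈ M, y ∈ x → ∃ z ∈ M, z ∈ w ∧
          θ.Sat Empty.elim M (push (push (push p x) y) z) := by
  rw [axCollection, sat_allN]
  simp only [Fml.Sat, sat_ball, sat_bex, sat_imp, sat_skip, x_, Tm.eval]
  have key : ∀ (p : Fin k → ZFSet.{v}) (x w y z : ZFSet.{v}), (fun i : Fin (k + 3) =>
      if (i : ℕ) < k + 1 then push (push (push (push p x) w) y) z i.castSucc
      else push (push (push (push p x) w) y) z i.succ) = push (push (push p x) y) z := by
    intro p x w y z
    funext i
    simp only [push_apply, Fin.val_castSucc, Fin.val_succ]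
    split_ifs <;> first | rfl | omega
  simp only [push] at key
  simp only [key]
  simp [Fin.snoc]

theorem sat_axFoundation {k : ℕ} {θ : Fml Empty (k + 1)} :
    (axFoundation k θ).Sat Empty.elim M Fin.elim0 ↔ ∀ p : Fin k → ZFSet.{v}, (∀ i, p i ∈ M) →
      (∀ x ∈ M, (∀ y ∈ M, y ∈ x → θ.Sat Empty.elim M (push p y)) → θ.Sat Empty.elim M (push p x)) →
        ∀ x ∈ M, θ.Sat Empty.elim M (push p x) := by
  rw [axFoundation, sat_allN]
  simp only [Fml.Sat, sat_ball, sat_imp, sat_skip, x_, Tm.eval]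
  have key : ∀ (p : Fin k → ZFSet.{v}) (x y : ZFSet.{v}), (fun i : Fin (k + 1) =>
      if (i : ℕ) < k then push (push p x) y i.castSucc
      else push (push p x) y i.succ) = push p y := by
    intro p x y
    funext i
    simp only [push_apply, Fin.val_castSucc, Fin.val_succ]
    split_ifs <;> first | rfl | omega
  simp only [push] at key
  simp only [key]
  simp [Fin.snoc]

/-- Foundation holds in every structure `(M, ∈)`. -/
theorem sat_foundation (k : ℕ) (θ : Fml Empty (k + 1)) :
    (axFoundation k θ).Sat Empty.elim M Fin.elim0 := by
  rw [sat_axFoundation]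
  intro p hp h x hx
  induction x using ZFSet.inductionOn with
  | _ x ih => exact h x hx fun y hy hyx => ih y hyx hy

end Schemes

section Tuples

variable {M : Set ZFSet.{v}} (htr : ∀ x ∈ M, ∀ y ∈ x, y ∈ M)
  (hsep : ∀ θ : Fml Empty 3, θ.IsDelta0 → (axSeparation 1 θ).Sat Empty.elim M Fin.elim0)

include htr hsep

/-- Separation with one parameter, as closure under a set operation. -/
theorem exists_sep (θ : Fml Empty 3) (hθ : θ.IsDelta0) {p x : ZFSet.{v}} (hp : p ∈ M) (hx : x ∈ M) :
    ∃ y ∈ M, ∀ z, z ∈ y ↔ z ∈ x ∧ θ.Sat Empty.elim M (push (push (fun _ : Fin 1 => p) x) z) := by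
  obtain ⟨y, hy, h₁, h₂⟩ := sat_axSeparation.1 (hsep θ hθ) (fun _ => p) (fun _ => hp) x hx
  exact ⟨y, hy, fun z => ⟨fun hz => h₂ z (htr y hy z hz) hz,
    fun hz => h₁ z (htr x hx z hz.1) hz.1 hz.2⟩⟩

/-- The pairing axiom only yields a set that contains `a` and `b`. Since separation is available
with a single parameter, `{a, b}` is obtained by removing `a` and `b` one after the other, and
passing to the complement. -/
theorem pair_mem_of_sep (hpair : axPairing.Sat Empty.elim M Fin.elim0) {a b : ZFSet.{v}}
    (ha : a ∈ M) (hb : b ∈ M) : ({a, b} : ZFSet.{v}) ∈ M := by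
  simp only [axPairing, Fml.Sat, x_, Tm.eval] at hpair
  obtain ⟨p, hp, hap, hbp⟩ := hpair a ha b hb
  change a ∈ p at hap
  change b ∈ p at hbp
  -- remove `a` and `b` from `p`, and take the complement
  obtain ⟨p₁, hp₁, h₁⟩ := exists_sep htr hsep (.ne (x_ 2) (x_ 0)) (.lit (.ne _ _)) ha hp
  obtain ⟨p₂, hp₂, h₂⟩ := exists_sep htr hsep (.ne (x_ 2) (x_ 0)) (.lit (.ne _ _)) hb hp₁
  obtain ⟨y, hy, h⟩ := exists_sep htr hsep (.nmem (x_ 2) (x_ 0)) (.lit (.nmem _ _)) hp₂ hp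
  convert hy
  ext z
  rw [h]
  change z ∈ ({a, b} : ZFSet.{v}) ↔ z ∈ p ∧ z ∉ p₂
  rw [h₂, h₁]
  change _ ↔ z ∈ p ∧ ¬ ((z ∈ p ∧ z ≠ a) ∧ z ≠ b)
  rw [ZFSet.mem_pair]
  constructor
  · rintro (rfl | rfl)
    · exact ⟨hap, by simp⟩
    · exact ⟨hbp, by simp⟩
  · rintro ⟨hz, h⟩
    by_contra! hc
    exact h ⟨⟨hz, hc.1⟩, hc.2⟩

omit htr hsep in
/-- `Δ₀`-definition of the components `b`, `c` of an ordered pair `t`, where `t`, `b`, `c` are the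
variables `0`, `n + 2`, `n + 3`. -/
def isPairFml (n : ℕ) : Fml Empty (n + 4) :=
  .and (.ball (x_ 0) (.mem (x_ (n + 2)) (x_ (n + 4))))
    (.ball (x_ 0) (.ball (x_ (n + 4)) (.or (.eq (x_ (n + 5)) (x_ (n + 2)))
      (.eq (x_ (n + 5)) (x_ (n + 3))))))

omit htr hsep in
theorem isDelta0_isPairFml (n : ℕ) : (isPairFml n).IsDelta0 :=
  .and (.ball _ (.lit (.mem _ _)))
    (.ball _ (.ball _ (.or (.lit (.eq _ _)) (.lit (.eq _ _)))))

omit htr hsep in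
theorem sat_isPairFml {n : ℕ} {x : Fin (n + 4) → ZFSet.{v}} : (isPairFml n).Sat Empty.elim M x ↔
    (∀ w ∈ M, w ∈ x 0 → x ⟨n + 2, by omega⟩ ∈ w) ∧ ∀ w ∈ M, w ∈ x 0 → ∀ d ∈ M, d ∈ w →
      d = x ⟨n + 2, by omega⟩ ∨ d = x ⟨n + 3, by omega⟩ := by
  simp only [isPairFml, Fml.Sat, sat_ball, x_, Tm.eval]
  simp [Fin.snoc]

/-- Finitely many parameters of a `Δ₀`-formula can be replaced by a single one. -/
theorem exists_single_param (hpair : axPairing.Sat Empty.elim M Fin.elim0) (hne : M.Nonempty)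
    {n : ℕ} (φ : Fml Empty n) (hφ : φ.IsDelta0)
    {v : Fin n → ZFSet.{v}} (hv : ∀ i, v i ∈ M) (k : ℕ) :
    ∃ ψ : Fml Empty (n + 1), ψ.IsDelta0 ∧ ∃ t ∈ M, ∀ y : Fin n → ZFSet.{v}, (∀ i, y i ∈ M) →
      (ψ.Sat Empty.elim M (Fin.cons t y : Fin (n + 1) → ZFSet.{v}) ↔
        φ.Sat Empty.elim M fun i => if (i : ℕ) < k then v i else y i) := by
  -- the first `k` parameters are coded by iterated ordered pairs, with the last one outermost
  induction k with
  | zero =>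
    obtain ⟨t, ht⟩ := hne
    refine ⟨φ.rename Fin.succ, isDelta0_rename _ hφ, t, ht, fun y _ => ?_⟩
    rw [sat_rename]
    simp
  | succ k ih =>
    obtain ⟨ψ₀, hψ₀, t₀, ht₀, h₀⟩ := ih
    by_cases hk : k < n
    · let a := v ⟨k, hk⟩
      have ha : a ∈ M := hv _
      have hs : ({t₀} : ZFSet.{v}) ∈ M := by
        have := pair_mem_of_sep htr hsep hpair ht₀ ht₀
        simpa using this
      have hs' := pair_mem_of_sep htr hsep hpair ht₀ ha
      have ht : ZFSet.pair t₀ a ∈ M := pair_mem_of_sep htr hsep hpair hs hs'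
      let g : Fin (n + 1) → Fin (n + 4) := Fin.cases ⟨n + 2, by omega⟩ fun i =>
        if (i : ℕ) = k then ⟨n + 3, by omega⟩ else ⟨i + 1, by omega⟩
      refine ⟨.bex (x_ 0) (.bex (x_ (n + 1))
        (.bex (x_ (n + 1)) (.and (isPairFml n) (ψ₀.rename g)))),
        .bex _ (.bex _ (.bex _ (.and (isDelta0_isPairFml n) (isDelta0_rename _ hψ₀)))), _, ht,
        fun y hy => ?_⟩
      have hg : ∀ w b c, (push (push (push (Fin.cons (ZFSet.pair t₀ a) y : Fin (n + 1) → ZFSet.{v})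
        w) b) c) ∘ g = Fin.cons b fun i => if (i : ℕ) = k then c else y i := by
        intro w b c
        funext i
        induction i using Fin.cases with
        | zero => simp [g, push_apply]
        | succ i =>
          simp only [Function.comp_apply, g, Fin.cases_succ, Fin.cons_succ]
          split_ifs with hi
          · simp [push_apply]
          · have hi' := i.2
            simp only [push_apply]
            rw [dif_pos (by omega), dif_pos (by omega), dif_pos (by omega)]
            exact Fin.cons_succ (α := fun _ => ZFSet.{v}) _ y i
      have hsem : ∀ w b c, (isPairFml n).Sat Empty.elim M
          (push (push (push (Fin.cons (ZFSet.pair t₀ a) y : Fin (n + 1) → ZFSet.{v}) w) b) c) ↔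
            (∀ w ∈ M, w ∈ ZFSet.pair t₀ a → b ∈ w) ∧
              ∀ w ∈ M, w ∈ ZFSet.pair t₀ a → ∀ d ∈ M, d ∈ w → d = b ∨ d = c := by
        intro w b c
        rw [sat_isPairFml]
        simp [push_apply]
      simp only [sat_bex, x_, Tm.eval, Fml.Sat, sat_rename]
      simp only [push] at hsem hg
      simp only [hsem, hg]
      have hφ' : (φ.Sat Empty.elim M fun i => if (i : ℕ) < k + 1 then v i else y i) ↔
          ψ₀.Sat Empty.elim M (Fin.cons t₀ fun i => if (i : ℕ) = k then a else y i :
            Fin (n + 1) → ZFSet.{v}) := by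
        rw [h₀ _ fun i => ?_]
        · refine iff_of_eq (congrArg (fun x => Fml.Sat _ _ x φ) (funext fun i => ?_))
          split_ifs with h₁ h₂ h₃ h₃
          · rfl
          · exact congrArg v (Fin.ext h₃)
          · omega
          · omega
          · omega
          · rfl
        · split_ifs
          · exact ha
          · exact hy i
      rw [hφ']
      constructor
      · rintro ⟨w, hw, hwt, b, hb, hbw, c, hc, hcw, ⟨h₁, h₂⟩, h⟩
        replace hwt : w ∈ ZFSet.pair t₀ a := hwt
        replace hcw : c ∈ w := by simpa [Fin.snoc] using hcw
        have hb : b = t₀ := by simpa using h₁ {t₀} hs (by simp [ZFSet.pair])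
        subst hb
        have hc : c = a := by
          have ha' := h₂ {b, a} hs' (by simp [ZFSet.pair]) a ha (by simp)
          rcases (by simpa [ZFSet.pair] using hwt : w = {b} ∨ w = {b, a}) with rfl | rfl <;>
          simp at hcw <;> aesop
        rwa [← hc]
      · intro h
        refine ⟨{t₀, a}, hs', ?_, t₀, ht₀, ?_, a, ha, ?_, ⟨?_, ?_⟩, h⟩
        · change {t₀, a} ∈ ZFSet.pair t₀ a
          simp [ZFSet.pair]
        · simp [Fin.snoc]
        · simp [Fin.snoc]
        · intro w _ hw
          rcases (by simpa [ZFSet.pair] using hw : w = {t₀} ∨ w = {t₀, a}) with rfl | rfl <;> simp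
        · intro w _ hw d _ hd
          rcases (by simpa [ZFSet.pair] using hw : w = {t₀} ∨ w = {t₀, a}) with rfl | rfl
          · exact .inl (by simpa using hd)
          · simpa using hd
    · refine ⟨ψ₀, hψ₀, t₀, ht₀, fun y hy => (h₀ y hy).trans ?_⟩
      refine iff_of_eq (congrArg (fun x => Fml.Sat _ _ x φ) (funext fun i => ?_))
      have := i.2
      rw [if_pos (by omega), if_pos (by omega)]

/-- A `Δ₀`-formula with `k` parameters is equivalent to one with a single parameter. -/
theorem exists_one_param (hpair : axPairing.Sat Empty.elim M Fin.elim0) (hne : M.Nonempty)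
    {k m : ℕ} (φ : Fml Empty (k + m)) (hφ : φ.IsDelta0) {p : Fin k → ZFSet.{v}}
    (hp : ∀ i, p i ∈ M) :
    ∃ ψ : Fml Empty (1 + m), ψ.IsDelta0 ∧ ∃ t ∈ M, ∀ q : Fin (k + m) → ZFSet.{v}, (∀ i, q i ∈ M) →
      (∀ i, q (Fin.castAdd m i) = p i) → ∀ q' : Fin (1 + m) → ZFSet.{v}, q' 0 = t →
        (∀ j, q' (Fin.natAdd 1 j) = q (Fin.natAdd k j)) →
          (ψ.Sat Empty.elim M q' ↔ φ.Sat Empty.elim M q) := by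
  obtain ⟨a, ha⟩ := hne
  obtain ⟨ψ, hψ, t, ht, h⟩ := exists_single_param htr hsep hpair ⟨a, ha⟩ φ hφ
    (v := fun i => if h : (i : ℕ) < k then p ⟨i, h⟩ else a)
    (fun i => by split_ifs; exacts [hp _, ha]) k
  let g : Fin (k + m + 1) → Fin (1 + m) := Fin.cases 0 fun i =>
    if h : (i : ℕ) < k then 0 else ⟨1 + (i - k), by omega⟩
  refine ⟨ψ.rename g, isDelta0_rename _ hψ, t, ht, fun q hq hqp q' h0 hqq' => ?_⟩
  have hg : q' ∘ g = Fin.cons t fun i => if (i : ℕ) < k then t else q i := by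
    funext i
    induction i using Fin.cases with
    | zero => simpa [g] using h0
    | succ i =>
      simp only [Function.comp_apply, g, Fin.cases_succ, Fin.cons_succ]
      split_ifs with hi
      · exact h0
      · have := hqq' ⟨i - k, by omega⟩
        exact this.trans (congrArg q (Fin.ext (by simp only [Fin.natAdd_mk]; omega)))
  rw [sat_rename, hg, h]
  · refine iff_of_eq (congrArg (fun x => Fml.Sat _ _ x φ) (funext fun i => ?_))
    split_ifs with hi
    · exact (hqp ⟨i, hi⟩).symm
    · rfl
  · intro i
    split_ifs
    exacts [ht, hq i]

end Tuples

/-- A transitive set that satisfies the axioms of the search trees is admissible. -/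
theorem admissible_of_sat {K : ℕ} (hK : 1 ≤ K) {A : ZFSet.{v}} (hA : A.IsTransitive)
    (hne : ∃ a, a ∈ A) (h : ∀ φ, IsTreeAxiom K φ → φ.Sat Empty.elim {x | x ∈ A} Fin.elim0) :
    Admissible A := by
  have htr : ∀ x ∈ {x | x ∈ A}, ∀ y ∈ x, y ∈ {x | x ∈ A} := fun x hx y hy => hA x hx hy
  have hsep : ∀ θ : Fml Empty 3, θ.IsDelta0 →
      (axSeparation 1 θ).Sat Empty.elim {x | x ∈ A} Fin.elim0 :=
    fun θ hθ => h _ (.separation 1 θ hK hθ)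
  have hpair := h _ .pairing
  refine ⟨hA, fun φ hφ => ?_⟩
  cases hφ with
  | equality => exact h _ .equality
  | extensionality => exact h _ .extensionality
  | pairing => exact h _ .pairing
  | union => exact h _ .union
  | infinity => exact h _ .infinity
  | separation k θ hθ =>
    rw [sat_axSeparation]
    intro p hp x hx
    obtain ⟨ψ, hψ, t, ht, hψ'⟩ := exists_one_param htr hsep hpair hne (k := k) (m := 2) θ hθ hp
    have key : ∀ z ∈ {x | x ∈ A}, ψ.Sat Empty.elim {x | x ∈ A}
        (push (push (fun _ : Fin 1 => t) x) z) ↔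
          θ.Sat Empty.elim {x | x ∈ A} (push (push p x) z) := by
      intro z hz
      refine hψ' _ (push_mem (push_mem hp hx) hz) (fun i => ?_) _ ?_ (fun j => ?_)
      · have := i.2
        simp only [push_apply, Fin.val_castAdd]
        rw [dif_pos (by omega), dif_pos (by omega)]
      · simp [push_apply]
      · fin_cases j <;> simp [push_apply]
    obtain ⟨y, hy, h₁, h₂⟩ := sat_axSeparation.1 (hsep ψ hψ) (fun _ => t) (fun _ => ht) x hx
    exact ⟨y, hy, fun z hz hzx hθ => h₁ z hz hzx ((key z hz).2 hθ),
      fun z hz hzy => ⟨(h₂ z hz hzy).1, (key z hz).1 (h₂ z hz hzy).2⟩⟩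
  | collection k θ hθ =>
    rw [sat_axCollection]
    intro p hp x hx hyp
    obtain ⟨ψ, hψ, t, ht, hψ'⟩ := exists_one_param htr hsep hpair hne (k := k) (m := 3) θ hθ hp
    have key : ∀ y ∈ {x | x ∈ A}, ∀ z ∈ {x | x ∈ A}, (Fml.or ψ ψ).Sat Empty.elim {x | x ∈ A}
        (push (push (push (fun _ : Fin 1 => t) x) y) z) ↔
          θ.Sat Empty.elim {x | x ∈ A} (push (push (push p x) y) z) := by
      intro y hy z hz
      rw [Fml.Sat, or_self]
      refine hψ' _ (push_mem (push_mem (push_mem hp hx) hy) hz) (fun i => ?_) _ ?_ (fun j => ?_)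
      · have := i.2
        simp only [push_apply, Fin.val_castAdd]
        rw [dif_pos (by omega), dif_pos (by omega), dif_pos (by omega)]
      · simp [push_apply]
      · fin_cases j <;> simp [push_apply]
    -- collection is available for disjunctions only
    have hcoll := h _ (.collection 1 ψ ψ hK (.or hψ hψ))
    obtain ⟨w, hw, hw'⟩ := sat_axCollection.1 hcoll (fun _ => t) (fun _ => ht) x hx
      fun y hy hyx => (hyp y hy hyx).imp fun z hz => ⟨hz.1, (key y hy z hz.1).2 hz.2⟩
    refine ⟨w, hw, fun y hy hyx => ?_⟩
    obtain ⟨z, hz, hzw, hz'⟩ := hw' y hy hyx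
    exact ⟨z, hz, hzw, (key y hy z hz).1 hz'⟩
  | foundation k θ => exact sat_foundation k θ

end

section

/-! ### Well-foundedness without admissible sets -/

/-- In a transitive model, a nonempty set of nodes without minimal element yields an admissible
set above `u`. -/
theorem exists_admissible {K : ℕ} (hK : 1 ≤ K) {θ : ℕ → Fml Empty 0}
    (hθ : Nat.Primrec fun k => (θ k).godel)
    (hax : ∀ φ, IsTreeAxiom K φ → ∃ k, θ k = φ) {e : Enum.{v}}
    (he : ∀ n, ∀ x ∈ e n, x ∈ Set.range e) (h0 : ∅ ∈ Set.range e) (h1 : {∅} ∈ Set.range e)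
    {W : Set ZFSet.{v}} (hW : IsTransitiveModel W) (heW : code e ∈ W) {o : Ordinal.{v}}
    (hoW : code o ∈ W) {B : CSet.{v} (List Ranked.{v})} (hBW : code B ∈ W) (hne : ∃ σ, σ ∈ B.toSet)
    (hlt : ∀ σ ∈ B.toSet, ∃ τ ∈ B.toSet, KBLt e θ o τ σ) :
    ∃ A ∈ W, Admissible A ∧ ∀ n, e n ∈ A := by
  have hwo := wellOrderOn_RLt he o
  have htr : ∀ a b c, RLt e o a b → RLt e o b c → RLt e o a c := fun _ _ _ => RLt_trans he
  have hnodes : ∀ σ ∈ B.toSet, σ ∈ nodes e θ o := fun σ hσ => by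
    obtain ⟨τ, -, h⟩ := hlt σ hσ
    exact h.2.1
  have hB : ∀ σ ∈ B.toSet, σ ∈ listsOver (RStage (Set.range e) o) := fun σ hσ =>
    nodes_listsOver he h0 h1 (hnodes σ hσ)
  have hlt' : ∀ σ ∈ B.toSet, ∃ τ ∈ B.toSet, KB (RLt e o) τ σ := fun σ hσ => by
    obtain ⟨τ, hτ, h⟩ := hlt σ hσ
    exact ⟨τ, hτ, (KBLt_iff.1 h).2.2⟩
  obtain ⟨f, hf⟩ := exists_branch hwo htr hB hne hlt'
  -- the branch is a branch of the search tree, and its entries form a structure `m`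
  have hpath : ∀ n, (List.range n).map f ∈ nodes e θ o := by
    intro n
    obtain ⟨σ, hσ⟩ := hne
    obtain ⟨q, hq, -, hpq⟩ := (hf _).2 ⟨n, rfl⟩ σ hσ
    exact nodes_of_prefix hpq (hnodes q hq)
  obtain ⟨Γ, hΓ⟩ := exists_isBranch hpath
  let M : Set ZFSet.{v} := Set.range e ∪ Set.range fun n => (f n).2
  have hsat : ∀ φ, IsTreeAxiom K φ → φ.Sat Empty.elim M Fin.elim0 := by
    intro φ hφ
    obtain ⟨k, rfl⟩ := hax φ hφ
    exact hΓ.sat_axiom k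
  obtain ⟨m, hmW, hm⟩ : ∃ m : CSet.{v} ZFSet.{v}, code m ∈ W ∧ m.toSet = M := by
    have hK {α : Type (v + 1)} [SetCode.{v} α] {f : α → Enum.{v} × Ordinal.{v}}
        {σ τ : α → List Ranked.{v}} (hf : PR.{v} f) (hσ : PR.{v} σ) (hτ : PR.{v} τ) :
        PR.{v} fun a => KBLt (f a).1 θ (f a).2 (σ a) (τ a) :=
      PR.KBLt hθ (by fun_prop) (by fun_prop) hσ hτ
    obtain ⟨m, hmW, hm⟩ := hW.exists_cset
      (s := fun x : (Enum.{v} × Ordinal.{v}) × CSet.{v} (List Ranked.{v}) => Set.range x.1.1 ∪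
        {a | ∃ q ∈ x.2.toSet, a ∈ {a | ∃ p ∈ {p | p ∈ {p | p <+: q} ∧ ∀ τ ∈ x.2.toSet,
          ∃ ρ ∈ x.2.toSet, (ρ = τ ∨ KBLt x.1.1 θ x.1.2 ρ τ) ∧ p <+: ρ},
            a ∈ {a | ∃ c ∈ {c | c ∈ p}, a = c.2}}})
      (a := ((e, o), B)) (by fun_prop) (hW.pair_mem (hW.pair_mem heW hoW) hBW)
    refine ⟨m, hmW, hm.trans (congrArg (Set.range e ∪ ·) ?_)⟩
    have hD : ∀ p, (∀ τ ∈ B.toSet, ∃ ρ ∈ B.toSet, (ρ = τ ∨ KBLt e θ o ρ τ) ∧ p <+: ρ) ↔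
        Dense (RLt e o) B.toSet p := by
      refine fun p => forall₂_congr fun τ hτ => exists_congr fun ρ => and_congr_right fun hρ => ?_
      simp only [KBLt_iff, hnodes τ hτ, hnodes ρ hρ, true_and]
    ext a
    simp only [Set.mem_ofPred_eq, hD, hf]
    constructor
    · rintro ⟨q, -, _, ⟨-, n, rfl⟩, c, hc, rfl⟩
      obtain ⟨i, -, rfl⟩ := List.mem_map.1 hc
      exact ⟨i, rfl⟩
    · rintro ⟨n, rfl⟩
      obtain ⟨σ, hσ⟩ := hne
      obtain ⟨q, hq, -, hpq⟩ := (hf _).2 ⟨n + 1, rfl⟩ σ hσ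
      exact ⟨q, hq, _, ⟨hpq, n + 1, rfl⟩, f n, by simpa using ⟨n, by omega, rfl⟩, rfl⟩
  have hmM : {x | x ∈ m.val} = M := hm
  -- the collapse of `m`
  obtain ⟨c, hcPR, hc⟩ := exists_collapse.{v}
  obtain ⟨A, hAW, hA⟩ := hW.exists_cset
    (s := fun m : CSet.{v} ZFSet.{v} => {y | ∃ x ∈ m.toSet, y = c (code m) x})
    (a := m) (PRS.image (PRS.toSet PR.id) (by fun_prop)) hmW
  have hmem : ∀ y, y ∈ A.val ↔ ∃ x ∈ m.val, c m.val x = y := by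
    intro y
    have : y ∈ A.toSet ↔ ∃ x ∈ m.val, y = c m.val x := by
      rw [hA]
      rfl
    exact this.trans (exists_congr fun x => and_congr_right fun _ => eq_comm)
  have hu : ∀ x ∈ Set.range e, c m.val x = x := fun x hx =>
    collapse_eq_self (hc m.val) (range_transitive he)
      (fun x hx => (Set.ext_iff.1 hmM x).2 (.inl hx)) hx
  have heA : ∀ n, e n ∈ A.val := fun n =>
    (hmem _).2 ⟨e n, (Set.ext_iff.1 hmM _).2 (.inl ⟨n, rfl⟩), hu _ ⟨n, rfl⟩⟩
  rw [← hmM] at hsat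
  refine ⟨A.val, hAW, admissible_of_sat hK ?_ ⟨_, heA 0⟩ fun φ hφ => ?_, heA⟩
  · intro y hy z hz
    obtain ⟨x, hx, rfl⟩ := (hmem y).1 hy
    obtain ⟨w, -, hw, rfl⟩ := (hc _ _ _).1 hz
    exact (hmem _).2 ⟨w, hw, rfl⟩
  · have hset : {x | x ∈ A.val} = {y | ∃ x ∈ m.val, c m.val x = y} := Set.ext hmem
    rw [hset]
    have := (sat_collapse (hc m.val) (hsat _ .extensionality) φ (x := Fin.elim0)
      fun i => i.elim0).2 (hsat φ hφ)
    rwa [Subsingleton.elim (c m.val ∘ Fin.elim0) Fin.elim0] at this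

/-- In a transitive model without admissible set above `u`, every nonempty set of terms has a
minimal element. -/
theorem exists_minimal {K : ℕ} (hK : 1 ≤ K) {θ : ℕ → Fml Empty 0}
    (hθ : Nat.Primrec fun k => (θ k).godel)
    (hax : ∀ φ, IsTreeAxiom K φ → ∃ k, θ k = φ) {e : Enum.{v}}
    (he : ∀ n, ∀ x ∈ e n, x ∈ Set.range e) (h0 : ∅ ∈ Set.range e) (h1 : {∅} ∈ Set.range e)
    {W : Set ZFSet.{v}} (hW : IsTransitiveModel W) (heW : code e ∈ W)
    (hno : ¬ ∃ A ∈ W, Admissible A ∧ ∀ n, e n ∈ A) {o : Ordinal.{v}} (ho : code o ∈ W)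
    {a : ZFSet.{v}} (ha : a ∈ W) (hsub : ∀ z ∈ a, ∃ t ∈ epsTerms e θ o, code t = z)
    (hne : a ≠ ∅) : ∃ t ∈ epsTerms e θ o, code t ∈ a ∧ ∀ s, code s ∈ a → ¬ EpsLt e θ o s t := by
  by_contra! hcon
  let A : CSet.{v} Term.{v} := ⟨a, fun z hz => (hsub z hz).imp fun t ht => ht.2⟩
  have hA : ∀ t ∈ A.toSet, t ∈ epsTerms e θ o := by
    intro t ht
    obtain ⟨s, hs, h⟩ := hsub (code t) ht
    rwa [← code_injective h]
  obtain ⟨z, hz⟩ := (ZFSet.eq_empty_or_nonempty a).resolve_left hne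
  obtain ⟨t, -, rfl⟩ := hsub z hz
  obtain ⟨B, hBW, hB, hB'⟩ := exists_descending_nodes hθ he h0 h1 hW heW ho (A := A) ha hA ⟨t, hz⟩
    fun t ht => hcon t (hA t ht) ht
  exact hno (exists_admissible hK hθ hax he h0 h1 hW heW
    (hW.code_mem (f := fun o : Ordinal.{v} => Ordinal.omega0 ^ o) (by fun_prop) ho) hBW hB hB')

end

section

/-! ### The well-ordering principle -/

section Principle

variable {e : Enum.{v}} {θ : ℕ → Fml Empty 0} {T rk : (Fin 2 → ZFSet.{v}) → ZFSet.{v}}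
  {α : Ordinal.{v}} {s t z : ZFSet.{v}}

theorem IsEpsSystem.mem_carrier_iff (hT : IsEpsSystem e θ α (T ![enumCode e, α.toZFSet])) :
    z ∈ carrier T (enumCode e) α ↔ ∃ t ∈ epsTerms e θ α, code t = z := by
  obtain ⟨X, R, hp, hX, -⟩ := hT
  have : z ∈ carrier T (enumCode e) α ↔ z ∈ X := by
    refine ⟨?_, fun h => ⟨X, R, hp, h⟩⟩
    rintro ⟨X', R', hp', h⟩
    rwa [(ZFSet.pair_injective (hp.symm.trans hp')).1]
  rw [this, hX]
  exact exists_congr fun t => and_congr_right fun _ => eq_comm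

theorem IsEpsSystem.carrierLt_iff (hT : IsEpsSystem e θ α (T ![enumCode e, α.toZFSet])) :
    CarrierLt T (enumCode e) α s t ↔
      ∃ s' t', EpsLt e θ α s' t' ∧ code s' = s ∧ code t' = t := by
  obtain ⟨X, R, hp, -, hR⟩ := hT
  have : CarrierLt T (enumCode e) α s t ↔ ZFSet.pair s t ∈ R := by
    refine ⟨?_, fun h => ⟨X, R, hp, h⟩⟩
    rintro ⟨X', R', hp', h⟩
    rwa [(ZFSet.pair_injective (hp.symm.trans hp')).2]
  rw [this, hR]
  refine exists₂_congr fun s' t' => and_congr_right fun _ => ?_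
  rw [ZFSet.pair_inj, eq_comm, @eq_comm _ t]
  rfl

theorem IsEpsSystem.carrierLt_code_iff (hT : IsEpsSystem e θ α (T ![enumCode e, α.toZFSet]))
    {s t : Term.{v}} : CarrierLt T (enumCode e) α (code s) (code t) ↔ EpsLt e θ α s t := by
  rw [hT.carrierLt_iff]
  refine ⟨?_, fun h => ⟨s, t, h, rfl, rfl⟩⟩
  rintro ⟨s', t', h, hs, ht⟩
  rwa [← code_injective hs, ← code_injective ht]

theorem IsEpsSystem.subset_prod (hT : IsEpsSystem e θ α (T ![enumCode e, α.toZFSet])) :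
    ∃ X R, T ![enumCode e, α.toZFSet] = ZFSet.pair X R ∧ R ⊆ X.prod X := by
  obtain ⟨X, R, hp, hX, hR⟩ := hT
  refine ⟨X, R, hp, fun z hz => ?_⟩
  obtain ⟨s, t, h, rfl⟩ := (hR z).1 hz
  rw [ZFSet.pair_mem_prod]
  exact ⟨(hX _).2 ⟨s, h.1, rfl⟩, (hX _).2 ⟨t, h.2.1, rfl⟩⟩

variable (hT : ∀ α : Ordinal.{v}, IsEpsSystem e θ α (T ![enumCode e, α.toZFSet]))
  (he : ∀ n, ∀ x ∈ e n, x ∈ Set.range e) (h0 : ∅ ∈ Set.range e) (h1 : {∅} ∈ Set.range e)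
include hT he h0 h1

/-- The minimal stage of a term is bounded by the set-theoretic rank of its code. This makes rank
functions independent of the model in which the minimal stage is computed. -/
theorem mem_carrier_rank (h : ∃ β, s ∈ carrier T (enumCode e) β) :
    s ∈ carrier T (enumCode e) (s.rank + 1) := by
  obtain ⟨β, h⟩ := h
  obtain ⟨t, ht, rfl⟩ := (hT β).mem_carrier_iff.1 h
  exact (hT _).mem_carrier_iff.2
    ⟨t, epsTerms_mono he (le_add_of_nonneg_right zero_le_one) (mem_epsTerms_rank he h0 h1 ht), rfl⟩

theorem wellOrders_epsTerms {K : ℕ} (hK : 1 ≤ K) (hθ : Nat.Primrec fun k => (θ k).godel)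
    (hax : ∀ φ, IsTreeAxiom K φ → ∃ k, θ k = φ) {W : Set ZFSet.{v}} (hW : IsTransitiveModel W)
    (heW : enumCode e ∈ W) (hno : ¬ ∃ A ∈ W, Admissible A ∧ ∀ n, e n ∈ A)
    (hα : α.toZFSet ∈ W) :
    WellOrders W (CarrierLt T (enumCode e) α) (carrier T (enumCode e) α) where
  irrefl s hs h := by
    obtain ⟨s, hs', rfl⟩ := (hT α).mem_carrier_iff.1 hs
    exact epsLt_irrefl he s ((hT α).carrierLt_code_iff.1 h)
  trans r hr s hs t ht hrs hst := by
    obtain ⟨r, hr', rfl⟩ := (hT α).mem_carrier_iff.1 hr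
    obtain ⟨s, hs', rfl⟩ := (hT α).mem_carrier_iff.1 hs
    obtain ⟨t, ht', rfl⟩ := (hT α).mem_carrier_iff.1 ht
    rw [(hT α).carrierLt_code_iff] at *
    exact epsLt_trans he hrs hst
  total s hs t ht := by
    obtain ⟨s, hs', rfl⟩ := (hT α).mem_carrier_iff.1 hs
    obtain ⟨t, ht', rfl⟩ := (hT α).mem_carrier_iff.1 ht
    rw [(hT α).carrierLt_code_iff, (hT α).carrierLt_code_iff, code_inj]
    exact epsLt_total he h0 h1 hs' ht'
  minimal a ha hsub hne := by
    obtain ⟨t, -, hta, hmin⟩ := exists_minimal hK hθ hax he h0 h1 hW heW hno hα ha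
      (fun z hz => (hT α).mem_carrier_iff.1 (hsub z hz)) hne
    refine ⟨code t, hta, fun s hs h => ?_⟩
    obtain ⟨s, -, rfl⟩ := (hT α).mem_carrier_iff.1 (hsub s hs)
    exact hmin s hs ((hT α).carrierLt_code_iff.1 h)

theorem isWOP_epsTerms {K : ℕ} (hK : 1 ≤ K) (hθ : Nat.Primrec fun k => (θ k).godel)
    (hax : ∀ φ, IsTreeAxiom K φ → ∃ k, θ k = φ) (hTP : SetPrimrec T) (hrkP : SetPrimrec rk)
    (hrk : ∀ s : ZFSet.{v},
      (∀ o ≤ s.rank, IsLeast {o | ∃ t ∈ epsTerms e θ (o + 1), code t = s} o →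
        rk ![enumCode e, s] = o.toZFSet) ∧
      ((¬ ∃ o ≤ s.rank, ∃ t ∈ epsTerms e θ (o + 1), code t = s) → rk ![enumCode e, s] = {{∅}}))
    {W : Set ZFSet.{v}} (hW : IsTransitiveModel W) (heW : enumCode e ∈ W)
    (hno : ¬ ∃ A ∈ W, Admissible A ∧ ∀ n, e n ∈ A) : IsWOP W T rk (enumCode e) where
  primrec := hTP
  primrec_rank := hrkP
  isPair α _ := (hT α).subset_prod
  wellOrders α hα := wellOrders_epsTerms hT he h0 h1 hK hθ hax hW heW hno hα
  subset α β _ hαβ s hs := by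
    obtain ⟨s, hs', rfl⟩ := (hT α).mem_carrier_iff.1 hs
    exact (hT β).mem_carrier_iff.2 ⟨s, epsTerms_mono he hαβ.le hs', rfl⟩
  restrict α β _ hαβ s t := by
    constructor
    · intro h
      obtain ⟨s, t, h', rfl, rfl⟩ := (hT α).carrierLt_iff.1 h
      exact ⟨(hT β).carrierLt_code_iff.2 (epsLt_mono he hαβ.le h'),
        (hT α).mem_carrier_iff.2 ⟨s, h'.1, rfl⟩, (hT α).mem_carrier_iff.2 ⟨t, h'.2.1, rfl⟩⟩
    · rintro ⟨h, hs, ht⟩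
      obtain ⟨s, hs', rfl⟩ := (hT α).mem_carrier_iff.1 hs
      obtain ⟨t, ht', rfl⟩ := (hT α).mem_carrier_iff.1 ht
      rw [(hT β).carrierLt_code_iff] at h
      exact (hT α).carrierLt_code_iff.2 ((epsLt_iff_of_le he h0 h1 hαβ.le hs' ht').1 h)
  limit γ _ hγ s := by
    constructor
    · intro hs
      obtain ⟨s, hs', rfl⟩ := (hT γ).mem_carrier_iff.1 hs
      obtain ⟨α, hα, hs⟩ := (epsTerms_limit he h0 h1 hγ).1 hs'
      exact ⟨α, hα, (hT α).mem_carrier_iff.2 ⟨s, hs, rfl⟩⟩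
    · rintro ⟨α, hα, hs⟩
      obtain ⟨s, hs', rfl⟩ := (hT α).mem_carrier_iff.1 hs
      exact (hT γ).mem_carrier_iff.2 ⟨s, epsTerms_mono he hα.le hs', rfl⟩
  rank_eq s _ α hα h := by
    have hmem {β : Ordinal.{v}} := (hT (β + 1)).mem_carrier_iff (z := s)
    -- `W` contains all ordinals below `α`, so that `α` is the minimal stage outside `W` as well
    have hle : ∀ β, s ∈ carrier T (enumCode e) (β + 1) → α ≤ β := fun β hβ => by
      by_contra! hlt
      exact hlt.not_ge (h.2 ⟨hW.trans _ hα _ (Ordinal.toZFSet_mem_toZFSet_iff.2 hlt), hβ⟩)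
    exact (hrk s).1 α (hle _ (mem_carrier_rank hT he h0 h1 ⟨_, h.1.2⟩))
      ⟨hmem.1 h.1.2, fun β hβ => hle β (hmem.2 hβ)⟩
  rank_default s hs h := by
    refine (hrk s).2 fun ⟨β, _, hβ⟩ => h ⟨s.rank, ?_, ?_⟩
    · exact hW.code_mem (f := ZFSet.rank) (by fun_prop) hs
    · exact mem_carrier_rank hT he h0 h1 ⟨_, (hT _).mem_carrier_iff.2 hβ⟩

end Principle

end

end KPTree

end

theorem mainTheorem5 (K : ℕ) (hK : 1 ≤ K) (θ : ℕ → Fml Empty 0)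
    (hθ : ∀ φ, IsTreeAxiom K φ ↔ ∃ k, θ k = φ)
    (hθ_primrec : Nat.Primrec fun k => (θ k).godel) :
    ∃ T rk : (Fin 2 → ZFSet.{v}) → ZFSet.{v}, SetPrimrec T ∧ SetPrimrec rk ∧
      ∀ e : ℕ → ZFSet.{v}, (∀ n, ∀ x ∈ e n, x ∈ Set.range e) →
        ∅ ∈ Set.range e → {∅} ∈ Set.range e →
          (∀ α : Ordinal.{v}, IsEpsSystem e θ α (T ![enumCode e, α.toZFSet])) ∧
          ∀ W : Set ZFSet.{v}, IsTransitiveModel W → enumCode e ∈ W →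
            (¬ ∃ A ∈ W, Admissible A ∧ ∀ n, e n ∈ A) →
              IsWOP W T rk (enumCode e) := by
  obtain ⟨T, hT, hTe⟩ := exists_epsSystem.{v} hθ_primrec
  obtain ⟨rk, hrk, hrke⟩ := exists_epsRank.{v} hθ_primrec
  refine ⟨T, rk, hT, hrk, fun e he h0 h1 => ⟨hTe e, fun W hW heW hno => ?_⟩⟩
  exact isWOP_epsTerms (hTe e) he h0 h1 hK hθ_primrec (fun φ => (hθ φ).1) hT hrk (hrke e) hW heW
    hno
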